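/- **Setting.** Let $\mu>0$, $\lambda\in\mathbb R$, and let $\rho_0:[0,\infty)\to[0,\infty)$ be Hölder continuous on every $[0,M]$, with spectral dimension $$\mathfrak D=\inf\Big\{p>0:\int_0^\infty\frac{\rho_0(t)\,dt}{(1+t)^{p/2}}<\infty\Big\}<6 ,\qquad D=2\lfloor \mathfrak D/2\rfloor\in\{0,2,4\}.$$ For a function $\rho$ on an interval $S\subset(-\frac{\mu^2}{2},\infty)$ put $$R_D(z)=z-\lambda(-z)^{D/2}\int_S\frac{\rho(t)\,dt}{(t+\mu^2)^{D/2}(t+\mu^2+z)} .$$ Let $R_D^{-1}$ denote the inverse of $R_D$ on the half plane $\mathrm{Re}\,z>-\frac{\mu^2}{2}$, and let $\log$ be the principal logarithm. For a cut-off $\Lambda>0$, a *deformation* of $\rho_0|_{[0,\Lambda^2]}$ is a continuous function $\rho_\lambda$ on an interval $[\nu,L]\subset(-\frac{\mu^2}2,\infty)$ such that, with $R_D$ built from $\rho_\lambda$ and $S=[\nu,L]$, one has $R_D(\nu)=0$, $R_D(L)=\Lambda^2$, $R_D([\nu,L])\subset[0,\Lambda^2]$ and $\rho_\lambda(x)=\rho_0(R_D(x))$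 on $[\nu,L]$. Put $$\beta=\int_\nu^{L}\frac{\rho_\lambda(t)\,dt}{(t+\mu^2/2)^2}+\delta_{D,4}\int_\nu^{L}\frac{\rho_\lambda(t)\,dt}{(t+\mu^2)^2}.$$ With $\kappa=\int_\nu^L\frac{\rho_\lambda(t)\,dt}{t+\mu^2}$ and $\kappa'=\int_\nu^L\frac{\rho_\lambda(t)\,dt}{(t+\mu^2)^2}$ the bare mass is $\mu_{bare}^2=\mu^2$ for $D=0$, $\mu_{bare}^2=\mu^2-2\lambda\kappa$ for $D=2$, and $\mu^2_{bare}=\mu^2(1-\lambda\kappa')-2\lambda\kappa$ for $D=4$. A *planar 2-point function* of the quartic matrix field theory with cut-off $\Lambda$ and field renormalisation $Z$ is a symmetric function $G:[0,\Lambda^2]^2\to\mathbb R$, Hölder continuous in each variable, which solves the planar Schwinger–Dyson equation (with absolutely convergent integral) $$(\mu_{bare}^2+x+y)\,ZG(x,y)=1-\lambda\int_0^{\Lambda^2}dt\,\rho_0(t)\Big(ZG(x,y)\,ZG(x,t)-\frac{ZG(t,y)-ZG(x,y)}{t-x}\Big),\qquad x,y\in[0,\Lambda^2].$$ **Theorem.**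 (1) Let $\Lambda>0$, let $\rho_\lambda$ be a deformation of $\rho_0|_{[0,\Lambda^2]}$ and let $|\lambda|\,\beta<1$. Then there is $Z>0$, with $Z=1$ if $\mathfrak D<4$, such that $$G(a,b)=\frac{\mu^{2\delta_{D,4}}\exp(N_D(a,b))}{\mu^2+a+b},\qquad a,b\in[0,\Lambda^2],$$ is a (real-valued) planar 2-point function with field renormalisation $Z$. Here, with $R_D$ built from $\rho_\lambda$, $$\begin{aligned}N_D(a,b)=\frac1{2\pi \mathrm i}\int_{-\infty}^\infty dt\,\Big\{&\log\big(a-R_D(-\tfrac{\mu^2}2-\mathrm it)\big)\tfrac{d}{dt}\log\big(b-R_D(-\tfrac{\mu^2}2+\mathrm it)\big)\\&-\log\big(a-(-\tfrac{\mu^2}2-\mathrm it)\big)\tfrac{d}{dt}\log\big(b-(-\tfrac{\mu^2}2+\mathrm it)\big)\\&-\delta_{D,4}\log\big(-R_D(-\tfrac{\mu^2}2-\mathrm it)\big)\tfrac{d}{dt}\log\big(-R_D(-\tfrac{\mu^2}2+\mathrm it)\big)\\&+\delta_{D,4}\log\big(-(-\tfrac{\mu^2}2-\mathrm it)\big)\tfrac{d}{dt}\log\big(-(-\tfrac{\mu^2}2+\mathrm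 it)\big)\Big\}\end{aligned}$$ is absolutely convergent. If $4\le\mathfrak D<6$, then $G(0,0)=1$, and this is a choice of normalisation: for every $c>0$ the function $cG$ is a planar 2-point function with the same bare mass and field renormalisation $Z/c$. If $\mathfrak D<4$, then every $a\in[0,\Lambda^2]$ has exactly one preimage $R_D^{-1}(a)$ in the half plane $\mathrm{Re}\,z>-\frac{\mu^2}2$, and, with an absolutely convergent integral, for $a,b\in[0,\Lambda^2]$, $$G(a,b)=\frac{(\mu^2+a+b)\exp\Big\{\frac1{2\pi \mathrm i}\int_{-\infty}^\infty dt\,\log\Big(\frac{a-R_D(-\frac{\mu^2}2-\mathrm it)}{a-(-\frac{\mu^2}2-\mathrm it)}\Big)\frac d{dt}\log\Big(\frac{b-R_D(-\frac{\mu^2}2+\mathrm it)}{b-(-\frac{\mu^2}2+\mathrm it)}\Big)\Big\}}{(\mu^2+b+R_D^{-1}(a))(\mu^2+a+R_D^{-1}(b))}.$$ (2) (Removal of the cut-off.) Let $\Lambda_n\to\infty$, let $\rho_n$ on $[\nu_n,L_n]$ be deformations of $\rho_0|_{[0,\Lambda_n^2]}$ with $|\lambda|\beta_n\le\theta$ for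 all $n$ and some $\theta<1$, and suppose that $\nu_n\to\nu>-\frac{\mu^2}2$ and $\rho_n(x)\to\rho(x)$ for all $x>\nu$. Let $R_D$ and $N_D$ be built from $\rho$ on $S=(\nu,\infty)$. Then $\int_\nu^\infty|\rho(t)|(t+\mu^2)^{-D/2-1}dt<\infty$, $R_D(\nu)=0$, and $R_D(x)\ge0$ and $\rho(x)=\rho_0(R_D(x))$ for all $x>\nu$. For all $a,b\ge0$ the integral $N_D(a,b)$ converges absolutely, and the functions $G_n(a,b)=\mu^{2\delta_{D,4}}\exp(N_D^{(n)}(a,b))/(\mu^2+a+b)$, with $N_D^{(n)}$ built from $\rho_n$ on $[\nu_n,L_n]$, converge to $G(a,b)=\mu^{2\delta_{D,4}}\exp(N_D(a,b))/(\mu^2+a+b)$. If $\mathfrak D<4$, then every $a\geq 0$ has exactly one preimage $R_D^{-1}(a)$ in the half plane, and this limit $G(a,b)$ also has the alternative representation displayed in (1), with an absolutely convergent integral, for all $a,b\ge0$. -/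

import Mathlib

open MeasureTheory Set Filter Topology
open scoped NNReal ENNReal

noncomputable section

namespace QuarticMatrix

/-! ### The undeformed measure and its spectral dimension -/

/-- The spectral dimension of the measure `ρ0(t) dt` on `[0,∞)`, that is
`inf {p > 0 : ∫ ρ0(t) / (1+t)^(p/2) dt < ∞}`, as an extended nonnegative real. -/
def spectralDimension (ρ0 : ℝ → ℝ) : ℝ≥0∞ :=
  sInf {p : ℝ≥0∞ | ∃ q : ℝ, 0 < q ∧ p = ENNReal.ofReal q ∧
    ∫⁻ t in Ici (0 : ℝ), ENNReal.ofReal (ρ0 t / (1 + t) ^ (q / 2)) < ∞}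

/-- The even integer `D = 2 ⌊𝔇/2⌋` attached to the spectral dimension `𝔇`. -/
def evenDim (ρ0 : ℝ → ℝ) : ℕ := 2 * ⌊(spectralDimension ρ0).toReal / 2⌋₊

/-- `f` is Hölder continuous on `s` for some exponent in `(0,1]`. -/
def IsHolderOn (f : ℝ → ℝ) (s : Set ℝ) : Prop :=
  ∃ C α : ℝ≥0, 0 < α ∧ α ≤ 1 ∧ HolderOnWith C α f s

/-! ### The functions `h_D` and `R_D` -/

/-- `h_D(w) = (w+μ²)^(D/2) ∫_S ρ(t) / ((t+μ²)^(D/2) (t-w)) dt` for the measure `ρ(t) dt` on `S`. -/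
def h (D : ℕ) (μ : ℝ) (ρ : ℝ → ℝ) (S : Set ℝ) (w : ℂ) : ℂ :=
  (w + (μ : ℂ) ^ 2) ^ (D / 2) *
    ∫ t in S, (ρ t : ℂ) / (((t : ℂ) + (μ : ℂ) ^ 2) ^ (D / 2) * ((t : ℂ) - w))

/-- `R_D(z) = z - λ h_D(-μ²-z)`. -/
def R (D : ℕ) (μ lam : ℝ) (ρ : ℝ → ℝ) (S : Set ℝ) (z : ℂ) : ℂ :=
  z - (lam : ℂ) * h D μ ρ S (-(μ : ℂ) ^ 2 - z)

/-- The right half plane `Re z > -μ²/2`. -/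
def halfPlane (μ : ℝ) : Set ℂ := {z : ℂ | -μ ^ 2 / 2 < z.re}

/-- The inverse of `R_D` on the half plane `Re z > -μ²/2`. -/
def Rinv (D : ℕ) (μ lam : ℝ) (ρ : ℝ → ℝ) (S : Set ℝ) : ℂ → ℂ :=
  Function.invFunOn (R D μ lam ρ S) (halfPlane μ)

/-- `∫_S ρ(t)/(t+μ²/2)² dt + δ_{D,4} ∫_S ρ(t)/(t+μ²)² dt`, the inverse of the bound on `|λ|`. -/
def couplingBound (D : ℕ) (μ : ℝ) (ρ : ℝ → ℝ) (S : Set ℝ) : ℝ :=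
  (∫ t in S, ρ t / (t + μ ^ 2 / 2) ^ 2) +
    if D = 4 then ∫ t in S, ρ t / (t + μ ^ 2) ^ 2 else 0

/-- `ρ` on `[ν, L]` is the deformation of `ρ0` on `[0, Λ²]`: `ν = R_D⁻¹(0)`, `L = R_D⁻¹(Λ²)` and
`ρ(x) = ρ0(R_D(x))`, where `R_D` is built with `ρ` itself.  (`R_D` is real on `[ν, L]`.) -/
structure IsDeformation (D : ℕ) (μ lam : ℝ) (ρ0 : ℝ → ℝ) (Λ : ℝ) (ρ : ℝ → ℝ) (ν L : ℝ) : Prop where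
  left_mem : (ν : ℂ) ∈ halfPlane μ
  right_mem : (L : ℂ) ∈ halfPlane μ
  continuousOn : ContinuousOn ρ (Icc ν L)
  map_left : R D μ lam ρ (Icc ν L) ν = 0
  map_right : R D μ lam ρ (Icc ν L) L = (Λ : ℂ) ^ 2
  maps_to : ∀ x ∈ Icc ν L, (R D μ lam ρ (Icc ν L) x).re ∈ Icc 0 (Λ ^ 2)
  deform : ∀ x ∈ Icc ν L, ρ x = ρ0 (R D μ lam ρ (Icc ν L) x).re

/-- The same without cut-off: `ρ` on `(ν, ∞)` is the deformation of `ρ0` on `(0, ∞)`, and the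
integral defining `R_D` converges absolutely. -/
structure IsDeformationNoCutoff (D : ℕ) (μ lam : ℝ) (ρ0 : ℝ → ℝ) (ρ : ℝ → ℝ) (ν : ℝ) : Prop where
  left_mem : (ν : ℂ) ∈ halfPlane μ
  integrable : IntegrableOn (fun t => ρ t / (t + μ ^ 2) ^ (D / 2 + 1)) (Ioi ν)
  map_left : R D μ lam ρ (Ioi ν) ν = 0
  maps_to : ∀ x ∈ Ioi ν, 0 ≤ (R D μ lam ρ (Ioi ν) x).re
  deform : ∀ x ∈ Ioi ν, ρ x = ρ0 (R D μ lam ρ (Ioi ν) x).re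

/-! ### The planar two-point function -/

/-- The bare mass squared `μ_bare²`: it is `μ²` for `D = 0`, `μ² - 2 λ h_{02}(-μ²)` for `D = 2` and
`μ² (1 - λ h_{04}'(-μ²)) - 2 λ h_{04}(-μ²)` for `D = 4`, where
`h_{0D}(-μ²) = ∫_S ρ(t)/(t+μ²) dt` and `h_{0D}'(-μ²) = ∫_S ρ(t)/(t+μ²)² dt`. -/
def bareMassSq (D : ℕ) (μ lam : ℝ) (ρ : ℝ → ℝ) (S : Set ℝ) : ℝ :=
  if D = 0 then μ ^ 2
  else if D = 2 then μ ^ 2 - 2 * lam * ∫ t in S, ρ t / (t + μ ^ 2)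
  else μ ^ 2 * (1 - lam * ∫ t in S, ρ t / (t + μ ^ 2) ^ 2)
    - 2 * lam * ∫ t in S, ρ t / (t + μ ^ 2)

/-- The integrand of the planar Schwinger-Dyson equation, with `G` replaced by `Z G`. -/
def sdIntegrand (ρ0 : ℝ → ℝ) (Z : ℝ) (G : ℝ → ℝ → ℝ) (x y t : ℝ) : ℝ :=
  ρ0 t * (Z * G x y * (Z * G x t) - (Z * G t y - Z * G x y) / (t - x))

/-- `G` is a planar two-point function of the quartic model with coupling constant `λ`, measure
`ρ0(t) dt` on `[0, Λ²]`, bare mass squared `mbSq` and field renormalisation `Z`: it is symmetric and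
Hölder continuous in each variable, and it solves the planar Schwinger-Dyson equation
`(μ_bare² + x + y) Z G(x,y)
  = 1 - λ ∫_0^{Λ²} ρ0(t) (ZG(x,y) ZG(x,t) - (ZG(t,y) - ZG(x,y))/(t-x)) dt`. -/
structure IsPlanarTwoPoint (ρ0 : ℝ → ℝ) (lam Λ mbSq Z : ℝ) (G : ℝ → ℝ → ℝ) : Prop where
  symm : ∀ x ∈ Icc 0 (Λ ^ 2), ∀ y ∈ Icc 0 (Λ ^ 2), G x y = G y x
  holder : ∀ y ∈ Icc 0 (Λ ^ 2), IsHolderOn (fun x => G x y) (Icc 0 (Λ ^ 2))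
  integrable : ∀ x ∈ Icc 0 (Λ ^ 2), ∀ y ∈ Icc 0 (Λ ^ 2),
    IntegrableOn (sdIntegrand ρ0 Z G x y) (Icc 0 (Λ ^ 2))
  schwinger_dyson : ∀ x ∈ Icc 0 (Λ ^ 2), ∀ y ∈ Icc 0 (Λ ^ 2),
    (mbSq + x + y) * (Z * G x y) =
      1 - lam * ∫ t in Icc 0 (Λ ^ 2), sdIntegrand ρ0 Z G x y t

/-! ### The explicit formulas -/

/-- The line `t ↦ -μ²/2 + i t`. -/
def line (μ t : ℝ) : ℂ := -(μ : ℂ) ^ 2 / 2 + Complex.I * t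

/-- `log(a - F(-μ²/2 - i t)) · d/dt log(b - F(-μ²/2 + i t))`. -/
def logTerm (μ : ℝ) (F : ℂ → ℂ) (a b t : ℝ) : ℂ :=
  Complex.log (a - F (line μ (-t))) * deriv (fun s : ℝ => Complex.log (b - F (line μ s))) t

/-- The integrand of `N_D(a,b)`. -/
def integrandN (D : ℕ) (μ lam : ℝ) (ρ : ℝ → ℝ) (S : Set ℝ) (a b t : ℝ) : ℂ :=
  logTerm μ (R D μ lam ρ S) a b t - logTerm μ id a b t
    - (if D = 4 then 1 else 0) * logTerm μ (R D μ lam ρ S) 0 0 t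
    + (if D = 4 then 1 else 0) * logTerm μ id 0 0 t

/-- `N_D(a,b)`. -/
def N (D : ℕ) (μ lam : ℝ) (ρ : ℝ → ℝ) (S : Set ℝ) (a b : ℝ) : ℂ :=
  1 / (2 * Real.pi * Complex.I) * ∫ t : ℝ, integrandN D μ lam ρ S a b t

/-- `μ^(2 δ_{D,4}) exp(N_D(a,b)) / (μ²+a+b)`. -/
def formulaG (D : ℕ) (μ lam : ℝ) (ρ : ℝ → ℝ) (S : Set ℝ) (a b : ℝ) : ℂ :=
  (μ : ℂ) ^ (if D = 4 then 2 else 0) * Complex.exp (N D μ lam ρ S a b) / ((μ : ℂ) ^ 2 + a + b)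

/-- The integrand of the alternative representation. -/
def integrandAlt (D : ℕ) (μ lam : ℝ) (ρ : ℝ → ℝ) (S : Set ℝ) (a b t : ℝ) : ℂ :=
  Complex.log ((a - R D μ lam ρ S (line μ (-t))) / (a - line μ (-t))) *
    deriv (fun s : ℝ => Complex.log ((b - R D μ lam ρ S (line μ s)) / (b - line μ s))) t

/-- The alternative representation, which involves `R_D⁻¹`. -/
def formulaAlt (D : ℕ) (μ lam : ℝ) (ρ : ℝ → ℝ) (S : Set ℝ) (a b : ℝ) : ℂ :=
  ((μ : ℂ) ^ 2 + a + b) *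
      Complex.exp (1 / (2 * Real.pi * Complex.I) * ∫ t : ℝ, integrandAlt D μ lam ρ S a b t) /
    (((μ : ℂ) ^ 2 + b + Rinv D μ lam ρ S a) * ((μ : ℂ) ^ 2 + a + Rinv D μ lam ρ S b))

end QuarticMatrix

end

/-! Put m = μ²/2. The hypothesis |λ|β < 1 says that R = R_D differs from the identity by a strict
contraction on a half plane slightly larger than Re z ≥ −m. With conjugation symmetry and R(ν) = 0
this yields injectivity, real preimages of [0, ∞), the sign of Im R, and lower bounds for a − R on
the line Re z = −m. At finite cut-off moreover R(z) = A z + B − λ ∫ ρ(t)/(t + 2m + z) dt with A > 0.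

In the variables x = R(w), t = R(s) the measure ρ0(t) dt becomes ρ(s) R'(s) ds. For fixed b the
candidate for Z G is g_b(z) = exp(C_b(R z)) / (A (b + 2m + z)), where C_b is the Cauchy integral
over the image under R of the line Re z = −m, with density log((b − R(−2m − z)) / (A (b + 2m + z))).
This solves a Riemann–Hilbert problem: crossing the line multiplies exp C_b by the ratio under the
logarithm (`exp_cauchyLog_cross`), while to the left of the curve exp C_b tends to 1, so that the
Cauchy integral of exp C_b − 1 over the curve vanishes (`integral_exp_cauchyLog_eq_zero`). After the
crossing the same integrand is (b − R(−2m − z)) g_b(z) − 1, and b − R(−2m − z) is linear in z minus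
λ ∫ ρ(s)/(z − s) ds. Cauchy's formula to the right of the line then gives a linear integral equation
for g_b (`gTwo_linear`).

Symmetry. For a = R(α) the exponent C_b(a) splits into an integral of logarithms of ratios,
symmetric in a and b by parts and reflection (`integral_alt_comm`), and an integral with an explicit
rational factor, evaluated by residues (`crossExponent_eq`). The result `gTwo_eq` is symmetric, real
and positive, and it contains both displayed representations of G.

The nonlinear equation. The linear equations at (R v, w) and at (R w, v) share a value by symmetry.
Multiplying by R(v), subtracting and letting v → ∞, where R(v) g_b(v) → 1, evaluates ∫ ρ g R'
(`integral_gTwo_mul_deriv`). Inserting this into the linear equation produces the Schwinger–Dyson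
equation with mass 2mA − 2B, which is the bare mass (`gTwo_schwinger_dyson`, `bareMassSq_eq`). For D
< 4 one has A = 1 and Z = 1; for D = 4 dividing by the value at (0, 0) gives the normalised G, and
that value becomes Z.

Removal of the cut-off. All constants can be chosen uniformly in n. The spectral dimension is
strictly below D + 2, so the deformed measures are integrable against a power slightly weaker than
the one in the kernel of R_D; this prevents loss of mass at infinity (`DeformSeq.tendsto_integral`).
Hence R_n → R, locally uniformly by equicontinuity, and the derivatives converge too. Uniform power
bounds then allow dominated convergence in the exponents: from the subtraction at a = b = 0 when D =
4, and from uniform closeness of R_n to the identity on the line when D < 4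
(`DeformSeq.exists_lineNear`). -/

noncomputable section

/-! ### Contour integrals over vertical lines. -/

namespace VerticalLine

/-- The point `c + i t` of the vertical line `Re z = c`. -/
def vline (c t : ℝ) : ℂ := c + t * Complex.I

@[simp] lemma vline_re (c t : ℝ) : (vline c t).re = c := by simp [vline]

@[simp] lemma vline_im (c t : ℝ) : (vline c t).im = t := by simp [vline]

lemma continuous_vline (c : ℝ) : Continuous (vline c) := by
  unfold vline; fun_prop

lemma hasDerivAt_vline (c t : ℝ) : HasDerivAt (vline c) Complex.I t := by
  have h := ((Complex.ofRealCLM.hasDerivAt (x := t)).mul_const Complex.I).const_add (c : ℂ)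
  have e : Complex.ofRealCLM 1 * Complex.I = Complex.I := by simp
  rwa [e] at h

lemma abs_le_norm_vline (c t : ℝ) : |t| ≤ ‖vline c t‖ := by
  simpa using Complex.abs_im_le_norm (vline c t)

lemma abs_re_le_norm_vline (c t : ℝ) : |c| ≤ ‖vline c t‖ := by
  simpa using Complex.abs_re_le_norm (vline c t)

lemma integrable_rpow_neg {r : ℝ} (hr : 1 < r) : Integrable (fun t : ℝ => (1 + |t|) ^ (-r)) := by
  have := integrable_one_add_norm (E := ℝ) (μ := volume) (r := r) (by simpa using hr)
  simpa using this

lemma rpow_neg_norm_le {r : ℝ} (hr : 0 ≤ r) (z : ℂ) :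
    (1 + ‖z‖) ^ (-r) ≤ (1 + |z.im|) ^ (-r) :=
  Real.rpow_le_rpow_of_nonpos (by positivity) (by linarith [Complex.abs_im_le_norm z]) (by linarith)

lemma integrable_of_le_rpow_neg {E : Type*} [NormedAddCommGroup E] {f : ℝ → E} {C r : ℝ}
    (hr : 1 < r) (hf : AEStronglyMeasurable f) (hb : ∀ t, ‖f t‖ ≤ C * (1 + |t|) ^ (-r)) :
    Integrable f :=
  ((integrable_rpow_neg hr).const_mul C).mono' hf (ae_of_all _ hb)

lemma tendsto_one_add_abs_rpow_neg {r : ℝ} (hr : 0 < r) :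
    Tendsto (fun t : ℝ => (1 + |t|) ^ (-r)) atTop (𝓝 0) :=
  (tendsto_rpow_neg_atTop hr).comp (tendsto_atTop_add_const_left _ _ tendsto_abs_atTop_atTop)

/-- A function which is continuous on a closed set and decays at infinity obeys the decay bound
everywhere. -/
lemma exists_bound_of_large {S : Set ℂ} (hS : IsClosed S) {r C M : ℝ} {f : ℂ → ℂ}
    (hf : ContinuousOn f S)
    (hb : ∀ z ∈ S, M ≤ ‖z‖ → ‖f z‖ ≤ C * (1 + ‖z‖) ^ (-r)) :
    ∃ C', ∀ z ∈ S, ‖f z‖ ≤ C' * (1 + ‖z‖) ^ (-r) := by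
  have hK : IsCompact (S ∩ Metric.closedBall 0 M) :=
    (isCompact_closedBall 0 M).inter_left hS
  have hcont : ContinuousOn (fun z : ℂ => ‖f z‖ * (1 + ‖z‖) ^ r)
      (S ∩ Metric.closedBall 0 M) := by
    refine ((hf.mono inter_subset_left).norm).mul (ContinuousOn.rpow_const (by fun_prop) ?_)
    intro x _; left; positivity
  obtain ⟨B, hB⟩ := (hK.image_of_continuousOn hcont).bddAbove
  refine ⟨max C B, fun z hz => ?_⟩
  have hp : 0 < (1 + ‖z‖) ^ (-r) := by positivity
  rcases le_total M ‖z‖ with h | h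
  · exact (hb z hz h).trans (by gcongr; exact le_max_left _ _)
  · have h1 : ‖f z‖ * (1 + ‖z‖) ^ r ≤ B := hB ⟨z, ⟨hz, by simpa using h⟩, rfl⟩
    have h2 : (1 + ‖z‖) ^ r * (1 + ‖z‖) ^ (-r) = 1 := by
      rw [← Real.rpow_add (by positivity)]; simp
    calc ‖f z‖ = (‖f z‖ * (1 + ‖z‖) ^ r) * (1 + ‖z‖) ^ (-r) := by rw [mul_assoc, h2, mul_one]
      _ ≤ max C B * (1 + ‖z‖) ^ (-r) := by gcongr; exact h1.trans (le_max_right _ _)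

/-- Shifting a vertical line of integration within a strip. -/
theorem integral_vline_eq_of_strip {a b C r : ℝ} (hab : a ≤ b) (hr : 1 < r) {f : ℂ → ℂ}
    (hd : ∀ z : ℂ, a ≤ z.re → z.re ≤ b → DifferentiableAt ℂ f z)
    (hb : ∀ z : ℂ, a ≤ z.re → z.re ≤ b → ‖f z‖ ≤ C * (1 + |z.im|) ^ (-r)) :
    ∫ t : ℝ, f (vline a t) = ∫ t : ℝ, f (vline b t) := by
  have hcont : ∀ c, a ≤ c → c ≤ b → Continuous fun t => f (vline c t) := fun c h1 h2 =>
    continuous_iff_continuousAt.2 fun t =>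
      ContinuousAt.comp (hd _ (by simpa) (by simpa)).continuousAt (continuous_vline c).continuousAt
  have hint : ∀ c, a ≤ c → c ≤ b → Integrable fun t => f (vline c t) := fun c h1 h2 =>
    integrable_of_le_rpow_neg hr (hcont c h1 h2).aestronglyMeasurable fun t => by
      simpa using hb (vline c t) (by simpa) (by simpa)
  have hrect : ∀ T : ℝ, (∫ y in (-T)..T, f (vline b y)) - ∫ y in (-T)..T, f (vline a y)
      = Complex.I * ((∫ x in a..b, f (x + (-T : ℝ) * Complex.I))
        - ∫ x in a..b, f (x + (T : ℝ) * Complex.I)) := by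
    intro T
    have h := Complex.integral_boundary_rect_eq_zero_of_differentiableOn f
      ((a : ℂ) + (-T : ℝ) * Complex.I) ((b : ℂ) + (T : ℝ) * Complex.I) (by
        intro z hz
        have hz1 := hz.1
        simp only [mem_preimage, Complex.add_re, Complex.mul_re, Complex.ofReal_re, Complex.I_re,
          Complex.ofReal_im, Complex.I_im, mul_zero, mul_one, sub_self, add_zero,
          uIcc_of_le hab] at hz1
        exact (hd z hz1.1 hz1.2).differentiableWithinAt)
    simp only [Complex.add_re, Complex.mul_re, Complex.ofReal_re, Complex.I_re, Complex.add_im,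
      Complex.mul_im, Complex.ofReal_im, Complex.I_im, mul_zero, mul_one, sub_self, add_zero,
      zero_add, smul_eq_mul] at h
    have h' := congrArg (fun x => -Complex.I * x) h
    simp only [mul_zero] at h'
    have hI := Complex.I_mul_I
    unfold vline
    linear_combination h' - ((∫ y in (-T)..T, f (b + y * Complex.I))
      - ∫ y in (-T)..T, f (a + y * Complex.I)) * (-hI)
  have hT : Tendsto (fun T : ℝ => T) atTop atTop := tendsto_id
  have hlim := (intervalIntegral_tendsto_integral (hint b hab le_rfl) tendsto_neg_atTop_atBot hT).sub
    (intervalIntegral_tendsto_integral (hint a le_rfl hab) tendsto_neg_atTop_atBot hT)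
  -- The horizontal sides have the fixed length |b − a| and the integrand decays in the imaginary
  -- part, so they disappear as T → ∞.
  have hhor : ∀ s : ℝ, ‖∫ x in a..b, f (x + (s : ℝ) * Complex.I)‖
      ≤ C * (1 + |s|) ^ (-r) * |b - a| := by
    intro s
    refine intervalIntegral.norm_integral_le_of_norm_le_const fun x hx => ?_
    rw [uIoc_of_le hab] at hx
    simpa using hb (x + s * Complex.I) (by simpa using hx.1.le) (by simpa using hx.2)
  have hzero : Tendsto (fun T : ℝ => (∫ y in (-T)..T, f (vline b y))
      - ∫ y in (-T)..T, f (vline a y)) atTop (𝓝 0) := by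
    have hz : Tendsto (fun T : ℝ => 2 * (C * (1 + |T|) ^ (-r) * |b - a|)) atTop (𝓝 0) := by
      simpa using (((tendsto_one_add_abs_rpow_neg (zero_lt_one.trans hr)).const_mul C).mul_const
        (|b - a|)).const_mul 2
    refine squeeze_zero_norm (fun T => ?_) hz
    rw [hrect, norm_mul, Complex.norm_I, one_mul]
    refine (norm_sub_le _ _).trans ?_
    have h1 := hhor (-T)
    have h2 := hhor T
    rw [abs_neg] at h1
    linarith
  have := tendsto_nhds_unique hzero hlim
  exact (sub_eq_zero.1 this.symm).symm

/-- The integral over a vertical line of a function that is holomorphic to its right and decays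
vanishes. -/
theorem integral_vline_eq_zero {c C r : ℝ} (hr : 1 < r) {f : ℂ → ℂ}
    (hd : ∀ z : ℂ, c ≤ z.re → DifferentiableAt ℂ f z)
    (hb : ∀ z : ℂ, c ≤ z.re → ‖f z‖ ≤ C * (1 + ‖z‖) ^ (-r)) :
    ∫ t : ℝ, f (vline c t) = 0 := by
  have hC : 0 ≤ C := by
    have h := (norm_nonneg _).trans (hb (c : ℂ) (by simp))
    exact nonneg_of_mul_nonneg_left h (by positivity)
  have hb' : ∀ z : ℂ, c ≤ z.re → ‖f z‖ ≤ C * (1 + |z.im|) ^ (-r) := fun z hz =>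
    (hb z hz).trans (by gcongr C * ?_; exact rpow_neg_norm_le (r := r) (by linarith) z)
  -- The integral does not depend on the line, and it tends to zero when the line moves to the
  -- right: the decay in t dominates while the integrand goes to zero pointwise.
  have hcst : ∀ c', c ≤ c' → ∫ t : ℝ, f (vline c t) = ∫ t : ℝ, f (vline c' t) := fun c' h =>
    integral_vline_eq_of_strip h hr (fun z h1 _ => hd z h1) (fun z h1 _ => hb' z h1)
  have hlim : Tendsto (fun c' : ℝ => ∫ t : ℝ, f (vline c' t)) atTop (𝓝 (∫ _ : ℝ, (0 : ℂ))) := by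
    refine tendsto_integral_filter_of_dominated_convergence (fun t => C * (1 + |t|) ^ (-r)) ?_ ?_
      ((integrable_rpow_neg hr).const_mul C) ?_
    · filter_upwards [eventually_ge_atTop c] with c' h
      exact (continuous_iff_continuousAt.2 fun t => ContinuousAt.comp
        (hd _ (by simpa)).continuousAt (continuous_vline c').continuousAt).aestronglyMeasurable
    · filter_upwards [eventually_ge_atTop c] with c' h
      exact ae_of_all _ fun t => by simpa using hb' (vline c' t) (by simpa)
    · refine ae_of_all _ fun t => ?_
      have hz : Tendsto (fun c' : ℝ => C * (1 + |c'|) ^ (-r)) atTop (𝓝 0) := by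
        simpa using (tendsto_one_add_abs_rpow_neg (zero_lt_one.trans hr)).const_mul C
      refine squeeze_zero_norm' ?_ hz
      filter_upwards [eventually_ge_atTop c] with c' h
      refine (hb _ (by simpa)).trans ?_
      gcongr C * ?_
      exact Real.rpow_le_rpow_of_nonpos (by positivity)
        (by linarith [abs_re_le_norm_vline c' t]) (by linarith)
  have h2 : Tendsto (fun c' : ℝ => ∫ t : ℝ, f (vline c' t)) atTop (𝓝 (∫ t : ℝ, f (vline c t))) :=
    tendsto_const_nhds.congr' (by
      filter_upwards [eventually_ge_atTop c] with c' h using hcst c' h)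
  simpa using tendsto_nhds_unique h2 hlim

/-- The real part of `vline c t - p` is a nonzero constant and its imaginary part grows like t;
hence each denominator of this kind gains a factor `(1 + |t|)⁻¹`. -/
lemma exists_one_add_norm_le_mul (c : ℝ) {p : ℂ} (hp : p.re ≠ c) :
    ∃ K, 0 < K ∧ ∀ t, 1 + |t| ≤ K * ‖vline c t - p‖ := by
  refine ⟨1 + (1 + |p.im|) / |c - p.re|, ?_, fun t => ?_⟩
  · have : 0 < |c - p.re| := abs_pos.2 (sub_ne_zero.2 hp.symm)
    positivity
  · have h0 : 0 < |c - p.re| := abs_pos.2 (sub_ne_zero.2 hp.symm)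
    have h1 : |c - p.re| ≤ ‖vline c t - p‖ := by
      simpa using Complex.abs_re_le_norm (vline c t - p)
    have h2 : |t - p.im| ≤ ‖vline c t - p‖ := by
      simpa using Complex.abs_im_le_norm (vline c t - p)
    have h3 : |t| ≤ |t - p.im| + |p.im| := by
      simpa using abs_add_le (t - p.im) p.im
    have h4 : 1 + |p.im| ≤ (1 + |p.im|) / |c - p.re| * ‖vline c t - p‖ := by
      rw [div_mul_eq_mul_div, le_div_iff₀ h0]
      gcongr
    linarith

lemma isClosed_rightHalf (c : ℝ) : IsClosed {z : ℂ | c ≤ z.re} :=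
  isClosed_le continuous_const Complex.continuous_re

lemma isOpen_rightHalf (c : ℝ) : IsOpen {z : ℂ | c < z.re} :=
  isOpen_lt continuous_const Complex.continuous_re

/-- Both poles to the left of the line. -/
lemma integral_two_poles_left {c : ℝ} {p q : ℂ} (hp : p.re < c) (hq : q.re < c) :
    ∫ t : ℝ, ((vline c t - p) * (vline c t - q))⁻¹ = 0 := by
  have hne : ∀ s z : ℂ, s.re < c → c ≤ z.re → z - s ≠ 0 := by
    intro s z hs hz h
    have := congrArg Complex.re h
    simp at this
    linarith
  have hd : ∀ z : ℂ, c ≤ z.re → DifferentiableAt ℂ (fun z => ((z - p) * (z - q))⁻¹) z := by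
    intro z hz
    exact DifferentiableAt.inv (by fun_prop) (mul_ne_zero (hne p z hp hz) (hne q z hq hz))
  -- For ‖z‖ ≥ 1 + 2‖s‖ one has ‖z − s‖ ≥ (1 + ‖z‖)/4; the two factors 1/4, for p and for q, give
  -- the constant 16.
  obtain ⟨C, hC⟩ := exists_bound_of_large (isClosed_rightHalf c) (r := 2) (C := 16) (M := 1 + 2 * ‖p‖ + 2 * ‖q‖)
    (f := fun z => ((z - p) * (z - q))⁻¹)
    (fun z hz => (hd z hz).continuousAt.continuousWithinAt) (by
      intro z hz hM
      have h : ∀ s : ℂ, 1 + 2 * ‖s‖ ≤ ‖z‖ → (1 + ‖z‖) / 4 ≤ ‖z - s‖ := by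
        intro s hs
        linarith [norm_sub_norm_le z s, norm_nonneg z]
      have h1 := h p (by linarith [norm_nonneg q])
      have h2 := h q (by linarith [norm_nonneg p])
      rw [norm_inv, norm_mul, Real.rpow_neg (by positivity), ← div_eq_mul_inv,
        inv_eq_one_div, div_le_div_iff₀ (by
          have := norm_nonneg z
          have : 0 < (1 + ‖z‖) / 4 := by positivity
          exact mul_pos (by linarith) (by linarith)) (by positivity)]
      have : (1 + ‖z‖) / 4 * ((1 + ‖z‖) / 4) ≤ ‖z - p‖ * ‖z - q‖ := by gcongr
      rw [Real.rpow_two]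
      nlinarith)
  exact integral_vline_eq_zero (f := fun z => ((z - p) * (z - q))⁻¹) one_lt_two hd hC

lemma neg_vline_neg (c t : ℝ) : -vline (-c) (-t) = vline c t := by
  simp [vline, add_comm]

/-- Both poles to the right of the line. -/
lemma integral_two_poles_right {c : ℝ} {p q : ℂ} (hp : c < p.re) (hq : c < q.re) :
    ∫ t : ℝ, ((vline c t - p) * (vline c t - q))⁻¹ = 0 := by
  rw [← integral_neg_eq_self, ← integral_two_poles_left (c := -c) (p := -p) (q := -q)
    (by simpa) (by simpa)]
  congr 1
  ext t
  have := neg_vline_neg c (-t)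
  rw [neg_neg] at this
  rw [← this]
  ring

lemma integrable_two_poles {c : ℝ} {p q : ℂ} (hp : p.re ≠ c) (hq : q.re ≠ c) :
    Integrable fun t : ℝ => ((vline c t - p) * (vline c t - q))⁻¹ := by
  obtain ⟨K, hK, h1⟩ := exists_one_add_norm_le_mul c hp
  obtain ⟨K', hK', h2⟩ := exists_one_add_norm_le_mul c hq
  have hne : ∀ s : ℂ, s.re ≠ c → ∀ t, vline c t - s ≠ 0 := by
    intro s hs t h
    have := congrArg Complex.re h
    simp at this
    exact hs (by linarith)
  refine integrable_of_le_rpow_neg (C := K * K') one_lt_two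
    (Continuous.aestronglyMeasurable (Continuous.inv₀ ?_ fun t =>
      mul_ne_zero (hne p hp t) (hne q hq t))) fun t => ?_
  · have := continuous_vline c
    fun_prop
  · rw [norm_inv, norm_mul, Real.rpow_neg (by positivity), Real.rpow_two,
      ← div_eq_mul_inv, inv_eq_one_div, div_le_div_iff₀
        (mul_pos (norm_pos_iff.2 (hne p hp t)) (norm_pos_iff.2 (hne q hq t))) (by positivity)]
    have := mul_le_mul (h1 t) (h2 t) (by positivity) (by positivity)
    nlinarith

/-- One pole on each side of the line. -/
lemma integral_two_poles {c : ℝ} {p w : ℂ} (hp : p.re < c) (hw : c < w.re) :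
    ∫ t : ℝ, ((vline c t - p) * (vline c t - w))⁻¹ = 2 * Real.pi / (p - w) := by
  have hne : ∀ s : ℂ, s.re ≠ c → ∀ t, vline c t - s ≠ 0 := by
    intro s hs t h
    have := congrArg Complex.re h
    simp at this
    exact hs (by linarith)
  have hpw : p - w ≠ 0 := by
    intro h
    have := congrArg Complex.re h
    simp at this
    linarith
  have hp0 : ((c - 1 : ℝ) : ℂ).re < c := by simp
  have hw0 : c < ((c + 1 : ℝ) : ℂ).re := by simp
  -- Splitting into 1/(z − p) and 1/(z − w) would destroy integrability. Comparing with the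
  -- reference poles c − 1 and c + 1 keeps quadratic decay; the first two terms have both poles on
  -- one side and integrate to zero, the last one gives 2π.
  have key : ∀ t, (p - w) * ((vline c t - p) * (vline c t - w))⁻¹
      = (p - (c - 1 : ℝ)) * ((vline c t - p) * (vline c t - (c - 1 : ℝ)))⁻¹
        - (w - (c + 1 : ℝ)) * ((vline c t - w) * (vline c t - (c + 1 : ℝ)))⁻¹
        + 2 * ((1 + t ^ 2)⁻¹ : ℝ) := by
    intro t
    have h1 := hne p hp.ne t
    have h2 := hne w hw.ne' t
    have h3 := hne _ hp0.ne t
    have h4 := hne _ hw0.ne' t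
    have h5 : (vline c t - (c - 1 : ℝ)) * (vline c t - (c + 1 : ℝ)) = -(1 + t ^ 2) := by
      unfold vline
      push_cast
      linear_combination (t : ℂ) ^ 2 * Complex.I_sq
    have h6 : (((1 + t ^ 2)⁻¹ : ℝ) : ℂ)
        = -((vline c t - (c - 1 : ℝ)) * (vline c t - (c + 1 : ℝ)))⁻¹ := by
      rw [h5]; push_cast; rw [inv_neg, neg_neg]
    rw [h6]
    field_simp
    push_cast
    ring
  have hint : (p - w) * ∫ t : ℝ, ((vline c t - p) * (vline c t - w))⁻¹ = 2 * Real.pi := by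
    rw [← integral_const_mul]
    simp_rw [key]
    rw [integral_add, integral_sub, integral_const_mul, integral_const_mul, integral_const_mul,
      integral_two_poles_left hp hp0, integral_two_poles_right hw hw0,
      integral_complex_ofReal, integral_univ_inv_one_add_sq]
    · simp
    · exact (integrable_two_poles hp.ne hp0.ne).const_mul _
    · exact (integrable_two_poles hw.ne' hw0.ne').const_mul _
    · exact ((integrable_two_poles hp.ne hp0.ne).const_mul _).sub
        ((integrable_two_poles hw.ne' hw0.ne').const_mul _)
    · exact (integrable_inv_one_add_sq.ofReal).const_mul _
  rw [eq_div_iff hpw]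
  linear_combination hint

/-- A decaying function divided by `z - w`, split into a regular part that decays faster than
`1 / z` and an explicit rational function. -/
lemma exists_regular_part {S U : Set ℂ} (hS : IsClosed S) (hU : IsOpen U) (hSU : S ⊆ U)
    {p w : ℂ} (hw : w ∈ U) (hp : p ∉ U) {C r : ℝ} (hr : 0 < r) {g : ℂ → ℂ}
    (hd : DifferentiableOn ℂ g U) (hb : ∀ z ∈ S, ‖g z‖ ≤ C * (1 + ‖z‖) ^ (-r)) :
    ∃ (φ : ℂ → ℂ) (C' s : ℝ), 1 < s ∧ DifferentiableOn ℂ φ U ∧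
      (∀ z ∈ S, ‖φ z‖ ≤ C' * (1 + ‖z‖) ^ (-s)) ∧
      ∀ z ∈ U, z ≠ w → g z / (z - w) = φ z + g w * (w - p) * ((z - p) * (z - w))⁻¹ := by
  have hne0 : ∀ z ∈ U, z - p ≠ 0 := fun z hz h => hp (sub_eq_zero.1 h ▸ hz)
  have hwc : w - p ≠ 0 := hne0 w hw
  -- The subtracted fraction has its pole at p, outside U, and makes G vanish at w. The difference
  -- quotient of G at w is therefore G/(z − w) away from w.
  set G : ℂ → ℂ := fun z => g z - g w * (w - p) / (z - p) with hG
  have hGd : DifferentiableOn ℂ G U :=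
    hd.sub (DifferentiableOn.div (by fun_prop) (by fun_prop) hne0)
  have hGw : G w = 0 := by simp [hG, hwc]
  set φ := dslope G w with hφ
  have hφd : DifferentiableOn ℂ φ U :=
    (Complex.differentiableOn_dslope (hU.mem_nhds hw)).2 hGd
  have hφv : ∀ z, z ≠ w → φ z = G z / (z - w) := by
    intro z hz
    rw [hφ, dslope_of_ne _ hz, slope_def_field, hGw, sub_zero]
  -- The subtracted fraction decays only like 1/‖z‖, which caps the exponent at 1.
  set s : ℝ := min r 1 with hs
  have hs0 : 0 < s := lt_min hr one_pos
  obtain ⟨C', hC'⟩ := exists_bound_of_large hS (r := 1 + s)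
    (C := (C + ‖g w * (w - p)‖ * 4) * 4) (M := 1 + 2 * ‖w‖ + 2 * ‖p‖) (f := φ)
    (hφd.continuousOn.mono hSU) (by
      intro z hz hM
      have h : ∀ s : ℂ, 1 + 2 * ‖s‖ ≤ ‖z‖ → (1 + ‖z‖) / 4 ≤ ‖z - s‖ := by
        intro s hs
        linarith [norm_sub_norm_le z s, norm_nonneg z]
      have h1 := h w (by linarith [norm_nonneg p])
      have h2 := h p (by linarith [norm_nonneg w])
      have hz1 : 0 < 1 + ‖z‖ := by positivity
      have hzw : z ≠ w := by
        rintro rfl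
        simp at h1
        linarith
      have hC : 0 ≤ C := by
        have h := (norm_nonneg _).trans (hb z hz)
        exact nonneg_of_mul_nonneg_left h (by positivity)
      have hA : ‖g z‖ ≤ C * (1 + ‖z‖) ^ (-s) := (hb z hz).trans (by
        gcongr
        · linarith [norm_nonneg z]
        · exact min_le_left _ _)
      have hB : ‖g w * (w - p) / (z - p)‖ ≤ ‖g w * (w - p)‖ * 4 * (1 + ‖z‖) ^ (-s) := by
        rw [norm_div, mul_assoc]
        have h3 : (1 + ‖z‖) ^ (-(1 : ℝ)) ≤ (1 + ‖z‖) ^ (-s) :=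
          Real.rpow_le_rpow_of_exponent_le (by linarith [norm_nonneg z])
            (by linarith [min_le_right r 1])
        rw [Real.rpow_neg_one] at h3
        rw [div_eq_mul_inv]
        gcongr
        calc ‖z - p‖⁻¹ ≤ ((1 + ‖z‖) / 4)⁻¹ := by gcongr
          _ = 4 * (1 + ‖z‖)⁻¹ := by field_simp
          _ ≤ _ := by gcongr
      have hGb : ‖G z‖ ≤ (C + ‖g w * (w - p)‖ * 4) * (1 + ‖z‖) ^ (-s) := by
        refine (norm_sub_le _ _).trans ?_
        linarith
      rw [hφv z hzw, norm_div]
      have h5 : (1 + ‖z‖) ^ (-(1 + s)) = (1 + ‖z‖)⁻¹ * (1 + ‖z‖) ^ (-s) := by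
        rw [neg_add, Real.rpow_add hz1, Real.rpow_neg_one]
      rw [h5, div_eq_mul_inv]
      calc ‖G z‖ * ‖z - w‖⁻¹
          ≤ ((C + ‖g w * (w - p)‖ * 4) * (1 + ‖z‖) ^ (-s)) * ((1 + ‖z‖) / 4)⁻¹ := by gcongr
        _ = _ := by field_simp)
  refine ⟨φ, C', 1 + s, by linarith, hφd, hC', fun z hz hzw => ?_⟩
  rw [hφv z hzw]
  have h1 : z - w ≠ 0 := sub_ne_zero.2 hzw
  have h2 := hne0 z hz
  simp only [hG]
  field_simp
  ring

lemma continuous_comp_vline {U : Set ℂ} (hU : IsOpen U) {φ : ℂ → ℂ} (hφ : DifferentiableOn ℂ φ U)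
    {c : ℝ} (hc : ∀ t, vline c t ∈ U) : Continuous fun t => φ (vline c t) :=
  continuous_iff_continuousAt.2 fun t =>
    ContinuousAt.comp (hφ.differentiableAt (hU.mem_nhds (hc t))).continuousAt
      (continuous_vline c).continuousAt

lemma bound_vline {S : Set ℂ} {f : ℂ → ℂ} {C r : ℝ} (hr : 0 ≤ r)
    (h : ∀ z ∈ S, ‖f z‖ ≤ C * (1 + ‖z‖) ^ (-r)) :
    ∀ z ∈ S, ‖f z‖ ≤ C * (1 + |z.im|) ^ (-r) := by
  intro z hz
  have hC : 0 ≤ C := by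
    have h := (norm_nonneg _).trans (h z hz)
    exact nonneg_of_mul_nonneg_left h (by positivity)
  refine (h z hz).trans ?_
  gcongr C * ?_
  exact rpow_neg_norm_le hr z

lemma vline_ne {c : ℝ} {w : ℂ} (hw : w.re ≠ c) (t : ℝ) : vline c t ≠ w := by
  rintro rfl
  simp at hw

/-- Cauchy's formula for a half plane. -/
theorem integral_vline_cauchy {c0 c C r : ℝ} (hc : c0 < c) (hr : 0 < r) {g : ℂ → ℂ} {w : ℂ}
    (hw : c < w.re) (hd : DifferentiableOn ℂ g {z | c0 < z.re})
    (hb : ∀ z : ℂ, c ≤ z.re → ‖g z‖ ≤ C * (1 + ‖z‖) ^ (-r)) :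
    ∫ t : ℝ, g (vline c t) / (vline c t - w) = -2 * Real.pi * g w := by
  have hopen := isOpen_rightHalf c0
  -- The auxiliary pole sits at c0, on the excluded edge of the domain of g and to the left of the
  -- line. The regular part integrates to zero, the rational part has one pole on each side.
  obtain ⟨φ, C', s, hs, hφd, hφb, hφ⟩ := exists_regular_part (isClosed_rightHalf c) hopen
    (fun z hz => lt_of_lt_of_le hc hz) (p := c0) (w := w) (by simp; linarith) (by simp) hr hd hb
  have hzero := integral_vline_eq_zero (f := φ) hs (fun z hz =>
    hφd.differentiableAt (hopen.mem_nhds (lt_of_lt_of_le hc hz))) hφb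
  have hφint : Integrable fun t => φ (vline c t) :=
    integrable_of_le_rpow_neg hs
      (continuous_comp_vline hopen hφd fun t => by simpa).aestronglyMeasurable fun t => by
        simpa using bound_vline (by linarith) hφb (vline c t) (by simp)
  have h1 : (c0 : ℂ) - w ≠ 0 := by
    intro h
    have := congrArg Complex.re h
    simp at this
    linarith
  calc ∫ t : ℝ, g (vline c t) / (vline c t - w)
      = ∫ t : ℝ, (φ (vline c t)
          + g w * (w - c0) * ((vline c t - c0) * (vline c t - w))⁻¹) := by
        congr 1
        ext t
        exact hφ _ (by simpa) (vline_ne hw.ne' t)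
    _ = g w * (w - c0) * (2 * Real.pi / (c0 - w)) := by
        rw [integral_add hφint ((integrable_two_poles (by simpa using hc.ne) hw.ne').const_mul _),
          hzero, zero_add, integral_const_mul, integral_two_poles (by simpa) hw]
    _ = -2 * Real.pi * g w := by
        field_simp
        ring

/-- Cauchy's formula for a left half plane. -/
theorem integral_vline_cauchy_left {c0 c C r : ℝ} (hc : c < c0) (hr : 0 < r) {g : ℂ → ℂ} {w : ℂ}
    (hw : w.re < c) (hd : DifferentiableOn ℂ g {z | z.re < c0})
    (hb : ∀ z : ℂ, z.re ≤ c → ‖g z‖ ≤ C * (1 + ‖z‖) ^ (-r)) :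
    ∫ t : ℝ, g (vline c t) / (vline c t - w) = 2 * Real.pi * g w := by
  have h := integral_vline_cauchy (c0 := -c0) (c := -c) (w := -w) (g := fun z => g (-z)) (r := r)
    (C := C) (by linarith) hr (by simpa)
    (hd.comp (by fun_prop) (fun z hz => by simp at hz ⊢; linarith))
    (fun z hz => by simpa using hb (-z) (by simp; linarith))
  rw [← integral_neg_eq_self]
  have h2 : ∀ t, g (vline c (-t)) / (vline c (-t) - w)
      = -(g (-vline (-c) t) / (vline (-c) t - -w)) := by
    intro t
    have := neg_vline_neg c (-t)
    rw [neg_neg] at this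
    rw [← this, ← div_neg]
    congr 1
    ring
  simp_rw [h2]
  rw [integral_neg, h]
  simp

/-- Two poles to the right of the line, for a bounded numerator. -/
theorem integral_vline_cauchy_two {c0 c C : ℝ} (hc : c0 < c) {g : ℂ → ℂ} {w v : ℂ}
    (hw : c < w.re) (hv : c < v.re) (hwv : w ≠ v) (hd : DifferentiableOn ℂ g {z | c0 < z.re})
    (hb : ∀ z : ℂ, c ≤ z.re → ‖g z‖ ≤ C) :
    ∫ t : ℝ, g (vline c t) / ((vline c t - w) * (vline c t - v))
      = -2 * Real.pi * ((g w - g v) / (w - v)) := by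
  have hopen : IsOpen {z : ℂ | c0 < z.re} := isOpen_lt continuous_const Complex.continuous_re
  have hline : ∀ (q : ℂ), c < q.re → ∀ t, vline c t - q ≠ 0 := by
    intro q hq t h
    have := congrArg Complex.re h
    simp at this
    linarith
  -- The difference quotient at v turns a bounded numerator into one that decays like 1/‖z‖, so the
  -- formula for the single pole w applies. The leftover constant g v comes with two poles on the
  -- same side and contributes nothing.
  set φ := dslope g v with hφ
  have hφd : DifferentiableOn ℂ φ {z | c0 < z.re} :=
    (Complex.differentiableOn_dslope (hopen.mem_nhds (by simp; linarith))).2 hd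
  have hφv : ∀ z, z ≠ v → φ z = (g z - g v) / (z - v) := by
    intro z hz
    rw [hφ, dslope_of_ne _ hz, slope_def_field]
  obtain ⟨C', hC'⟩ := exists_bound_of_large (isClosed_rightHalf c) (r := 1) (C := 2 * C * 4)
    (M := 1 + 2 * ‖v‖) (f := φ) (hφd.continuousOn.mono fun z hz => lt_of_lt_of_le hc hz) (by
      intro z hz hM
      have h1 : (1 + ‖z‖) / 4 ≤ ‖z - v‖ := by
        linarith [norm_sub_norm_le z v, norm_nonneg z]
      have hz1 : 0 < 1 + ‖z‖ := by positivity
      have hzv : z ≠ v := by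
        rintro rfl
        simp at h1
        linarith
      rw [hφv z hzv, norm_div, Real.rpow_neg_one, div_eq_mul_inv]
      have h2 : ‖g z - g v‖ ≤ 2 * C :=
        (norm_sub_le _ _).trans (by linarith [hb z hz, hb v hv.le])
      have h3 : 0 ≤ 2 * C := (norm_nonneg _).trans h2
      calc ‖g z - g v‖ * ‖z - v‖⁻¹ ≤ (2 * C) * ((1 + ‖z‖) / 4)⁻¹ := by gcongr
        _ = _ := by field_simp)
  have h := integral_vline_cauchy hc one_pos hw hφd hC'
  have hint : Integrable fun t => φ (vline c t) / (vline c t - w) := by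
    obtain ⟨K, hK, hKt⟩ := exists_one_add_norm_le_mul c hw.ne'
    have hφc : Continuous fun t => φ (vline c t) := continuous_iff_continuousAt.2 fun t =>
      ContinuousAt.comp (hφd.differentiableAt (hopen.mem_nhds (by simpa))).continuousAt
        (continuous_vline c).continuousAt
    refine integrable_of_le_rpow_neg (r := 2) (C := C' * K) one_lt_two
      (Continuous.aestronglyMeasurable (hφc.div ((continuous_vline c).sub continuous_const)
        (hline w hw))) fun t => ?_
    have hC'0 : 0 ≤ C' := by
      have h := (norm_nonneg _).trans (hC' (c : ℂ) (by simp))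
      exact nonneg_of_mul_nonneg_left h (by positivity)
    have h1 : ‖φ (vline c t)‖ ≤ C' * (1 + |t|)⁻¹ := by
      refine (hC' _ (by simp)).trans ?_
      rw [← Real.rpow_neg_one]
      gcongr C' * ?_
      simpa using rpow_neg_norm_le (r := 1) (by linarith) (vline c t)
    have h2 : ‖vline c t - w‖⁻¹ ≤ K * (1 + |t|)⁻¹ := by
      rw [inv_le_iff_one_le_mul₀ (norm_pos_iff.2 (hline w hw t)), mul_assoc,
        mul_comm _ ‖_‖, ← mul_assoc, ← div_eq_mul_inv, le_div_iff₀ (by positivity)]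
      linarith [hKt t]
    rw [norm_div, div_eq_mul_inv, Real.rpow_neg (by positivity), Real.rpow_two]
    calc _ ≤ (C' * (1 + |t|)⁻¹) * (K * (1 + |t|)⁻¹) := by gcongr
      _ = _ := by field_simp
  have hsplit : ∀ t, g (vline c t) / ((vline c t - w) * (vline c t - v))
      = φ (vline c t) / (vline c t - w)
        + g v * ((vline c t - w) * (vline c t - v))⁻¹ := by
    intro t
    have h1 := hline w hw t
    have h2 := hline v hv t
    rw [hφv _ (sub_ne_zero.1 h2)]
    field_simp
    ring
  simp_rw [hsplit]
  rw [integral_add hint ((integrable_two_poles hw.ne' hv.ne').const_mul _), h, integral_const_mul,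
    integral_two_poles_right hw hv, mul_zero, add_zero, hφv w hwv]

/-- The residue at a point between two vertical lines. -/
theorem integral_vline_sub_integral_vline {c0 c3 a b C r : ℝ} (h0 : c0 < a) (h3 : b < c3)
    (hr : 0 < r) {g : ℂ → ℂ} {w : ℂ} (ha : a < w.re) (hb : w.re < b)
    (hd : DifferentiableOn ℂ g {z | c0 < z.re ∧ z.re < c3})
    (hbd : ∀ z : ℂ, a ≤ z.re → z.re ≤ b → ‖g z‖ ≤ C * (1 + ‖z‖) ^ (-r)) :
    (∫ t : ℝ, g (vline b t) / (vline b t - w)) - ∫ t : ℝ, g (vline a t) / (vline a t - w)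
      = 2 * Real.pi * g w := by
  have hopen : IsOpen {z : ℂ | c0 < z.re ∧ z.re < c3} :=
    (isOpen_lt continuous_const Complex.continuous_re).inter
      (isOpen_lt Complex.continuous_re continuous_const)
  have hclosed : IsClosed {z : ℂ | a ≤ z.re ∧ z.re ≤ b} :=
    (isClosed_le continuous_const Complex.continuous_re).inter
      (isClosed_le Complex.continuous_re continuous_const)
  obtain ⟨φ, C', s, hs, hφd, hφb, hφ⟩ := exists_regular_part hclosed hopen
    (fun z hz => ⟨h0.trans_le hz.1, hz.2.trans_lt h3⟩) (p := c0) (w := w)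
    ⟨by linarith, by linarith⟩ (by simp) hr hd (fun z hz => hbd z hz.1 hz.2)
  have hφb' := bound_vline (by linarith) hφb
  -- The regular part has the same integral on both lines. Only the rational part distinguishes
  -- them: on the line b both poles lie to the left, on the line a they are separated.
  have hshift := integral_vline_eq_of_strip (a := a) (b := b) (f := φ) (by linarith) hs
    (fun z h1 h2 => hφd.differentiableAt (hopen.mem_nhds ⟨by linarith, by linarith⟩))
    (fun z h1 h2 => hφb' z ⟨h1, h2⟩)
  have hval : ∀ c, a ≤ c → c ≤ b → w.re ≠ c → ∫ t : ℝ, g (vline c t) / (vline c t - w)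
      = (∫ t : ℝ, φ (vline c t))
        + g w * (w - c0) * ∫ t : ℝ, ((vline c t - c0) * (vline c t - w))⁻¹ := by
    intro c h1 h2 hwc
    have hφint : Integrable fun t => φ (vline c t) :=
      integrable_of_le_rpow_neg hs (continuous_comp_vline hopen hφd fun t =>
        ⟨by simp; linarith, by simp; linarith⟩).aestronglyMeasurable fun t => by
          simpa using hφb' (vline c t) ⟨by simpa, by simpa⟩
    rw [← integral_const_mul, ← integral_add hφint
      ((integrable_two_poles (by simpa using (h0.trans_le h1).ne) hwc).const_mul _)]
    congr 1
    ext t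
    exact hφ _ ⟨by simp; linarith, by simp; linarith⟩ (vline_ne hwc t)
  have h1 : (c0 : ℂ) - w ≠ 0 := by
    intro h
    have := congrArg Complex.re h
    simp at this
    linarith
  rw [hval b (by linarith) le_rfl hb.ne, hval a le_rfl (by linarith) ha.ne', hshift,
    integral_two_poles_left (by simp; linarith) hb, integral_two_poles (by simpa) ha]
  field_simp
  ring

end VerticalLine
-- Contraction data, the Cauchy logarithm and basic estimates.
namespace QuarticMatrix

open VerticalLine ComplexConjugate

/-- A complex logarithm is controlled by the distance of its argument to `1`. -/
lemma norm_log_le_of_le_norm {κ : ℝ} (hκ : 0 < κ) {w : ℂ} (hw : κ ≤ ‖w‖) :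
    ‖Complex.log w‖ ≤ (3 + 2 * κ⁻¹ + 2 * Real.pi) * ‖w - 1‖ := by
  have hκi : 0 < κ⁻¹ := inv_pos.2 hκ
  have hpi := Real.pi_pos
  -- Close to 1 the Taylor bound suffices. Otherwise ‖w − 1‖ ≥ 1/2, so the constants κ⁻¹ and π are
  -- absorbed at the price of a factor 2.
  rcases le_total ‖w - 1‖ (1 / 2) with h | h
  · have h1 := Complex.norm_log_one_add_half_le_self h
    rw [add_sub_cancel] at h1
    refine h1.trans ?_
    gcongr
    linarith
  · have hw0 : 0 < ‖w‖ := hκ.trans_le hw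
    have h1 : ‖Complex.log w‖ ≤ |Real.log ‖w‖| + Real.pi := by
      refine (Complex.norm_le_abs_re_add_abs_im _).trans ?_
      rw [Complex.log_re, Complex.log_im]
      gcongr
      exact Complex.abs_arg_le_pi w
    have h2 : |Real.log ‖w‖| ≤ ‖w - 1‖ + κ⁻¹ := by
      rw [abs_le]
      have h3 : ‖w‖ ≤ ‖w - 1‖ + 1 := by
        simpa using norm_add_le (w - 1) 1
      have h4 := Real.log_le_sub_one_of_pos hw0
      have h5 := Real.log_le_sub_one_of_pos (inv_pos.2 hw0)
      rw [Real.log_inv] at h5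
      have h6 : ‖w‖⁻¹ ≤ κ⁻¹ := by gcongr
      constructor <;> linarith [norm_nonneg (w - 1)]
    nlinarith

/-- `R` is a contraction perturbation of the identity on a half plane slightly larger than
`Re z ≥ -m`, real on the real axis, with zero `ν`. -/
structure ContrData (m θ δ ν : ℝ) (R : ℂ → ℂ) : Prop where
  θ_nonneg : 0 ≤ θ
  θ_lt : θ < 1
  δ_pos : 0 < δ
  δ_lt : δ < m
  δ_lt' : δ < ν + m
  contr : ∀ z w : ℂ, -m - δ < z.re → -m - δ < w.re → ‖R z - R w - (z - w)‖ ≤ θ * ‖z - w‖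
  diff : DifferentiableOn ℂ R {z | -m - δ < z.re}
  conj_eq : ∀ z, R (conj z) = conj (R z)
  zero : R ν = 0

/-- The data of a finite cut-off that enter the contour arguments: in addition `R` is a linear
function plus a Stieltjes transform. -/
structure CutData (lam A B m θ δ ν L : ℝ) (ρ : ℝ → ℝ) (R : ℂ → ℂ) : Prop
    extends ContrData m θ δ ν R where
  A_pos : 0 < A
  asymp : ∃ K, ∀ z : ℂ, -m - δ < z.re → ‖R z - A * z - B‖ ≤ K * (1 + ‖z‖)⁻¹
  deriv_asymp : ∃ K, ∀ z : ℂ, -m - δ < z.re → ‖deriv R z - A‖ ≤ K * (1 + ‖z‖)⁻¹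
  cont : ContinuousOn ρ (Icc ν L)
  formula : ∀ z : ℂ, -m - δ < z.re →
    R z = A * z + B - lam * ∫ t in Icc ν L, (ρ t : ℂ) / (t + 2 * m + z)

/-- The logarithm of the ratio of `b - R` and its asymptotics. -/
def logRatio (A : ℝ) (R : ℂ → ℂ) (b : ℝ) (ζ : ℂ) : ℂ :=
  Complex.log ((b - R ζ) / (A * (b - ζ)))

/-- The Cauchy integral over the image under `R` of the line `Re z = c`, with density the reflected
`logRatio`. -/
def cauchyLog (A m : ℝ) (R : ℂ → ℂ) (b c : ℝ) (X : ℂ) : ℂ :=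
  (2 * Real.pi : ℂ)⁻¹ * ∫ t : ℝ, logRatio A R b (-(2 * m) - vline c t) *
    deriv R (vline c t) / (R (vline c t) - X)

/-- The integrand bound used for all Cauchy integrals below. -/
lemma inv_mul_inv_le {c d : ℝ} (hd : 0 < d) : ∃ K, 0 < K ∧ ∀ (w : ℂ) (t : ℝ), d ≤ |w.re - c| →
    (1 + |t|)⁻¹ * ‖vline c t - w‖⁻¹ ≤ K * (1 + ‖w‖) ^ (-(1 / 4) : ℝ) *
      ((1 + |t|) ^ (-(3 / 2) : ℝ) + (1 + |t - w.im|) ^ (-(3 / 2) : ℝ)) := by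
  set K1 := 1 + 1 / d with hK1
  set K2 := 1 + (1 + |c|) / d with hK2
  have hK1p : 1 ≤ K1 := by rw [hK1]; linarith [show 0 < 1 / d by positivity]
  have hK2p : 1 ≤ K2 := by rw [hK2]; linarith [show 0 < (1 + |c|) / d by positivity]
  refine ⟨K2 ^ (1 / 4 : ℝ) * K1 ^ (3 / 2 : ℝ), by positivity, fun w t hw => ?_⟩
  set P := 1 + |t| with hP
  set Q := ‖vline c t - w‖ with hQ
  have hP1 : 1 ≤ P := by rw [hP]; linarith [abs_nonneg t]
  have hQd : d ≤ Q := hw.trans (by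
    have := Complex.abs_re_le_norm (vline c t - w)
    rw [Complex.sub_re, vline_re, abs_sub_comm] at this
    exact this)
  have hQ0 : 0 < Q := hd.trans_le hQd
  have hQt : |t - w.im| ≤ Q := by simpa using Complex.abs_im_le_norm (vline c t - w)
  have h1 : 1 + |t - w.im| ≤ K1 * Q := by
    have : 1 ≤ 1 / d * Q := by rw [div_mul_eq_mul_div, one_mul, le_div_iff₀ hd]; linarith
    rw [hK1]; linarith
  have h2 : 1 + ‖w‖ ≤ K2 * (P * Q) := by
    have h3 : ‖w‖ ≤ Q + (|c| + |t|) := by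
      have h4 : ‖vline c t‖ ≤ |c| + |t| := by
        simpa using Complex.norm_le_abs_re_add_abs_im (vline c t)
      have h5 := norm_sub_norm_le w (vline c t)
      rw [norm_sub_rev] at h5
      linarith
    have h6 : (1 + |c|) * P ≤ (1 + |c|) / d * (P * Q) := by
      rw [div_mul_eq_mul_div, le_div_iff₀ hd, mul_assoc]
      gcongr
    have h7 : Q ≤ P * Q := by nlinarith
    have h8 : 1 + (|c| + |t|) ≤ (1 + |c|) * P := by
      rw [hP]; nlinarith [abs_nonneg c, abs_nonneg t, mul_nonneg (abs_nonneg c) (abs_nonneg t)]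
    rw [hK2]; linarith
  have hPQ : 0 < P * Q := by positivity
  -- The exponent of PQ is divided as 1/4 + 3/4. The first part becomes decay in w, because 1 + ‖w‖
  -- ≤ K2 P Q; the second is integrable in t, because P^(−3/4) Q^(−3/4) is at most P^(−3/2) +
  -- Q^(−3/2).
  have e1 : P⁻¹ * Q⁻¹ = (P * Q) ^ (-(1 / 4) : ℝ) * (P * Q) ^ (-(3 / 4) : ℝ) := by
    rw [← Real.rpow_add hPQ, ← mul_inv]; norm_num [Real.rpow_neg_one]
  have e2 : (P * Q) ^ (-(1 / 4) : ℝ) ≤ K2 ^ (1 / 4 : ℝ) * (1 + ‖w‖) ^ (-(1 / 4) : ℝ) := by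
    have h3 : (K2 * (P * Q)) ^ (-(1 / 4) : ℝ) ≤ (1 + ‖w‖) ^ (-(1 / 4) : ℝ) :=
      Real.rpow_le_rpow_of_nonpos (by positivity) h2 (by norm_num)
    rw [Real.mul_rpow (by positivity) hPQ.le] at h3
    calc (P * Q) ^ (-(1 / 4) : ℝ)
        = K2 ^ (1 / 4 : ℝ) * (K2 ^ (-(1 / 4) : ℝ) * (P * Q) ^ (-(1 / 4) : ℝ)) := by
          rw [← mul_assoc, ← Real.rpow_add (by positivity)]; simp
      _ ≤ _ := by gcongr
  have e3 : (P * Q) ^ (-(3 / 4) : ℝ) ≤ P ^ (-(3 / 2) : ℝ) + Q ^ (-(3 / 2) : ℝ) := by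
    rw [Real.mul_rpow (by positivity) hQ0.le]
    have hp : P ^ (-(3 / 2) : ℝ) = (P ^ (-(3 / 4) : ℝ)) ^ 2 := by
      rw [← Real.rpow_natCast, ← Real.rpow_mul (by positivity)]; norm_num
    have hq : Q ^ (-(3 / 2) : ℝ) = (Q ^ (-(3 / 4) : ℝ)) ^ 2 := by
      rw [← Real.rpow_natCast, ← Real.rpow_mul (by positivity)]; norm_num
    rw [hp, hq]
    nlinarith [sq_nonneg (P ^ (-(3 / 4) : ℝ) - Q ^ (-(3 / 4) : ℝ)),
      sq_nonneg (P ^ (-(3 / 4) : ℝ)), sq_nonneg (Q ^ (-(3 / 4) : ℝ))]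
  have e4 : Q ^ (-(3 / 2) : ℝ) ≤ K1 ^ (3 / 2 : ℝ) * (1 + |t - w.im|) ^ (-(3 / 2) : ℝ) := by
    have h3 : (K1 * Q) ^ (-(3 / 2) : ℝ) ≤ (1 + |t - w.im|) ^ (-(3 / 2) : ℝ) :=
      Real.rpow_le_rpow_of_nonpos (by positivity) h1 (by norm_num)
    rw [Real.mul_rpow (by positivity) hQ0.le] at h3
    calc Q ^ (-(3 / 2) : ℝ)
        = K1 ^ (3 / 2 : ℝ) * (K1 ^ (-(3 / 2) : ℝ) * Q ^ (-(3 / 2) : ℝ)) := by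
          rw [← mul_assoc, ← Real.rpow_add (by positivity)]; simp
      _ ≤ _ := by gcongr
  have e5 : 1 ≤ K1 ^ (3 / 2 : ℝ) := Real.one_le_rpow hK1p (by norm_num)
  rw [e1]
  calc (P * Q) ^ (-(1 / 4) : ℝ) * (P * Q) ^ (-(3 / 4) : ℝ)
      ≤ (K2 ^ (1 / 4 : ℝ) * (1 + ‖w‖) ^ (-(1 / 4) : ℝ)) *
        (K1 ^ (3 / 2 : ℝ) * P ^ (-(3 / 2) : ℝ)
          + K1 ^ (3 / 2 : ℝ) * (1 + |t - w.im|) ^ (-(3 / 2) : ℝ)) := by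
        gcongr
        refine e3.trans (add_le_add ?_ e4)
        exact le_mul_of_one_le_left (by positivity) e5
    _ = _ := by ring

/-- Translation invariance removes the dependence on s, so the Cauchy integrals are bounded
uniformly in the imaginary part of the evaluation point. -/
lemma integral_bump (K s : ℝ) : ∫ t : ℝ, K * ((1 + |t|) ^ (-(3 / 2) : ℝ)
      + (1 + |t - s|) ^ (-(3 / 2) : ℝ)) = K * (2 * ∫ t : ℝ, (1 + |t|) ^ (-(3 / 2) : ℝ)) := by
  have h : Integrable fun t : ℝ => (1 + |t|) ^ (-(3 / 2) : ℝ) := integrable_rpow_neg (by norm_num)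
  rw [integral_const_mul, integral_add h (h.comp_sub_right s),
    integral_sub_right_eq_self (fun t : ℝ => (1 + |t|) ^ (-(3 / 2) : ℝ)), two_mul]

lemma integrable_bump (K s : ℝ) : Integrable fun t : ℝ => K * ((1 + |t|) ^ (-(3 / 2) : ℝ)
      + (1 + |t - s|) ^ (-(3 / 2) : ℝ)) := by
  have h : Integrable fun t : ℝ => (1 + |t|) ^ (-(3 / 2) : ℝ) := integrable_rpow_neg (by norm_num)
  exact (h.add (h.comp_sub_right s)).const_mul K

/-! ### Consequences of the contraction property. -/

namespace ContrData

variable {m θ δ ν : ℝ} {R : ℂ → ℂ}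

lemma contr_neg (H : ContrData m θ δ ν R) : -m < ν := by
  linarith [H.δ_lt', H.δ_pos]

lemma norm_sub_ge (H : ContrData m θ δ ν R) {z w : ℂ} (hz : -m - δ < z.re)
    (hw : -m - δ < w.re) : (1 - θ) * ‖z - w‖ ≤ ‖R z - R w‖ := by
  have h := H.contr z w hz hw
  have h2 := norm_sub_norm_le (z - w) (R z - R w)
  rw [norm_sub_rev (z - w)] at h2
  linarith

/-- Moving z to the left by s only increases its distance to points w on its right, so the
contraction error θ‖w − z‖ is still absorbed. The bound concerns the points R z − s, which need not
be values of R. -/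
lemma norm_sub_add_ge (H : ContrData m θ δ ν R) {z w : ℂ} (hz : -m - δ < z.re)
    (hzw : z.re ≤ w.re) {s : ℝ} (hs : 0 ≤ s) :
    (1 - θ) * ‖w - (z - s)‖ ≤ ‖R w - (R z - s)‖ := by
  have h := H.contr w z (by linarith) hz
  have h1 : ‖w - z‖ ≤ ‖w - (z - s)‖ := by
    rw [← sq_le_sq₀ (norm_nonneg _) (norm_nonneg _), Complex.sq_norm, Complex.sq_norm,
      Complex.normSq_apply, Complex.normSq_apply]
    simp only [Complex.sub_re, Complex.sub_im, Complex.ofReal_re, Complex.ofReal_im]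
    nlinarith
  have h2 := norm_sub_norm_le (w - (z - s)) (R w - (R z - s))
  rw [norm_sub_rev (w - (z - (s : ℂ))) (R w - (R z - s)),
    show R w - (R z - s) - (w - (z - s)) = R w - R z - (w - z) by ring] at h2
  have := H.θ_nonneg
  have h3 : θ * ‖w - z‖ ≤ θ * ‖w - (z - s)‖ := by gcongr
  linarith

/-- The shifted bound with w = ν, where R vanishes, and s = b. It is uniform in b ≥ 0. -/
lemma norm_sub_ge_of_re_le (H : ContrData m θ δ ν R) {ζ : ℂ} (hζ : -m - δ < ζ.re)
    (hζν : ζ.re ≤ ν) {b : ℝ} (hb : 0 ≤ b) : (1 - θ) * ‖(ν : ℂ) - ζ + b‖ ≤ ‖(b : ℂ) - R ζ‖ := by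
  have h := H.norm_sub_add_ge hζ (w := ν) (by simpa) hb
  rw [H.zero] at h
  rwa [show (b : ℂ) - R ζ = 0 - (R ζ - b) by ring, show (ν : ℂ) - ζ + b = ν - (ζ - b) by ring]

lemma injOn (H : ContrData m θ δ ν R) {z w : ℂ} (hz : -m - δ < z.re)
    (hw : -m - δ < w.re) (h : R z = R w) : z = w := by
  have h1 := H.norm_sub_ge hz hw
  rw [h, sub_self, norm_zero] at h1
  have h2 : ‖z - w‖ ≤ 0 := by
    by_contra! h3
    nlinarith [H.θ_lt]
  exact sub_eq_zero.1 (norm_le_zero_iff.1 h2)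

lemma differentiableAt (H : ContrData m θ δ ν R) {z : ℂ} (hz : -m - δ < z.re) :
    DifferentiableAt ℂ R z :=
  H.diff.differentiableAt ((isOpen_rightHalf _).mem_nhds hz)

lemma diff_deriv (H : ContrData m θ δ ν R) :
    DifferentiableOn ℂ (deriv R) {z | -m - δ < z.re} :=
  H.diff.deriv (isOpen_rightHalf _)

lemma norm_deriv_sub_one_le (H : ContrData m θ δ ν R) {z : ℂ} (hz : -m - δ < z.re) :
    ‖deriv R z - 1‖ ≤ θ := by
  have h : HasDerivAt (fun w => R w - w) (deriv R z - 1) z :=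
    (H.differentiableAt hz).hasDerivAt.sub (hasDerivAt_id z)
  refine h.le_of_lip' H.θ_nonneg ?_
  filter_upwards [(isOpen_rightHalf (-m - δ)).mem_nhds hz] with w hw
  have := H.contr w z hw hz
  rwa [show R w - R z - (w - z) = R w - w - (R z - z) by ring] at this

lemma norm_deriv_le (H : ContrData m θ δ ν R) {z : ℂ} (hz : -m - δ < z.re) :
    ‖deriv R z‖ ≤ 2 := by
  have h := H.norm_deriv_sub_one_le hz
  have h2 := norm_add_le (deriv R z - 1) 1
  rw [sub_add_cancel, norm_one] at h2
  linarith [H.θ_lt]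

lemma norm_dslope_sub_one_le (H : ContrData m θ δ ν R) {z w : ℂ} (hz : -m - δ < z.re)
    (hw : -m - δ < w.re) : ‖dslope R w z - 1‖ ≤ θ := by
  rcases eq_or_ne z w with rfl | h
  · rw [dslope_same]
    exact H.norm_deriv_sub_one_le hz
  · have h0 : z - w ≠ 0 := sub_ne_zero.2 h
    rw [dslope_of_ne _ h, slope_def_field, div_sub_one h0, norm_div,
      div_le_iff₀ (norm_pos_iff.2 h0)]
    exact H.contr z w hz hw

lemma norm_dslope_ge (H : ContrData m θ δ ν R) {z w : ℂ} (hz : -m - δ < z.re)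
    (hw : -m - δ < w.re) : 1 - θ ≤ ‖dslope R w z‖ := by
  have h := H.norm_dslope_sub_one_le hz hw
  have h2 := norm_sub_norm_le 1 (dslope R w z)
  rw [norm_sub_rev, norm_one] at h2
  linarith

lemma dslope_ne_zero (H : ContrData m θ δ ν R) {z w : ℂ} (hz : -m - δ < z.re)
    (hw : -m - δ < w.re) : dslope R w z ≠ 0 := by
  have := H.norm_dslope_ge hz hw
  exact norm_pos_iff.1 (by linarith [H.θ_lt])

lemma dslope_differentiableOn (H : ContrData m θ δ ν R) {w : ℂ} (hw : -m - δ < w.re) :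
    DifferentiableOn ℂ (dslope R w) {z | -m - δ < z.re} :=
  (Complex.differentiableOn_dslope ((isOpen_rightHalf _).mem_nhds hw)).2 H.diff

/-- The function `R'(z) (z - w) / (R(z) - R(w))`. -/
lemma diff_ratio (H : ContrData m θ δ ν R) {w : ℂ} (hw : -m - δ < w.re) :
    DifferentiableOn ℂ (fun z => deriv R z / dslope R w z) {z | -m - δ < z.re} :=
  H.diff_deriv.div (H.dslope_differentiableOn hw) fun _ hz => H.dslope_ne_zero hz hw

lemma norm_ratio_le (H : ContrData m θ δ ν R) {z w : ℂ} (hz : -m - δ < z.re)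
    (hw : -m - δ < w.re) : ‖deriv R z / dslope R w z‖ ≤ 2 / (1 - θ) := by
  have := H.θ_lt
  rw [norm_div]
  exact div_le_div₀ zero_le_two (H.norm_deriv_le hz) (by linarith) (H.norm_dslope_ge hz hw)

lemma ratio_same (H : ContrData m θ δ ν R) {w : ℂ} (hw : -m - δ < w.re) :
    deriv R w / dslope R w w = 1 := by
  have := H.dslope_ne_zero hw hw
  rw [dslope_same] at this ⊢
  exact div_self this

/-- Gives the kernel of the deformed variable a bounded holomorphic numerator over z − w, so that
Cauchy's formula for a simple pole applies; by `ratio_same` the residue is that of 1/(z − w). -/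
lemma ratio_div (H : ContrData m θ δ ν R) {z w : ℂ} (hz : -m - δ < z.re)
    (hw : -m - δ < w.re) (hzw : z ≠ w) :
    deriv R z / dslope R w z / (z - w) = deriv R z / (R z - R w) := by
  have h1 : z - w ≠ 0 := sub_ne_zero.2 hzw
  have h2 : R z - R w ≠ 0 := fun h => hzw (H.injOn hz hw (sub_eq_zero.1 h))
  rw [dslope_of_ne _ hzw, slope_def_field]
  field_simp

/-- Contraction applied to z and its conjugate: conjugation symmetry turns both differences into
twice imaginary parts. -/
lemma abs_im_sub_le (H : ContrData m θ δ ν R) {z : ℂ} (hz : -m - δ < z.re) :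
    |(R z).im - z.im| ≤ θ * |z.im| := by
  have h := H.contr z (conj z) hz (by simpa)
  rw [H.conj_eq, Complex.sub_conj, Complex.sub_conj, ← sub_mul, norm_mul, norm_mul,
    Complex.norm_I, ← Complex.ofReal_sub, Complex.norm_real, Complex.norm_real, ← mul_sub,
    Real.norm_eq_abs, Real.norm_eq_abs, abs_mul, abs_mul, abs_two] at h
  linarith

lemma ofReal_im (H : ContrData m θ δ ν R) (x : ℝ) : (R x).im = 0 := by
  have h := H.conj_eq x
  rw [Complex.conj_ofReal] at h
  exact Complex.conj_eq_iff_im.1 h.symm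

lemma im_mul_pos (H : ContrData m θ δ ν R) {z : ℂ} (hz : -m - δ < z.re)
    (h0 : z.im ≠ 0) : 0 < (R z).im * z.im := by
  have h := H.abs_im_sub_le hz
  have h1 := H.θ_lt
  have h2 : 0 < |z.im| := abs_pos.2 h0
  have h3 : |(R z).im - z.im| * |z.im| ≤ θ * z.im ^ 2 := by
    rw [← sq_abs]; nlinarith
  rw [← abs_mul] at h3
  have h4 := neg_abs_le (((R z).im - z.im) * z.im)
  have h5 : 0 < z.im ^ 2 := by positivity
  nlinarith

lemma sub_ofReal_pos (H : ContrData m θ δ ν R) {x : ℝ} (hx : -m - δ < x)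
    (hxν : x < ν) : (R x).re < 0 := by
  have h := H.contr ν x (by simp; linarith) (by simpa)
  have h1 := (Complex.abs_re_le_norm _).trans h
  rw [H.zero, ← Complex.ofReal_sub, Complex.norm_real, Real.norm_eq_abs, abs_of_pos (a := ν - x) (by linarith),
    abs_le] at h1
  simp at h1
  nlinarith [H.θ_lt, h1.1]

lemma m_pos (H : ContrData m θ δ ν R) : 0 < m := H.δ_pos.trans H.δ_lt

lemma exists_preimage (H : ContrData m θ δ ν R) {a : ℝ} (ha : 0 ≤ a) :
    ∃ α : ℝ, ν ≤ α ∧ R α = a := by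
  have hθ := H.θ_lt
  have hδ := H.δ_pos
  have hν := H.contr_neg
  have hcont : ContinuousOn (fun x : ℝ => (R x).re) (Ici ν) := by
    intro x hx
    have hx' : ν ≤ x := hx
    have hd := (H.differentiableAt (z := x) (by rw [Complex.ofReal_re]; linarith)).continuousAt
    exact (Complex.continuous_re.continuousAt.comp
      (ContinuousAt.comp (f := fun x : ℝ => (x : ℂ)) hd
        Complex.continuous_ofReal.continuousAt)).continuousWithinAt
  -- Chosen so that the lower bound (1 − θ)(x1 − ν) for R(x1) equals a.
  set x1 := ν + a / (1 - θ) with hx1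
  have hx1ν : ν ≤ x1 := by
    have : 0 ≤ a / (1 - θ) := div_nonneg ha (by linarith)
    linarith
  have h0 : (R (ν : ℂ)).re = 0 := by rw [H.zero]; rfl
  have h1 : a ≤ (R (x1 : ℂ)).re := by
    have h := H.contr x1 ν (by rw [Complex.ofReal_re]; linarith)
      (by rw [Complex.ofReal_re]; linarith)
    have h2 := (Complex.abs_re_le_norm _).trans h
    rw [H.zero, ← Complex.ofReal_sub, Complex.norm_real, Real.norm_eq_abs,
      abs_of_nonneg (a := x1 - ν) (by linarith), abs_le, sub_zero, Complex.sub_re,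
      Complex.ofReal_re] at h2
    have h3 : (1 - θ) * (x1 - ν) = a := by
      rw [hx1, add_sub_cancel_left, mul_div_cancel₀ _ (by linarith)]
    linarith [h2.1]
  obtain ⟨α, hα, hα'⟩ := intermediate_value_Icc hx1ν (hcont.mono fun x hx => hx.1)
    (show a ∈ Icc _ _ from ⟨by rw [h0]; exact ha, h1⟩)
  refine ⟨α, hα.1, Complex.ext (by rw [Complex.ofReal_re]; exact hα') ?_⟩
  rw [H.ofReal_im, Complex.ofReal_im]

lemma ofReal_mem (H : ContrData m θ δ ν R) {s : ℝ} (hs : ν ≤ s) :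
    -m - δ < (s : ℂ).re := by
  rw [Complex.ofReal_re]
  linarith [H.contr_neg, H.δ_pos]

lemma ofReal_re_eq (H : ContrData m θ δ ν R) (s : ℝ) : (((R s).re : ℝ) : ℂ) = R s :=
  Complex.ext (by simp) (by rw [Complex.ofReal_im, H.ofReal_im])

lemma re_sub_ge (H : ContrData m θ δ ν R) {s t : ℝ} (hs : ν ≤ s) (hst : s ≤ t) :
    (1 - θ) * (t - s) ≤ (R t).re - (R s).re := by
  have h := H.contr t s (H.ofReal_mem (hs.trans hst)) (H.ofReal_mem hs)
  have h2 := (Complex.abs_re_le_norm _).trans h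
  rw [← Complex.ofReal_sub, Complex.norm_real, Real.norm_eq_abs,
    abs_of_nonneg (a := t - s) (by linarith), abs_le, Complex.sub_re, Complex.sub_re,
    Complex.ofReal_re] at h2
  linarith [h2.1]

lemma re_nonneg (H : ContrData m θ δ ν R) {s : ℝ} (hs : ν ≤ s) : 0 ≤ (R s).re := by
  have h := H.re_sub_ge le_rfl hs
  rw [H.zero, Complex.zero_re, sub_zero] at h
  exact (mul_nonneg (by linarith [H.θ_lt]) (by linarith)).trans h

lemma hasDerivAt_re (H : ContrData m θ δ ν R) {s : ℝ} (hs : ν ≤ s) :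
    HasDerivAt (fun s : ℝ => (R s).re) (deriv R s).re s :=
  (H.differentiableAt (H.ofReal_mem hs)).hasDerivAt.real_of_complex

lemma ofReal_deriv_re_eq (H : ContrData m θ δ ν R) {s : ℝ} (hs : ν ≤ s) :
    (((deriv R s).re : ℝ) : ℂ) = deriv R s := by
  have h1 := (H.hasDerivAt_re hs).ofReal_comp
  simp_rw [H.ofReal_re_eq] at h1
  exact h1.unique (H.differentiableAt (H.ofReal_mem hs)).hasDerivAt.comp_ofReal

lemma deriv_re_pos (H : ContrData m θ δ ν R) {s : ℝ} (hs : ν ≤ s) :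
    0 < (deriv R s).re := by
  have h := (Complex.abs_re_le_norm _).trans (H.norm_deriv_sub_one_le (H.ofReal_mem hs))
  rw [Complex.sub_re, Complex.one_re, abs_le] at h
  linarith [h.1, H.θ_lt]

lemma re_strictMonoOn (H : ContrData m θ δ ν R) :
    StrictMonoOn (fun s : ℝ => (R s).re) (Ici ν) := by
  intro s hs t _ hst
  have h1 := H.re_sub_ge hs hst.le
  have h2 : 0 < (1 - θ) * (t - s) := mul_pos (by linarith [H.θ_lt]) (by linarith)
  simp only
  linarith

end ContrData

/-! ### The logarithm of the ratio near the line Re z = −m. -/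

namespace CutData

variable {lam A B m θ δ ν L : ℝ} {ρ : ℝ → ℝ} {R : ℂ → ℂ}

/-- Off the real axis b − R ζ and b − ζ have imaginary parts of the same sign, so the quotient
cannot be a real number ≤ 0. On the real axis numerator and denominator are positive, since the
strip lies to the left of ν and of 0. -/
lemma ratio_mem_slitPlane (H : CutData lam A B m θ δ ν L ρ R) {ζ : ℂ} (hζ : -m - δ < ζ.re)
    (hζν : ζ.re < -m + δ) {b : ℝ} (hb : 0 ≤ b) :
    ((b : ℂ) - R ζ) / (A * (b - ζ)) ∈ Complex.slitPlane := by
  have hA := H.A_pos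
  have hδ := H.δ_lt
  have hδ' := H.δ_lt'
  by_cases h : ζ.im = 0
  · have h1 : ζ = (ζ.re : ℂ) := Complex.ext rfl (by simpa using h)
    have h2 := H.sub_ofReal_pos hζ (by linarith)
    have h3 : R ζ = ((R ζ.re).re : ℂ) := by
      conv_lhs => rw [h1]
      exact Complex.ext rfl (by simpa using H.ofReal_im _)
    rw [h3, h1, ← Complex.ofReal_sub, ← Complex.ofReal_sub, ← Complex.ofReal_mul,
      ← Complex.ofReal_div, Complex.ofReal_mem_slitPlane]
    simp only [Complex.ofReal_re]
    exact div_pos (by linarith) (mul_pos hA (by linarith))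
  · have hne : (A : ℂ) * (b - ζ) ≠ 0 := by
      refine mul_ne_zero (by exact_mod_cast hA.ne') fun h0 => h ?_
      have := congrArg Complex.im h0
      simpa using this
    set q := ((b : ℂ) - R ζ) / (A * (b - ζ)) with hq
    rw [Complex.mem_slitPlane_iff]
    by_contra! hcon
    have hq1 : q = (q.re : ℂ) := Complex.ext rfl (by simpa using hcon.2)
    have h1 : (b : ℂ) - R ζ = q.re * (A * (b - ζ)) := by
      rw [← hq1, hq, div_mul_cancel₀ _ hne]
    have h2 := congrArg Complex.im h1
    simp at h2
    have h3 := H.im_mul_pos hζ h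
    rw [h2, mul_assoc, mul_assoc] at h3
    have h4 : 0 < ζ.im * ζ.im := mul_self_pos.2 h
    have h5 : 0 < A * (ζ.im * ζ.im) := mul_pos hA h4
    nlinarith [hcon.1]

lemma ratio_ne_zero (H : CutData lam A B m θ δ ν L ρ R) {ζ : ℂ} (hζ : -m - δ < ζ.re)
    (hζν : ζ.re < -m + δ) {b : ℝ} (hb : 0 ≤ b) : ((b : ℂ) - R ζ) / (A * (b - ζ)) ≠ 0 :=
  Complex.slitPlane_ne_zero (H.ratio_mem_slitPlane hζ hζν hb)

lemma exp_logRatio (H : CutData lam A B m θ δ ν L ρ R) {ζ : ℂ} (hζ : -m - δ < ζ.re)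
    (hζν : ζ.re < -m + δ) {b : ℝ} (hb : 0 ≤ b) :
    Complex.exp (logRatio A R b ζ) = (b - R ζ) / (A * (b - ζ)) :=
  Complex.exp_log (H.ratio_ne_zero hζ hζν hb)

/-- One constant serves all b ≥ 0: the strip lies to the left of both p = ν and p = 0, so adding b
only moves p − ζ further away from 0. -/
lemma exists_norm_ge (H : CutData lam A B m θ δ ν L ρ R) : ∃ κ, 0 < κ ∧ ∀ ζ : ℂ,
    -m - δ < ζ.re → ζ.re < -m + δ → ∀ b : ℝ, 0 ≤ b → κ * (1 + ‖ζ‖) ≤ ‖(b : ℂ) - R ζ‖ ∧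
      κ * (1 + ‖ζ‖) ≤ ‖(b : ℂ) - ζ‖ ∧ κ * (b + ‖ζ‖) ≤ ‖(b : ℂ) - R ζ‖ := by
  have hθ := H.θ_lt
  have hδ := H.δ_lt
  have hδ' := H.δ_lt'
  have aux : ∀ p : ℝ, -m + δ < p → ∃ κ, 0 < κ ∧ ∀ ζ : ℂ, -m - δ < ζ.re → ζ.re < -m + δ →
      ∀ b : ℝ, 0 ≤ b → κ * (1 + ‖ζ‖) ≤ ‖(p : ℂ) - ζ + b‖ ∧
        κ * (b + ‖ζ‖) ≤ ‖(p : ℂ) - ζ + b‖ := by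
    intro p hp
    set d := p + m - δ with hd
    have hd0 : 0 < d := by linarith
    refine ⟨(2 + (1 + |p|) / d)⁻¹, by positivity, fun ζ h1 h2 b hb => ?_⟩
    set Q := ‖(p : ℂ) - ζ + b‖ with hQ
    have h3 : d + b ≤ Q := by
      have := (le_abs_self _).trans (Complex.abs_re_le_norm ((p : ℂ) - ζ + b))
      simp at this
      linarith
    have h4 : ‖(p : ℂ) - ζ‖ ≤ Q := by
      rw [← sq_le_sq₀ (norm_nonneg _) (norm_nonneg _), Complex.sq_norm, Complex.sq_norm,
        Complex.normSq_apply, Complex.normSq_apply]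
      simp only [Complex.sub_re, Complex.sub_im, Complex.add_re, Complex.add_im,
        Complex.ofReal_re, Complex.ofReal_im]
      nlinarith
    have h5 : ‖ζ‖ ≤ Q + |p| := by
      have := norm_sub_norm_le ζ p
      rw [norm_sub_rev, Complex.norm_real, Real.norm_eq_abs] at this
      linarith
    have h6 : 1 + |p| ≤ (1 + |p|) / d * Q := by
      rw [div_mul_eq_mul_div, le_div_iff₀ hd0]
      gcongr
      linarith
    have h7 : 0 < 2 + (1 + |p|) / d := by positivity
    constructor
    · rw [inv_mul_le_iff₀ h7]
      linarith [abs_nonneg p]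
    · rw [inv_mul_le_iff₀ h7]
      linarith [abs_nonneg p]
  obtain ⟨κ1, hκ1, h1⟩ := aux ν (by linarith)
  obtain ⟨κ2, hκ2, h2⟩ := aux 0 (by linarith)
  have h1θ : 0 < 1 - θ := by linarith
  refine ⟨min ((1 - θ) * κ1) κ2, by positivity, fun ζ h3 h4 b hb => ⟨?_, ?_, ?_⟩⟩
  · refine le_trans ?_ (H.norm_sub_ge_of_re_le h3 (by linarith) hb)
    calc _ ≤ ((1 - θ) * κ1) * (1 + ‖ζ‖) := by gcongr; exact min_le_left _ _
      _ ≤ _ := by rw [mul_assoc]; gcongr; exact (h1 ζ h3 h4 b hb).1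
  · calc _ ≤ κ2 * (1 + ‖ζ‖) := by gcongr; exact min_le_right _ _
      _ ≤ _ := (h2 ζ h3 h4 b hb).1
      _ = _ := by congr 1; push_cast; ring
  · refine le_trans ?_ (H.norm_sub_ge_of_re_le h3 (by linarith) hb)
    calc _ ≤ ((1 - θ) * κ1) * (b + ‖ζ‖) := by gcongr; exact min_le_left _ _
      _ ≤ _ := by rw [mul_assoc]; gcongr; exact (h1 ζ h3 h4 b hb).2

lemma exists_norm_sub_le (H : CutData lam A B m θ δ ν L ρ R) :
    ∃ K, 0 < K ∧ ∀ z : ℂ, -m - δ < z.re → ‖R z - A * z‖ ≤ K := by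
  obtain ⟨K, hK⟩ := H.asymp
  refine ⟨|K| + |B| + 1, by positivity, fun z hz => ?_⟩
  have h1 := hK z hz
  have h2 := norm_add_le (R z - A * z - B) B
  rw [sub_add_cancel, Complex.norm_real, Real.norm_eq_abs] at h2
  have h3 : K * (1 + ‖z‖)⁻¹ ≤ |K| * 1 := by
    gcongr
    · exact le_abs_self K
    · exact inv_le_one_of_one_le₀ (by linarith [norm_nonneg z])
  linarith

/-- R − A z is bounded, so the ratio is 1 + O(1/‖ζ‖). The factor A in the denominator of `logRatio`
is there to make the logarithm decay. -/
lemma exists_norm_logRatio_le (H : CutData lam A B m θ δ ν L ρ R) {b : ℝ} (hb : 0 ≤ b) :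
    ∃ K, 0 < K ∧ ∀ ζ : ℂ, -m - δ < ζ.re → ζ.re < -m + δ →
      ‖logRatio A R b ζ‖ ≤ K * (1 + ‖ζ‖)⁻¹ := by
  have hA := H.A_pos
  obtain ⟨κ, hκ, hκ'⟩ := H.exists_norm_ge
  obtain ⟨K, hK, hK'⟩ := H.exists_norm_sub_le
  have hpi := Real.pi_pos
  set M := A * (b + A⁻¹ * K + 1) + b + K with hM
  have hM0 : 0 < M := by positivity
  have hb1 : ∀ ζ : ℂ, -m - δ < ζ.re → ‖(b : ℂ) - R ζ - A * (b - ζ)‖ ≤ M := by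
    intro ζ hζ
    have h1 : (b : ℂ) - R ζ - A * (b - ζ) = b - A * b - (R ζ - A * ζ) := by ring
    rw [h1]
    refine (norm_sub_le _ _).trans ?_
    have h2 : ‖(b : ℂ) - A * b‖ ≤ b + A * b := by
      refine (norm_sub_le _ _).trans ?_
      rw [norm_mul, Complex.norm_real, Complex.norm_real, Real.norm_eq_abs, Real.norm_eq_abs,
        abs_of_nonneg hb, abs_of_pos hA]
    have h3 := hK' ζ hζ
    have h4 : 0 ≤ A * (A⁻¹ * K + 1) := by positivity
    rw [hM]
    linarith
  have hup : ∀ ζ : ℂ, ‖(b : ℂ) - ζ‖ ≤ (1 + b) * (1 + ‖ζ‖) := by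
    intro ζ
    refine (norm_sub_le _ _).trans ?_
    rw [Complex.norm_real, Real.norm_eq_abs, abs_of_nonneg hb]
    nlinarith [norm_nonneg ζ]
  set κ' := κ / (A * (1 + b)) with hκ'def
  have hκ'0 : 0 < κ' := by positivity
  refine ⟨(3 + 2 * κ'⁻¹ + 2 * Real.pi) * (M / (A * κ)), by positivity, fun ζ h1 h2 => ?_⟩
  obtain ⟨h3, h4, -⟩ := hκ' ζ h1 h2 b hb
  have hpos : 0 < 1 + ‖ζ‖ := by positivity
  have h5 : 0 < ‖(b : ℂ) - ζ‖ := lt_of_lt_of_le (by positivity) h4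
  have hden : (A : ℂ) * (b - ζ) ≠ 0 :=
    mul_ne_zero (by exact_mod_cast hA.ne') (norm_pos_iff.1 h5)
  have hnd : ‖(A : ℂ) * (b - ζ)‖ = A * ‖(b : ℂ) - ζ‖ := by
    rw [norm_mul, Complex.norm_real, Real.norm_eq_abs, abs_of_pos hA]
  have hlow : κ' ≤ ‖((b : ℂ) - R ζ) / (A * (b - ζ))‖ := by
    rw [norm_div, hnd, le_div_iff₀ (by positivity), hκ'def, div_mul_eq_mul_div,
      div_le_iff₀ (by positivity)]
    calc κ * (A * ‖(b : ℂ) - ζ‖) ≤ κ * (A * ((1 + b) * (1 + ‖ζ‖))) := by gcongr; exact hup ζ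
      _ = κ * (1 + ‖ζ‖) * (A * (1 + b)) := by ring
      _ ≤ _ := by gcongr
  refine (norm_log_le_of_le_norm hκ'0 hlow).trans ?_
  rw [mul_assoc]
  gcongr
  rw [div_sub_one hden, norm_div, hnd, ← div_eq_mul_inv, div_div]
  have h6 : A * κ * (1 + ‖ζ‖) ≤ A * ‖(b : ℂ) - ζ‖ := by rw [mul_assoc]; gcongr
  gcongr
  exact hb1 ζ h1

lemma isOpen_strip (a b : ℝ) : IsOpen {z : ℂ | a < z.re ∧ z.re < b} :=
  (isOpen_lt continuous_const Complex.continuous_re).inter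
    (isOpen_lt Complex.continuous_re continuous_const)

lemma diff_logRatio (H : CutData lam A B m θ δ ν L ρ R) {b : ℝ} (hb : 0 ≤ b) :
    DifferentiableOn ℂ (logRatio A R b) {z | -m - δ < z.re ∧ z.re < -m + δ} := by
  refine DifferentiableOn.clog (DifferentiableOn.div ?_ (by fun_prop) ?_) ?_
  · exact (differentiableOn_const _).sub (H.diff.mono fun z hz => hz.1)
  · intro z hz h
    have := H.ratio_ne_zero hz.1 hz.2 hb
    rw [h, div_zero] at this
    exact this rfl
  · exact fun z hz => H.ratio_mem_slitPlane hz.1 hz.2 hb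

/-- The reflection z ↦ −2m − z maps the line Re z = −m to itself, and likewise the strip of half
width δ around it. -/
lemma diff_logRatio_refl (H : CutData lam A B m θ δ ν L ρ R) {b : ℝ} (hb : 0 ≤ b) :
    DifferentiableOn ℂ (fun z => logRatio A R b (-(2 * m) - z))
      {z | -m - δ < z.re ∧ z.re < -m + δ} := by
  refine (H.diff_logRatio hb).comp (by fun_prop) fun z hz => ?_
  have h1 := hz.1
  have h2 := hz.2
  constructor <;> simp <;> linarith

lemma exists_norm_logRatio_refl_le (H : CutData lam A B m θ δ ν L ρ R) {b : ℝ} (hb : 0 ≤ b) :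
    ∃ K, 0 < K ∧ ∀ z : ℂ, -m - δ < z.re → z.re < -m + δ →
      ‖logRatio A R b (-(2 * m) - z)‖ ≤ K * (1 + ‖z‖)⁻¹ := by
  obtain ⟨K, hK, h⟩ := H.exists_norm_logRatio_le hb
  have hm : 0 < m := H.δ_pos.trans H.δ_lt
  refine ⟨K * (1 + 2 * m), by positivity, fun z h1 h2 => ?_⟩
  refine (h _ (by simp; linarith) (by simp; linarith)).trans ?_
  rw [mul_assoc]
  gcongr
  rw [← div_eq_mul_inv, inv_eq_one_div, div_le_div_iff₀ (by positivity) (by positivity)]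
  have h3 : ‖z‖ ≤ ‖-(2 * (m : ℂ)) - z‖ + 2 * m := by
    have := norm_sub_le (-(2 * (m : ℂ)) - z) (-(2 * m))
    rw [show -(2 * (m : ℂ)) - z - -(2 * m) = -z by ring, norm_neg, norm_neg, norm_mul,
      Complex.norm_real, Real.norm_eq_abs, abs_of_pos hm] at this
    simpa using this
  nlinarith [norm_nonneg (-(2 * (m : ℂ)) - z)]

end CutData

end QuarticMatrix
-- Cauchy integrals over the image curve: bounds, derivative, dependence on the parameter.
namespace QuarticMatrix

open VerticalLine ComplexConjugate

namespace CutData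

variable {lam A B m θ δ ν L : ℝ} {ρ : ℝ → ℝ} {R : ℂ → ℂ}

/-- The derivative of `cauchyLog`. -/
def cauchyLog' (A m : ℝ) (R : ℂ → ℂ) (b c : ℝ) (X : ℂ) : ℂ :=
  (2 * Real.pi : ℂ)⁻¹ * ∫ t : ℝ, logRatio A R b (-(2 * m) - vline c t) *
    deriv R (vline c t) / (R (vline c t) - X) ^ 2

/-- The points of the image of the line `Re z = c` are separated from `X` as the points of the line
are from `w`. -/
def Sep (R : ℂ → ℂ) (c κ : ℝ) (X w : ℂ) : Prop :=
  ∀ t : ℝ, κ * ‖vline c t - w‖ ≤ ‖R (vline c t) - X‖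

lemma le_norm_vline_sub {c d : ℝ} {w : ℂ} (hw : d ≤ |w.re - c|) (t : ℝ) :
    d ≤ ‖vline c t - w‖ := by
  have := Complex.abs_re_le_norm (vline c t - w)
  rw [Complex.sub_re, vline_re, abs_sub_comm] at this
  exact hw.trans this

lemma continuous_R_vline (H : CutData lam A B m θ δ ν L ρ R) {c : ℝ} (h1 : -m - δ < c) :
    Continuous fun t => R (vline c t) :=
  continuous_comp_vline (isOpen_rightHalf _) H.diff fun t => by simpa

lemma continuous_deriv_vline (H : CutData lam A B m θ δ ν L ρ R) {c : ℝ} (h1 : -m - δ < c) :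
    Continuous fun t => deriv R (vline c t) :=
  continuous_comp_vline (isOpen_rightHalf _) H.diff_deriv fun t => by simpa

lemma continuous_logRatio_vline (H : CutData lam A B m θ δ ν L ρ R) {b : ℝ} (hb : 0 ≤ b) {c : ℝ}
    (h1 : -m - δ < c) (h2 : c < -m + δ) :
    Continuous fun t => logRatio A R b (-(2 * m) - vline c t) :=
  continuous_comp_vline (isOpen_strip _ _) (H.diff_logRatio_refl hb) fun t => by
    exact ⟨by rwa [vline_re], by rwa [vline_re]⟩

lemma norm_integrand_le {κ d : ℝ} (hκ : 0 < κ) (hd : 0 < d) {X w u D : ℂ} {c t K0 : ℝ}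
    (hK0 : 0 ≤ K0) (hw : d ≤ |w.re - c|) (hu : ‖u‖ ≤ K0 * (1 + |t|)⁻¹) (hD : ‖D‖ ≤ 2)
    {y : ℂ} (hy : κ * ‖vline c t - w‖ ≤ ‖y - X‖) :
    ‖u * D / (y - X)‖ ≤ 2 * K0 * κ⁻¹ * ((1 + |t|)⁻¹ * ‖vline c t - w‖⁻¹) := by
  have hQ : 0 < ‖vline c t - w‖ := hd.trans_le (le_norm_vline_sub hw t)
  rw [norm_div, norm_mul, div_eq_mul_inv]
  calc ‖u‖ * ‖D‖ * ‖y - X‖⁻¹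
      ≤ (K0 * (1 + |t|)⁻¹) * 2 * (κ * ‖vline c t - w‖)⁻¹ := by gcongr
    _ = _ := by rw [mul_inv]; ring

lemma exists_logRatio_vline_le (H : CutData lam A B m θ δ ν L ρ R) {b : ℝ} (hb : 0 ≤ b) {c : ℝ}
    (h1 : -m - δ < c) (h2 : c < -m + δ) :
    ∃ K, 0 < K ∧ ∀ t, ‖logRatio A R b (-(2 * m) - vline c t)‖ ≤ K * (1 + |t|)⁻¹ := by
  obtain ⟨K, hK, h⟩ := H.exists_norm_logRatio_refl_le hb
  refine ⟨K, hK, fun t => (h _ (by rwa [vline_re]) (by rwa [vline_re])).trans ?_⟩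
  gcongr
  exact abs_le_norm_vline c t

/-- Integrability and decay of Cauchy integrals with a density decaying like `1 / t`. -/
lemma cauchy_bound {c κ d : ℝ} (hκ : 0 < κ) (hd : 0 < d) :
    ∃ K1, 0 < K1 ∧ ∀ (u D y : ℝ → ℂ) (K0 : ℝ), 0 ≤ K0 → Continuous u → Continuous D →
      Continuous y → (∀ t, ‖u t‖ ≤ K0 * (1 + |t|)⁻¹) → (∀ t, ‖D t‖ ≤ 2) →
      ∀ X w : ℂ, d ≤ |w.re - c| → (∀ t, κ * ‖vline c t - w‖ ≤ ‖y t - X‖) →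
      Integrable (fun t => u t * D t / (y t - X)) ∧
      ‖∫ t : ℝ, u t * D t / (y t - X)‖ ≤ K0 * K1 * (1 + ‖w‖) ^ (-(1 / 4) : ℝ) ∧
      Integrable (fun t => u t * D t / (y t - X) ^ 2) ∧
      ‖∫ t : ℝ, u t * D t / (y t - X) ^ 2‖ ≤ K0 * K1 * (1 + ‖w‖) ^ (-(1 / 4) : ℝ) := by
  obtain ⟨K2, hK2, hK2'⟩ := inv_mul_inv_le (c := c) hd
  set I0 := ∫ t : ℝ, (1 + |t|) ^ (-(3 / 2) : ℝ) with hI0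
  have hI0n : 0 ≤ I0 := integral_nonneg fun t => by positivity
  refine ⟨2 * κ⁻¹ * (1 + κ⁻¹ * d⁻¹) * K2 * (2 * I0) + 1, by positivity,
    fun u D y K0 hK0 hu hD hy hub hDb X w hw hsep => ?_⟩
  have hQ : ∀ t, 0 < ‖vline c t - w‖ := fun t => hd.trans_le (le_norm_vline_sub hw t)
  have hy0 : ∀ t, 0 < ‖y t - X‖ := fun t => lt_of_lt_of_le (mul_pos hκ (hQ t)) (hsep t)
  have hne : ∀ t, y t - X ≠ 0 := fun t => norm_pos_iff.1 (hy0 t)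
  set W := (1 + ‖w‖) ^ (-(1 / 4) : ℝ) with hW
  have hW0 : 0 < W := by positivity
  have b1 : ∀ t, ‖u t * D t / (y t - X)‖ ≤ (2 * K0 * κ⁻¹ * (K2 * W)) *
      ((1 + |t|) ^ (-(3 / 2) : ℝ) + (1 + |t - w.im|) ^ (-(3 / 2) : ℝ)) := by
    intro t
    refine (norm_integrand_le hκ hd hK0 hw (hub t) (hDb t) (hsep t)).trans ?_
    rw [mul_assoc (2 * K0 * κ⁻¹)]
    exact mul_le_mul_of_nonneg_left (hK2' w t hw) (by positivity)
  have b2 : ∀ t, ‖u t * D t / (y t - X) ^ 2‖ ≤ (2 * K0 * κ⁻¹ * (κ⁻¹ * d⁻¹) * (K2 * W)) *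
      ((1 + |t|) ^ (-(3 / 2) : ℝ) + (1 + |t - w.im|) ^ (-(3 / 2) : ℝ)) := by
    intro t
    have h1 : ‖y t - X‖⁻¹ ≤ κ⁻¹ * d⁻¹ := by
      rw [← mul_inv]
      gcongr
      exact le_trans (by gcongr; exact le_norm_vline_sub hw t) (hsep t)
    rw [pow_two, ← div_div, norm_div, div_eq_mul_inv]
    calc _ ≤ ((2 * K0 * κ⁻¹ * (K2 * W)) *
          ((1 + |t|) ^ (-(3 / 2) : ℝ) + (1 + |t - w.im|) ^ (-(3 / 2) : ℝ))) * (κ⁻¹ * d⁻¹) := by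
          gcongr
          exact b1 t
      _ = _ := by ring
  refine ⟨(integrable_bump _ w.im).mono' (Continuous.aestronglyMeasurable
      ((hu.mul hD).div (hy.sub continuous_const) hne)) (ae_of_all _ b1), ?_,
    (integrable_bump _ w.im).mono' (Continuous.aestronglyMeasurable
      ((hu.mul hD).div ((hy.sub continuous_const).pow 2) fun t => pow_ne_zero 2 (hne t)))
      (ae_of_all _ b2), ?_⟩
  · refine (norm_integral_le_of_norm_le (integrable_bump _ w.im) (ae_of_all _ b1)).trans ?_
    rw [integral_bump, ← hI0]
    have : K0 * (2 * κ⁻¹ * (1 + κ⁻¹ * d⁻¹) * K2 * (2 * I0) + 1) * W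
        = 2 * K0 * κ⁻¹ * (K2 * W) * (2 * I0) + (2 * K0 * κ⁻¹ * (κ⁻¹ * d⁻¹) * K2 * (2 * I0) * W
          + K0 * W) := by ring
    rw [this]
    refine le_add_of_nonneg_right (by positivity)
  · refine (norm_integral_le_of_norm_le (integrable_bump _ w.im) (ae_of_all _ b2)).trans ?_
    rw [integral_bump, ← hI0]
    have : K0 * (2 * κ⁻¹ * (1 + κ⁻¹ * d⁻¹) * K2 * (2 * I0) + 1) * W
        = 2 * K0 * κ⁻¹ * (κ⁻¹ * d⁻¹) * (K2 * W) * (2 * I0) + (2 * K0 * κ⁻¹ * K2 * (2 * I0) * W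
          + K0 * W) := by ring
    rw [this]
    refine le_add_of_nonneg_right (by positivity)

lemma exists_cauchyLog_bound (H : CutData lam A B m θ δ ν L ρ R) {b : ℝ} (hb : 0 ≤ b) {c : ℝ}
    (h1 : -m - δ < c) (h2 : c < -m + δ) {κ d : ℝ} (hκ : 0 < κ) (hd : 0 < d) :
    ∃ K, 0 < K ∧ ∀ X w : ℂ, d ≤ |w.re - c| → Sep R c κ X w →
      ‖cauchyLog A m R b c X‖ ≤ K * (1 + ‖w‖) ^ (-(1 / 4) : ℝ) ∧
      ‖cauchyLog' A m R b c X‖ ≤ K * (1 + ‖w‖) ^ (-(1 / 4) : ℝ) := by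
  obtain ⟨K0, hK0, hu⟩ := H.exists_logRatio_vline_le hb h1 h2
  obtain ⟨K1, hK1, h⟩ := cauchy_bound (c := c) hκ hd
  have hpi := Real.pi_pos
  refine ⟨(2 * Real.pi)⁻¹ * (K0 * K1), by positivity, fun X w hw hs => ?_⟩
  obtain ⟨-, e1, -, e2⟩ := h _ _ _ K0 hK0.le (H.continuous_logRatio_vline hb h1 h2)
    (H.continuous_deriv_vline h1) (H.continuous_R_vline h1) hu
    (fun t => H.norm_deriv_le (by simpa)) X w hw hs
  have h3 : ‖(2 * Real.pi : ℂ)⁻¹‖ = (2 * Real.pi)⁻¹ := by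
    rw [norm_inv, norm_mul, Complex.norm_real, Real.norm_eq_abs, abs_of_pos hpi]
    simp
  constructor
  · rw [cauchyLog, norm_mul, h3, mul_assoc]
    gcongr
  · rw [cauchyLog', norm_mul, h3, mul_assoc]
    gcongr

/-- Separation of X from the curve is an open condition with a uniform margin, which permits
differentiation under the integral sign. -/
lemma hasDerivAt_cauchyLog (H : CutData lam A B m θ δ ν L ρ R) {b : ℝ} (hb : 0 ≤ b) {c : ℝ}
    (h1 : -m - δ < c) (h2 : c < -m + δ) {κ d : ℝ} (hκ : 0 < κ) (hd : 0 < d) {X w : ℂ}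
    (hw : d ≤ |w.re - c|) (hs : Sep R c κ X w) :
    HasDerivAt (cauchyLog A m R b c) (cauchyLog' A m R b c X) X := by
  obtain ⟨K0, hK0, hu⟩ := H.exists_logRatio_vline_le hb h1 h2
  obtain ⟨K1, hK1, h⟩ := cauchy_bound (c := c) hκ hd
  obtain ⟨K2, hK2, hK2'⟩ := inv_mul_inv_le (c := c) hd
  have hcu := H.continuous_logRatio_vline hb h1 h2
  have hcD := H.continuous_deriv_vline h1
  have hcy := H.continuous_R_vline h1
  have hDb : ∀ t, ‖deriv R (vline c t)‖ ≤ 2 := fun t => H.norm_deriv_le (by simpa)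
  obtain ⟨i1, -, i2, -⟩ := h _ _ _ K0 hK0.le hcu hcD hcy hu hDb X w hw hs
  have hε : 0 < κ * d / 2 := by positivity
  have hQ : ∀ t, d ≤ ‖vline c t - w‖ := le_norm_vline_sub hw
  -- All points of the curve are at distance at least κ d from X, so within κ d / 2 the separation
  -- survives with half the constant.
  have hsep' : ∀ X' ∈ Metric.ball X (κ * d / 2), ∀ t,
      κ / 2 * ‖vline c t - w‖ ≤ ‖R (vline c t) - X'‖ := by
    intro X' hX' t
    have e1 := hs t
    have e2 : ‖X' - X‖ ≤ κ * d / 2 := by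
      rw [← dist_eq_norm]; exact (Metric.mem_ball.1 hX').le
    have e3 : κ * d ≤ κ * ‖vline c t - w‖ := by gcongr; exact hQ t
    have e4 := norm_add_le (R (vline c t) - X') (X' - X)
    rw [sub_add_sub_cancel] at e4
    linarith
  have hne : ∀ X' ∈ Metric.ball X (κ * d / 2), ∀ t, R (vline c t) - X' ≠ 0 := by
    intro X' hX' t
    refine norm_pos_iff.1 (lt_of_lt_of_le ?_ (hsep' X' hX' t))
    have := hd.trans_le (hQ t)
    positivity
  refine HasDerivAt.const_mul _ (hasDerivAt_integral_of_dominated_loc_of_deriv_le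
    (s := Metric.ball X (κ * d / 2)) (F := fun X t => logRatio A R b (-(2 * m) - vline c t) *
    deriv R (vline c t) / (R (vline c t) - X))
    (F' := fun X t => logRatio A R b (-(2 * m) - vline c t) *
    deriv R (vline c t) / (R (vline c t) - X) ^ 2)
    (bound := fun t => 2 * K0 * (κ / 2)⁻¹ * ((κ / 2)⁻¹ * d⁻¹) * (K2 * (1 + ‖w‖) ^ (-(1 / 4) : ℝ)) *
      ((1 + |t|) ^ (-(3 / 2) : ℝ) + (1 + |t - w.im|) ^ (-(3 / 2) : ℝ)))
    (Metric.ball_mem_nhds X hε) ?_ i1 i2.aestronglyMeasurable ?_ (integrable_bump _ _) ?_).2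
  · filter_upwards [Metric.ball_mem_nhds X hε] with X' hX'
    exact Continuous.aestronglyMeasurable
      ((hcu.mul hcD).div (hcy.sub continuous_const) (hne X' hX'))
  · refine ae_of_all _ fun t X' hX' => ?_
    have e1 : ‖R (vline c t) - X'‖⁻¹ ≤ (κ / 2)⁻¹ * d⁻¹ := by
      rw [← mul_inv]
      gcongr
      exact le_trans (by gcongr; exact hQ t) (hsep' X' hX' t)
    have e2 := norm_integrand_le (κ := κ / 2) (by positivity) hd hK0.le hw (hu t) (hDb t)
      (hsep' X' hX' t)
    rw [pow_two, ← div_div, norm_div, div_eq_mul_inv]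
    calc _ ≤ (2 * K0 * (κ / 2)⁻¹ * ((1 + |t|)⁻¹ * ‖vline c t - w‖⁻¹)) * ((κ / 2)⁻¹ * d⁻¹) := by
          gcongr
      _ ≤ (2 * K0 * (κ / 2)⁻¹ * (K2 * (1 + ‖w‖) ^ (-(1 / 4) : ℝ) *
          ((1 + |t|) ^ (-(3 / 2) : ℝ) + (1 + |t - w.im|) ^ (-(3 / 2) : ℝ))))
            * ((κ / 2)⁻¹ * d⁻¹) := by
          refine mul_le_mul_of_nonneg_right ?_ (by positivity)
          exact mul_le_mul_of_nonneg_left (hK2' w t hw) (by positivity)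
      _ = _ := by ring
  · refine ae_of_all _ fun t X' hX' => ?_
    have e := (hasDerivAt_const X' (logRatio A R b (-(2 * m) - vline c t)
      * deriv R (vline c t))).fun_div ((hasDerivAt_id' X').const_sub (R (vline c t))) (hne X' hX' t)
    refine e.congr_deriv ?_
    simp

/-- The Cauchy integral is Lipschitz in the parameter of its density. -/
lemma exists_cauchyLog_lipschitz (H : CutData lam A B m θ δ ν L ρ R) {c : ℝ}
    (h1 : -m - δ < c) (h2 : c < -m + δ) {κ d : ℝ} (hκ : 0 < κ) (hd : 0 < d) :
    ∃ K, 0 < K ∧ ∀ b b' : ℝ, 0 ≤ b → 0 ≤ b' → ∀ X w : ℂ, d ≤ |w.re - c| → Sep R c κ X w →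
      ‖cauchyLog A m R b c X - cauchyLog A m R b' c X‖
        ≤ K * |b - b'| * (1 + ‖w‖) ^ (-(1 / 4) : ℝ) := by
  obtain ⟨κ0, hκ0, hlow⟩ := H.exists_norm_ge
  obtain ⟨K1, hK1, h⟩ := cauchy_bound (c := c) hκ hd
  have hpi := Real.pi_pos
  have hA := H.A_pos
  have hm : 0 < m := H.δ_pos.trans H.δ_lt
  have hu : ∀ t, ∀ b b' : ℝ, 0 ≤ b → 0 ≤ b' → ‖logRatio A R b (-(2 * m) - vline c t)
      - logRatio A R b' (-(2 * m) - vline c t)‖ ≤ 2 * κ0⁻¹ * (1 + 2 * m) * |b - b'| * (1 + |t|)⁻¹ := by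
    intro t b b' hb hb'
    set ζ : ℂ := -(2 * m) - vline c t with hζ
    have hz1 : -m - δ < ζ.re := by simp [hζ]; linarith
    have hz2 : ζ.re < -m + δ := by simp [hζ]; linarith
    -- In the derivative with respect to the parameter the factor A drops out, and two reciprocals
    -- remain which are O(1/|t|) uniformly in the parameter.
    have hder : ∀ x ∈ Ici (0 : ℝ), HasDerivWithinAt (fun x : ℝ => logRatio A R x ζ)
        (((x : ℂ) - R ζ)⁻¹ - ((x : ℂ) - ζ)⁻¹) (Ici 0) x := by
      intro x hx
      obtain ⟨l1, l2, -⟩ := hlow ζ hz1 hz2 x hx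
      have n1 : (x : ℂ) - R ζ ≠ 0 := norm_pos_iff.1 (lt_of_lt_of_le (by positivity) l1)
      have n2 : (x : ℂ) - ζ ≠ 0 := norm_pos_iff.1 (lt_of_lt_of_le (by positivity) l2)
      have hAc : (A : ℂ) ≠ 0 := by exact_mod_cast hA.ne'
      have d1 : HasDerivAt (fun x : ℝ => (x : ℂ)) 1 x := Complex.ofRealCLM.hasDerivAt
      have d2 := (d1.sub_const (R ζ)).fun_div ((d1.sub_const ζ).const_mul (A : ℂ))
        (mul_ne_zero hAc n2)
      have d3 := d2.clog_real (H.ratio_mem_slitPlane hz1 hz2 hx)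
      refine (d3.congr_deriv ?_).hasDerivWithinAt
      field_simp
    have hbd : ∀ x ∈ Ici (0 : ℝ), ‖((x : ℂ) - R ζ)⁻¹ - ((x : ℂ) - ζ)⁻¹‖
        ≤ 2 * κ0⁻¹ * (1 + 2 * m) * (1 + |t|)⁻¹ := by
      intro x hx
      obtain ⟨l1, l2, -⟩ := hlow ζ hz1 hz2 x hx
      have h3 : |t| ≤ ‖ζ‖ := by simpa [hζ] using Complex.abs_im_le_norm ζ
      have h4 : (κ0 * (1 + ‖ζ‖))⁻¹ ≤ κ0⁻¹ * (1 + 2 * m) * (1 + |t|)⁻¹ := by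
        rw [mul_inv]
        calc κ0⁻¹ * (1 + ‖ζ‖)⁻¹ ≤ κ0⁻¹ * 1 * (1 + |t|)⁻¹ := by rw [mul_one]; gcongr
          _ ≤ _ := by gcongr; linarith
      refine (norm_sub_le _ _).trans ?_
      rw [norm_inv, norm_inv]
      have h5 : ‖(x : ℂ) - R ζ‖⁻¹ ≤ (κ0 * (1 + ‖ζ‖))⁻¹ := by gcongr
      have h6 : ‖(x : ℂ) - ζ‖⁻¹ ≤ (κ0 * (1 + ‖ζ‖))⁻¹ := by gcongr
      linarith
    have := (convex_Ici (0 : ℝ)).norm_image_sub_le_of_norm_hasDerivWithin_le hder hbd hb' hb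
    rw [Real.norm_eq_abs] at this
    linarith
  refine ⟨(2 * Real.pi)⁻¹ * (2 * κ0⁻¹ * (1 + 2 * m) * K1), by positivity,
    fun b b' hb hb' X w hw hs => ?_⟩
  have hcu := H.continuous_logRatio_vline hb h1 h2
  have hcu' := H.continuous_logRatio_vline hb' h1 h2
  have hcD := H.continuous_deriv_vline h1
  have hcy := H.continuous_R_vline h1
  have hDb : ∀ t, ‖deriv R (vline c t)‖ ≤ 2 := fun t => H.norm_deriv_le (by simpa)
  obtain ⟨K0, hK0, hub⟩ := H.exists_logRatio_vline_le hb h1 h2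
  obtain ⟨K0', hK0', hub'⟩ := H.exists_logRatio_vline_le hb' h1 h2
  obtain ⟨i1, -⟩ := h _ _ _ K0 hK0.le hcu hcD hcy hub hDb X w hw hs
  obtain ⟨i2, -⟩ := h _ _ _ K0' hK0'.le hcu' hcD hcy hub' hDb X w hw hs
  obtain ⟨-, e, -⟩ := h _ _ _ (2 * κ0⁻¹ * (1 + 2 * m) * |b - b'|) (by positivity) (hcu.sub hcu')
    hcD hcy (fun t => hu t b b' hb hb') hDb X w hw hs
  have h3 : ‖(2 * Real.pi : ℂ)⁻¹‖ = (2 * Real.pi)⁻¹ := by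
    rw [norm_inv, norm_mul, Complex.norm_real, Real.norm_eq_abs, abs_of_pos hpi]
    simp
  rw [cauchyLog, cauchyLog, ← mul_sub, ← integral_sub i1 i2, norm_mul, h3]
  have h4 : ∀ t : ℝ, logRatio A R b (-(2 * m) - vline c t) * deriv R (vline c t)
      / (R (vline c t) - X) - logRatio A R b' (-(2 * m) - vline c t) * deriv R (vline c t)
      / (R (vline c t) - X) = (logRatio A R b (-(2 * m) - vline c t)
        - logRatio A R b' (-(2 * m) - vline c t)) * deriv R (vline c t)
      / (R (vline c t) - X) := fun t => by ring
  simp_rw [h4]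
  simp only [Pi.sub_apply] at e
  calc _ ≤ (2 * Real.pi)⁻¹ * (2 * κ0⁻¹ * (1 + 2 * m) * |b - b'| * K1
        * (1 + ‖w‖) ^ (-(1 / 4) : ℝ)) := by gcongr
    _ = _ := by ring

lemma sep_of_mem (H : CutData lam A B m θ δ ν L ρ R) {c : ℝ} (h1 : -m - δ < c) {w : ℂ}
    (hw : -m - δ < w.re) : Sep R c (1 - θ) (R w) w := fun t =>
  H.norm_sub_ge (by simpa) hw

/-- Allows the Cauchy integral to be evaluated and bounded at R z − s, thus sweeping out a region to
the left of the curve where no inverse of R is available. -/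
lemma sep_shift (H : CutData lam A B m θ δ ν L ρ R) {c : ℝ} {z : ℂ}
    (hz : -m - δ < z.re) (hzc : z.re ≤ c) {s : ℝ} (hs : 0 ≤ s) :
    Sep R c (1 - θ) (R z - s) (z - s) := fun t =>
  H.norm_sub_add_ge hz (by simpa) hs

end CutData

end QuarticMatrix
-- Crossing the line, and vanishing of the Cauchy integral on its left.
namespace QuarticMatrix

open VerticalLine ComplexConjugate

namespace CutData

variable {lam A B m θ δ ν L : ℝ} {ρ : ℝ → ℝ} {R : ℂ → ℂ}

/-- Crossing the line of integration multiplies the exponential of the Cauchy integral by the ratio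
whose logarithm is its density. -/
lemma exp_cauchyLog_cross (H : CutData lam A B m θ δ ν L ρ R) {b : ℝ} (hb : 0 ≤ b) {c1 c2 : ℝ}
    {w : ℂ} (h1 : -m - δ < c1) (h2 : c2 < -m + δ) (hw1 : c1 < w.re) (hw2 : w.re < c2) :
    Complex.exp (cauchyLog A m R b c2 (R w)) = Complex.exp (cauchyLog A m R b c1 (R w)) *
      ((b - R (-(2 * m) - w)) / (A * (b + 2 * m + w))) := by
  have hwW : -m - δ < w.re := h1.trans hw1
  obtain ⟨K, hK, hu⟩ := H.exists_norm_logRatio_refl_le hb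
  have hθ := H.θ_lt
  -- In the variable z the integrand is g(z)/(z − w), and the second factor of g is 1 at w. So the
  -- jump between the two lines is exactly the density at w.
  set g : ℂ → ℂ := fun z => logRatio A R b (-(2 * m) - z) * (deriv R z / dslope R w z) with hg
  have hcross := integral_vline_sub_integral_vline (c0 := -m - δ) (c3 := -m + δ) (a := c1)
    (b := c2) (C := K * (2 / (1 - θ))) (r := 1) h1 h2 one_pos (g := g) hw1 hw2
    ((H.diff_logRatio_refl hb).mul ((H.diff_ratio hwW).mono fun z hz => hz.1)) (by
      intro z hz1 hz2
      rw [hg, norm_mul, Real.rpow_neg_one]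
      calc _ ≤ (K * (1 + ‖z‖)⁻¹) * (2 / (1 - θ)) := by
            gcongr
            · exact hu z (by linarith) (by linarith)
            · exact H.norm_ratio_le (by linarith) hwW
        _ = _ := by ring)
  have hC : ∀ c, c1 ≤ c → c ≤ c2 → w.re ≠ c → cauchyLog A m R b c (R w)
      = (2 * Real.pi : ℂ)⁻¹ * ∫ t : ℝ, g (vline c t) / (vline c t - w) := by
    intro c hc1 hc2 hne
    rw [cauchyLog]
    congr 2
    ext t
    rw [hg, mul_div_assoc, mul_div_assoc,
      H.ratio_div (by rw [vline_re]; linarith) hwW (vline_ne hne t)]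
  have hgw : g w = logRatio A R b (-(2 * m) - w) := by
    simp only [hg]
    rw [H.ratio_same hwW, mul_one]
  have hpi : (2 * Real.pi : ℂ) ≠ 0 := by
    exact_mod_cast (by positivity : (2 * Real.pi : ℝ) ≠ 0)
  have hdiff : cauchyLog A m R b c2 (R w) = cauchyLog A m R b c1 (R w)
      + logRatio A R b (-(2 * m) - w) := by
    rw [hC c2 (by linarith) le_rfl hw2.ne, hC c1 le_rfl (by linarith) hw1.ne',
      sub_eq_iff_eq_add.1 hcross, hgw]
    field_simp
    ring
  rw [hdiff, Complex.exp_add, H.exp_logRatio (by simp; linarith) (by simp; linarith) hb]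
  congr 2
  ring

lemma norm_exp_sub_one_le_mul_exp (x : ℂ) : ‖Complex.exp x - 1‖ ≤ ‖x‖ * Real.exp ‖x‖ := by
  simpa using Complex.norm_exp_sub_sum_le_norm_mul_exp x 1

lemma exists_one_add_norm_le_sub {c : ℝ} {p : ℂ} (hp : c < p.re) :
    ∃ K, 0 < K ∧ ∀ y : ℂ, y.re ≤ c → 1 + ‖y‖ ≤ K * ‖p - y‖ := by
  have hd : 0 < p.re - c := by linarith
  refine ⟨(1 + ‖p‖) / (p.re - c) + 1, by positivity, fun y hy => ?_⟩
  have h1 : p.re - c ≤ ‖p - y‖ := by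
    have := (le_abs_self _).trans (Complex.abs_re_le_norm (p - y))
    simp at this
    linarith
  have h2 : 1 + ‖p‖ ≤ (1 + ‖p‖) / (p.re - c) * ‖p - y‖ := by
    rw [div_mul_eq_mul_div, le_div_iff₀ hd]
    gcongr
  have h3 : ‖y‖ ≤ ‖p‖ + ‖p - y‖ := by
    have := norm_sub_norm_le y p
    rw [norm_sub_rev] at this
    linarith
  linarith

/-- The exponential of the Cauchy integral is, to the left of the line, the boundary value of a
function that tends to `1`; hence the following integral vanishes. -/
theorem integral_exp_cauchyLog_eq_zero (H : CutData lam A B m θ δ ν L ρ R) {b : ℝ} (hb : 0 ≤ b)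
    {c1 c2 : ℝ} {w : ℂ} (h1 : -m - δ < c1) (h12 : c1 < c2) (h2 : c2 < -m + δ) (hw : c1 < w.re) :
    ∫ t : ℝ, (Complex.exp (cauchyLog A m R b c2 (R (vline c1 t))) - 1) /
      (R (vline c1 t) - R w) * deriv R (vline c1 t) = 0 := by
  have hθ := H.θ_lt
  have hθ' : 0 < 1 - θ := by linarith
  have hd : 0 < c2 - c1 := by linarith
  obtain ⟨K, hK, hC⟩ := H.exists_cauchyLog_bound hb (h1.trans h12) h2 hθ' hd
  obtain ⟨K1, hK1, hfar⟩ := exists_one_add_norm_le_sub hw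
  set g : ℂ → ℂ := fun X => (Complex.exp (cauchyLog A m R b c2 X) - 1) / (X - R w) with hg
  set g' : ℂ → ℂ := fun X => (Complex.exp (cauchyLog A m R b c2 X) * cauchyLog' A m R b c2 X
    * (X - R w) - (Complex.exp (cauchyLog A m R b c2 X) - 1) * 1) / (X - R w) ^ 2 with hg'
  -- The image curve is pushed to the left by σ². The square keeps the shift nonnegative while σ
  -- runs through all reals, so two-sided derivatives exist also at σ = 0.
  set P : ℝ → ℝ → ℂ := fun σ t => R (vline c1 t) - ((σ ^ 2 : ℝ) : ℂ) with hP
  set y : ℝ → ℝ → ℂ := fun σ t => vline c1 t - ((σ ^ 2 : ℝ) : ℂ) with hy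
  have hyre : ∀ σ t, (y σ t).re = c1 - σ ^ 2 := by intro σ t; simp [hy, -Complex.ofReal_pow]
  have hyim : ∀ σ t, (y σ t).im = t := by intro σ t; simp [hy, -Complex.ofReal_pow]
  have hW1 : ∀ t, -m - δ < (vline c1 t).re := fun t => by rwa [vline_re]
  have hsep : ∀ σ t, Sep R c2 (1 - θ) (P σ t) (y σ t) := fun σ t =>
    H.sep_shift (hW1 t) (by rw [vline_re]; exact h12.le) (sq_nonneg σ)
  have hdist : ∀ σ t, c2 - c1 ≤ |(y σ t).re - c2| := by
    intro σ t
    rw [hyre, abs_sub_comm]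
    exact le_trans (by nlinarith [sq_nonneg σ]) (le_abs_self _)
  have hden : ∀ σ t, (1 - θ) * K1⁻¹ * (1 + ‖y σ t‖) ≤ ‖P σ t - R w‖ := by
    intro σ t
    have e1 := H.norm_sub_add_ge (hW1 t) (w := w) (by rw [vline_re]; exact hw.le) (sq_nonneg σ)
    have e2 := hfar (y σ t) (by rw [hyre]; nlinarith [sq_nonneg σ])
    rw [norm_sub_rev (P σ t)]
    refine le_trans ?_ e1
    rw [mul_assoc]
    gcongr
    rw [inv_mul_le_iff₀ hK1]
    exact e2
  have hpos : ∀ σ t, 0 < 1 + ‖y σ t‖ := fun σ t => by positivity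
  have hne : ∀ σ t, P σ t - R w ≠ 0 := fun σ t =>
    norm_pos_iff.1 (lt_of_lt_of_le (by have := hpos σ t; positivity) (hden σ t))
  have hder : ∀ σ t, HasDerivAt g (g' (P σ t)) (P σ t) := fun σ t =>
    ((H.hasDerivAt_cauchyLog hb (h1.trans h12) h2 hθ' hd (hdist σ t) (hsep σ t)).cexp.sub_const
      1).fun_div ((hasDerivAt_id' (P σ t)).sub_const (R w)) (hne σ t)
  -- bounds
  set M := Real.exp K * K with hM
  have hM0 : 0 < M := by positivity
  have hle1 : ∀ σ t, (1 + ‖y σ t‖) ^ (-(1 / 4) : ℝ) ≤ 1 := fun σ t =>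
    Real.rpow_le_one_of_one_le_of_nonpos (by linarith [norm_nonneg (y σ t)]) (by norm_num)
  have hCle : ∀ σ t, ‖cauchyLog A m R b c2 (P σ t)‖ ≤ K := fun σ t =>
    ((hC _ _ (hdist σ t) (hsep σ t)).1).trans (by
      simpa using mul_le_mul_of_nonneg_left (hle1 σ t) hK.le)
  have hE : ∀ σ t, ‖Complex.exp (cauchyLog A m R b c2 (P σ t)) - 1‖
      ≤ M * (1 + ‖y σ t‖) ^ (-(1 / 4) : ℝ) := by
    intro σ t
    refine (norm_exp_sub_one_le_mul_exp _).trans ?_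
    calc _ ≤ (K * (1 + ‖y σ t‖) ^ (-(1 / 4) : ℝ)) * Real.exp K := by
          gcongr
          · exact (hC _ _ (hdist σ t) (hsep σ t)).1
          · exact hCle σ t
      _ = _ := by rw [hM]; ring
  have hEn : ∀ σ t, ‖Complex.exp (cauchyLog A m R b c2 (P σ t)) * cauchyLog' A m R b c2 (P σ t)‖
      ≤ M * (1 + ‖y σ t‖) ^ (-(1 / 4) : ℝ) := by
    intro σ t
    rw [norm_mul, hM, mul_assoc]
    gcongr
    · exact (Complex.norm_exp_le_exp_norm _).trans (Real.exp_le_exp.2 (hCle σ t))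
    · exact (hC _ _ (hdist σ t) (hsep σ t)).2
  -- The pole R w lies to the right of every shifted curve, which gives one more power of decay: 1/4
  -- from the exponential and 1 from this denominator, together the integrable exponent 5/4.
  set q := ((1 - θ) * K1⁻¹)⁻¹ with hq
  have hq0 : 0 < q := by positivity
  have hinv : ∀ σ t, ‖P σ t - R w‖⁻¹ ≤ q * (1 + ‖y σ t‖)⁻¹ := by
    intro σ t
    rw [hq, ← mul_inv]
    have := hpos σ t
    gcongr
    exact hden σ t
  have hpow : ∀ σ t, (1 + ‖y σ t‖) ^ (-(1 / 4) : ℝ) * (1 + ‖y σ t‖)⁻¹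
      = (1 + ‖y σ t‖) ^ (-(5 / 4) : ℝ) := by
    intro σ t
    rw [← Real.rpow_neg_one, ← Real.rpow_add (hpos σ t)]
    norm_num
  have hgb : ∀ σ t, ‖g (P σ t)‖ ≤ M * q * (1 + ‖y σ t‖) ^ (-(5 / 4) : ℝ) := by
    intro σ t
    simp only [hg]
    rw [norm_div, div_eq_mul_inv, ← hpow]
    calc _ ≤ (M * (1 + ‖y σ t‖) ^ (-(1 / 4) : ℝ)) * (q * (1 + ‖y σ t‖)⁻¹) := by
          gcongr
          · exact hE σ t
          · exact hinv σ t
      _ = _ := by ring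
  have hgb' : ∀ σ t, ‖g' (P σ t)‖ ≤ (M * q + M * q * q) * (1 + ‖y σ t‖) ^ (-(5 / 4) : ℝ) := by
    intro σ t
    have hsplit : g' (P σ t) = Complex.exp (cauchyLog A m R b c2 (P σ t))
        * cauchyLog' A m R b c2 (P σ t) / (P σ t - R w) - g (P σ t) / (P σ t - R w) := by
      have := hne σ t
      simp only [hg', hg]
      field_simp
    rw [hsplit]
    refine (norm_sub_le _ _).trans ?_
    rw [norm_div, norm_div, div_eq_mul_inv, div_eq_mul_inv, add_mul]
    have h3 : (1 + ‖y σ t‖)⁻¹ ≤ 1 := inv_le_one_of_one_le₀ (by linarith [norm_nonneg (y σ t)])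
    refine add_le_add ?_ ?_
    · rw [← hpow]
      calc _ ≤ (M * (1 + ‖y σ t‖) ^ (-(1 / 4) : ℝ)) * (q * (1 + ‖y σ t‖)⁻¹) := by
            gcongr
            · exact hEn σ t
            · exact hinv σ t
        _ = _ := by ring
    · calc _ ≤ (M * q * (1 + ‖y σ t‖) ^ (-(5 / 4) : ℝ)) * (q * 1) := by
            have := hpos σ t
            gcongr
            · exact hgb σ t
            · exact (hinv σ t).trans (by gcongr)
        _ = _ := by ring
  have hyt : ∀ σ t, (1 + ‖y σ t‖) ^ (-(5 / 4) : ℝ) ≤ (1 + |t|) ^ (-(5 / 4) : ℝ) := by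
    intro σ t
    have := rpow_neg_norm_le (r := 5 / 4) (by norm_num) (y σ t)
    rwa [hyim] at this
  -- continuity in `t`
  have hcR := H.continuous_R_vline h1
  have hcD := H.continuous_deriv_vline h1
  have hRder : ∀ t, HasDerivAt (fun t => R (vline c1 t)) (deriv R (vline c1 t) * Complex.I) t :=
    fun t => (H.differentiableAt (hW1 t)).hasDerivAt.comp_of_eq t (hasDerivAt_vline c1 t) rfl
  have hPc : ∀ σ, Continuous (P σ) := fun σ => hcR.sub continuous_const
  have hgc : ∀ σ, Continuous fun t => g (P σ t) := fun σ => continuous_iff_continuousAt.2 fun t =>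
    ((hder σ t).continuousAt).comp (f := P σ) (hPc σ).continuousAt
  have hgder : ∀ σ t, HasDerivAt (fun t => g (P σ t))
      (g' (P σ t) * (deriv R (vline c1 t) * Complex.I)) t := fun σ t =>
    (hder σ t).comp t ((hRder t).sub_const _)
  -- Continuity of g' is not needed: up to the factor −i the product is a t-derivative, and
  -- derivatives are measurable.
  have hgm' : ∀ σ, AEStronglyMeasurable fun t => g' (P σ t) * deriv R (vline c1 t) := by
    intro σ
    have : (fun t => g' (P σ t) * deriv R (vline c1 t))
        = fun t => deriv (fun t => g (P σ t)) t * (-Complex.I) := by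
      ext t
      rw [(hgder σ t).deriv, mul_assoc, mul_assoc, mul_neg, Complex.I_mul_I, neg_neg, mul_one]
    rw [this]
    exact ((stronglyMeasurable_deriv _).mul_const _).aestronglyMeasurable
  have hDb : ∀ t, ‖deriv R (vline c1 t)‖ ≤ 2 := fun t => H.norm_deriv_le (hW1 t)
  have hb1 : ∀ σ t, ‖g (P σ t) * deriv R (vline c1 t)‖
      ≤ M * q * 2 * (1 + ‖y σ t‖) ^ (-(5 / 4) : ℝ) := by
    intro σ t
    rw [norm_mul]
    calc _ ≤ (M * q * (1 + ‖y σ t‖) ^ (-(5 / 4) : ℝ)) * 2 := by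
          gcongr
          · exact hgb σ t
          · exact hDb t
      _ = _ := by ring
  have hb2 : ∀ σ t, ‖g' (P σ t) * deriv R (vline c1 t)‖
      ≤ (M * q + M * q * q) * 2 * (1 + |t|) ^ (-(5 / 4) : ℝ) := by
    intro σ t
    rw [norm_mul]
    calc _ ≤ ((M * q + M * q * q) * (1 + ‖y σ t‖) ^ (-(5 / 4) : ℝ)) * 2 := by
          gcongr
          · exact hgb' σ t
          · exact hDb t
      _ ≤ ((M * q + M * q * q) * (1 + |t|) ^ (-(5 / 4) : ℝ)) * 2 := by
          gcongr ?_ * _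
          exact mul_le_mul_of_nonneg_left (hyt σ t) (by positivity)
      _ = _ := by ring
  have hint' : ∀ σ, Integrable fun t => g' (P σ t) * deriv R (vline c1 t) := fun σ =>
    integrable_of_le_rpow_neg (by norm_num) (hgm' σ) (hb2 σ)
  have hb1' : ∀ σ t, ‖g (P σ t) * deriv R (vline c1 t)‖
      ≤ M * q * 2 * (1 + |t|) ^ (-(5 / 4) : ℝ) := fun σ t =>
    (hb1 σ t).trans (mul_le_mul_of_nonneg_left (hyt σ t) (by positivity))
  -- Up to the factor i the integrand is the t-derivative of g along the shifted curve, and g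
  -- vanishes at both ends.
  have hzero' : ∀ σ, ∫ t : ℝ, g' (P σ t) * deriv R (vline c1 t) = 0 := by
    intro σ
    have hlim : ∀ l : Filter ℝ, Tendsto (fun t => |t|) l atTop →
        Tendsto (fun t => g (P σ t)) l (𝓝 0) := by
      intro l hl
      have hz : Tendsto (fun t : ℝ => M * q * (1 + |t|) ^ (-(5 / 4) : ℝ)) l (𝓝 0) := by
        simpa using ((tendsto_rpow_neg_atTop (by norm_num : (0 : ℝ) < 5 / 4)).comp
          (tendsto_atTop_add_const_left l 1 hl)).const_mul (M * q)
      exact squeeze_zero_norm (fun t => (hgb σ t).trans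
        (mul_le_mul_of_nonneg_left (hyt σ t) (by positivity))) hz
    have := integral_of_hasDerivAt_of_tendsto (hgder σ) (by
      simpa only [mul_assoc] using (hint' σ).mul_const Complex.I)
      (hlim _ tendsto_abs_atBot_atTop) (hlim _ tendsto_abs_atTop_atTop)
    simp only [← mul_assoc] at this
    rw [integral_mul_const, sub_zero] at this
    simpa using this
  -- The integral over the shifted curve is constant in σ, because its σ-derivative is a multiple of
  -- the preceding integral, and it tends to zero as σ → ∞. Translating the curve takes the place of
  -- closing the contour in the X-plane.
  set J : ℝ → ℂ := fun σ => ∫ t : ℝ, g (P σ t) * deriv R (vline c1 t) with hJ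
  have hJder : ∀ σ, HasDerivAt J 0 σ := by
    intro σ
    have hPσ : ∀ t σ', HasDerivAt (fun σ => P σ t) (-(2 * σ' : ℝ) : ℂ) σ' := by
      intro t σ'
      have := ((hasDerivAt_pow 2 σ').ofReal_comp).const_sub (R (vline c1 t))
      simp only [hP]
      simpa using this
    have := (hasDerivAt_integral_of_dominated_loc_of_deriv_le (s := Metric.ball σ 1)
      (F := fun σ t => g (P σ t) * deriv R (vline c1 t))
      (F' := fun σ t => g' (P σ t) * deriv R (vline c1 t) * (-(2 * σ : ℝ) : ℂ))
      (x₀ := σ) (bound := fun t => (M * q + M * q * q) * 2 * (1 + |t|) ^ (-(5 / 4) : ℝ)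
        * (2 * (|σ| + 1))) (μ := volume) (Metric.ball_mem_nhds σ one_pos)
      (Eventually.of_forall fun σ' => ((hgc σ').mul hcD).aestronglyMeasurable)
      (integrable_of_le_rpow_neg (by norm_num) ((hgc σ).mul hcD).aestronglyMeasurable (hb1' σ))
      ((hgm' σ).mul_const _) ?_ ?_ ?_).2
    · rw [integral_mul_const, hzero', zero_mul] at this
      exact this
    · refine ae_of_all _ fun t σ' hσ' => ?_
      rw [norm_mul]
      refine mul_le_mul (hb2 σ' t) ?_ (norm_nonneg _) (by positivity)
      rw [norm_neg, Complex.norm_real, Real.norm_eq_abs, abs_mul, abs_two]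
      have h3 : |σ' - σ| < 1 := by simpa [Real.dist_eq] using hσ'
      have h4 : |σ'| ≤ |σ' - σ| + |σ| := by simpa using abs_add_le (σ' - σ) σ
      linarith
    · exact (((integrable_rpow_neg (by norm_num)).const_mul _).mul_const _)
    · refine ae_of_all _ fun t σ' _ => ?_
      have := ((hder σ' t).comp_of_eq σ' (hPσ t σ') rfl).mul_const (deriv R (vline c1 t))
      refine this.congr_deriv ?_
      ring
  have hJc : ∀ σ, J 0 = J σ := fun σ =>
    is_const_of_deriv_eq_zero (fun σ => (hJder σ).differentiableAt) (fun σ => (hJder σ).deriv) 0 σ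
  have hJlim : Tendsto J atTop (𝓝 0) := by
    have : Tendsto J atTop (𝓝 (∫ _ : ℝ, (0 : ℂ))) := by
      refine tendsto_integral_filter_of_dominated_convergence
        (fun t => M * q * 2 * (1 + |t|) ^ (-(5 / 4) : ℝ))
        (Eventually.of_forall fun σ => ((hgc σ).mul hcD).aestronglyMeasurable)
        (Eventually.of_forall fun σ => ae_of_all _ (hb1' σ))
        ((integrable_rpow_neg (by norm_num)).const_mul _) (ae_of_all _ fun t => ?_)
      have hyn : Tendsto (fun σ : ℝ => 1 + ‖y σ t‖) atTop atTop := by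
        refine tendsto_atTop_mono (fun σ => ?_)
          (tendsto_atTop_add_const_right atTop (-c1) (tendsto_pow_atTop two_ne_zero))
        have := Complex.abs_re_le_norm (y σ t)
        rw [hyre] at this
        linarith [neg_abs_le (c1 - σ ^ 2)]
      have hz : Tendsto (fun σ : ℝ => M * q * 2 * (1 + ‖y σ t‖) ^ (-(5 / 4) : ℝ)) atTop (𝓝 0) := by
        simpa using ((tendsto_rpow_neg_atTop (by norm_num : (0 : ℝ) < 5 / 4)).comp hyn).const_mul
          (M * q * 2)
      exact squeeze_zero_norm (fun σ => hb1 σ t) hz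
    simpa using this
  have hJ0 : J 0 = 0 := tendsto_nhds_unique (tendsto_const_nhds.congr hJc) hJlim
  simpa [hJ, hg, hP] using hJ0

end CutData

end QuarticMatrix
-- The candidate two-point function and its linear equation.
namespace QuarticMatrix

open VerticalLine ComplexConjugate

/-- The two-point function, multiplied by the field renormalisation, in the variables `z, b` with
`a = R(z)`. -/
def gTwo (A m : ℝ) (R : ℂ → ℂ) (b : ℝ) (z : ℂ) : ℂ :=
  Complex.exp (cauchyLog A m R b (-m) (R z)) / (A * (b + 2 * m + z))

namespace CutData

variable {lam A B m θ δ ν L : ℝ} {ρ : ℝ → ℝ} {R : ℂ → ℂ}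

lemma add_ne_zero (H : CutData lam A B m θ δ ν L ρ R) {b : ℝ} (hb : 0 ≤ b) {z : ℂ}
    (hz : -m ≤ z.re) : (A : ℂ) * (b + 2 * m + z) ≠ 0 := by
  refine mul_ne_zero (by exact_mod_cast H.A_pos.ne') fun h => ?_
  have := congrArg Complex.re h
  simp at this
  linarith [H.m_pos]

lemma diff_exp_cauchyLog (H : CutData lam A B m θ δ ν L ρ R) {b : ℝ} (hb : 0 ≤ b) :
    DifferentiableOn ℂ (fun z => Complex.exp (cauchyLog A m R b (-m) (R z))) {z | -m < z.re} := by
  intro z hz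
  have hz' : -m < z.re := hz
  have hδ := H.δ_pos
  have hθ := H.θ_lt
  have hzW : -m - δ < z.re := by linarith
  have h := H.hasDerivAt_cauchyLog hb (c := -m) (by linarith) (by linarith) (κ := 1 - θ)
    (d := z.re + m) (by linarith) (by linarith) (X := R z) (w := z)
    (by rw [sub_neg_eq_add]; exact le_abs_self _) (H.sep_of_mem (by linarith) hzW)
  exact ((h.differentiableAt.comp z (H.differentiableAt hzW)).cexp).differentiableWithinAt

lemma diff_gTwo (H : CutData lam A B m θ δ ν L ρ R) {b : ℝ} (hb : 0 ≤ b) :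
    DifferentiableOn ℂ (gTwo A m R b) {z | -m < z.re} :=
  (H.diff_exp_cauchyLog hb).div (by fun_prop) fun z hz => H.add_ne_zero hb (le_of_lt hz)

lemma one_add_norm_le (H : CutData lam A B m θ δ ν L ρ R) {b : ℝ} (hb : 0 ≤ b) :
    ∃ K, 0 < K ∧ ∀ z : ℂ, -m ≤ z.re → 1 + ‖z‖ ≤ K * ‖(A : ℂ) * (b + 2 * m + z)‖ := by
  obtain ⟨K, hK, h⟩ := exists_one_add_norm_le_sub (c := m) (p := (b : ℂ) + 2 * m)
    (by simp; linarith [H.m_pos])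
  have hA := H.A_pos
  refine ⟨K * A⁻¹, by positivity, fun z hz => ?_⟩
  have := h (-z) (by simp; linarith)
  rw [norm_neg, sub_neg_eq_add] at this
  rw [norm_mul, Complex.norm_real, Real.norm_eq_abs, abs_of_pos hA, mul_assoc, ← mul_assoc A⁻¹,
    inv_mul_cancel₀ hA.ne', one_mul]
  exact this

/-- For X = R z the separation from the curve is inherited from the distance of z to the line, hence
so is the decay in ‖z‖. -/
lemma exists_cauchyLog_right_bound (H : CutData lam A B m θ δ ν L ρ R) {b : ℝ} (hb : 0 ≤ b)
    {c : ℝ} (hc : -m < c) : ∃ K, 0 < K ∧ ∀ z : ℂ, c ≤ z.re →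
      ‖cauchyLog A m R b (-m) (R z)‖ ≤ K * (1 + ‖z‖) ^ (-(1 / 4) : ℝ) := by
  have hδ := H.δ_pos
  have hθ := H.θ_lt
  obtain ⟨K, hK, h⟩ := H.exists_cauchyLog_bound hb (c := -m) (by linarith) (by linarith)
    (κ := 1 - θ) (d := c + m) (by linarith) (by linarith)
  exact ⟨K, hK, fun z hz => (h (R z) z
    (by rw [sub_neg_eq_add]; exact le_trans (by linarith) (le_abs_self _))
    (H.sep_of_mem (by linarith) (by linarith))).1⟩

lemma exists_norm_exp_sub_one_le (H : CutData lam A B m θ δ ν L ρ R) {b : ℝ} (hb : 0 ≤ b)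
    {c : ℝ} (hc : -m < c) : ∃ K, 0 < K ∧ ∀ z : ℂ, c ≤ z.re →
      ‖Complex.exp (cauchyLog A m R b (-m) (R z)) - 1‖ ≤ K * (1 + ‖z‖) ^ (-(1 / 4) : ℝ) := by
  obtain ⟨K, hK, h⟩ := H.exists_cauchyLog_right_bound hb hc
  refine ⟨K * Real.exp K, by positivity, fun z hz => ?_⟩
  refine (norm_exp_sub_one_le_mul_exp _).trans ?_
  have h1 : (1 + ‖z‖) ^ (-(1 / 4) : ℝ) ≤ 1 :=
    Real.rpow_le_one_of_one_le_of_nonpos (by linarith [norm_nonneg z]) (by norm_num)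
  have h2 : ‖cauchyLog A m R b (-m) (R z)‖ ≤ K :=
    (h z hz).trans (by simpa using mul_le_mul_of_nonneg_left h1 hK.le)
  calc _ ≤ (K * (1 + ‖z‖) ^ (-(1 / 4) : ℝ)) * Real.exp K := by
        gcongr
        exact h z hz
    _ = _ := by ring

lemma exists_norm_exp_le (H : CutData lam A B m θ δ ν L ρ R) {b : ℝ} (hb : 0 ≤ b)
    {c : ℝ} (hc : -m < c) : ∃ K, 0 < K ∧ ∀ z : ℂ, c ≤ z.re →
      ‖Complex.exp (cauchyLog A m R b (-m) (R z))‖ ≤ K := by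
  obtain ⟨K, hK, h⟩ := H.exists_norm_exp_sub_one_le hb hc
  refine ⟨K + 1, by positivity, fun z hz => ?_⟩
  have h1 : (1 + ‖z‖) ^ (-(1 / 4) : ℝ) ≤ 1 :=
    Real.rpow_le_one_of_one_le_of_nonpos (by linarith [norm_nonneg z]) (by norm_num)
  have h2 := norm_add_le (Complex.exp (cauchyLog A m R b (-m) (R z)) - 1) 1
  rw [sub_add_cancel, norm_one] at h2
  have := (h z hz).trans (mul_le_mul_of_nonneg_left h1 hK.le)
  linarith

lemma exists_norm_gTwo_le (H : CutData lam A B m θ δ ν L ρ R) {b : ℝ} (hb : 0 ≤ b)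
    {c : ℝ} (hc : -m < c) : ∃ K, 0 < K ∧ ∀ z : ℂ, c ≤ z.re →
      ‖gTwo A m R b z‖ ≤ K * (1 + ‖z‖)⁻¹ := by
  obtain ⟨K, hK, h⟩ := H.exists_norm_exp_le hb hc
  obtain ⟨K', hK', h'⟩ := H.one_add_norm_le hb
  refine ⟨K * K', by positivity, fun z hz => ?_⟩
  have h1 := norm_pos_iff.2 (H.add_ne_zero hb (z := z) (by linarith))
  rw [gTwo, norm_div, ← div_eq_mul_inv, div_le_div_iff₀ h1 (by positivity), mul_assoc]
  exact mul_le_mul (h z hz) (h' z (by linarith)) (by positivity) hK.le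

/-- The first integrand of the linear Schwinger-Dyson equation. -/
lemma exists_norm_mul_gTwo_sub_one_le (H : CutData lam A B m θ δ ν L ρ R) {b : ℝ} (hb : 0 ≤ b)
    {c : ℝ} (hc : -m < c) : ∃ K, 0 < K ∧ ∀ z : ℂ, c ≤ z.re →
      ‖(b + 2 * m * A - B + A * z) * gTwo A m R b z - 1‖ ≤ K * (1 + ‖z‖) ^ (-(1 / 4) : ℝ) := by
  obtain ⟨K1, hK1, h1⟩ := H.exists_norm_exp_sub_one_le hb hc
  obtain ⟨K2, hK2, h2⟩ := H.exists_norm_gTwo_le hb hc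
  obtain ⟨K', hK', h'⟩ := H.one_add_norm_le hb
  -- The prefactor differs from the denominator A (b + 2m + z) of `gTwo` only by this constant.
  set q : ℂ := b - B - A * b with hq
  refine ⟨K1 + ‖q‖ * K2, by positivity, fun z hz => ?_⟩
  have hne := H.add_ne_zero hb (z := z) (by linarith)
  have hsplit : (b + 2 * m * A - B + A * z) * gTwo A m R b z - 1
      = (Complex.exp (cauchyLog A m R b (-m) (R z)) - 1) + q * gTwo A m R b z := by
    have hA := left_ne_zero_of_mul hne
    have hs := right_ne_zero_of_mul hne
    rw [gTwo, hq]
    field_simp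
    ring
  rw [hsplit, add_mul]
  have h3 : (1 + ‖z‖)⁻¹ ≤ (1 + ‖z‖) ^ (-(1 / 4) : ℝ) := by
    rw [← Real.rpow_neg_one]
    exact Real.rpow_le_rpow_of_exponent_le (by linarith [norm_nonneg z]) (by norm_num)
  refine (norm_add_le _ _).trans (add_le_add (h1 z hz) ?_)
  rw [norm_mul, mul_assoc]
  gcongr
  exact (h2 z hz).trans (by gcongr)

/-- The linear Schwinger-Dyson equation. -/
theorem gTwo_linear (H : CutData lam A B m θ δ ν L ρ R) {b : ℝ} (hb : 0 ≤ b) {w : ℝ}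
    (hw : ν ≤ w) :
    IntegrableOn (fun s : ℝ => (ρ s : ℂ) * (gTwo A m R b w / (w - s)
      + gTwo A m R b s * deriv R s / (R s - R w))) (Icc ν L) ∧
    (b + 2 * m * A - B + A * w) * gTwo A m R b w - 1
      = lam * ∫ s in Icc ν L, (ρ s : ℂ) * (gTwo A m R b w / (w - s)
        + gTwo A m R b s * deriv R s / (R s - R w)) := by
  have hδ := H.δ_pos
  have hδ' := H.δ_lt'
  have hθ := H.θ_lt
  have hm := H.m_pos
  -- Two lines to the right of Re z = −m and inside the strip. The Cauchy integral over c2 is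
  -- evaluated at points of the line c1, on its left; the one over −m has these points on its right.
  obtain ⟨c1, hc1, hc1'⟩ : ∃ c1, -m < c1 ∧ c1 < -m + δ := ⟨-m + δ / 2, by linarith, by linarith⟩
  obtain ⟨c2, hc2, hc2'⟩ : ∃ c2, c1 < c2 ∧ c2 < -m + δ :=
    ⟨(c1 + (-m + δ)) / 2, by linarith, by linarith⟩
  have hwW : -m - δ < (w : ℂ).re := by rw [Complex.ofReal_re]; linarith
  have hwc : c1 < (w : ℂ).re := by rw [Complex.ofReal_re]; linarith
  have hzW : ∀ t, -m - δ < (vline c1 t).re := fun t => by rw [vline_re]; linarith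
  have hzero := H.integral_exp_cauchyLog_eq_zero hb (c1 := c1) (c2 := c2) (w := w)
    (by linarith) hc2 hc2' hwc
  set Q : ℂ → ℂ := fun z => deriv R z / dslope R w z with hQ
  set k : ℂ → ℂ := fun z => gTwo A m R b z * Q z with hk
  set P : ℂ → ℂ := fun z => b + 2 * m * A - B + A * z with hP
  have hsub : {z : ℂ | -m < z.re} ⊆ {z : ℂ | -m - δ < z.re} := fun z (hz : -m < z.re) =>
    show -m - δ < z.re by linarith
  have hQd : DifferentiableOn ℂ Q {z | -m < z.re} := (H.diff_ratio hwW).mono hsub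
  have hgd := H.diff_gTwo hb
  have hkd : DifferentiableOn ℂ k {z | -m < z.re} := hgd.mul hQd
  have hfd : DifferentiableOn ℂ (fun z => (P z * gTwo A m R b z - 1) * Q z) {z | -m < z.re} :=
    ((DifferentiableOn.mul (by fun_prop) hgd).sub_const 1).mul hQd
  have hQb : ∀ z : ℂ, c1 ≤ z.re → ‖Q z‖ ≤ 2 / (1 - θ) := fun z hz =>
    H.norm_ratio_le (by linarith) hwW
  obtain ⟨K1, hK1, hF⟩ := H.exists_norm_mul_gTwo_sub_one_le hb hc1
  obtain ⟨K2, hK2, hG⟩ := H.exists_norm_gTwo_le hb hc1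
  have hq0 : 0 ≤ 2 / (1 - θ) := div_nonneg zero_le_two (by linarith)
  have hfb : ∀ z : ℂ, c1 ≤ z.re → ‖(P z * gTwo A m R b z - 1) * Q z‖
      ≤ K1 * (2 / (1 - θ)) * (1 + ‖z‖) ^ (-(1 / 4) : ℝ) := by
    intro z hz
    rw [norm_mul]
    calc _ ≤ (K1 * (1 + ‖z‖) ^ (-(1 / 4) : ℝ)) * (2 / (1 - θ)) :=
          mul_le_mul (hF z hz) (hQb z hz) (norm_nonneg _) (by positivity)
      _ = _ := by ring
  have hkb : ∀ z : ℂ, c1 ≤ z.re → ‖k z‖ ≤ K2 * (2 / (1 - θ)) * (1 + ‖z‖)⁻¹ := by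
    intro z hz
    rw [hk, norm_mul]
    calc _ ≤ (K2 * (1 + ‖z‖)⁻¹) * (2 / (1 - θ)) :=
          mul_le_mul (hG z hz) (hQb z hz) (norm_nonneg _) (by positivity)
      _ = _ := by ring
  have hI1 := integral_vline_cauchy (c0 := -m) hc1 (by norm_num) hwc hfd hfb
  have hkb' : ∀ z : ℂ, c1 ≤ z.re → ‖k z‖ ≤ K2 * (2 / (1 - θ)) := fun z hz =>
    (hkb z hz).trans (mul_le_of_le_one_right (by positivity)
      (inv_le_one_of_one_le₀ (by linarith [norm_nonneg z])))
  -- Both w and s lie to the right of the line c1, so the integral is a divided difference of k.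
  have hI2 : ∀ s : ℝ, ν ≤ s → w ≠ s → ∫ t : ℝ, k (vline c1 t) / ((vline c1 t - w) *
      (vline c1 t - s)) = -2 * Real.pi * ((k w - k s) / (w - s)) := fun s hs hne =>
    integral_vline_cauchy_two (c0 := -m) hc1 hwc (by rw [Complex.ofReal_re]; linarith)
      (by exact_mod_cast hne) hkd hkb'
  -- the product integrand
  set F : ℝ → ℝ → ℂ := fun t s => (ρ s : ℂ) * (k (vline c1 t) / ((vline c1 t - w) *
      (vline c1 t - s))) with hF'
  obtain ⟨K3, hK3, hfar⟩ := exists_one_add_norm_le_mul c1 hwc.ne'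
  have hkc : Continuous fun t => k (vline c1 t) :=
    continuous_comp_vline (isOpen_rightHalf _) hkd fun t => by
      show -m < (vline c1 t).re
      rwa [vline_re]
  have hwne : ∀ t, vline c1 t - w ≠ 0 := fun t => sub_ne_zero.2 (vline_ne hwc.ne' t)
  have hsne : ∀ s : ℝ, ν ≤ s → ∀ t, vline c1 t - s ≠ 0 := fun s hs t =>
    sub_ne_zero.2 (vline_ne (by rw [Complex.ofReal_re]; linarith) t)
  have hsd : ∀ s : ℝ, ν ≤ s → ∀ t, ν - c1 ≤ ‖vline c1 t - s‖ := by
    intro s hs t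
    have := Complex.abs_re_le_norm (vline c1 t - s)
    rw [Complex.sub_re, vline_re, Complex.ofReal_re] at this
    linarith [neg_abs_le (c1 - s)]
  have hνc : 0 < ν - c1 := by linarith
  set M := K2 * (2 / (1 - θ)) * K3 * (ν - c1)⁻¹ with hM
  have hM0 : 0 ≤ M := by positivity
  have hwi : ∀ t, ‖vline c1 t - w‖⁻¹ ≤ K3 * (1 + |t|)⁻¹ := by
    intro t
    rw [inv_le_iff_one_le_mul₀ (norm_pos_iff.2 (hwne t)), mul_assoc, mul_comm _ ‖_‖,
      ← mul_assoc, ← div_eq_mul_inv, le_div_iff₀ (by positivity)]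
    linarith [hfar t]
  have hkt : ∀ t, ‖k (vline c1 t)‖ ≤ K2 * (2 / (1 - θ)) * (1 + |t|)⁻¹ := by
    intro t
    refine (hkb _ (by rw [vline_re])).trans ?_
    gcongr
    exact abs_le_norm_vline c1 t
  have hker : ∀ s : ℝ, ν ≤ s → ∀ t, ‖k (vline c1 t) / ((vline c1 t - w) * (vline c1 t - s))‖
      ≤ M * (1 + |t|) ^ (-2 : ℝ) := by
    intro s hs t
    have h3 : ‖vline c1 t - s‖⁻¹ ≤ (ν - c1)⁻¹ := by
      gcongr
      exact hsd s hs t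
    rw [norm_div, norm_mul (vline c1 t - w), div_eq_mul_inv, mul_inv,
      Real.rpow_neg (by positivity), Real.rpow_two]
    calc _ ≤ (K2 * (2 / (1 - θ)) * (1 + |t|)⁻¹) * ((K3 * (1 + |t|)⁻¹) * (ν - c1)⁻¹) := by
          gcongr
          · exact hkt t
          · exact hwi t
      _ = _ := by rw [hM, ← inv_pow]; ring
  have hρi : Integrable ρ (volume.restrict (Icc ν L)) :=
    H.cont.integrableOn_compact isCompact_Icc
  -- The kernel is O(t⁻²) uniformly in s, since s keeps the distance ν − c1 from the line; the
  -- product bound justifies Fubini.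
  have hFi : Integrable (Function.uncurry F) (volume.prod (volume.restrict (Icc ν L))) := by
    refine Integrable.mono' (g := fun p : ℝ × ℝ => (M * (1 + |p.1|) ^ (-2 : ℝ)) * ‖ρ p.2‖)
      (((integrable_rpow_neg one_lt_two).const_mul M).mul_prod hρi.norm) ?_ ?_
    · refine AEStronglyMeasurable.mul ?_ ?_
      · exact (Complex.continuous_ofReal.comp_aestronglyMeasurable
          hρi.aestronglyMeasurable).comp_snd
      · refine Measurable.aestronglyMeasurable ?_
        have m1 : Measurable fun p : ℝ × ℝ => k (vline c1 p.1) :=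
          (hkc.comp continuous_fst).measurable
        have m2 : Measurable fun p : ℝ × ℝ => vline c1 p.1 :=
          ((continuous_vline c1).comp continuous_fst).measurable
        have m3 : Measurable fun p : ℝ × ℝ => (p.2 : ℂ) := by fun_prop
        exact m1.div ((m2.sub_const _).mul (m2.sub m3))
    · have hae : ∀ᵐ p : ℝ × ℝ ∂(volume.prod (volume.restrict (Icc ν L))), p.2 ∈ Icc ν L :=
        Measure.quasiMeasurePreserving_snd.ae (ae_restrict_mem measurableSet_Icc)
      filter_upwards [hae] with p hp
      simp only [Function.uncurry, hF']
      rw [norm_mul, mul_comm, Complex.norm_real]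
      gcongr
      exact hker p.2 hp.1 p.1
  have hswap := integral_integral_swap hFi
  have hinner : ∀ᵐ s ∂(volume.restrict (Icc ν L)), ∫ t : ℝ, F t s = -2 * Real.pi *
      ((ρ s : ℂ) * (gTwo A m R b w / (w - s) + gTwo A m R b s * deriv R s / (R s - R w))) := by
    -- The formula with two distinct poles fails only at s = w, a null set.
    have hne : ∀ᵐ s ∂(volume.restrict (Icc ν L)), s ≠ w :=
      ae_restrict_of_ae (Measure.ae_ne volume w)
    filter_upwards [ae_restrict_mem measurableSet_Icc, hne] with s hs hsw
    simp only [hF']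
    rw [integral_const_mul, hI2 s hs.1 hsw.symm]
    have e1 : k w = gTwo A m R b w := by
      simp only [hk, hQ]
      rw [H.ratio_same hwW, mul_one]
    have hsw' : (s : ℂ) ≠ w := by exact_mod_cast hsw
    have hs0 : (s : ℂ) - w ≠ 0 := sub_ne_zero.2 hsw'
    have hs0' : (w : ℂ) - s ≠ 0 := sub_ne_zero.2 hsw'.symm
    have e2 : k s = gTwo A m R b s * (deriv R s / (R s - R w)) * (s - w) := by
      simp only [hk, hQ]
      rw [← H.ratio_div (by rw [Complex.ofReal_re]; linarith [hs.1]) hwW hsw']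
      field_simp
    rw [e1, e2]
    have e3 : (gTwo A m R b w - gTwo A m R b s * (deriv R s / (R s - R w)) * (s - w)) / (w - s)
        = gTwo A m R b w / (w - s) + gTwo A m R b s * deriv R s / (R s - R w) := by
      field_simp
      ring
    rw [e3]
    ring
  have hpi : (2 * Real.pi : ℂ) ≠ 0 := by
    exact_mod_cast (by positivity : (2 * Real.pi : ℝ) ≠ 0)
  have hintT : IntegrableOn (fun s : ℝ => (ρ s : ℂ) * (gTwo A m R b w / (w - s)
      + gTwo A m R b s * deriv R s / (R s - R w))) (Icc ν L) := by
    have h3 := (hFi.integral_prod_right).congr hinner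
    refine (h3.const_mul (-(2 * Real.pi : ℂ))⁻¹).congr (ae_of_all _ fun s => ?_)
    simp only []
    field_simp
  refine ⟨hintT, ?_⟩
  -- the two pieces of the vanishing line integral
  have hpiece : ∀ t, (Complex.exp (cauchyLog A m R b c2 (R (vline c1 t))) - 1) /
      (R (vline c1 t) - R w) * deriv R (vline c1 t)
      = (P (vline c1 t) * gTwo A m R b (vline c1 t) - 1) * Q (vline c1 t) / (vline c1 t - w)
        - lam * ∫ s in Icc ν L, F t s := by
    intro t
    have hcross := H.exp_cauchyLog_cross hb (c1 := -m) (c2 := c2) (w := vline c1 t) (by linarith)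
      hc2' (by rwa [vline_re]) (by rwa [vline_re])
    have hform := H.formula (-(2 * m) - vline c1 t) (by simp; linarith)
    have hS : ∫ s in Icc ν L, (ρ s : ℂ) / (s + 2 * m + (-(2 * m) - vline c1 t))
        = -∫ s in Icc ν L, (ρ s : ℂ) * (vline c1 t - s)⁻¹ := by
      rw [← integral_neg]
      congr 1
      ext s
      rw [show (s : ℂ) + 2 * m + (-(2 * m) - vline c1 t) = -(vline c1 t - s) by ring, div_neg,
        div_eq_mul_inv]
    rw [hS] at hform
    have hexp : Complex.exp (cauchyLog A m R b c2 (R (vline c1 t)))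
        = (P (vline c1 t) - lam * ∫ s in Icc ν L, (ρ s : ℂ) * (vline c1 t - s)⁻¹)
          * gTwo A m R b (vline c1 t) := by
      rw [hcross, hform, gTwo, hP]
      ring
    have hFint : ∫ s in Icc ν L, F t s = (∫ s in Icc ν L, (ρ s : ℂ) * (vline c1 t - s)⁻¹)
        * (gTwo A m R b (vline c1 t) * Q (vline c1 t) / (vline c1 t - w)) := by
      rw [← integral_mul_const]
      congr 1
      ext s
      simp only [hF', hk]
      rw [← div_div, div_eq_mul_inv (_ / _)]
      ring
    rw [hexp, hFint, mul_div_assoc, H.ratio_div (hzW t) hwW (vline_ne hwc.ne' t), mul_div_assoc,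
      H.ratio_div (hzW t) hwW (vline_ne hwc.ne' t)]
    ring
  have hi1 : Integrable fun t => (P (vline c1 t) * gTwo A m R b (vline c1 t) - 1) *
      Q (vline c1 t) / (vline c1 t - w) := by
    have hc : Continuous fun t => (P (vline c1 t) * gTwo A m R b (vline c1 t) - 1) *
        Q (vline c1 t) := continuous_comp_vline (isOpen_rightHalf _) hfd fun t => by
      show -m < (vline c1 t).re
      rwa [vline_re]
    refine integrable_of_le_rpow_neg (r := 5 / 4) (C := K1 * (2 / (1 - θ)) * K3) (by norm_num)
      (hc.div ((continuous_vline c1).sub continuous_const) hwne).aestronglyMeasurable fun t => ?_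
    rw [norm_div, div_eq_mul_inv]
    have h3 : (1 + ‖vline c1 t‖) ^ (-(1 / 4) : ℝ) ≤ (1 + |t|) ^ (-(1 / 4) : ℝ) := by
      simpa using rpow_neg_norm_le (r := 1 / 4) (by norm_num) (vline c1 t)
    have h4 : (1 + |t|) ^ (-(5 / 4) : ℝ) = (1 + |t|) ^ (-(1 / 4) : ℝ) * (1 + |t|)⁻¹ := by
      rw [← Real.rpow_neg_one, ← Real.rpow_add (by positivity)]
      norm_num
    rw [h4]
    calc _ ≤ (K1 * (2 / (1 - θ)) * (1 + |t|) ^ (-(1 / 4) : ℝ)) * (K3 * (1 + |t|)⁻¹) := by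
          refine mul_le_mul ((hfb _ (by rw [vline_re])).trans ?_) (hwi t) (by positivity)
            (by positivity)
          gcongr
      _ = _ := by ring
  have hi2 : Integrable fun t => ∫ s in Icc ν L, F t s := hFi.integral_prod_left
  simp_rw [hpiece] at hzero
  rw [integral_sub hi1 (hi2.const_mul _), hI1, integral_const_mul, hswap,
    integral_congr_ae hinner, integral_const_mul] at hzero
  have e1 : Q w = 1 := H.ratio_same hwW
  rw [e1, mul_one] at hzero
  have hP' : P w = b + 2 * m * A - B + A * w := rfl
  rw [← hP']
  refine mul_left_cancel₀ hpi ?_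
  linear_combination -hzero

end CutData

end QuarticMatrix
-- Logarithms along the line, with constants uniform in the curve.
namespace QuarticMatrix

open VerticalLine ComplexConjugate

/-- What is used of the restriction `F` of `R` to the line `Re z = -m`, uniformly in the
constants. -/
structure LineBase (κ K : ℝ) (F F' : ℝ → ℂ) : Prop where
  κ_pos : 0 < κ
  hasDeriv : ∀ t, HasDerivAt F (F' t) t
  conj_eq : ∀ t, F (-t) = conj (F t)
  im_pos : ∀ t, t ≠ 0 → 0 < (F t).im * t
  zero_re : (F 0).re < 0
  low : ∀ a : ℝ, 0 ≤ a → ∀ t, κ * (1 + |t|) ≤ ‖(a : ℂ) - F t‖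
  up : ∀ t, ‖F t‖ ≤ K * (1 + |t|)
  up' : ∀ t, ‖F' t‖ ≤ K

/-- `log (a - F)`. -/
def lineLog (F : ℝ → ℂ) (a : ℝ) (t : ℝ) : ℂ := Complex.log (a - F t)

/-- The derivative of `lineLog`. -/
def lineLog' (F F' : ℝ → ℂ) (a : ℝ) (t : ℝ) : ℂ := -F' t / (a - F t)

namespace LineBase

variable {κ K : ℝ} {F F' : ℝ → ℂ}

lemma K_nonneg (H : LineBase κ K F F') : 0 ≤ K := (norm_nonneg _).trans (H.up' 0)

lemma zero_im (H : LineBase κ K F F') : (F 0).im = 0 := by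
  have := H.conj_eq 0
  rw [neg_zero] at this
  exact Complex.conj_eq_iff_im.1 this.symm

lemma continuous (H : LineBase κ K F F') : Continuous F :=
  continuous_iff_continuousAt.2 fun t => (H.hasDeriv t).continuousAt

lemma measurable' (H : LineBase κ K F F') : Measurable F' := by
  have : F' = deriv F := funext fun t => (H.hasDeriv t).deriv.symm
  rw [this]
  exact measurable_deriv F

lemma mem_slitPlane (H : LineBase κ K F F') {a : ℝ} (ha : 0 ≤ a) (t : ℝ) :
    (a : ℂ) - F t ∈ Complex.slitPlane := by
  rw [Complex.mem_slitPlane_iff]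
  rcases eq_or_ne t 0 with rfl | h
  · left
    rw [Complex.sub_re, Complex.ofReal_re]
    linarith [H.zero_re]
  · right
    intro h2
    have := H.im_pos t h
    simp at h2
    rw [h2, zero_mul] at this
    exact lt_irrefl _ this

lemma norm_pos (H : LineBase κ K F F') {a : ℝ} (ha : 0 ≤ a) (t : ℝ) : 0 < ‖(a : ℂ) - F t‖ :=
  lt_of_lt_of_le (mul_pos H.κ_pos (by positivity)) (H.low a ha t)

lemma ne_zero (H : LineBase κ K F F') {a : ℝ} (ha : 0 ≤ a) (t : ℝ) : (a : ℂ) - F t ≠ 0 :=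
  norm_pos_iff.1 (H.norm_pos ha t)

lemma hasDerivAt_lineLog (H : LineBase κ K F F') {a : ℝ} (ha : 0 ≤ a) (t : ℝ) :
    HasDerivAt (lineLog F a) (lineLog' F F' a t) t :=
  ((H.hasDeriv t).const_sub (a : ℂ)).clog_real (H.mem_slitPlane ha t)

lemma continuous_lineLog (H : LineBase κ K F F') {a : ℝ} (ha : 0 ≤ a) : Continuous (lineLog F a) :=
  continuous_iff_continuousAt.2 fun t => (H.hasDerivAt_lineLog ha t).continuousAt

lemma measurable_lineLog' (H : LineBase κ K F F') (a : ℝ) : Measurable (lineLog' F F' a) :=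
  H.measurable'.neg.div (measurable_const.sub H.continuous.measurable)

lemma inv_norm_le (H : LineBase κ K F F') {a : ℝ} (ha : 0 ≤ a) (t : ℝ) :
    ‖(a : ℂ) - F t‖⁻¹ ≤ κ⁻¹ * (1 + |t|)⁻¹ := by
  have := H.κ_pos
  rw [← mul_inv]
  gcongr
  exact H.low a ha t

lemma norm_lineLog'_le (H : LineBase κ K F F') {a : ℝ} (ha : 0 ≤ a) (t : ℝ) :
    ‖lineLog' F F' a t‖ ≤ K * κ⁻¹ * (1 + |t|)⁻¹ := by
  rw [lineLog', norm_div, norm_neg, div_eq_mul_inv, mul_assoc]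
  exact mul_le_mul (H.up' t) (H.inv_norm_le ha t) (by positivity) H.K_nonneg

lemma norm_lineLog'_sub_le (H : LineBase κ K F F') {a b : ℝ} (ha : 0 ≤ a) (hb : 0 ≤ b) (t : ℝ) :
    ‖lineLog' F F' a t - lineLog' F F' b t‖ ≤ K * |a - b| * κ⁻¹ ^ 2 * (1 + |t|) ^ (-2 : ℝ) := by
  have h1 := H.ne_zero ha t
  have h2 := H.ne_zero hb t
  have : lineLog' F F' a t - lineLog' F F' b t
      = F' t * (a - b : ℝ) * (((a : ℂ) - F t)⁻¹ * ((b : ℂ) - F t)⁻¹) := by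
    simp only [lineLog']
    field_simp
    push_cast
    ring
  rw [this, norm_mul, norm_mul, norm_mul, norm_inv, norm_inv, Complex.norm_real, Real.norm_eq_abs,
    Real.rpow_neg (by positivity), Real.rpow_two, ← inv_pow]
  have hK := H.K_nonneg
  have hκ := H.κ_pos
  calc _ ≤ K * |a - b| * ((κ⁻¹ * (1 + |t|)⁻¹) * (κ⁻¹ * (1 + |t|)⁻¹)) := by
        gcongr
        · exact H.up' t
        · exact H.inv_norm_le ha t
        · exact H.inv_norm_le hb t
    _ = _ := by ring

lemma norm_lineLog_sub_le (H : LineBase κ K F F') {a b : ℝ} (ha : 0 ≤ a) (hb : 0 ≤ b) (t : ℝ) :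
    ‖lineLog F a t - lineLog F b t‖ ≤ |a - b| * κ⁻¹ * (1 + |t|)⁻¹ := by
  have hder : ∀ x ∈ Ici (0 : ℝ), HasDerivWithinAt (fun x : ℝ => lineLog F x t)
      (1 / ((x : ℂ) - F t)) (Ici 0) x := by
    intro x hx
    have d1 : HasDerivAt (fun x : ℝ => (x : ℂ)) 1 x := Complex.ofRealCLM.hasDerivAt
    exact ((d1.sub_const (F t)).clog_real (H.mem_slitPlane hx t)).hasDerivWithinAt
  have := (convex_Ici (0 : ℝ)).norm_image_sub_le_of_norm_hasDerivWithin_le hder (fun x hx => by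
    rw [one_div, norm_inv]
    exact H.inv_norm_le hx t) hb ha
  rw [Real.norm_eq_abs] at this
  linarith

/-- The argument is bounded by π, and the modulus lies between constant multiples of 1 and 1 + |t|,
so its logarithm grows slower than any power. The constant depends on F only through κ and K. -/
lemma exists_norm_lineLog_le (κ K a : ℝ) (hκ : 0 < κ) (ha : 0 ≤ a) {ε : ℝ} (hε : 0 < ε) :
    ∃ C, 0 < C ∧ ∀ F F' : ℝ → ℂ, LineBase κ K F F' →
      ∀ t, ‖lineLog F a t‖ ≤ C * (1 + |t|) ^ ε := by
  have hpi := Real.pi_pos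
  refine ⟨|Real.log κ| + (|Real.log (a + |K| + 1)| + ε⁻¹) + Real.pi, by positivity,
    fun F F' H t => ?_⟩
  set x := 1 + |t| with hx
  have hx1 : 1 ≤ x := by rw [hx]; linarith [abs_nonneg t]
  have hxε : 1 ≤ x ^ ε := Real.one_le_rpow hx1 hε.le
  have hn := H.norm_pos ha t
  have h1 : ‖lineLog F a t‖ ≤ |Real.log ‖(a : ℂ) - F t‖| + Real.pi := by
    refine (Complex.norm_le_abs_re_add_abs_im _).trans ?_
    rw [lineLog, Complex.log_re, Complex.log_im]
    gcongr
    exact Complex.abs_arg_le_pi _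
  have hup : ‖(a : ℂ) - F t‖ ≤ (a + |K| + 1) * x := by
    refine (norm_sub_le _ _).trans ?_
    rw [Complex.norm_real, Real.norm_eq_abs, abs_of_nonneg ha]
    have h2 := H.up t
    have h3 : K * x ≤ |K| * x := by gcongr; exact le_abs_self K
    nlinarith
  have hlow : κ ≤ ‖(a : ℂ) - F t‖ := le_trans (by rw [← hx]; nlinarith) (H.low a ha t)
  have hlogx : Real.log x ≤ ε⁻¹ * x ^ ε := by
    have := Real.log_le_rpow_div (by linarith : 0 ≤ x) hε
    rwa [div_eq_inv_mul] at this
  have h4 : Real.log ‖(a : ℂ) - F t‖ ≤ |Real.log (a + |K| + 1)| + ε⁻¹ * x ^ ε := by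
    refine (Real.log_le_log hn hup).trans ?_
    rw [Real.log_mul (by positivity) (by positivity)]
    exact add_le_add (le_abs_self _) hlogx
  have h5 : -|Real.log κ| ≤ Real.log ‖(a : ℂ) - F t‖ :=
    (neg_abs_le _).trans (Real.log_le_log hκ hlow)
  have h6 : |Real.log ‖(a : ℂ) - F t‖| ≤ |Real.log κ| + (|Real.log (a + |K| + 1)| + ε⁻¹ * x ^ ε) := by
    rw [abs_le]
    constructor
    · have : 0 ≤ |Real.log (a + |K| + 1)| + ε⁻¹ * x ^ ε := by positivity
      linarith
    · linarith [abs_nonneg (Real.log κ)]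
  refine h1.trans ?_
  have e1 : |Real.log κ| ≤ |Real.log κ| * x ^ ε := le_mul_of_one_le_right (abs_nonneg _) hxε
  have e2 : |Real.log (a + |K| + 1)| ≤ |Real.log (a + |K| + 1)| * x ^ ε :=
    le_mul_of_one_le_right (abs_nonneg _) hxε
  have e3 : Real.pi ≤ Real.pi * x ^ ε := le_mul_of_one_le_right hpi.le hxε
  linarith

lemma conj_lineLog (H : LineBase κ K F F') {a : ℝ} (ha : 0 ≤ a) (t : ℝ) :
    conj (lineLog F a t) = lineLog F a (-t) := by
  rw [lineLog, lineLog, ← Complex.log_conj _ (Complex.slitPlane_arg_ne_pi (H.mem_slitPlane ha t)),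
    map_sub, Complex.conj_ofReal, H.conj_eq]

lemma deriv_neg_eq (H : LineBase κ K F F') (t : ℝ) : F' (-t) = -conj (F' t) := by
  have h1 : HasDerivAt (fun s => F (-s)) (-F' (-t)) t := by
    have := (H.hasDeriv (-t)).scomp t (hasDerivAt_neg t)
    rw [neg_one_smul] at this
    exact this
  have h2 : HasDerivAt (fun s => conj (F s)) (conj (F' t)) t := by
    exact Complex.conjCLE.toContinuousLinearMap.hasFDerivAt.comp_hasDerivAt t (H.hasDeriv t)
  simp_rw [H.conj_eq] at h1
  rw [← h1.unique h2, neg_neg]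

lemma conj_lineLog' (H : LineBase κ K F F') (a : ℝ) (t : ℝ) :
    conj (lineLog' F F' a t) = -lineLog' F F' a (-t) := by
  simp only [lineLog', map_div₀, map_sub, map_neg, Complex.conj_ofReal, H.conj_eq,
    H.deriv_neg_eq]
  ring

/-- The subtracted product of logarithm and derivative that occurs in dimension four. -/
lemma exists_norm_subtracted_le (κ K a b : ℝ) (hκ : 0 < κ) (ha : 0 ≤ a) (hb : 0 ≤ b) :
    ∃ C, 0 < C ∧ ∀ F F' : ℝ → ℂ, LineBase κ K F F' → ∀ t,
      ‖lineLog F a (-t) * lineLog' F F' b t - lineLog F 0 (-t) * lineLog' F F' 0 t‖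
        ≤ C * (1 + |t|) ^ (-(3 / 2) : ℝ) := by
  obtain ⟨C, hC, h⟩ := exists_norm_lineLog_le κ K 0 hκ le_rfl (ε := 1 / 2) (by norm_num)
  refine ⟨a * κ⁻¹ * (|K| * κ⁻¹) + C * (|K| * b * κ⁻¹ ^ 2) + 1, by positivity, fun F F' H t => ?_⟩
  have hK := H.K_nonneg
  rw [abs_of_nonneg hK]
  set x := 1 + |t| with hx
  have hx1 : 1 ≤ x := by rw [hx]; linarith [abs_nonneg t]
  have hx0 : 0 < x := by linarith
  have e1 := H.norm_lineLog_sub_le ha le_rfl (-t)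
  have e2 := H.norm_lineLog'_le hb t
  have e3 := h F F' H (-t)
  have e4 := H.norm_lineLog'_sub_le hb le_rfl t
  rw [sub_zero, abs_of_nonneg ha, abs_neg, ← hx] at e1
  rw [sub_zero, abs_of_nonneg hb, ← hx] at e4
  rw [abs_neg, ← hx] at e3
  rw [← hx] at e2
  -- Each change of a or b to 0 gains a factor 1/(1 + |t|), which pays for the growth of the
  -- remaining logarithm; the exponent 1/2 for that growth is more than enough.
  have hsplit : lineLog F a (-t) * lineLog' F F' b t - lineLog F 0 (-t) * lineLog' F F' 0 t
      = (lineLog F a (-t) - lineLog F 0 (-t)) * lineLog' F F' b t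
        + lineLog F 0 (-t) * (lineLog' F F' b t - lineLog' F F' 0 t) := by ring
  have p1 : x⁻¹ * x⁻¹ ≤ x ^ (-(3 / 2) : ℝ) := by
    rw [← mul_inv, ← pow_two, ← Real.rpow_two, ← Real.rpow_neg hx0.le]
    exact Real.rpow_le_rpow_of_exponent_le hx1 (by norm_num)
  have p2 : x ^ (1 / 2 : ℝ) * x ^ (-2 : ℝ) = x ^ (-(3 / 2) : ℝ) := by
    rw [← Real.rpow_add hx0]; norm_num
  rw [hsplit]
  refine (norm_add_le _ _).trans ?_
  rw [norm_mul, norm_mul]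
  have t1 : ‖lineLog F a (-t) - lineLog F 0 (-t)‖ * ‖lineLog' F F' b t‖
      ≤ a * κ⁻¹ * (K * κ⁻¹) * x ^ (-(3 / 2) : ℝ) := by
    calc _ ≤ (a * κ⁻¹ * x⁻¹) * (K * κ⁻¹ * x⁻¹) := mul_le_mul e1 e2 (norm_nonneg _) (by positivity)
      _ = a * κ⁻¹ * (K * κ⁻¹) * (x⁻¹ * x⁻¹) := by ring
      _ ≤ _ := by gcongr
  have t2 : ‖lineLog F 0 (-t)‖ * ‖lineLog' F F' b t - lineLog' F F' 0 t‖
      ≤ C * (K * b * κ⁻¹ ^ 2) * x ^ (-(3 / 2) : ℝ) := by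
    calc _ ≤ (C * x ^ (1 / 2 : ℝ)) * (K * b * κ⁻¹ ^ 2 * x ^ (-2 : ℝ)) :=
          mul_le_mul e3 e4 (norm_nonneg _) (by positivity)
      _ = C * (K * b * κ⁻¹ ^ 2) * (x ^ (1 / 2 : ℝ) * x ^ (-2 : ℝ)) := by ring
      _ = _ := by rw [p2]
  have : 0 ≤ x ^ (-(3 / 2) : ℝ) := by positivity
  linarith

end LineBase

/-- The asymptotics of `F` and of its derivative. -/
structure LineNear (A m κ K ε : ℝ) (F F' : ℝ → ℂ) : Prop extends LineBase κ K F F' where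
  A_pos : 0 < A
  m_pos : 0 < m
  ε_pos : 0 < ε
  ε_le : ε ≤ 1
  near : ∀ t, ‖F t - A * vline (-m) t‖ ≤ K * (1 + |t|) ^ (1 - ε)
  near' : ∀ t, ‖F' t - A * Complex.I‖ ≤ K * (1 + |t|) ^ (-ε)

/-- The logarithm of the ratio of `a - F` and its asymptotics. -/
def lineRatio (A m : ℝ) (F : ℝ → ℂ) (a t : ℝ) : ℂ :=
  Complex.log ((a - F t) / (A * (a - vline (-m) t)))

/-- The derivative of `lineRatio`. -/
def lineRatio' (m : ℝ) (F F' : ℝ → ℂ) (a t : ℝ) : ℂ :=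
  lineLog' F F' a t - lineLog' (vline (-m)) (fun _ => Complex.I) a t

/-- The undeformed line, which serves as comparison curve. -/
lemma lineBase_vline {m : ℝ} (hm : 0 < m) :
    LineBase (min m 1 / 2) (m + 1) (vline (-m)) (fun _ => Complex.I) where
  κ_pos := by positivity
  hasDeriv t := hasDerivAt_vline _ t
  conj_eq t := by simp [vline]
  im_pos t ht := by simpa using mul_self_pos.2 ht
  zero_re := by simpa
  low a ha t := by
    have h1 := Complex.abs_re_le_norm ((a : ℂ) - vline (-m) t)
    have h2 := Complex.abs_im_le_norm ((a : ℂ) - vline (-m) t)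
    simp only [Complex.sub_re, Complex.sub_im, Complex.ofReal_re, Complex.ofReal_im, vline_re,
      vline_im, zero_sub, abs_neg, sub_neg_eq_add] at h1 h2
    have h3 := (le_abs_self _).trans h1
    have h4 : min m 1 * |t| ≤ 1 * |t| := by gcongr; exact min_le_right _ _
    have h5 := min_le_left m 1
    nlinarith
  up t := by
    refine (Complex.norm_le_abs_re_add_abs_im _).trans ?_
    rw [vline_re, vline_im, abs_neg, abs_of_pos hm]
    nlinarith [abs_nonneg t, mul_nonneg hm.le (abs_nonneg t)]
  up' t := by simp [hm.le]

namespace LineNear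

variable {A m κ K ε : ℝ} {F F' : ℝ → ℂ}

lemma arg_mul_nonneg {z : ℂ} (hz : z ∈ Complex.slitPlane) {s : ℝ} (h : 0 < z.im * s ∨ z.im = 0) :
    0 ≤ z.arg * s ∧ |z.arg| < Real.pi := by
  have h1 := (Complex.mem_slitPlane_iff_arg.1 hz).1
  have h2 := Complex.neg_pi_lt_arg z
  have h3 := (Complex.arg_le_pi z).lt_of_ne h1
  refine ⟨?_, abs_lt.2 ⟨h2, h3⟩⟩
  rcases h with h | h
  · rcases lt_trichotomy s 0 with hs | hs | hs
    · have : z.im < 0 := by nlinarith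
      exact mul_nonneg_of_nonpos_of_nonpos (Complex.arg_neg_iff.2 this).le hs.le
    · simp [hs] at h
    · have : 0 ≤ z.im := by nlinarith
      exact mul_nonneg (Complex.arg_nonneg_iff.2 this) hs.le
  · have : z.arg = 0 := by
      rw [Complex.arg_eq_zero_iff]
      refine ⟨?_, h⟩
      rcases Complex.mem_slitPlane_iff.1 hz with h4 | h4
      · exact h4.le
      · exact absurd h h4
    simp [this]

/-- No multiple of 2πi appears: Im F has the sign of t, as has the imaginary part of the undeformed
line, so the two arguments have the same sign and their difference stays in (−π, π). At t = 0 the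
first argument is zero. -/
lemma lineRatio_eq (H : LineNear A m κ K ε F F') {a : ℝ} (ha : 0 ≤ a) (t : ℝ) :
    lineRatio A m F a t = lineLog F a t - lineLog (vline (-m)) a t - Real.log A := by
  have H0 := lineBase_vline H.m_pos
  have hs1 := H.mem_slitPlane ha t
  have hs2 := H0.mem_slitPlane ha t
  have hn1 := H.ne_zero ha t
  have hn2 := H0.ne_zero ha t
  have hdiff : |((a : ℂ) - F t).arg - ((a : ℂ) - vline (-m) t).arg| < Real.pi := by
    rcases eq_or_ne t 0 with rfl | ht
    · have e1 := arg_mul_nonneg hs1 (s := 1) (Or.inr (by simp [H.zero_im]))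
      have e1' := arg_mul_nonneg hs1 (s := -1) (Or.inr (by simp [H.zero_im]))
      have : ((a : ℂ) - F 0).arg = 0 := by linarith [e1.1, e1'.1]
      rw [this, zero_sub, abs_neg]
      exact (arg_mul_nonneg hs2 (s := 1) (Or.inr (by simp))).2
    · have e1 := arg_mul_nonneg hs1 (s := -t) (Or.inl (by simpa using H.im_pos t ht))
      have e2 := arg_mul_nonneg hs2 (s := -t) (Or.inl (by simpa using H0.im_pos t ht))
      have a1 := abs_lt.1 e1.2
      have a2 := abs_lt.1 e2.2
      rw [abs_lt]
      rcases ht.lt_or_gt with h | h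
      · have b1 : 0 ≤ ((a : ℂ) - F t).arg := by nlinarith [e1.1]
        have b2 : 0 ≤ ((a : ℂ) - vline (-m) t).arg := by nlinarith [e2.1]
        constructor <;> linarith [a1.1, a1.2, a2.1, a2.2]
      · have b1 : ((a : ℂ) - F t).arg ≤ 0 := by nlinarith [e1.1]
        have b2 : ((a : ℂ) - vline (-m) t).arg ≤ 0 := by nlinarith [e2.1]
        constructor <;> linarith [a1.1, a1.2, a2.1, a2.2]
  have harg : ((a : ℂ) - vline (-m) t)⁻¹.arg = -((a : ℂ) - vline (-m) t).arg := by
    rw [Complex.arg_inv, if_neg (Complex.slitPlane_arg_ne_pi hs2)]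
  have h1 : ((a : ℂ) - F t) / (A * (a - vline (-m) t))
      = ((A⁻¹ : ℝ) : ℂ) * ((a - F t) * (a - vline (-m) t)⁻¹) := by
    push_cast
    rw [div_eq_mul_inv, mul_inv]
    ring
  rw [lineRatio, h1, Complex.log_ofReal_mul (inv_pos.2 H.A_pos) (mul_ne_zero hn1 (inv_ne_zero hn2)),
    Complex.log_mul hn1 (inv_ne_zero hn2) (by
      rw [harg]
      have := abs_lt.1 hdiff
      exact ⟨by linarith [this.1], by linarith [this.2]⟩),
    Complex.log_inv _ (Complex.slitPlane_arg_ne_pi hs2), Real.log_inv, lineLog, lineLog]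
  push_cast
  ring

lemma hasDerivAt_lineRatio (H : LineNear A m κ K ε F F') {a : ℝ} (ha : 0 ≤ a) (t : ℝ) :
    HasDerivAt (lineRatio A m F a) (lineRatio' m F F' a t) t := by
  rw [show lineRatio A m F a = fun t => lineLog F a t - lineLog (vline (-m)) a t - Real.log A from
    funext fun t => H.lineRatio_eq ha t]
  exact ((H.hasDerivAt_lineLog ha t).sub
    ((lineBase_vline H.m_pos).hasDerivAt_lineLog ha t)).sub_const _

lemma continuous_lineRatio (H : LineNear A m κ K ε F F') {a : ℝ} (ha : 0 ≤ a) :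
    Continuous (lineRatio A m F a) :=
  continuous_iff_continuousAt.2 fun t => (H.hasDerivAt_lineRatio ha t).continuousAt

lemma measurable_lineRatio' (H : LineNear A m κ K ε F F') (a : ℝ) :
    Measurable (lineRatio' m F F' a) :=
  (H.measurable_lineLog' a).sub ((lineBase_vline H.m_pos).measurable_lineLog' a)

-- The quotient is 1 + O(|t|^(−ε)). For the derivative the two fractions are put over a common
-- denominator, where the leading terms in A cancel and leave O(|t|^(1 − ε)) over O(t²).
set_option maxHeartbeats 400000 in
lemma exists_norm_lineRatio_le (A m κ K ε a : ℝ) (hA : 0 < A) (hm : 0 < m) (hκ : 0 < κ)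
    (hε : ε ≤ 1) (ha : 0 ≤ a) : ∃ C, 0 < C ∧ ∀ F F' : ℝ → ℂ, LineNear A m κ K ε F F' → ∀ t,
      ‖lineRatio A m F a t‖ ≤ C * (1 + |t|) ^ (-ε) ∧
      ‖lineRatio' m F F' a t‖ ≤ C * (1 + |t|) ^ (-1 - ε) := by
  have H0 := lineBase_vline hm
  set κ0 := min m 1 / 2 with hκ0
  have hκ0p : 0 < κ0 := H0.κ_pos
  set M := a * |1 - A| + |K| + |K| * (a + m + 1) with hM
  set κ1 := κ / (A * (a + m + 1)) with hκ1
  have hκ1p : 0 < κ1 := by positivity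
  have hpi := Real.pi_pos
  refine ⟨(3 + 2 * κ1⁻¹ + 2 * Real.pi) * (M * (A * κ0)⁻¹) + M * (κ⁻¹ * κ0⁻¹) + 1,
    by positivity, fun F F' H t => ?_⟩
  have hK : 0 ≤ K := H.K_nonneg
  rw [abs_of_nonneg hK] at hM
  set x := 1 + |t| with hx
  have hx1 : 1 ≤ x := by rw [hx]; linarith [abs_nonneg t]
  have hx0 : 0 < x := by linarith
  have hn1 := H.ne_zero ha t
  have hn2 := H0.ne_zero ha t
  have hv : ‖(a : ℂ) - vline (-m) t‖ ≤ (a + m + 1) * x := by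
    refine (norm_sub_le _ _).trans ?_
    rw [Complex.norm_real, Real.norm_eq_abs, abs_of_nonneg ha]
    have := H0.up t
    rw [← hx] at this
    nlinarith
  have hx1ε : 1 ≤ x ^ (1 - ε) := Real.one_le_rpow hx1 (by linarith)
  have hconst : ‖((a * (1 - A) : ℝ) : ℂ)‖ ≤ a * |1 - A| * x ^ (1 - ε) := by
    rw [Complex.norm_real, Real.norm_eq_abs, abs_mul, abs_of_nonneg ha]
    exact le_mul_of_one_le_right (by positivity) hx1ε
  have hnear := H.near t
  have hnear' := H.near' t
  rw [← hx] at hnear hnear'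
  have hpow1 : x ^ (1 - ε) * x⁻¹ = x ^ (-ε) := by
    rw [← Real.rpow_neg_one, ← Real.rpow_add hx0]; congr 1; ring
  have hpow2 : x ^ (1 - ε) * (x⁻¹ * x⁻¹) = x ^ (-1 - ε) := by
    rw [← Real.rpow_neg_one, ← Real.rpow_add hx0, ← Real.rpow_add hx0]; congr 1; ring
  have hpow3 : x ^ (-ε) * x = x ^ (1 - ε) := by
    rw [← Real.rpow_add_one hx0.ne']; congr 1; ring
  have hinv0 := H0.inv_norm_le ha t
  have hinv := H.inv_norm_le ha t
  rw [← hx] at hinv0 hinv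
  have hAc : (A : ℂ) ≠ 0 := by exact_mod_cast hA.ne'
  have hnd : ‖(A : ℂ) * (a - vline (-m) t)‖ = A * ‖(a : ℂ) - vline (-m) t‖ := by
    rw [norm_mul, Complex.norm_real, Real.norm_eq_abs, abs_of_pos hA]
  have hMn : 0 ≤ M := by rw [hM]; positivity
  constructor
  · have hlow : κ1 ≤ ‖((a : ℂ) - F t) / (A * (a - vline (-m) t))‖ := by
      rw [norm_div, hnd, le_div_iff₀ (mul_pos hA (norm_pos_iff.2 hn2)), hκ1,
        div_mul_eq_mul_div, div_le_iff₀ (by positivity)]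
      calc κ * (A * ‖(a : ℂ) - vline (-m) t‖) ≤ κ * (A * ((a + m + 1) * x)) := by
            have := H.κ_pos
            gcongr
        _ = κ * x * (A * (a + m + 1)) := by ring
        _ ≤ _ := by gcongr; exact H.low a ha t
    refine (norm_log_le_of_le_norm hκ1p hlow).trans ?_
    have hq : ‖((a : ℂ) - F t) / (A * (a - vline (-m) t)) - 1‖ ≤ M * (A * κ0)⁻¹ * x ^ (-ε) := by
      rw [div_sub_one (mul_ne_zero hAc hn2), norm_div, div_eq_mul_inv, hnd,
        show (a : ℂ) - F t - A * (a - vline (-m) t)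
          = ((a * (1 - A) : ℝ) : ℂ) - (F t - A * vline (-m) t) by push_cast; ring, ← hpow1, mul_inv]
      have e1 : ‖((a * (1 - A) : ℝ) : ℂ) - (F t - A * vline (-m) t)‖ ≤ M * x ^ (1 - ε) := by
        refine (norm_sub_le _ _).trans ?_
        have : 0 ≤ K * (a + m + 1) * x ^ (1 - ε) := by positivity
        rw [hM]; linarith
      calc _ ≤ (M * x ^ (1 - ε)) * (A⁻¹ * (κ0⁻¹ * x⁻¹)) := by gcongr
        _ = _ := by rw [mul_inv]; ring
    have hpos : 0 ≤ M * (κ⁻¹ * κ0⁻¹) + 1 := by positivity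
    calc _ ≤ (3 + 2 * κ1⁻¹ + 2 * Real.pi) * (M * (A * κ0)⁻¹ * x ^ (-ε)) := by gcongr
      _ = (3 + 2 * κ1⁻¹ + 2 * Real.pi) * (M * (A * κ0)⁻¹) * x ^ (-ε) := by ring
      _ ≤ _ := mul_le_mul_of_nonneg_right (by linarith) (by positivity)
  · have hsplit : lineRatio' m F F' a t = (-((F' t - A * Complex.I) * (a - vline (-m) t))
        + (((a * (1 - A) : ℝ) : ℂ) - (F t - A * vline (-m) t)) * Complex.I)
        * (((a : ℂ) - F t)⁻¹ * ((a : ℂ) - vline (-m) t)⁻¹) := by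
      simp only [lineRatio', lineLog']
      field_simp
      push_cast
      ring
    rw [hsplit, norm_mul, norm_mul, norm_inv, norm_inv]
    have e1 : ‖-((F' t - A * Complex.I) * (a - vline (-m) t))
        + (((a * (1 - A) : ℝ) : ℂ) - (F t - A * vline (-m) t)) * Complex.I‖ ≤ M * x ^ (1 - ε) := by
      refine (norm_add_le _ _).trans ?_
      rw [norm_neg, norm_mul, norm_mul, Complex.norm_I, mul_one]
      have e2 : ‖F' t - A * Complex.I‖ * ‖(a : ℂ) - vline (-m) t‖
          ≤ K * (a + m + 1) * x ^ (1 - ε) := by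
        calc _ ≤ (K * x ^ (-ε)) * ((a + m + 1) * x) :=
              mul_le_mul hnear' hv (norm_nonneg _) (by positivity)
          _ = K * (a + m + 1) * (x ^ (-ε) * x) := by ring
          _ = _ := by rw [hpow3]
      have e3 := norm_sub_le ((a * (1 - A) : ℝ) : ℂ) (F t - A * vline (-m) t)
      rw [hM]; linarith
    have hκ' := H.κ_pos
    calc _ ≤ (M * x ^ (1 - ε)) * ((κ⁻¹ * x⁻¹) * (κ0⁻¹ * x⁻¹)) := by gcongr
      _ = M * (κ⁻¹ * κ0⁻¹) * (x ^ (1 - ε) * (x⁻¹ * x⁻¹)) := by ring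
      _ = M * (κ⁻¹ * κ0⁻¹) * x ^ (-1 - ε) := by rw [hpow2]
      _ ≤ _ := by
        have h1 : 0 ≤ (3 + 2 * κ1⁻¹ + 2 * Real.pi) * (M * (A * κ0)⁻¹) + 1 := by positivity
        exact mul_le_mul_of_nonneg_right (by linarith) (by positivity)

end LineNear

end QuarticMatrix
-- Symmetry and splitting of the exponents.
namespace QuarticMatrix

open VerticalLine ComplexConjugate

lemma tendsto_zero_of_norm_le_rpow {f : ℝ → ℂ} {C r : ℝ} (hr : 0 < r)
    (h : ∀ t, ‖f t‖ ≤ C * (1 + |t|) ^ (-r)) {l : Filter ℝ} (hl : Tendsto (fun t => |t|) l atTop) :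
    Tendsto f l (𝓝 0) := by
  have hz : Tendsto (fun t : ℝ => C * (1 + |t|) ^ (-r)) l (𝓝 0) := by
    simpa using ((tendsto_rpow_neg_atTop hr).comp
      (tendsto_atTop_add_const_left l 1 hl)).const_mul C
  exact squeeze_zero_norm h hz

/-- Integration by parts against a reflected function. -/
lemma integral_reflect_mul_deriv {u u' v v' : ℝ → ℂ} {C r : ℝ} (hr : 0 < r)
    (hu : ∀ t, HasDerivAt u (u' t) t) (hv : ∀ t, HasDerivAt v (v' t) t)
    (h1 : Integrable fun t => u (-t) * v' t) (h2 : Integrable fun t => v (-t) * u' t)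
    (hb : ∀ t, ‖u (-t) * v t‖ ≤ C * (1 + |t|) ^ (-r)) :
    ∫ t : ℝ, u (-t) * v' t = ∫ t : ℝ, v (-t) * u' t := by
  -- The sign from the reflection cancels the sign from integration by parts, so the pairing is
  -- symmetric rather than antisymmetric.
  have hd : ∀ t, HasDerivAt (fun s => u (-s)) (-u' (-t)) t := by
    intro t
    have := (hu (-t)).scomp t (hasDerivAt_neg t)
    rw [neg_one_smul] at this
    exact this
  have h3 : Integrable fun t => -u' (-t) * v t := by
    have := h2.comp_neg.neg
    refine this.congr (ae_of_all _ fun t => ?_)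
    simp only [Pi.neg_apply, neg_neg]
    ring
  have h := integral_mul_deriv_eq_deriv_mul (u := fun s => u (-s)) (v := v) (u' := fun t => -u' (-t))
    (v' := v') (a' := 0) (b' := 0) (fun t _ => hd t) (fun t _ => hv t) h1 h3
    (tendsto_zero_of_norm_le_rpow hr hb tendsto_abs_atBot_atTop)
    (tendsto_zero_of_norm_le_rpow hr hb tendsto_abs_atTop_atTop)
  rw [h, sub_zero, zero_sub, ← integral_neg, ← integral_neg_eq_self]
  congr 1
  ext t
  simp only [neg_neg]
  ring

lemma integral_add_three {f g h : ℝ → ℂ} (hf : Integrable f) (hg : Integrable g)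
    (hh : Integrable h) : ∫ t, (f t + g t + h t) = (∫ t, f t) + (∫ t, g t) + ∫ t, h t := by
  have hfg : Integrable fun t => f t + g t := hf.add hg
  rw [integral_add hfg hh, integral_add hf hg]

lemma integral_sub_add_const_mul {f g h : ℝ → ℂ} (c : ℂ) (hf : Integrable f) (hg : Integrable g)
    (hh : Integrable h) :
    ∫ t, (f t - g t + c * h t) = (∫ t, f t) - (∫ t, g t) + c * ∫ t, h t := by
  have hfg : Integrable fun t => f t - g t := hf.sub hg
  rw [integral_add hfg (hh.const_mul c), integral_sub hf hg, integral_const_mul]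

namespace LineNear

variable {A m κ K ε : ℝ} {F F' : ℝ → ℂ}

lemma exists_norm_alt_le (A m κ K ε a b : ℝ) (hA : 0 < A) (hm : 0 < m) (hκ : 0 < κ) (hε0 : 0 < ε)
    (hε : ε ≤ 1) (ha : 0 ≤ a) (hb : 0 ≤ b) :
    ∃ C, 0 < C ∧ ∀ F F' : ℝ → ℂ, LineNear A m κ K ε F F' → ∀ t,
      ‖lineRatio A m F a (-t) * lineRatio' m F F' b t‖ ≤ C * (1 + |t|) ^ (-(1 + ε)) := by
  obtain ⟨C1, hC1, h1⟩ := exists_norm_lineRatio_le A m κ K ε a hA hm hκ hε ha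
  obtain ⟨C2, hC2, h2⟩ := exists_norm_lineRatio_le A m κ K ε b hA hm hκ hε hb
  refine ⟨C1 * C2, by positivity, fun F F' H t => ?_⟩
  have e1 := (h1 F F' H (-t)).1
  have e2 := (h2 F F' H t).2
  rw [abs_neg] at e1
  have e3 : (1 + |t|) ^ (-ε) ≤ 1 := Real.rpow_le_one_of_one_le_of_nonpos
    (by linarith [abs_nonneg t]) (by linarith)
  rw [norm_mul, show -(1 + ε) = -1 - ε by ring]
  calc _ ≤ (C1 * 1) * (C2 * (1 + |t|) ^ (-1 - ε)) :=
        mul_le_mul (e1.trans (by gcongr)) e2 (norm_nonneg _) (by positivity)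
    _ = _ := by ring

/-- Products of a logarithm and a decaying derivative, and of decaying function and the derivative
of a logarithm. -/
lemma exists_norm_cross_le (A m κ K ε a b : ℝ) (hA : 0 < A) (hm : 0 < m) (hκ : 0 < κ)
    (hε0 : 0 < ε) (hε : ε ≤ 1) (ha : 0 ≤ a) (hb : 0 ≤ b) :
    ∃ C, 0 < C ∧ ∀ F F' : ℝ → ℂ, LineNear A m κ K ε F F' → ∀ t,
      ‖lineLog (vline (-m)) a (-t) * lineRatio' m F F' b t‖ ≤ C * (1 + |t|) ^ (-(1 + ε / 2)) ∧
      ‖lineRatio A m F b (-t) * lineLog' (vline (-m)) (fun _ => Complex.I) a t‖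
        ≤ C * (1 + |t|) ^ (-(1 + ε / 2)) ∧
      ‖lineLog (vline (-m)) a (-t) * lineRatio A m F b t‖ ≤ C * (1 + |t|) ^ (-(ε / 2)) := by
  have H0 := lineBase_vline hm
  obtain ⟨C1, hC1, h1⟩ := exists_norm_lineRatio_le A m κ K ε b hA hm hκ hε hb
  obtain ⟨C2, hC2, h2⟩ := LineBase.exists_norm_lineLog_le _ (m + 1) a H0.κ_pos ha (half_pos hε0)
  set C3 := (m + 1) * (min m 1 / 2)⁻¹ with hC3
  have hC3p : 0 < C3 := by positivity
  refine ⟨C2 * C1 + C1 * C3, by positivity, fun F F' H t => ?_⟩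
  set x := 1 + |t| with hx
  have hx1 : 1 ≤ x := by rw [hx]; linarith [abs_nonneg t]
  have hx0 : 0 < x := by linarith
  have e1 := h2 _ _ H0 (-t)
  have e2 := (h1 F F' H t).2
  have e2' := (h1 F F' H t).1
  have e3 := (h1 F F' H (-t)).1
  have e4 := H0.norm_lineLog'_le ha t
  rw [abs_neg, ← hx] at e1 e3
  rw [← hx] at e2 e2' e4
  have p1 : x ^ (ε / 2) * x ^ (-1 - ε) = x ^ (-(1 + ε / 2)) := by
    rw [← Real.rpow_add hx0]; congr 1; ring
  have p2 : x ^ (-ε) * x⁻¹ ≤ x ^ (-(1 + ε / 2)) := by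
    rw [← Real.rpow_neg_one, ← Real.rpow_add hx0]
    exact Real.rpow_le_rpow_of_exponent_le hx1 (by linarith)
  have p3 : x ^ (ε / 2) * x ^ (-ε) = x ^ (-(ε / 2)) := by
    rw [← Real.rpow_add hx0]; congr 1; ring
  have n1 : 0 ≤ C2 * C1 := by positivity
  have n2 : 0 ≤ C1 * C3 := by positivity
  refine ⟨?_, ?_, ?_⟩
  · rw [norm_mul]
    calc _ ≤ (C2 * x ^ (ε / 2)) * (C1 * x ^ (-1 - ε)) :=
          mul_le_mul e1 e2 (norm_nonneg _) (by positivity)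
      _ = C2 * C1 * (x ^ (ε / 2) * x ^ (-1 - ε)) := by ring
      _ ≤ _ := by
        rw [p1]
        exact mul_le_mul_of_nonneg_right (by linarith) (by positivity)
  · rw [norm_mul]
    calc _ ≤ (C1 * x ^ (-ε)) * (C3 * x⁻¹) := mul_le_mul e3 e4 (norm_nonneg _) (by positivity)
      _ = C1 * C3 * (x ^ (-ε) * x⁻¹) := by ring
      _ ≤ C1 * C3 * x ^ (-(1 + ε / 2)) := by gcongr
      _ ≤ _ := mul_le_mul_of_nonneg_right (by linarith) (by positivity)
  · rw [norm_mul]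
    calc _ ≤ (C2 * x ^ (ε / 2)) * (C1 * x ^ (-ε)) :=
          mul_le_mul e1 e2' (norm_nonneg _) (by positivity)
      _ = C2 * C1 * (x ^ (ε / 2) * x ^ (-ε)) := by ring
      _ ≤ _ := by
        rw [p3]
        exact mul_le_mul_of_nonneg_right (by linarith) (by positivity)

lemma integrable_alt (H : LineNear A m κ K ε F F') {a b : ℝ} (ha : 0 ≤ a) (hb : 0 ≤ b) :
    Integrable fun t => lineRatio A m F a (-t) * lineRatio' m F F' b t := by
  obtain ⟨C, -, h⟩ := exists_norm_alt_le A m κ K ε a b H.A_pos H.m_pos H.κ_pos H.ε_pos H.ε_le ha hb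
  exact integrable_of_le_rpow_neg (by linarith [H.ε_pos])
    (((H.continuous_lineRatio ha).comp continuous_neg).measurable.mul
      (H.measurable_lineRatio' b)).aestronglyMeasurable (h F F' H)

lemma integrable_cross (H : LineNear A m κ K ε F F') {a b : ℝ} (ha : 0 ≤ a) (hb : 0 ≤ b) :
    Integrable (fun t => lineLog (vline (-m)) a (-t) * lineRatio' m F F' b t) ∧
    Integrable (fun t => lineRatio A m F b (-t)
      * lineLog' (vline (-m)) (fun _ => Complex.I) a t) := by
  obtain ⟨C, -, h⟩ :=
    exists_norm_cross_le A m κ K ε a b H.A_pos H.m_pos H.κ_pos H.ε_pos H.ε_le ha hb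
  have H0 := lineBase_vline H.m_pos
  have hε := H.ε_pos
  exact ⟨integrable_of_le_rpow_neg (by linarith)
    (((H0.continuous_lineLog ha).comp continuous_neg).measurable.mul
      (H.measurable_lineRatio' b)).aestronglyMeasurable fun t => (h F F' H t).1,
    integrable_of_le_rpow_neg (by linarith)
    (((H.continuous_lineRatio hb).comp continuous_neg).measurable.mul
      (H0.measurable_lineLog' a)).aestronglyMeasurable fun t => (h F F' H t).2.1⟩

/-- The origin of the symmetry of the two-point function. -/
lemma integral_alt_comm (H : LineNear A m κ K ε F F') {a b : ℝ} (ha : 0 ≤ a) (hb : 0 ≤ b) :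
    ∫ t, lineRatio A m F a (-t) * lineRatio' m F F' b t
      = ∫ t, lineRatio A m F b (-t) * lineRatio' m F F' a t := by
  obtain ⟨C1, hC1, h1⟩ :=
    exists_norm_lineRatio_le A m κ K ε a H.A_pos H.m_pos H.κ_pos H.ε_le ha
  obtain ⟨C2, hC2, h2⟩ :=
    exists_norm_lineRatio_le A m κ K ε b H.A_pos H.m_pos H.κ_pos H.ε_le hb
  have hε := H.ε_pos
  refine integral_reflect_mul_deriv (r := ε) (C := C1 * C2) H.ε_pos (H.hasDerivAt_lineRatio ha)
    (H.hasDerivAt_lineRatio hb) (H.integrable_alt ha hb) (H.integrable_alt hb ha) fun t => ?_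
  have e1 := (h1 F F' H (-t)).1
  have e2 := (h2 F F' H t).1
  rw [abs_neg] at e1
  have e3 : (1 + |t|) ^ (-ε) ≤ 1 := Real.rpow_le_one_of_one_le_of_nonpos
    (by linarith [abs_nonneg t]) (by linarith)
  rw [norm_mul]
  calc _ ≤ (C1 * 1) * (C2 * (1 + |t|) ^ (-ε)) :=
        mul_le_mul (e1.trans (by gcongr)) e2 (norm_nonneg _) (by positivity)
    _ = _ := by ring

/-- Moves the derivative onto the undeformed logarithm, whose derivative is a rational function with
one pole; the integral then becomes accessible to residues. -/
lemma integral_cross_eq (H : LineNear A m κ K ε F F') {a b : ℝ} (ha : 0 ≤ a) (hb : 0 ≤ b) :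
    ∫ t, lineLog (vline (-m)) a (-t) * lineRatio' m F F' b t
      = ∫ t, lineRatio A m F b (-t) * lineLog' (vline (-m)) (fun _ => Complex.I) a t := by
  obtain ⟨C, -, h⟩ :=
    exists_norm_cross_le A m κ K ε a b H.A_pos H.m_pos H.κ_pos H.ε_pos H.ε_le ha hb
  obtain ⟨i1, i2⟩ := H.integrable_cross ha hb
  exact integral_reflect_mul_deriv (half_pos H.ε_pos)
    ((lineBase_vline H.m_pos).hasDerivAt_lineLog ha) (H.hasDerivAt_lineRatio hb) i1 i2
    fun t => (h F F' H t).2.2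

lemma conj_lineRatio (H : LineNear A m κ K ε F F') {a : ℝ} (ha : 0 ≤ a) (t : ℝ) :
    conj (lineRatio A m F a t) = lineRatio A m F a (-t) := by
  rw [H.lineRatio_eq ha, H.lineRatio_eq ha, map_sub, map_sub, H.conj_lineLog ha,
    (lineBase_vline H.m_pos).conj_lineLog ha, Complex.conj_ofReal]

lemma conj_lineRatio' (H : LineNear A m κ K ε F F') (a t : ℝ) :
    conj (lineRatio' m F F' a t) = -lineRatio' m F F' a (-t) := by
  rw [lineRatio', lineRatio', map_sub, H.conj_lineLog',
    (lineBase_vline H.m_pos).conj_lineLog']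
  ring

/-- The exponent of the alternative representation. -/
def altExponent (A m : ℝ) (F F' : ℝ → ℂ) (a b : ℝ) : ℂ :=
  1 / (2 * Real.pi * Complex.I) * ∫ t : ℝ, lineRatio A m F a (-t) * lineRatio' m F F' b t

lemma altExponent_comm (H : LineNear A m κ K ε F F') {a b : ℝ} (ha : 0 ≤ a) (hb : 0 ≤ b) :
    altExponent A m F F' a b = altExponent A m F F' b a := by
  rw [altExponent, H.integral_alt_comm ha hb, altExponent]

/-- Conjugation reflects t and reverses the sign of the derivative; that sign is compensated by the
conjugate of 1/(2πi). -/
lemma conj_altExponent (H : LineNear A m κ K ε F F') {a b : ℝ} (ha : 0 ≤ a) :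
    conj (altExponent A m F F' a b) = altExponent A m F F' a b := by
  have h1 : conj (1 / (2 * Real.pi * Complex.I)) = -(1 / (2 * Real.pi * Complex.I)) := by
    simp only [map_div₀, map_one, map_mul, Complex.conj_ofReal, Complex.conj_I, map_ofNat]
    rw [mul_neg, div_neg]
  rw [altExponent, map_mul, h1, ← integral_conj, ← integral_neg_eq_self, neg_mul, ← mul_neg,
    ← integral_neg]
  congr 2
  ext t
  rw [map_mul, H.conj_lineRatio ha, H.conj_lineRatio', neg_neg, neg_neg]
  ring

/-- The integral that is computed by the residue theorem. -/
def crossExponent (A m : ℝ) (F : ℝ → ℂ) (a b : ℝ) : ℂ :=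
  1 / (2 * Real.pi * Complex.I) * ∫ t : ℝ, lineRatio A m F a (-t)
    * lineLog' (vline (-m)) (fun _ => Complex.I) b t

/-- The difference of the first two terms of the integrand of `N_D`. -/
def logDiff (m : ℝ) (F F' : ℝ → ℂ) (a b t : ℝ) : ℂ :=
  lineLog F a (-t) * lineLog' F F' b t
    - lineLog (vline (-m)) a (-t) * lineLog' (vline (-m)) (fun _ => Complex.I) b t

/-- With log(a − F) = `lineRatio` + log(a − z) + log A the product of the two undeformed factors
cancels. What remains decays, except for the term with log A, which is absent for A = 1 and
integrable after the subtraction at b = 0. -/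
lemma logDiff_eq (H : LineNear A m κ K ε F F') {a : ℝ} (ha : 0 ≤ a) (b t : ℝ) :
    logDiff m F F' a b t = (lineRatio A m F a (-t) * lineRatio' m F F' b t
      + lineLog (vline (-m)) a (-t) * lineRatio' m F F' b t
      + lineRatio A m F a (-t) * lineLog' (vline (-m)) (fun _ => Complex.I) b t)
      + Real.log A * lineLog' F F' b t := by
  have h := H.lineRatio_eq ha (-t)
  have h' : lineLog F a (-t) = lineRatio A m F a (-t) + lineLog (vline (-m)) a (-t)
      + Real.log A := by rw [h]; ring
  rw [logDiff, h', lineRatio']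
  ring

lemma exists_norm_logDiff_le (m κ K ε a b : ℝ) (hm : 0 < m) (hκ : 0 < κ) (hε0 : 0 < ε)
    (hε : ε ≤ 1) (ha : 0 ≤ a) (hb : 0 ≤ b) :
    ∃ C, 0 < C ∧ ∀ F F' : ℝ → ℂ, LineNear 1 m κ K ε F F' → ∀ t,
      ‖logDiff m F F' a b t‖ ≤ C * (1 + |t|) ^ (-(1 + ε / 2)) := by
  obtain ⟨C1, hC1, h1⟩ := exists_norm_alt_le 1 m κ K ε a b one_pos hm hκ hε0 hε ha hb
  obtain ⟨C2, hC2, h2⟩ := exists_norm_cross_le 1 m κ K ε a b one_pos hm hκ hε0 hε ha hb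
  obtain ⟨C3, hC3, h3⟩ := exists_norm_cross_le 1 m κ K ε b a one_pos hm hκ hε0 hε hb ha
  refine ⟨C1 + C2 + C3, by positivity, fun F F' H t => ?_⟩
  have e1 := h1 F F' H t
  have e2 := (h2 F F' H t).1
  have e3 := (h3 F F' H t).2.1
  have e4 : (1 + |t|) ^ (-(1 + ε)) ≤ (1 + |t|) ^ (-(1 + ε / 2)) :=
    Real.rpow_le_rpow_of_exponent_le (by linarith [abs_nonneg t]) (by linarith)
  have e5 := mul_le_mul_of_nonneg_left e4 hC1.le
  rw [H.logDiff_eq ha, Real.log_one, Complex.ofReal_zero, zero_mul, add_zero, add_mul, add_mul]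
  exact (norm_add₃_le).trans (by linarith)

/-- The exponent `N_D` in dimension less than four. -/
lemma integral_logDiff (H : LineNear 1 m κ K ε F F') {a b : ℝ} (ha : 0 ≤ a) (hb : 0 ≤ b) :
    1 / (2 * Real.pi * Complex.I) * ∫ t, logDiff m F F' a b t
      = altExponent 1 m F F' a b + crossExponent 1 m F b a + crossExponent 1 m F a b := by
  have i1 := H.integrable_alt ha hb
  obtain ⟨i2, -⟩ := H.integrable_cross ha hb
  obtain ⟨-, i3⟩ := H.integrable_cross hb ha
  have : ∀ t, logDiff m F F' a b t = lineRatio 1 m F a (-t) * lineRatio' m F F' b t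
      + lineLog (vline (-m)) a (-t) * lineRatio' m F F' b t
      + lineRatio 1 m F a (-t) * lineLog' (vline (-m)) (fun _ => Complex.I) b t := by
    intro t
    rw [H.logDiff_eq ha, Real.log_one, Complex.ofReal_zero, zero_mul, add_zero]
  simp_rw [this]
  rw [integral_add_three i1 i2 i3, H.integral_cross_eq ha hb, altExponent,
    crossExponent, crossExponent]
  ring

/-- The exponent `N_D` in dimension four. -/
lemma integral_logDiff_sub (H : LineNear A m κ K ε F F') {a b : ℝ} (ha : 0 ≤ a) (hb : 0 ≤ b) :
    1 / (2 * Real.pi * Complex.I) * ∫ t, (logDiff m F F' a b t - logDiff m F F' 0 0 t)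
      = (altExponent A m F F' a b + crossExponent A m F b a + crossExponent A m F a b)
        - (altExponent A m F F' 0 0 + crossExponent A m F 0 0 + crossExponent A m F 0 0) := by
  have H0 := lineBase_vline H.m_pos
  have hz : (0 : ℝ) ≤ 0 := le_rfl
  have hi : ∀ {a b : ℝ}, 0 ≤ a → 0 ≤ b → Integrable fun t =>
      lineRatio A m F a (-t) * lineRatio' m F F' b t
      + lineLog (vline (-m)) a (-t) * lineRatio' m F F' b t
      + lineRatio A m F a (-t) * lineLog' (vline (-m)) (fun _ => Complex.I) b t := by
    intro a b ha hb
    exact ((H.integrable_alt ha hb).add (H.integrable_cross ha hb).1).add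
      (H.integrable_cross hb ha).2
  have hI : ∀ {a b : ℝ}, 0 ≤ a → 0 ≤ b → 1 / (2 * Real.pi * Complex.I) * ∫ t,
      (lineRatio A m F a (-t) * lineRatio' m F F' b t
      + lineLog (vline (-m)) a (-t) * lineRatio' m F F' b t
      + lineRatio A m F a (-t) * lineLog' (vline (-m)) (fun _ => Complex.I) b t)
      = altExponent A m F F' a b + crossExponent A m F b a + crossExponent A m F a b := by
    intro a b ha hb
    have i1 := H.integrable_alt ha hb
    obtain ⟨i2, -⟩ := H.integrable_cross ha hb
    obtain ⟨-, i3⟩ := H.integrable_cross hb ha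
    rw [integral_add_three i1 i2 i3, H.integral_cross_eq ha hb, altExponent,
      crossExponent, crossExponent]
    ring
  have hlogb : ∀ t, ‖lineLog' F F' b t - lineLog' F F' 0 t‖
      ≤ K * |b - 0| * κ⁻¹ ^ 2 * (1 + |t|) ^ (-2 : ℝ) := H.norm_lineLog'_sub_le hb hz
  have hlogi : Integrable fun t => lineLog' F F' b t - lineLog' F F' 0 t :=
    integrable_of_le_rpow_neg one_lt_two
      ((H.measurable_lineLog' b).sub (H.measurable_lineLog' 0)).aestronglyMeasurable hlogb
  -- The contribution of log A is the integral of a total derivative that vanishes at both ends.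
  have hlog0 : ∫ t, (lineLog' F F' b t - lineLog' F F' 0 t) = 0 := by
    have hb' : ∀ t, ‖lineLog F b t - lineLog F 0 t‖
        ≤ |b - 0| * κ⁻¹ * (1 + |t|) ^ (-1 : ℝ) := fun t => by
      rw [Real.rpow_neg_one]
      exact H.norm_lineLog_sub_le hb hz t
    have := integral_of_hasDerivAt_of_tendsto
      (fun t => (H.hasDerivAt_lineLog hb t).fun_sub (H.hasDerivAt_lineLog hz t)) hlogi
      (tendsto_zero_of_norm_le_rpow one_pos hb' tendsto_abs_atBot_atTop)
      (tendsto_zero_of_norm_le_rpow one_pos hb' tendsto_abs_atTop_atTop)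
    simpa using this
  have hsplit : ∀ t, logDiff m F F' a b t - logDiff m F F' 0 0 t
      = ((lineRatio A m F a (-t) * lineRatio' m F F' b t
      + lineLog (vline (-m)) a (-t) * lineRatio' m F F' b t
      + lineRatio A m F a (-t) * lineLog' (vline (-m)) (fun _ => Complex.I) b t)
      - (lineRatio A m F 0 (-t) * lineRatio' m F F' 0 t
      + lineLog (vline (-m)) 0 (-t) * lineRatio' m F F' 0 t
      + lineRatio A m F 0 (-t) * lineLog' (vline (-m)) (fun _ => Complex.I) 0 t))
      + Real.log A * (lineLog' F F' b t - lineLog' F F' 0 t) := by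
    intro t
    rw [H.logDiff_eq ha, H.logDiff_eq hz]
    ring
  simp_rw [hsplit]
  rw [integral_sub_add_const_mul _ (hi ha hb) (hi hz hz) hlogi, hlog0, mul_zero, add_zero, mul_sub, hI ha hb, hI hz hz]

end LineNear

end QuarticMatrix
-- Residue evaluation and the explicit form of the two-point function.
namespace QuarticMatrix

open VerticalLine ComplexConjugate LineNear

namespace CutData

variable {lam A B m θ δ ν L : ℝ} {ρ : ℝ → ℝ} {R : ℂ → ℂ}

/-- The restriction of `R` to the line `Re z = -m`. -/
lemma exists_lineNear (H : CutData lam A B m θ δ ν L ρ R) : ∃ κ K : ℝ,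
    LineNear A m κ K 1 (fun t => R (vline (-m) t))
      (fun t => deriv R (vline (-m) t) * Complex.I) := by
  have hδ := H.δ_pos
  have hm := H.m_pos
  have hA := H.A_pos
  have hin : ∀ t, -m - δ < (vline (-m) t).re := fun t => by rw [vline_re]; linarith
  have hin' : ∀ t, (vline (-m) t).re < -m + δ := fun t => by rw [vline_re]; linarith
  have him : ∀ t, |t| ≤ ‖vline (-m) t‖ := fun t => by
    simpa using Complex.abs_im_le_norm (vline (-m) t)
  obtain ⟨κ, hκ, h1⟩ := H.exists_norm_ge
  obtain ⟨K0, hK0, h2⟩ := H.exists_norm_sub_le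
  obtain ⟨K1, h3⟩ := H.deriv_asymp
  have e1 : K0 ≤ K0 + A * (m + 1) + 2 + |K1| := by
    have := mul_pos hA (show 0 < m + 1 by linarith)
    linarith [abs_nonneg K1]
  have e2 : 0 ≤ K0 + A * (m + 1) + 2 + |K1| := hK0.le.trans e1
  -- At finite cut-off R − A z is bounded, so the exponent of closeness is ε = 1.
  refine ⟨κ, K0 + A * (m + 1) + 2 + |K1|, ?_⟩
  exact {
    κ_pos := hκ
    hasDeriv := fun t => (H.differentiableAt (hin t)).hasDerivAt.comp t (hasDerivAt_vline _ t)
    conj_eq := fun t => by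
      rw [← H.conj_eq]
      simp [vline]
    im_pos := fun t ht => by
      simpa using H.im_mul_pos (hin t) (by rwa [vline_im])
    zero_re := by
      have := H.sub_ofReal_pos (x := -m) (by linarith) H.contr_neg
      simpa [vline] using this
    low := fun a ha t => by
      refine le_trans ?_ (h1 _ (hin t) (hin' t) a ha).1
      gcongr
      exact him t
    up := fun t => by
      have h4 := norm_add_le (R (vline (-m) t) - A * vline (-m) t) (A * vline (-m) t)
      rw [sub_add_cancel, norm_mul, Complex.norm_real, Real.norm_eq_abs, abs_of_pos hA] at h4
      have h5 := (lineBase_vline hm).up t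
      have h6 := h2 _ (hin t)
      have h7 : A * ‖vline (-m) t‖ ≤ A * ((m + 1) * (1 + |t|)) := by gcongr
      have h8 : (K0 + A * (m + 1)) * (1 + |t|) ≤ (K0 + A * (m + 1) + 2 + |K1|) * (1 + |t|) := by
        gcongr ?_ * _
        linarith [abs_nonneg K1]
      have h9 : K0 ≤ K0 * (1 + |t|) := by
        nlinarith [abs_nonneg t]
      linarith
    up' := fun t => by
      rw [norm_mul, Complex.norm_I, mul_one]
      have := mul_pos hA (show 0 < m + 1 by linarith)
      linarith [H.norm_deriv_le (hin t), abs_nonneg K1]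
    A_pos := hA
    m_pos := hm
    ε_pos := one_pos
    ε_le := le_rfl
    near := fun t => by
      rw [sub_self, Real.rpow_zero, mul_one]
      exact (h2 _ (hin t)).trans e1
    near' := fun t => by
      rw [← sub_mul, norm_mul, Complex.norm_I, mul_one, Real.rpow_neg_one]
      refine (h3 _ (hin t)).trans ?_
      have h4 : |K1| ≤ K0 + A * (m + 1) + 2 + |K1| := by
        have := mul_pos hA (show 0 < m + 1 by linarith)
        linarith
      gcongr
      · exact (le_abs_self _).trans h4
      · exact him t }

/-- The logarithm of the difference quotient of `R` at `α`. -/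
lemma exists_norm_log_dslope_le (H : CutData lam A B m θ δ ν L ρ R) {α : ℝ} (hα : ν ≤ α) :
    ∃ C, 0 < C ∧ ∀ z : ℂ, -m - δ < z.re → 0 < (dslope R α z / A).re ∧
      ‖Complex.log (dslope R α z / A)‖ ≤ C * (1 + ‖z‖)⁻¹ := by
  have hA := H.A_pos
  have hθ := H.θ_lt
  have hαW : -m - δ < (α : ℂ).re := by
    rw [Complex.ofReal_re]; linarith [H.δ_lt', H.δ_pos]
  obtain ⟨K, hK, h2⟩ := H.exists_norm_sub_le
  have hpi := Real.pi_pos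
  set κ := (1 - θ) / A with hκ
  have hκ0 : 0 < κ := div_pos (by linarith) hA
  set M := (2 + |α|) * (2 + A + 2 * K) with hM
  have hM0 : 0 < M := by positivity
  refine ⟨(3 + 2 * κ⁻¹ + 2 * Real.pi) * (M * A⁻¹), by positivity, fun z hz => ⟨?_, ?_⟩⟩
  · have h1 := (Complex.abs_re_le_norm _).trans (H.norm_dslope_sub_one_le hz hαW)
    rw [Complex.sub_re, Complex.one_re, abs_le] at h1
    rw [Complex.div_ofReal_re]
    exact div_pos (by linarith [h1.1]) hA
  · have hlow : κ ≤ ‖dslope R α z / (A : ℂ)‖ := by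
      rw [norm_div, Complex.norm_real, Real.norm_eq_abs, abs_of_pos hA, hκ]
      gcongr
      exact H.norm_dslope_ge hz hαW
    refine (norm_log_le_of_le_norm hκ0 hlow).trans ?_
    have hAc : (A : ℂ) ≠ 0 := by exact_mod_cast hA.ne'
    have key : ‖dslope R α z - A‖ * (1 + ‖z‖) ≤ M := by
      have hup : ‖dslope R α z - A‖ ≤ 2 + A := by
        have h3 := H.norm_dslope_sub_one_le hz hαW
        have h4 : ‖(1 : ℂ) - A‖ ≤ 1 + A := (norm_sub_le _ _).trans (by
          rw [norm_one, Complex.norm_real, Real.norm_eq_abs, abs_of_pos hA])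
        have h5 := norm_add_le (dslope R α z - 1) (1 - (A : ℂ))
        rw [show dslope R α z - 1 + (1 - (A : ℂ)) = dslope R α z - A by ring] at h5
        linarith
      have h6 : ‖z‖ ≤ ‖z - α‖ + |α| := by
        have := norm_add_le (z - α) (α : ℂ)
        rwa [sub_add_cancel, Complex.norm_real, Real.norm_eq_abs] at this
      -- Near α the difference quotient is bounded by the contraction property; away from α
      -- boundedness of R − A z gives the decay.
      rcases le_total ‖z - α‖ 1 with h | h
      · calc ‖dslope R α z - A‖ * (1 + ‖z‖) ≤ (2 + A) * (2 + |α|) := by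
              refine mul_le_mul hup ?_ (by positivity) (by linarith)
              linarith
          _ ≤ M := by
            rw [hM, mul_comm]
            refine mul_le_mul_of_nonneg_left ?_ (by positivity)
            linarith
      · have hne : z - α ≠ 0 := norm_pos_iff.1 (by linarith)
        have h7 : ‖dslope R α z - A‖ * ‖z - α‖ ≤ 2 * K := by
          rw [← norm_mul, dslope_of_ne _ (sub_ne_zero.1 hne), slope_def_field, sub_mul,
            div_mul_cancel₀ _ hne,
            show R z - R α - A * (z - α) = (R z - A * z) - (R α - A * α) by ring]
          exact (norm_sub_le _ _).trans (by linarith [h2 z hz, h2 α hαW])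
        calc ‖dslope R α z - A‖ * (1 + ‖z‖)
            ≤ ‖dslope R α z - A‖ * ((2 + |α|) * ‖z - α‖) := by
              gcongr
              nlinarith [abs_nonneg α]
          _ = (2 + |α|) * (‖dslope R α z - A‖ * ‖z - α‖) := by ring
          _ ≤ (2 + |α|) * (2 * K) := by gcongr
          _ ≤ M := by
            rw [hM]
            gcongr
            linarith
    rw [div_sub_one hAc, norm_div, Complex.norm_real, Real.norm_eq_abs, abs_of_pos hA, mul_assoc]
    gcongr
    rw [div_eq_mul_inv, mul_right_comm]
    gcongr
    rwa [← div_eq_mul_inv, le_div_iff₀ (by positivity)]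

end CutData

/-- The logarithm of a cross ratio on a half plane to the left of both points. -/
lemma exists_norm_log_sub_div_le {a α c : ℝ} (ha : c < a) (hα : c < α) :
    ∃ C, 0 < C ∧ ∀ z : ℂ, z.re ≤ c → ‖Complex.log ((α - z) / (a - z))‖ ≤ C * (1 + ‖z‖)⁻¹ := by
  obtain ⟨K1, hK1, h1⟩ := CutData.exists_one_add_norm_le_sub (c := c) (p := (a : ℂ)) (by simpa)
  obtain ⟨K2, hK2, h2⟩ := CutData.exists_one_add_norm_le_sub (c := c) (p := (α : ℂ)) (by simpa)
  have hpi := Real.pi_pos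
  set κ := (K2 * (1 + |a|))⁻¹ with hκ
  have hκ0 : 0 < κ := by positivity
  refine ⟨(3 + 2 * κ⁻¹ + 2 * Real.pi) * ((|α - a| + 1) * K1), by positivity, fun z hz => ?_⟩
  have e1 := h1 z hz
  have e2 := h2 z hz
  have p1 : 0 < ‖(a : ℂ) - z‖ := by
    have : 0 < 1 + ‖z‖ := by positivity
    by_contra! h
    nlinarith
  have hne : (a : ℂ) - z ≠ 0 := norm_pos_iff.1 p1
  have hlow : κ ≤ ‖((α : ℂ) - z) / (a - z)‖ := by
    rw [norm_div, le_div_iff₀ p1, hκ, inv_mul_le_iff₀ (by positivity)]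
    have h3 : ‖(a : ℂ) - z‖ ≤ |a| + ‖z‖ := (norm_sub_le _ _).trans (by
      rw [Complex.norm_real, Real.norm_eq_abs])
    have h4 : |a| + ‖z‖ ≤ (1 + |a|) * (1 + ‖z‖) := by
      nlinarith [abs_nonneg a, norm_nonneg z, mul_nonneg (abs_nonneg a) (norm_nonneg z)]
    calc ‖(a : ℂ) - z‖ ≤ (1 + |a|) * (1 + ‖z‖) := h3.trans h4
      _ ≤ (1 + |a|) * (K2 * ‖(α : ℂ) - z‖) := by gcongr
      _ = _ := by ring
  refine (norm_log_le_of_le_norm hκ0 hlow).trans ?_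
  rw [div_sub_one hne, norm_div, sub_sub_sub_cancel_right, ← Complex.ofReal_sub,
    Complex.norm_real, Real.norm_eq_abs, mul_assoc]
  gcongr
  rw [div_le_iff₀ p1]
  calc |α - a| ≤ (|α - a| + 1) * ((1 + ‖z‖) * (1 + ‖z‖)⁻¹) := by
        rw [mul_inv_cancel₀ (by positivity)]; linarith
    _ ≤ (|α - a| + 1) * ((K1 * ‖(a : ℂ) - z‖) * (1 + ‖z‖)⁻¹) := by gcongr
    _ = _ := by ring

lemma sub_div_sub_re_pos {a α : ℝ} {z : ℂ} (ha : z.re < a) (hα : z.re < α) :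
    0 < (((α : ℂ) - z) / (a - z)).re := by
  have h : 0 < Complex.normSq ((a : ℂ) - z) := Complex.normSq_pos.2 fun h => by
    have := congrArg Complex.re h
    simp at this
    linarith
  rw [Complex.div_re, ← add_div]
  refine div_pos ?_ h
  simp only [Complex.sub_re, Complex.sub_im, Complex.ofReal_re, Complex.ofReal_im]
  nlinarith [mul_pos (sub_pos.2 ha) (sub_pos.2 hα), sq_nonneg z.im]

lemma log_mul_of_re_pos {x y : ℂ} (hx : 0 < x.re) (hy : 0 < y.re) :
    Complex.log (x * y) = Complex.log x + Complex.log y := by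
  have h1 := abs_lt.1 (Complex.abs_arg_lt_pi_div_two_iff.2 (Or.inl hx))
  have h2 := abs_lt.1 (Complex.abs_arg_lt_pi_div_two_iff.2 (Or.inl hy))
  have hx0 : x ≠ 0 := fun h => by simp [h] at hx
  have hy0 : y ≠ 0 := fun h => by simp [h] at hy
  exact Complex.log_mul hx0 hy0 ⟨by linarith [h1.1, h2.1], by linarith [h1.2, h2.2]⟩

namespace CutData

variable {lam A B m θ δ ν L : ℝ} {ρ : ℝ → ℝ} {R : ℂ → ℂ}

/-- Evaluation of the cross exponent by the residue theorem. -/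
lemma crossExponent_eq (H : CutData lam A B m θ δ ν L ρ R) {a b α : ℝ} (ha : 0 ≤ a) (hb : 0 ≤ b)
    (hα : ν ≤ α) (hRα : R α = a) :
    crossExponent A m (fun t => R (vline (-m) t)) a b
      = -Real.log ((2 * m + b + α) / (2 * m + a + b)) := by
  have hδ := H.δ_pos
  have hδ' := H.δ_lt'
  have hm := H.m_pos
  have hA := H.A_pos
  have hαm : -m < α := by linarith
  have ham : -m < a := by linarith
  have hAc : (A : ℂ) ≠ 0 := by exact_mod_cast hA.ne'
  obtain ⟨C1, hC1, h1⟩ := H.exists_norm_log_dslope_le hα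
  obtain ⟨C2, hC2, h2⟩ := exists_norm_log_sub_div_le (c := -m) ham hαm
  obtain ⟨K3, hK3, h3⟩ := exists_one_add_norm_le_sub (c := m) (p := (b : ℂ) + 2 * m)
    (by simp; linarith)
  have h3' : ∀ z : ℂ, -m ≤ z.re → 1 + ‖z‖ ≤ K3 * ‖z - (-(b + 2 * m))‖ := fun z hz => by
    have := h3 (-z) (by rw [Complex.neg_re]; linarith)
    rwa [norm_neg, show (b : ℂ) + 2 * m - -z = z - (-(b + 2 * m)) by ring] at this
  have hne : ∀ z : ℂ, -m ≤ z.re → z - (-(b + 2 * m)) ≠ 0 := fun z hz h => by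
    have := h3' z hz
    rw [h, norm_zero, mul_zero] at this
    linarith [norm_nonneg z]
  -- As R α = a, the ratio (a − R)/(A (a − z)) is the difference quotient of R at α over A, times (α
  -- − z)/(a − z). The logarithm V of the first factor is holomorphic to the right of the line and W
  -- to the left. The pole −(b + 2m) lies on the left, so V contributes zero and W its value there.
  set V : ℂ → ℂ := fun z => Complex.log (dslope R α z / A) with hV
  set W : ℂ → ℂ := fun z => Complex.log ((α - z) / (a - z)) with hW
  have hαW : -m - δ < (α : ℂ).re := by rw [Complex.ofReal_re]; linarith
  have hVd : DifferentiableOn ℂ V {z | -m - δ < z.re} := by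
    refine DifferentiableOn.clog ((H.dslope_differentiableOn hαW).div_const _) fun z hz => ?_
    exact Complex.mem_slitPlane_iff.2 (Or.inl (h1 z hz).1)
  have hWd : DifferentiableOn ℂ W {z | z.re < min a α} := by
    refine DifferentiableOn.clog (DifferentiableOn.div (by fun_prop) (by fun_prop) ?_) ?_
    · intro z hz h
      have hz' : z.re < min a α := hz
      have := congrArg Complex.re h
      simp at this
      linarith [(lt_min_iff.1 hz').1]
    · intro z hz
      have hz' : z.re < min a α := hz
      exact Complex.mem_slitPlane_iff.2
        (Or.inl (sub_div_sub_re_pos (lt_min_iff.1 hz').1 (lt_min_iff.1 hz').2))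
  have hbd : ∀ {C : ℝ} {x : ℂ} {z : ℂ}, 0 < C → -m ≤ z.re → ‖x‖ ≤ C * (1 + ‖z‖)⁻¹ →
      ‖x / (z - (-(b + 2 * m)))‖ ≤ C * K3 * (1 + ‖z‖) ^ (-2 : ℝ) := by
    intro C x z hC hz hx
    have hp : 0 < 1 + ‖z‖ := by positivity
    have hp' := norm_pos_iff.2 (hne z hz)
    rw [norm_div, div_le_iff₀ hp', Real.rpow_neg hp.le, Real.rpow_two]
    calc ‖x‖ ≤ C * (1 + ‖z‖)⁻¹ := hx
      _ = C * ((1 + ‖z‖) * ((1 + ‖z‖) ^ 2)⁻¹) := by field_simp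
      _ ≤ C * ((K3 * ‖z - (-(b + 2 * m))‖) * ((1 + ‖z‖) ^ 2)⁻¹) := by
        gcongr
        exact h3' z hz
      _ = _ := by ring
  have hVz : ∫ t : ℝ, V (vline (-m) t) / (vline (-m) t - (-(b + 2 * m))) = 0 := by
    refine integral_vline_eq_zero (f := fun z => V z / (z - (-(b + 2 * m)))) one_lt_two
      (fun z hz => ?_) fun z hz => hbd hC1 hz (h1 z (by linarith)).2
    have hz' : -m - δ < z.re := by linarith
    exact (hVd.differentiableAt ((isOpen_rightHalf _).mem_nhds hz')).div (by fun_prop) (hne z hz)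
  have hWz : ∫ t : ℝ, W (vline (-m) t) / (vline (-m) t - (-(b + 2 * m)))
      = 2 * Real.pi * W (-(b + 2 * m)) := by
    refine integral_vline_cauchy_left (c0 := min a α) (r := 1) (lt_min ham hαm) one_pos
      (by simp; linarith) hWd (C := C2) fun z hz => ?_
    rw [Real.rpow_neg_one]
    exact h2 z hz
  have hci : ∀ {U : ℂ → ℂ} {C : ℝ}, 0 < C → Continuous (fun t => U (vline (-m) t)) →
      (∀ t, ‖U (vline (-m) t)‖ ≤ C * (1 + ‖vline (-m) t‖)⁻¹) →
      Integrable fun t => U (vline (-m) t) / (vline (-m) t - (-(b + 2 * m))) := by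
    intro U C hC hU hUb
    refine integrable_of_le_rpow_neg (r := 2) (C := C * K3) one_lt_two
      (hU.div ((continuous_vline _).sub continuous_const) fun t =>
        hne _ (by rw [vline_re])).aestronglyMeasurable fun t => ?_
    refine (hbd hC (by rw [vline_re]) (hUb t)).trans ?_
    gcongr C * K3 * ?_
    refine Real.rpow_le_rpow_of_nonpos (by positivity) ?_ (by norm_num)
    have := Complex.abs_im_le_norm (vline (-m) t)
    rw [vline_im] at this
    linarith
  have iV := hci hC1 (continuous_comp_vline (isOpen_rightHalf _) hVd fun t => by
    rw [mem_ofPred, vline_re]; linarith) fun t => (h1 _ (by rw [vline_re]; linarith)).2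
  have iW := hci hC2 (continuous_comp_vline (isOpen_lt Complex.continuous_re continuous_const) hWd
    fun t => by rw [mem_ofPred, vline_re]; exact lt_min ham hαm) fun t =>
      h2 _ (by rw [vline_re])
  have hsum : ∀ t : ℝ, lineRatio A m (fun t => R (vline (-m) t)) a t
      = V (vline (-m) t) + W (vline (-m) t) := by
    intro t
    have e1 : -m - δ < (vline (-m) t).re := by rw [vline_re]; linarith
    have hne1 : vline (-m) t ≠ α := fun h => by
      have := congrArg Complex.re h
      rw [vline_re, Complex.ofReal_re] at this
      linarith
    have hne2 : (a : ℂ) - vline (-m) t ≠ 0 := fun h => by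
      have := congrArg Complex.re h
      simp at this
      linarith
    have hne3 : (α : ℂ) - vline (-m) t ≠ 0 := fun h => hne1 (sub_eq_zero.1 h).symm
    have hne4 := sub_ne_zero.2 hne1
    rw [hV, hW]
    simp only
    rw [← log_mul_of_re_pos (h1 _ e1).1 (sub_div_sub_re_pos (by rwa [vline_re])
      (by rwa [vline_re])), lineRatio, dslope_of_ne _ hne1, slope_def_field, hRα]
    congr 1
    rw [show (α : ℂ) - vline (-m) t = -(vline (-m) t - α) by ring]
    field_simp
    ring
  -- On the line Re z = −m reversing t is the same as reflecting z ↦ −2m − z.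
  have hrefl : ∀ t : ℝ, vline (-m) (-t) = -(2 * m) - vline (-m) t := fun t => by
    simp only [vline]
    push_cast
    ring
  have hWv : W (-(b + 2 * m)) = Real.log ((2 * m + b + α) / (2 * m + a + b)) := by
    rw [hW, Complex.ofReal_log (div_nonneg (by linarith) (by linarith))]
    push_cast
    ring_nf
  rw [crossExponent, ← integral_neg_eq_self]
  have hint : ∀ t : ℝ, lineRatio A m (fun t => R (vline (-m) t)) a (- -t)
      * lineLog' (vline (-m)) (fun _ => Complex.I) b (-t)
      = -Complex.I * (V (vline (-m) t) / (vline (-m) t - (-(b + 2 * m)))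
        + W (vline (-m) t) / (vline (-m) t - (-(b + 2 * m)))) := by
    intro t
    rw [neg_neg, hsum, lineLog', hrefl, ← add_div, mul_comm, mul_div_assoc', div_mul_eq_mul_div,
      show (b : ℂ) - (-(2 * m) - vline (-m) t) = vline (-m) t - (-(b + 2 * m)) by ring]
  simp_rw [hint]
  rw [integral_const_mul, integral_add iV iW, hVz, hWz, hWv, zero_add]
  have hpi : (Real.pi : ℂ) ≠ 0 := by exact_mod_cast Real.pi_ne_zero
  have hI := Complex.I_ne_zero
  field_simp

lemma exp_crossExponent (H : CutData lam A B m θ δ ν L ρ R) {a b α : ℝ} (ha : 0 ≤ a)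
    (hb : 0 ≤ b) (hα : ν ≤ α) (hRα : R α = a) :
    Complex.exp (crossExponent A m (fun t => R (vline (-m) t)) a b)
      = (2 * m + a + b) / (2 * m + b + α) := by
  have hm := H.m_pos
  have := H.contr_neg
  rw [H.crossExponent_eq ha hb hα hRα, ← Complex.ofReal_neg, ← Real.log_inv, ← Complex.ofReal_exp,
    Real.exp_log (inv_pos.2 (div_pos (by linarith) (by linarith))), inv_div]
  push_cast
  rfl

/-- The factor R'/(R − a) is the logarithmic derivative of a − R; splitting off that of a − z
separates the symmetric exponent from the one computed by residues. -/
lemma cauchyLog_eq (H : CutData lam A B m θ δ ν L ρ R) {a b : ℝ} (ha : 0 ≤ a) (hb : 0 ≤ b) :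
    cauchyLog A m R b (-m) a
      = altExponent A m (fun t => R (vline (-m) t)) (fun t => deriv R (vline (-m) t) * Complex.I) b a
        + crossExponent A m (fun t => R (vline (-m) t)) b a := by
  obtain ⟨κ, K, hL⟩ := H.exists_lineNear
  have i1 := hL.integrable_alt hb ha
  obtain ⟨-, i2⟩ := hL.integrable_cross ha hb
  rw [altExponent, crossExponent, ← mul_add, ← integral_add i1 i2, cauchyLog]
  have hrefl : ∀ t : ℝ, -(2 * m) - vline (-m) t = vline (-m) (-t) := fun t => by
    simp only [vline]
    push_cast
    ring
  have hint : ∀ t : ℝ, lineRatio A m (fun t => R (vline (-m) t)) b (-t)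
      * lineRatio' m (fun t => R (vline (-m) t)) (fun t => deriv R (vline (-m) t) * Complex.I) a t
      + lineRatio A m (fun t => R (vline (-m) t)) b (-t)
        * lineLog' (vline (-m)) (fun _ => Complex.I) a t
      = Complex.I * (logRatio A R b (-(2 * m) - vline (-m) t) * deriv R (vline (-m) t)
        / (R (vline (-m) t) - a)) := by
    intro t
    have hne := hL.ne_zero ha t
    have hne' : R (vline (-m) t) - a ≠ 0 := fun h => hne (by rw [← neg_sub, h, neg_zero])
    rw [← mul_add, lineRatio', sub_add_cancel, lineLog', hrefl, logRatio, lineRatio,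
      ← neg_sub (R (vline (-m) t)) (a : ℂ), neg_div_neg_eq]
    field_simp
  simp_rw [hint]
  rw [integral_const_mul]
  have hpi : (Real.pi : ℂ) ≠ 0 := by exact_mod_cast Real.pi_ne_zero
  have hI := Complex.I_ne_zero
  field_simp

/-- The two-point function at the preimage of a point of the positive half line. -/
lemma gTwo_eq (H : CutData lam A B m θ δ ν L ρ R) {α β : ℝ} {a b : ℝ} (ha : 0 ≤ a) (hb : 0 ≤ b)
    (hβ : ν ≤ β) (hRα : R α = a) (hRβ : R β = b) :
    gTwo A m R b α
      = Complex.exp (altExponent A m (fun t => R (vline (-m) t))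
          (fun t => deriv R (vline (-m) t) * Complex.I) a b) * (2 * m + a + b)
        / (A * (2 * m + b + α) * (2 * m + a + β)) := by
  obtain ⟨κ, K, hL⟩ := H.exists_lineNear
  rw [gTwo, hRα, H.cauchyLog_eq ha hb, Complex.exp_add, H.exp_crossExponent hb ha hβ hRβ,
    hL.altExponent_comm hb ha, mul_div_assoc', div_div]
  congr 1 <;> ring

lemma gTwo_comm (H : CutData lam A B m θ δ ν L ρ R) {α β : ℝ} {a b : ℝ} (ha : 0 ≤ a) (hb : 0 ≤ b)
    (hα : ν ≤ α) (hβ : ν ≤ β) (hRα : R α = a) (hRβ : R β = b) :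
    gTwo A m R b α = gTwo A m R a β := by
  obtain ⟨κ, K, hL⟩ := H.exists_lineNear
  rw [H.gTwo_eq ha hb hβ hRα hRβ, H.gTwo_eq hb ha hα hRβ hRα, hL.altExponent_comm ha hb]
  congr 1 <;> ring

/-- The two-point function is positive. -/
lemma exists_gTwo_eq_ofReal (H : CutData lam A B m θ δ ν L ρ R) {α a b : ℝ} (ha : 0 ≤ a)
    (hb : 0 ≤ b) (hα : ν ≤ α) (hRα : R α = a) : ∃ g : ℝ, 0 < g ∧ gTwo A m R b α = g := by
  obtain ⟨κ, K, hL⟩ := H.exists_lineNear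
  obtain ⟨β, hβ, hRβ⟩ := H.exists_preimage hb
  have hre := Complex.conj_eq_iff_re.1 (hL.conj_altExponent (b := b) ha)
  have hm := H.m_pos
  have hA := H.A_pos
  have hν := H.contr_neg
  refine ⟨Real.exp (altExponent A m (fun t => R (vline (-m) t))
          (fun t => deriv R (vline (-m) t) * Complex.I) a b).re * (2 * m + a + b)
        / (A * (2 * m + b + α) * (2 * m + a + β)), ?_, ?_⟩
  · have h1 : 0 < 2 * m + a + b := by linarith
    have h2 : 0 < 2 * m + b + α := by linarith
    have h3 : 0 < 2 * m + a + β := by linarith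
    positivity
  · rw [H.gTwo_eq ha hb hβ hRα hRβ]
    nth_rw 1 [← hre]
    push_cast
    rfl

end CutData

end QuarticMatrix
-- The limit of large argument and the nonlinear equation.
namespace QuarticMatrix

open VerticalLine ComplexConjugate LineNear

lemma norm_exp_sub_exp_le {x y : ℂ} {K : ℝ} (hx : ‖x‖ ≤ K) (hy : ‖y‖ ≤ K) :
    ‖Complex.exp x - Complex.exp y‖ ≤ Real.exp (3 * K) * ‖x - y‖ := by
  have h1 : Complex.exp x - Complex.exp y = Complex.exp y * (Complex.exp (x - y) - 1) := by
    rw [mul_sub, ← Complex.exp_add, add_sub_cancel, mul_one]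
  have h2 : ‖Complex.exp y‖ ≤ Real.exp K := by
    rw [Complex.norm_exp]
    exact Real.exp_le_exp.2 ((Complex.re_le_norm y).trans hy)
  have h3 := CutData.norm_exp_sub_one_le_mul_exp (x - y)
  have h4 : Real.exp ‖x - y‖ ≤ Real.exp (2 * K) :=
    Real.exp_le_exp.2 ((norm_sub_le _ _).trans (by linarith))
  rw [h1, norm_mul]
  calc _ ≤ Real.exp K * (‖x - y‖ * Real.exp (2 * K)) := by
        gcongr
        exact h3.trans (by gcongr)
    _ = Real.exp K * Real.exp (2 * K) * ‖x - y‖ := by ring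
    _ = _ := by
      rw [← Real.exp_add]
      ring_nf

namespace CutData

variable {lam A B m θ δ ν L : ℝ} {ρ : ℝ → ℝ} {R : ℂ → ℂ}

lemma continuousOn_comp_ofReal {f : ℂ → ℂ} {c : ℝ}
    (hc : c < ν) (hf : DifferentiableOn ℂ f {z | c < z.re}) :
    ContinuousOn (fun s : ℝ => f s) (Icc ν L) :=
  hf.continuousOn.comp Complex.continuous_ofReal.continuousOn fun s hs => by
    rw [mem_ofPred, Complex.ofReal_re]
    exact hc.trans_le hs.1

lemma exists_norm_le_mul (H : CutData lam A B m θ δ ν L ρ R) :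
    ∃ K, 0 < K ∧ ∀ v : ℝ, ν ≤ v → ‖R v‖ ≤ K * (1 + |v|) := by
  obtain ⟨K, hK, h⟩ := H.exists_norm_sub_le
  have hA := H.A_pos
  refine ⟨K + A, by positivity, fun v hv => ?_⟩
  have h1 := norm_add_le (R v - A * v) (A * (v : ℂ))
  rw [sub_add_cancel, norm_mul, Complex.norm_real, Complex.norm_real, Real.norm_eq_abs,
    Real.norm_eq_abs, abs_of_pos hA] at h1
  nlinarith [h v (H.ofReal_mem hv), abs_nonneg v, mul_nonneg hK.le (abs_nonneg v)]

/-- Bounds for the two-point function which are uniform in the first argument. -/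
lemma exists_gTwo_lipschitz (H : CutData lam A B m θ δ ν L ρ R) (M : ℝ) :
    ∃ K, 0 < K ∧ ∀ v : ℝ, ν ≤ v → ∀ b ∈ Icc 0 M, ‖gTwo A m R b v‖ * (1 + |v|) ≤ K ∧
      ∀ b' ∈ Icc 0 M, ‖gTwo A m R b v - gTwo A m R b' v‖ * (1 + |v|) ≤ K * |b - b'| := by
  have hδ := H.δ_pos
  have hm := H.m_pos
  have hA := H.A_pos
  have hν := H.contr_neg
  have hθ := H.θ_lt
  obtain ⟨K0, hK0, h0⟩ := H.exists_cauchyLog_right_bound (b := 0) le_rfl hν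
  obtain ⟨K1, hK1, h1⟩ := H.exists_cauchyLog_lipschitz (c := -m) (κ := 1 - θ) (d := ν + m)
    (by linarith) (by linarith) (by linarith) (by linarith)
  obtain ⟨K2, hK2, h2⟩ := H.one_add_norm_le (b := 0) le_rfl
  have hrp : ∀ v : ℝ, (1 + ‖(v : ℂ)‖) ^ (-(1 / 4) : ℝ) ≤ 1 := fun v =>
    Real.rpow_le_one_of_one_le_of_nonpos (by linarith [norm_nonneg (v : ℂ)]) (by norm_num)
  have hlip : ∀ v : ℝ, ν ≤ v → ∀ b b' : ℝ, 0 ≤ b → 0 ≤ b' →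
      ‖cauchyLog A m R b (-m) (R v) - cauchyLog A m R b' (-m) (R v)‖ ≤ K1 * |b - b'| := by
    intro v hv b b' hb hb'
    refine (h1 b b' hb hb' (R v) v ?_ (H.sep_of_mem (by linarith) (H.ofReal_mem hv))).trans ?_
    · rw [Complex.ofReal_re, sub_neg_eq_add, abs_of_pos (by linarith)]
      linarith
    · exact mul_le_of_le_one_right (by positivity) (hrp v)
  set K := K0 + K1 * |M| with hK
  have hKp : 0 < K := by positivity
  -- The bound at b = 0 and the Lipschitz estimate in b cover all of [0, M] with a single constant.
  have hbd : ∀ v : ℝ, ν ≤ v → ∀ b ∈ Icc 0 M, ‖cauchyLog A m R b (-m) (R v)‖ ≤ K := by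
    intro v hv b hb
    have e1 := hlip v hv b 0 hb.1 le_rfl
    have e2 := h0 v (by rwa [Complex.ofReal_re])
    have e3 : K0 * (1 + ‖(v : ℂ)‖) ^ (-(1 / 4) : ℝ) ≤ K0 := mul_le_of_le_one_right hK0.le (hrp v)
    have e4 := norm_add_le (cauchyLog A m R b (-m) (R v) - cauchyLog A m R 0 (-m) (R v))
      (cauchyLog A m R 0 (-m) (R v))
    rw [sub_add_cancel] at e4
    rw [sub_zero, abs_of_nonneg hb.1] at e1
    have e5 : K1 * b ≤ K1 * |M| := by
      gcongr
      exact hb.2.trans (le_abs_self M)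
    linarith
  set E := Real.exp (3 * K) with hE
  refine ⟨E * (1 + K1) * K2 + E * K2 * m⁻¹, by positivity, fun v hv b hb => ?_⟩
  have hp : ∀ b : ℝ, 0 ≤ b → (1 + |v|) ≤ K2 * ‖(A : ℂ) * (b + 2 * m + v)‖ ∧
      A * m ≤ ‖(A : ℂ) * (b + 2 * m + v)‖ := by
    intro b hb
    have e1 := h2 v (by rw [Complex.ofReal_re]; linarith)
    have e2 : ∀ b : ℝ, 0 ≤ b → ‖(A : ℂ) * (b + 2 * m + v)‖ = A * (b + 2 * m + v) := by
      intro b hb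
      rw [show (A : ℂ) * (b + 2 * m + v) = ((A * (b + 2 * m + v) : ℝ) : ℂ) by push_cast; ring,
        Complex.norm_real, Real.norm_eq_abs, abs_of_nonneg]
      exact mul_nonneg hA.le (by linarith)
    rw [e2 0 le_rfl, Complex.norm_real, Real.norm_eq_abs] at e1
    rw [e2 b hb]
    constructor
    · refine e1.trans ?_
      gcongr
    · gcongr
      linarith
  have hEb : ∀ b ∈ Icc 0 M, ‖Complex.exp (cauchyLog A m R b (-m) (R v))‖ ≤ E := by
    intro b hb
    rw [Complex.norm_exp, hE]
    exact Real.exp_le_exp.2 ((Complex.re_le_norm _).trans ((hbd v hv b hb).trans (by linarith)))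
  have hq : ∀ b ∈ Icc 0 M, ‖gTwo A m R b v‖ * (1 + |v|) ≤ E * K2 := by
    intro b hb
    obtain ⟨p1, p2⟩ := hp b hb.1
    have p3 : 0 < ‖(A : ℂ) * (b + 2 * m + v)‖ := lt_of_lt_of_le (by positivity) p2
    rw [gTwo, norm_div, div_mul_eq_mul_div, div_le_iff₀ p3, mul_assoc]
    exact mul_le_mul (hEb b hb) p1 (by positivity) (by positivity)
  refine ⟨(hq b hb).trans ?_, fun b' hb' => ?_⟩
  · have : 0 ≤ E * K1 * K2 + E * K2 * m⁻¹ := by positivity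
    linarith
  · obtain ⟨p1, p2⟩ := hp b hb.1
    obtain ⟨p1', p2'⟩ := hp b' hb'.1
    have p3 : 0 < ‖(A : ℂ) * (b + 2 * m + v)‖ := lt_of_lt_of_le (by positivity) p2
    have p3' : 0 < ‖(A : ℂ) * (b' + 2 * m + v)‖ := lt_of_lt_of_le (by positivity) p2'
    have n1 := norm_pos_iff.1 p3
    have n2 := norm_pos_iff.1 p3'
    have hsplit : gTwo A m R b v - gTwo A m R b' v
        = (Complex.exp (cauchyLog A m R b (-m) (R v)) - Complex.exp (cauchyLog A m R b' (-m) (R v)))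
          / (A * (b + 2 * m + v)) + gTwo A m R b' v * (A * (b' - b)) / (A * (b + 2 * m + v)) := by
      rw [gTwo, gTwo]
      have := left_ne_zero_of_mul n1
      have := right_ne_zero_of_mul n1
      have := right_ne_zero_of_mul n2
      field_simp
      ring
    have e1 := (norm_exp_sub_exp_le (hbd v hv b hb) (hbd v hv b' hb')).trans
      (mul_le_mul_of_nonneg_left (hlip v hv b b' hb.1 hb'.1) (Real.exp_pos _).le)
    rw [← hE] at e1
    have e2 : ‖(Complex.exp (cauchyLog A m R b (-m) (R v))
        - Complex.exp (cauchyLog A m R b' (-m) (R v))) / (A * (b + 2 * m + v))‖ * (1 + |v|)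
        ≤ E * K1 * K2 * |b - b'| := by
      rw [norm_div, div_mul_eq_mul_div, div_le_iff₀ p3]
      calc _ ≤ (E * (K1 * |b - b'|)) * (K2 * ‖(A : ℂ) * (b + 2 * m + v)‖) := by gcongr
        _ = _ := by ring
    have e3 : ‖gTwo A m R b' v * (A * (b' - b)) / (A * (b + 2 * m + v))‖ * (1 + |v|)
        ≤ E * K2 * m⁻¹ * |b - b'| := by
      rw [norm_div, div_mul_eq_mul_div, div_le_iff₀ p3, norm_mul, norm_mul, ← Complex.ofReal_sub,
        Complex.norm_real, Complex.norm_real, Real.norm_eq_abs, Real.norm_eq_abs, abs_of_pos hA,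
        abs_sub_comm b' b]
      calc _ = ‖gTwo A m R b' v‖ * (1 + |v|) * (A * |b - b'|) := by ring
        _ ≤ E * K2 * (A * |b - b'|) := mul_le_mul_of_nonneg_right (hq b' hb') (by positivity)
        _ = E * K2 * m⁻¹ * |b - b'| * (A * m) := by field_simp
        _ ≤ _ := by gcongr
    rw [hsplit]
    have e4 := mul_le_mul_of_nonneg_right (norm_add_le ((Complex.exp (cauchyLog A m R b (-m) (R v))
        - Complex.exp (cauchyLog A m R b' (-m) (R v))) / (A * (b + 2 * m + v)))
        (gTwo A m R b' v * (A * (b' - b)) / (A * (b + 2 * m + v))))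
        (show 0 ≤ 1 + |v| by positivity)
    have e5 : 0 ≤ E * K2 * |b - b'| := by positivity
    linarith

/-- The difference of the Cauchy kernels of `R` and of the identity. -/
lemma exists_kernel (H : CutData lam A B m θ δ ν L ρ R) {w : ℝ} (hw : ν ≤ w) :
    ∃ k : ℝ → ℂ, ContinuousOn k (Icc ν L) ∧ ∀ s : ℝ, ν ≤ s → s ≠ w →
      k s = 1 / ((w : ℂ) - s) + deriv R s / (R s - R w) := by
  have hwW := H.ofReal_mem hw
  -- R'(z)(z − w)/(R z − R w) equals 1 at w, so its difference quotient there is the sum of the two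
  -- kernels with their opposite poles removed.
  have hd : DifferentiableOn ℂ (dslope (fun z => deriv R z / dslope R w z) w)
      {z | -m - δ < z.re} :=
    (Complex.differentiableOn_dslope ((isOpen_rightHalf _).mem_nhds hwW)).2 (H.diff_ratio hwW)
  refine ⟨fun s => dslope (fun z => deriv R z / dslope R w z) w s,
    continuousOn_comp_ofReal (by linarith [H.contr_neg, H.δ_pos]) hd, fun s hs hsw => ?_⟩
  have hsw' : (s : ℂ) ≠ w := by exact_mod_cast hsw
  have h1 : (s : ℂ) - w ≠ 0 := sub_ne_zero.2 hsw'
  have h2 : (w : ℂ) - s ≠ 0 := sub_ne_zero.2 hsw'.symm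
  simp only
  rw [dslope_of_ne _ hsw', slope_def_field, H.ratio_same hwW, sub_div,
    H.ratio_div (H.ofReal_mem hs) hwW hsw', ← neg_sub (s : ℂ) w, one_div, one_div, inv_neg]
  ring

/-- The two-point function is asymptotically `1 / R`. -/
lemma tendsto_mul_gTwo (H : CutData lam A B m θ δ ν L ρ R) {b : ℝ} (hb : 0 ≤ b) :
    Tendsto (fun v : ℝ => R v * gTwo A m R b v) atTop (𝓝 1) := by
  have hν := H.contr_neg
  obtain ⟨K1, hK1, h1⟩ := H.exists_norm_mul_gTwo_sub_one_le hb hν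
  obtain ⟨K2, hK2, h2⟩ := H.exists_norm_gTwo_le hb hν
  obtain ⟨K3, hK3, h3⟩ := H.exists_norm_sub_le
  have hn : Tendsto (fun v : ℝ => ‖(v : ℂ)‖) atTop atTop := by
    simp_rw [Complex.norm_real, Real.norm_eq_abs]
    exact tendsto_abs_atTop_atTop
  have t1 : Tendsto (fun v : ℝ => (b + 2 * m * A - B + A * v) * gTwo A m R b v - 1) atTop
      (𝓝 0) := by
    have hz : Tendsto (fun v : ℝ => K1 * (1 + ‖(v : ℂ)‖) ^ (-(1 / 4) : ℝ)) atTop (𝓝 0) := by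
      simpa using ((tendsto_rpow_neg_atTop (by norm_num : (0 : ℝ) < 1 / 4)).comp
        (tendsto_atTop_add_const_left atTop 1 hn)).const_mul K1
    refine squeeze_zero_norm' ?_ hz
    filter_upwards [eventually_ge_atTop ν] with v hv
    exact h1 v (by rwa [Complex.ofReal_re])
  have hz2 : Tendsto (fun v : ℝ => (1 + ‖(v : ℂ)‖)⁻¹) atTop (𝓝 0) :=
    tendsto_inv_atTop_zero.comp (tendsto_atTop_add_const_left atTop 1 hn)
  -- R v differs from the linear prefactor by a bounded amount, which the decay of the two-point
  -- function suppresses.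
  have t2 : Tendsto (fun v : ℝ => (R v - A * v - (b + 2 * m * A - B)) * gTwo A m R b v) atTop
      (𝓝 0) := by
    have hz : Tendsto (fun v : ℝ => (K3 + ‖(b : ℂ) + 2 * m * A - B‖) * (K2 * (1 + ‖(v : ℂ)‖)⁻¹))
        atTop (𝓝 0) := by
      simpa using (hz2.const_mul K2).const_mul (K3 + ‖(b : ℂ) + 2 * m * A - B‖)
    refine squeeze_zero_norm' ?_ hz
    filter_upwards [eventually_ge_atTop ν] with v hv
    rw [norm_mul]
    have e1 := h3 v (H.ofReal_mem hv)
    have e2 := h2 v (by rwa [Complex.ofReal_re])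
    gcongr
    exact (norm_sub_le _ _).trans (by gcongr)
  have := (t1.add t2).add_const 1
  rw [add_zero, zero_add] at this
  refine this.congr fun v => ?_
  ring

/-- The limiting form of the linear Schwinger-Dyson equation. -/
theorem integral_gTwo_mul_deriv (H : CutData lam A B m θ δ ν L ρ R) {w : ℝ} (hw : ν ≤ w) :
    IntegrableOn (fun s : ℝ => (ρ s : ℂ) * (gTwo A m R (R w).re s * deriv R s)) (Icc ν L) ∧
    IntegrableOn (fun s : ℝ => (ρ s : ℂ) * (1 / ((w : ℂ) - s) + deriv R s / (R s - R w)))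
      (Icc ν L) ∧
    B + A * w - R w
      = lam * (∫ s in Icc ν L, (ρ s : ℂ) * (gTwo A m R (R w).re s * deriv R s))
        + lam * ∫ s in Icc ν L, (ρ s : ℂ) * (1 / ((w : ℂ) - s) + deriv R s / (R s - R w)) := by
  have hν := H.contr_neg
  have hθ := H.θ_lt
  set x := (R w).re with hx
  have hx0 : 0 ≤ x := H.re_nonneg hw
  have hxR : (x : ℂ) = R w := H.ofReal_re_eq w
  obtain ⟨k, hkc, hk⟩ := H.exists_kernel hw
  have hρc : ContinuousOn (fun s => (ρ s : ℂ)) (Icc ν L) :=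
    Complex.continuous_ofReal.comp_continuousOn H.cont
  have hgc : ContinuousOn (fun s : ℝ => gTwo A m R x s * deriv R s) (Icc ν L) :=
    (continuousOn_comp_ofReal hν (H.diff_gTwo hx0)).mul
      (continuousOn_comp_ofReal (by linarith [H.δ_pos]) H.diff_deriv)
  have hRc : ContinuousOn (fun s : ℝ => R s) (Icc ν L) :=
    continuousOn_comp_ofReal (by linarith [H.δ_pos]) H.diff
  have hae : ∀ᵐ s ∂(volume.restrict (Icc ν L)), s ∈ Icc ν L ∧ s ≠ w := by
    filter_upwards [ae_restrict_mem measurableSet_Icc,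
      ae_restrict_of_ae (Measure.ae_ne volume w)] with s h1 h2 using ⟨h1, h2⟩
  have i1 : IntegrableOn (fun s : ℝ => (ρ s : ℂ) * (gTwo A m R x s * deriv R s)) (Icc ν L) :=
    (hρc.mul hgc).integrableOn_Icc
  have i2 : IntegrableOn (fun s : ℝ => (ρ s : ℂ)
      * (1 / ((w : ℂ) - s) + deriv R s / (R s - R w))) (Icc ν L) := by
    have : IntegrableOn (fun s => (ρ s : ℂ) * k s) (Icc ν L) := (hρc.mul hkc).integrableOn_Icc
    refine Integrable.congr this ?_
    filter_upwards [hae] with s hs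
    rw [hk s hs.1.1 hs.2]
  refine ⟨i1, i2, ?_⟩
  obtain ⟨Kρ, hKρ⟩ := isCompact_Icc.exists_bound_of_continuousOn hρc
  obtain ⟨Kg, hKg⟩ := isCompact_Icc.exists_bound_of_continuousOn hgc
  obtain ⟨Kk, hKk⟩ := isCompact_Icc.exists_bound_of_continuousOn hkc
  obtain ⟨KR, hKR⟩ := isCompact_Icc.exists_bound_of_continuousOn hRc
  obtain ⟨K1, hK1, hup⟩ := H.exists_norm_le_mul
  set M := max KR x with hM
  have hxM : x ∈ Icc 0 M := ⟨hx0, le_max_right _ _⟩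
  have hsM : ∀ s ∈ Icc ν L, (R s).re ∈ Icc 0 M := fun s hs =>
    ⟨H.re_nonneg hs.1, (Complex.re_le_norm _).trans ((hKR s hs).trans (le_max_left _ _))⟩
  obtain ⟨K2, hK2, hlip⟩ := H.exists_gTwo_lipschitz M
  -- Difference of the integrands of the linear equations at (R v, w) and (R w, v), multiplied by R
  -- v. By symmetry both left sides contain the same value, and the factor R v − A v + A w − R w
  -- left after subtraction has the limit B + A w − R w.
  set Φ : ℝ → ℝ → ℂ := fun v s =>
    R v * ((ρ s : ℂ) * (gTwo A m R (R v).re w / (w - s)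
      + gTwo A m R (R v).re s * deriv R s / (R s - R w)))
    - R v * ((ρ s : ℂ) * (gTwo A m R x v / (v - s)
      + gTwo A m R x s * deriv R s / (R s - R v))) with hΦ
  have hsym : ∀ v s : ℝ, ν ≤ v → ν ≤ s → gTwo A m R (R v).re s = gTwo A m R (R s).re v :=
    fun v s hv hs => H.gTwo_comm (H.re_nonneg hs) (H.re_nonneg hv) hs hv
      (H.ofReal_re_eq s).symm (H.ofReal_re_eq v).symm
  have hΦi : ∀ v, ν ≤ v → IntegrableOn (Φ v) (Icc ν L) := fun v hv =>
    ((H.gTwo_linear (H.re_nonneg hv) hw).1.const_mul _).sub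
      ((H.gTwo_linear hx0 hv).1.const_mul _)
  have hEq : ∀ v, ν ≤ v → (R v - A * v + A * w - R w) * (R v * gTwo A m R x v)
      = lam * ∫ s in Icc ν L, Φ v s := by
    intro v hv
    obtain ⟨j1, e1⟩ := H.gTwo_linear (H.re_nonneg hv) hw
    obtain ⟨j2, e2⟩ := H.gTwo_linear hx0 hv
    rw [hΦ, integral_sub (j1.const_mul _) (j2.const_mul _), integral_const_mul,
      integral_const_mul]
    have hg := hsym v w hv hw
    rw [← hx] at hg
    linear_combination R v * e1 - R v * e2 - R v * gTwo A m R x v * H.ofReal_re_eq v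
      + R v * gTwo A m R x v * hxR
      - R v * ((R v).re + 2 * m * A - B + A * w) * hg
  -- Symmetry moves v into the deformed argument, so that v enters the two-point function only
  -- through products R v · `gTwo`(v), which tend to 1.
  have hΦ' : ∀ v s : ℝ, ν ≤ v → ν ≤ s → Φ v s
      = (ρ s : ℂ) * ((R v * gTwo A m R x v) * (1 / ((w : ℂ) - s))
        + (R v * gTwo A m R (R s).re v) * (deriv R s / (R s - R w)))
        - ((ρ s : ℂ) * ((R v * gTwo A m R x v) * (1 / ((v : ℂ) - s))
        + (gTwo A m R x s * deriv R s) * (R v / (R s - R v)))) := by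
    intro v s hv hs
    rw [hΦ]
    simp only
    rw [hsym v w hv hw, hsym v s hv hs, ← hx]
    ring
  have hcv : Tendsto (fun v : ℝ => (v : ℂ)) atTop (Bornology.cobounded ℂ) := by
    rw [← tendsto_norm_atTop_iff_cobounded]
    simp_rw [Complex.norm_real, Real.norm_eq_abs]
    exact tendsto_abs_atTop_atTop
  have hdiv : ∀ s : ℝ, ν ≤ s → Tendsto (fun v : ℝ => R v / (R s - R v)) atTop (𝓝 (-1)) := by
    intro s hs
    have hb : Tendsto (fun v : ℝ => R s / (R s - R v)) atTop (𝓝 0) := by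
      have h1 : Tendsto (fun v : ℝ => ‖R s‖ * ((1 - θ) * (v - s))⁻¹) atTop (𝓝 0) := by
        have : Tendsto (fun v : ℝ => (1 - θ) * (v - s)) atTop atTop :=
          (tendsto_atTop_add_const_right _ _ tendsto_id).const_mul_atTop (by linarith)
        simpa using (tendsto_inv_atTop_zero.comp this).const_mul ‖R s‖
      refine squeeze_zero_norm' ?_ h1
      filter_upwards [eventually_gt_atTop s] with v hv
      have h2 := H.norm_sub_ge (H.ofReal_mem hs) (H.ofReal_mem (hs.trans hv.le))
      rw [← Complex.ofReal_sub, Complex.norm_real, Real.norm_eq_abs, abs_sub_comm,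
        abs_of_pos (sub_pos.2 hv)] at h2
      have h3 : 0 < (1 - θ) * (v - s) := mul_pos (by linarith) (by linarith)
      rw [norm_div, div_eq_mul_inv]
      gcongr
    have := hb.sub_const 1
    rw [zero_sub] at this
    refine this.congr' ?_
    filter_upwards [eventually_gt_atTop s] with v hv
    have hne : R s - R v ≠ 0 := fun h => by
      have := H.injOn (H.ofReal_mem hs) (H.ofReal_mem (hs.trans hv.le)) (sub_eq_zero.1 h)
      exact hv.ne (by exact_mod_cast this)
    rw [div_sub_one hne]
    congr 1
    ring
  have hdct : Tendsto (fun v => ∫ s in Icc ν L, Φ v s) atTop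
      (𝓝 (∫ s in Icc ν L, ((ρ s : ℂ) * (gTwo A m R x s * deriv R s)
        + (ρ s : ℂ) * (1 / ((w : ℂ) - s) + deriv R s / (R s - R w))))) := by
    set C := |Kρ| * (K1 * K2 * |Kk| + 2 * (K1 * K2) + (K1 * K2 + |Kg| * (1 + |KR| * (1 - θ)⁻¹)))
      with hC
    refine tendsto_integral_filter_of_dominated_convergence (fun _ => C) ?_ ?_
      (integrable_const C) ?_
    · filter_upwards [eventually_ge_atTop ν] with v hv using (hΦi v hv).aestronglyMeasurable
    -- Taking v ≥ L + 1 keeps v at distance at least 1 from the domain of integration, so the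
    -- kernels containing v are bounded.
    · filter_upwards [eventually_ge_atTop (max ν (L + 1))] with v hv
      have hvν : ν ≤ v := (le_max_left _ _).trans hv
      have hvL : L + 1 ≤ v := (le_max_right _ _).trans hv
      filter_upwards [hae] with s hs
      obtain ⟨hs, hsw⟩ := hs
      have hFb : ∀ b ∈ Icc 0 M, ‖R v * gTwo A m R b v‖ ≤ K1 * K2 := by
        intro b hb
        rw [norm_mul]
        calc _ ≤ K1 * (1 + |v|) * ‖gTwo A m R b v‖ := by gcongr; exact hup v hvν
          _ = K1 * (‖gTwo A m R b v‖ * (1 + |v|)) := by ring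
          _ ≤ _ := by gcongr; exact (hlip v hvν b hb).1
      have hFl : ‖R v * gTwo A m R (R s).re v - R v * gTwo A m R x v‖
          ≤ K1 * K2 * ‖R s - R w‖ := by
        have e1 := (hlip v hvν _ (hsM s hs)).2 x hxM
        have e2 : |(R s).re - x| ≤ ‖R s - R w‖ := by
          rw [hx, ← Complex.sub_re]
          exact Complex.abs_re_le_norm _
        rw [← mul_sub, norm_mul]
        calc _ ≤ K1 * (1 + |v|) * ‖gTwo A m R (R s).re v - gTwo A m R x v‖ := by
              gcongr; exact hup v hvν
          _ = K1 * (‖gTwo A m R (R s).re v - gTwo A m R x v‖ * (1 + |v|)) := by ring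
          _ ≤ K1 * (K2 * ‖R s - R w‖) := by
            refine mul_le_mul_of_nonneg_left (e1.trans ?_) hK1.le
            gcongr
          _ = _ := by ring
      have hne : R s - R w ≠ 0 := fun h => by
        have := H.injOn (H.ofReal_mem hs.1) (H.ofReal_mem hw) (sub_eq_zero.1 h)
        exact hsw (by exact_mod_cast this)
      have hvs : (1 : ℝ) ≤ v - s := by linarith [hs.2]
      have h2 := H.norm_sub_ge (H.ofReal_mem hs.1) (H.ofReal_mem hvν)
      rw [← Complex.ofReal_sub, Complex.norm_real, Real.norm_eq_abs, abs_sub_comm,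
        abs_of_pos (by linarith)] at h2
      have h3 : 1 - θ ≤ ‖R s - R v‖ := by nlinarith
      have h1θ : 0 < 1 - θ := by linarith
      -- The two terms are separately singular at s = w. Rewriting them with k leaves a regular
      -- kernel and a difference in the parameter, whose Lipschitz bound cancels the pole.
      have b1 : ‖(R v * gTwo A m R x v) * (1 / ((w : ℂ) - s))
          + (R v * gTwo A m R (R s).re v) * (deriv R s / (R s - R w))‖
          ≤ K1 * K2 * |Kk| + 2 * (K1 * K2) := by
        have : (R v * gTwo A m R x v) * (1 / ((w : ℂ) - s))
          + (R v * gTwo A m R (R s).re v) * (deriv R s / (R s - R w))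
          = (R v * gTwo A m R x v) * k s
            + (R v * gTwo A m R (R s).re v - R v * gTwo A m R x v) * (deriv R s / (R s - R w)) := by
          rw [hk s hs.1 hsw]; ring
        rw [this]
        refine (norm_add_le _ _).trans (add_le_add ?_ ?_)
        · rw [norm_mul]
          exact mul_le_mul (hFb x hxM) ((hKk s hs).trans (le_abs_self _)) (norm_nonneg _)
            (by positivity)
        · rw [norm_mul, norm_div, mul_div_assoc', div_le_iff₀ (norm_pos_iff.2 hne)]
          calc _ ≤ (K1 * K2 * ‖R s - R w‖) * 2 := by
                gcongr
                exact H.norm_deriv_le (H.ofReal_mem hs.1)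
            _ = _ := by ring
      have b2 : ‖(R v * gTwo A m R x v) * (1 / ((v : ℂ) - s))‖ ≤ K1 * K2 := by
        rw [norm_mul, norm_div, norm_one, ← Complex.ofReal_sub, Complex.norm_real, Real.norm_eq_abs,
          abs_of_pos (a := v - s) (by linarith)]
        refine (mul_le_of_le_one_right (norm_nonneg _) ?_).trans (hFb x hxM)
        rw [div_le_one (by linarith)]
        exact hvs
      have b3 : ‖(gTwo A m R x s * deriv R s) * (R v / (R s - R v))‖
          ≤ |Kg| * (1 + |KR| * (1 - θ)⁻¹) := by
        rw [norm_mul]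
        refine mul_le_mul ((hKg s hs).trans (le_abs_self _)) ?_ (norm_nonneg _) (abs_nonneg _)
        have hp : 0 < ‖R s - R v‖ := h1θ.trans_le h3
        rw [norm_div, div_le_iff₀ hp, add_mul, one_mul]
        have e1 := norm_sub_le (R s) (R s - R v)
        rw [sub_sub_cancel] at e1
        have e2 : ‖R s‖ ≤ |KR| * (1 - θ)⁻¹ * ‖R s - R v‖ := by
          refine ((hKR s hs).trans (le_abs_self _)).trans ?_
          rw [mul_assoc]
          refine le_mul_of_one_le_right (abs_nonneg _) ?_
          rw [← div_eq_inv_mul, le_div_iff₀ h1θ]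
          linarith
        linarith
      have hρs := (hKρ s hs).trans (le_abs_self _)
      rw [hΦ' v s hvν hs.1, ← mul_sub, norm_mul, hC]
      refine mul_le_mul hρs ?_ (norm_nonneg _) (abs_nonneg _)
      refine (norm_sub_le _ _).trans (add_le_add b1 ((norm_add_le _ _).trans (add_le_add b2 b3)))
    · filter_upwards [hae] with s hs
      obtain ⟨hs, hsw⟩ := hs
      have t1 := H.tendsto_mul_gTwo hx0
      have t2 := H.tendsto_mul_gTwo (H.re_nonneg hs.1)
      have t3 : Tendsto (fun v : ℝ => 1 / ((v : ℂ) - s)) atTop (𝓝 0) := by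
        have : Tendsto (fun v : ℝ => 1 / (v - s)) atTop (𝓝 0) := by
          simp_rw [one_div]
          exact tendsto_inv_atTop_zero.comp (tendsto_atTop_add_const_right atTop (-s) tendsto_id)
        have h4 := (Complex.continuous_ofReal.tendsto 0).comp this
        rw [Complex.ofReal_zero] at h4
        refine h4.congr fun v => ?_
        simp
      have t4 := ((((t1.mul_const (1 / ((w : ℂ) - s))).add
        (t2.mul_const (deriv R s / (R s - R w)))).const_mul (ρ s : ℂ)).sub
        (((t1.mul t3).add ((hdiv s hs.1).const_mul (gTwo A m R x s * deriv R s))).const_mul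
          (ρ s : ℂ)))
      have : (ρ s : ℂ) * (gTwo A m R x s * deriv R s)
          + (ρ s : ℂ) * (1 / ((w : ℂ) - s) + deriv R s / (R s - R w))
          = (ρ s : ℂ) * (1 * (1 / ((w : ℂ) - s)) + 1 * (deriv R s / (R s - R w)))
            - (ρ s : ℂ) * (1 * 0 + gTwo A m R x s * deriv R s * -1) := by ring
      rw [this]
      refine t4.congr' ?_
      filter_upwards [eventually_ge_atTop ν] with v hv
      rw [hΦ' v s hv hs.1]
  rw [integral_add i1 i2] at hdct
  have hlhs : Tendsto (fun v : ℝ => (R v - A * v + A * w - R w) * (R v * gTwo A m R x v)) atTop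
      (𝓝 ((B + A * w - R w) * 1)) := by
    refine Tendsto.mul ?_ (H.tendsto_mul_gTwo hx0)
    obtain ⟨K, hK⟩ := H.asymp
    have h0 : Tendsto (fun v : ℝ => R v - A * v - B) atTop (𝓝 0) := by
      have hn : Tendsto (fun v : ℝ => ‖(v : ℂ)‖) atTop atTop := by
        simp_rw [Complex.norm_real, Real.norm_eq_abs]
        exact tendsto_abs_atTop_atTop
      have hz : Tendsto (fun v : ℝ => K * (1 + ‖(v : ℂ)‖)⁻¹) atTop (𝓝 0) := by
        simpa using (tendsto_inv_atTop_zero.comp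
          (tendsto_atTop_add_const_left atTop 1 hn)).const_mul K
      refine squeeze_zero_norm' ?_ hz
      filter_upwards [eventually_ge_atTop ν] with v hv using hK v (H.ofReal_mem hv)
    have := h0.add_const (B + A * w - R w : ℂ)
    rw [zero_add] at this
    exact this.congr fun v => by ring
  have := tendsto_nhds_unique (hlhs.congr' (by
    filter_upwards [eventually_ge_atTop ν] with v hv using hEq v hv)) (hdct.const_mul (lam : ℂ))
  rw [mul_one, mul_add] at this
  exact this

/-- The planar Schwinger-Dyson equation in the deformed variable. -/
theorem gTwo_schwinger_dyson (H : CutData lam A B m θ δ ν L ρ R) {w y : ℝ} (hw : ν ≤ w)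
    (hy : 0 ≤ y) :
    IntegrableOn (fun s : ℝ => (ρ s : ℂ) * deriv R s * (gTwo A m R y w * gTwo A m R (R w).re s
      - (gTwo A m R y s - gTwo A m R y w) / (R s - R w))) (Icc ν L) ∧
    (2 * m * A - 2 * B + R w + y) * gTwo A m R y w
      = 1 - lam * ∫ s in Icc ν L, (ρ s : ℂ) * deriv R s * (gTwo A m R y w * gTwo A m R (R w).re s
      - (gTwo A m R y s - gTwo A m R y w) / (R s - R w)) := by
  obtain ⟨i1, i2, e1⟩ := H.integral_gTwo_mul_deriv hw
  obtain ⟨i3, e3⟩ := H.gTwo_linear hy hw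
  -- The first two terms are evaluated by the limiting equation and the last by the linear one; each
  -- contributes −B to the mass, and the terms in A w cancel.
  have hsplit : ∀ s : ℝ, (ρ s : ℂ) * deriv R s * (gTwo A m R y w * gTwo A m R (R w).re s
      - (gTwo A m R y s - gTwo A m R y w) / (R s - R w))
      = gTwo A m R y w * ((ρ s : ℂ) * (gTwo A m R (R w).re s * deriv R s))
        + gTwo A m R y w * ((ρ s : ℂ) * (1 / ((w : ℂ) - s) + deriv R s / (R s - R w)))
        - (ρ s : ℂ) * (gTwo A m R y w / (w - s) + gTwo A m R y s * deriv R s / (R s - R w)) :=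
    fun s => by ring
  simp_rw [hsplit]
  have i12 : IntegrableOn (fun s : ℝ => gTwo A m R y w
      * ((ρ s : ℂ) * (gTwo A m R (R w).re s * deriv R s))
      + gTwo A m R y w * ((ρ s : ℂ) * (1 / ((w : ℂ) - s) + deriv R s / (R s - R w)))) (Icc ν L) :=
    (i1.const_mul _).add (i2.const_mul _)
  refine ⟨i12.sub i3, ?_⟩
  rw [integral_sub i12 i3, integral_add (i1.const_mul _) (i2.const_mul _), integral_const_mul,
    integral_const_mul]
  linear_combination e3 - gTwo A m R y w * e1
end CutData

end QuarticMatrix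
-- Return to the undeformed variable; rescaling.
namespace QuarticMatrix

open VerticalLine ComplexConjugate LineNear

namespace CutData

variable {lam A B m θ δ ν L : ℝ} {ρ : ℝ → ℝ} {R : ℂ → ℂ}

lemma image_re_Icc (H : CutData lam A B m θ δ ν L ρ R) (hνL : ν ≤ L) :
    (fun s : ℝ => (R s).re) '' Icc ν L = Icc 0 (R L).re := by
  have h0 : (R (ν : ℂ)).re = 0 := by rw [H.zero]; rfl
  rw [← h0]
  apply Subset.antisymm
  · rintro _ ⟨s, hs, rfl⟩
    exact ⟨H.re_strictMonoOn.monotoneOn self_mem_Ici hs.1 hs.1,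
      H.re_strictMonoOn.monotoneOn hs.1 hνL hs.2⟩
  · exact intermediate_value_Icc hνL fun s hs =>
      (H.hasDerivAt_re hs.1).continuousAt.continuousWithinAt

/-- The two-point function of the model in terms of `gTwo`. -/
theorem exists_isPlanarTwoPoint (H : CutData lam A B m θ δ ν L ρ R) {ρ0 : ℝ → ℝ} {Λ : ℝ}
    (hνL : ν ≤ L) (hL : R L = (Λ : ℂ) ^ 2) (hρ : ∀ s ∈ Icc ν L, ρ s = ρ0 (R s).re) :
    ∃ G : ℝ → ℝ → ℝ, IsPlanarTwoPoint ρ0 lam Λ (2 * m * A - 2 * B) 1 G ∧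
      ∀ a b α : ℝ, 0 ≤ a → 0 ≤ b → ν ≤ α → R α = a → 0 < G a b ∧ (G a b : ℂ) = gTwo A m R b α := by
  have hpre : ∀ a : ℝ, ∃ α : ℝ, 0 ≤ a → ν ≤ α ∧ R α = a := fun a => by
    by_cases ha : 0 ≤ a
    · obtain ⟨α, h⟩ := H.exists_preimage ha
      exact ⟨α, fun _ => h⟩
    · exact ⟨0, fun h => absurd h ha⟩
  choose p hp using hpre
  have hpu : ∀ a α : ℝ, 0 ≤ a → ν ≤ α → R α = a → α = p a := fun a α ha hα hR => by
    have := H.injOn (H.ofReal_mem hα) (H.ofReal_mem (hp a ha).1) (hR.trans (hp a ha).2.symm)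
    exact_mod_cast this
  set G : ℝ → ℝ → ℝ := fun a b => (gTwo A m R b (p a)).re with hG
  have hGc : ∀ a b : ℝ, 0 ≤ a → 0 ≤ b → 0 < G a b ∧ (G a b : ℂ) = gTwo A m R b (p a) := by
    intro a b ha hb
    obtain ⟨g, hg, hg'⟩ := H.exists_gTwo_eq_ofReal ha hb (hp a ha).1 (hp a ha).2
    rw [hG]
    simp only
    rw [hg', Complex.ofReal_re]
    exact ⟨hg, rfl⟩
  have hsymm : ∀ a b : ℝ, 0 ≤ a → 0 ≤ b → G a b = G b a := by
    intro a b ha hb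
    have := H.gTwo_comm ha hb (hp a ha).1 (hp b hb).1 (hp a ha).2 (hp b hb).2
    rw [hG]
    simp only
    rw [this]
  refine ⟨G, ?_, fun a b α ha hb hα hR => by rw [hpu a α ha hα hR]; exact hGc a b ha hb⟩
  have hLre : (R L).re = Λ ^ 2 := by rw [hL, ← Complex.ofReal_pow, Complex.ofReal_re]
  set r : ℝ → ℝ := fun s => (R s).re with hr
  have himg : r '' Icc ν L = Icc 0 (Λ ^ 2) := by rw [hr, H.image_re_Icc hνL, hLre]
  have hderiv : ∀ s ∈ Icc ν L, HasDerivWithinAt r ((deriv R s).re) (Icc ν L) s := fun s hs =>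
    (H.hasDerivAt_re hs.1).hasDerivWithinAt
  have hinj : InjOn r (Icc ν L) := H.re_strictMonoOn.injOn.mono fun s hs => hs.1
  have key : ∀ x ∈ Icc 0 (Λ ^ 2), ∀ y ∈ Icc 0 (Λ ^ 2),
      IntegrableOn (sdIntegrand ρ0 1 G x y) (Icc 0 (Λ ^ 2)) ∧
      (2 * m * A - 2 * B + x + y) * (1 * G x y)
        = 1 - lam * ∫ t in Icc 0 (Λ ^ 2), sdIntegrand ρ0 1 G x y t := by
    intro x hx y hy
    obtain ⟨i1, e1⟩ := H.gTwo_schwinger_dyson (hp x hx.1).1 hy.1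
    -- Prepares the substitution t = R(s): R is increasing on [ν, L] with image [0, Λ²], and R'
    -- together with ρ(s) = ρ0(R s) turns the integral into one over ρ0(t) dt.
    have hcongr : ∀ s ∈ Icc ν L, (ρ s : ℂ) * deriv R s * (gTwo A m R y (p x)
        * gTwo A m R (R (p x)).re s
        - (gTwo A m R y s - gTwo A m R y (p x)) / (R s - R (p x)))
        = ((|(deriv R s).re| • sdIntegrand ρ0 1 G x y (r s) : ℝ) : ℂ) := by
      intro s hs
      have hrs : 0 ≤ r s := H.re_nonneg hs.1
      have hps : p (r s) = s := (hpu _ s hrs hs.1 (H.ofReal_re_eq s).symm).symm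
      have g1 := (hGc x y hx.1 hy.1).2
      have g2 := (hGc (r s) y hrs hy.1).2
      have g3 : (G x (r s) : ℂ) = gTwo A m R x s := by
        rw [hsymm x _ hx.1 hrs, (hGc (r s) x hrs hx.1).2, hps]
      rw [hps] at g2
      rw [(hp x hx.1).2, Complex.ofReal_re, ← g1, ← g2, ← g3, ← H.ofReal_re_eq s,
        abs_of_pos (H.deriv_re_pos hs.1), smul_eq_mul, sdIntegrand, hρ s hs]
      nth_rw 1 [← H.ofReal_deriv_re_eq hs.1]
      push_cast
      ring
    have i2 : IntegrableOn (fun s : ℝ => ((|(deriv R s).re| • sdIntegrand ρ0 1 G x y (r s) : ℝ) : ℂ))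
        (Icc ν L) := i1.congr_fun hcongr measurableSet_Icc
    have i3 : IntegrableOn (fun s : ℝ => |(deriv R s).re| • sdIntegrand ρ0 1 G x y (r s))
        (Icc ν L) := by
      have := i2.re
      simpa [IntegrableOn] using this
    rw [setIntegral_congr_fun measurableSet_Icc hcongr, integral_complex_ofReal,
      ← integral_image_eq_integral_abs_deriv_smul measurableSet_Icc hderiv hinj, himg,
      (hp x hx.1).2, ← (hGc x y hx.1 hy.1).2] at e1
    refine ⟨?_, ?_⟩
    · rw [← himg]
      exact (integrableOn_image_iff_integrableOn_abs_deriv_smul measurableSet_Icc hderiv hinj _).2 i3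
    · rw [one_mul]
      exact_mod_cast e1
  refine ⟨fun x hx y hy => hsymm x y hx.1 hy.1, fun y hy => ?_, fun x hx y hy => (key x hx y hy).1,
    fun x hx y hy => (key x hx y hy).2⟩
  -- The Lipschitz bound is in the parameter b; symmetry carries it over to the other variable. The
  -- Hölder exponent is 1.
  obtain ⟨K, hK, hlip⟩ := H.exists_gTwo_lipschitz (Λ ^ 2)
  refine ⟨⟨K, hK.le⟩, 1, one_pos, le_rfl, ?_⟩
  refine LipschitzOnWith.holderOnWith (LipschitzOnWith.of_dist_le_mul fun x hx x' hx' => ?_)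
  rw [Real.dist_eq, Real.dist_eq, hsymm x y hx.1 hy.1, hsymm x' y hx'.1 hy.1]
  have h1 := (hlip _ (hp y hy.1).1 x hx).2 x' hx'
  have h2 : |G y x - G y x'| ≤ ‖gTwo A m R x (p y) - gTwo A m R x' (p y)‖ := by
    rw [hG]
    simp only
    rw [← Complex.sub_re]
    exact Complex.abs_re_le_norm _
  refine (h2.trans ?_).trans h1
  exact le_mul_of_one_le_right (norm_nonneg _) (by linarith [abs_nonneg (p y)])

end CutData

/-- The equation contains G only through the product with the field renormalisation, which is
unchanged. -/
lemma IsPlanarTwoPoint.const_mul {ρ0 : ℝ → ℝ} {lam Λ M Z : ℝ} {G : ℝ → ℝ → ℝ}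
    (h : IsPlanarTwoPoint ρ0 lam Λ M Z G) {c : ℝ} (hc : 0 < c) :
    IsPlanarTwoPoint ρ0 lam Λ M (Z / c) (fun a b => c * G a b) := by
  have hZ : ∀ a b, Z / c * (c * G a b) = Z * G a b := fun a b => by field_simp
  have hsd : ∀ x y, sdIntegrand ρ0 (Z / c) (fun a b => c * G a b) x y = sdIntegrand ρ0 Z G x y := by
    intro x y
    ext t
    simp only [sdIntegrand, hZ]
  refine ⟨fun x hx y hy => by rw [h.symm x hx y hy], fun y hy => ?_, fun x hx y hy => ?_,
    fun x hx y hy => ?_⟩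
  · obtain ⟨C, α, h0, h1, hH⟩ := h.holder y hy
    refine ⟨Real.toNNReal c * C, α, h0, h1, fun x hx x' hx' => ?_⟩
    have := hH x hx x' hx'
    have e : edist (c * G x y) (c * G x' y) = ENNReal.ofReal c * edist (G x y) (G x' y) := by
      rw [edist_dist, edist_dist, Real.dist_eq, Real.dist_eq, ← mul_sub, abs_mul, abs_of_pos hc,
        ENNReal.ofReal_mul hc.le]
    rw [e, ENNReal.coe_mul, mul_assoc]
    exact mul_le_mul_right this _
  · rw [hsd]
    exact h.integrable x hx y hy
  · rw [hsd, hZ]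
    exact h.schwinger_dyson x hx y hy

end QuarticMatrix
-- Uniform bounds on the line, and verification that R_D fits the abstract data.
namespace QuarticMatrix

open VerticalLine ComplexConjugate LineNear

namespace ContrData

variable {m θ δ ν : ℝ} {R : ℂ → ℂ}

lemma existsUnique_preimage (H : ContrData m θ δ ν R) {a : ℝ} (ha : 0 ≤ a) :
    ∃! z : ℂ, -m < z.re ∧ R z = a := by
  obtain ⟨α, hα, h⟩ := H.exists_preimage ha
  have hν := H.contr_neg
  have hδ := H.δ_pos
  refine ⟨α, ⟨by rw [Complex.ofReal_re]; linarith, h⟩, fun z hz => ?_⟩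
  exact H.injOn (by linarith [hz.1]) (H.ofReal_mem hα) (hz.2.trans h.symm)

/-- The restriction of `R` to the line `Re z = -m`, with constants that do not depend on `R`. -/
lemma lineBase (H : ContrData m θ δ ν R) {c N : ℝ} (hc : 0 < c) (hcν : c ≤ ν + m)
    (hN : |ν| ≤ N) :
    LineBase ((1 - θ) * (min c 1 / 2)) (2 * (N + m + 1)) (fun t => R (vline (-m) t))
      (fun t => deriv R (vline (-m) t) * Complex.I) := by
  have hδ := H.δ_pos
  have hm := H.m_pos
  have hθ := H.θ_lt
  have hin : ∀ t, -m - δ < (vline (-m) t).re := fun t => by rw [vline_re]; linarith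
  have hN0 : 0 ≤ N := (abs_nonneg ν).trans hN
  exact {
    κ_pos := mul_pos (by linarith) (by positivity)
    hasDeriv := fun t => (H.differentiableAt (hin t)).hasDerivAt.comp t (hasDerivAt_vline _ t)
    conj_eq := fun t => by
      rw [← H.conj_eq]
      simp [vline]
    im_pos := fun t ht => by
      simpa using H.im_mul_pos (hin t) (by rwa [vline_im])
    zero_re := by
      have := H.sub_ofReal_pos (x := -m) (by linarith) H.contr_neg
      simpa [vline] using this
    low := fun a ha t => by
      refine le_trans ?_ (H.norm_sub_ge_of_re_le (hin t) (by rw [vline_re]; linarith) ha)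
      rw [mul_assoc]
      refine mul_le_mul_of_nonneg_left ?_ (by linarith)
      have h1 := Complex.abs_re_le_norm ((ν : ℂ) - vline (-m) t + a)
      have h2 := Complex.abs_im_le_norm ((ν : ℂ) - vline (-m) t + a)
      simp only [Complex.sub_re, Complex.sub_im, Complex.add_re, Complex.add_im,
        Complex.ofReal_re, Complex.ofReal_im, vline_re,
        vline_im, zero_sub, add_zero, abs_neg, sub_neg_eq_add] at h1 h2
      have h3 := (le_abs_self _).trans h1
      have h4 : min c 1 * |t| ≤ 1 * |t| := by gcongr; exact min_le_right _ _
      have h5 := min_le_left c 1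
      linarith
    up := fun t => by
      have h1 := H.contr (vline (-m) t) ν (hin t) (H.ofReal_mem le_rfl)
      rw [H.zero, sub_zero] at h1
      have h2 := norm_add_le (R (vline (-m) t) - (vline (-m) t - ν)) (vline (-m) t - ν)
      rw [sub_add_cancel] at h2
      have h3 : ‖vline (-m) t - ν‖ ≤ (N + m + 1) * (1 + |t|) := by
        refine (Complex.norm_le_abs_re_add_abs_im _).trans ?_
        rw [Complex.sub_re, Complex.sub_im, vline_re, vline_im, Complex.ofReal_re,
          Complex.ofReal_im, sub_zero]
        have h4 : |-m - ν| ≤ m + N := (abs_sub _ _).trans (by rw [abs_neg, abs_of_pos hm]; gcongr)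
        nlinarith [abs_nonneg t, mul_nonneg (add_nonneg hN0 hm.le) (abs_nonneg t)]
      have h5 : θ * ‖vline (-m) t - ν‖ ≤ 1 * ‖vline (-m) t - ν‖ := by gcongr
      linarith
    up' := fun t => by
      rw [norm_mul, Complex.norm_I, mul_one]
      linarith [H.norm_deriv_le (hin t)] }

end ContrData

/-! ### The concrete function `R_D` -/

/-- The kernel of `R_D`. -/
def kern (k : ℕ) (T z : ℂ) : ℂ := (-z) ^ k / (T ^ k * (T + z))

lemma R_eq (D : ℕ) (μ lam : ℝ) (ρ : ℝ → ℝ) (S : Set ℝ) (z : ℂ) :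
    R D μ lam ρ S z = z - lam * ∫ t in S, (ρ t : ℂ) * kern (D / 2) (t + (μ : ℂ) ^ 2) z := by
  rw [R, h, sub_add_eq_add_sub, neg_add_cancel, zero_sub, ← integral_const_mul]
  congr 3
  ext t
  rw [kern, show (t : ℂ) - (-(μ : ℂ) ^ 2 - z) = t + (μ : ℂ) ^ 2 + z by ring]
  ring

lemma conj_R (D : ℕ) (μ lam : ℝ) (ρ : ℝ → ℝ) (S : Set ℝ) (z : ℂ) :
    R D μ lam ρ S (conj z) = conj (R D μ lam ρ S z) := by
  rw [R_eq, R_eq, map_sub, map_mul, ← integral_conj, Complex.conj_ofReal]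
  congr 3
  ext t
  simp [kern]

/-- The kernel is 1/(T + z) minus its Taylor polynomial at z = 0 of degree D/2 − 1. The subtracted
constant and linear terms become `shiftR` and the correction in `slopeR`. -/
lemma kern_eq {D : ℕ} (hD : D = 0 ∨ D = 2 ∨ D = 4) {T z : ℂ} (hT : T ≠ 0) (hTz : T + z ≠ 0) :
    kern (D / 2) T z = 1 / (T + z) - (if D = 0 then 0 else 1 / T)
      + (if D = 4 then z / T ^ 2 else 0) := by
  rcases hD with rfl | rfl | rfl <;> simp [kern] <;> field_simp <;> ring

lemma hasDerivAt_stieltjes {ρ : ℝ → ℝ} {ν L m c : ℝ} (hρ : ContinuousOn ρ (Icc ν L))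
    (hc : 0 < c) {z : ℂ} (hz : c ≤ ν + 2 * m + z.re) :
    HasDerivAt (fun z : ℂ => ∫ t in Icc ν L, (ρ t : ℂ) / (t + 2 * m + z))
      (∫ t in Icc ν L, -(ρ t : ℂ) / (t + 2 * m + z) ^ 2) z := by
  have hρc : ContinuousOn (fun t => (ρ t : ℂ)) (Icc ν L) :=
    Complex.continuous_ofReal.comp_continuousOn hρ
  have hlow : ∀ t ∈ Icc ν L, ∀ w ∈ Metric.ball z (c / 2), c / 2 ≤ ‖(t : ℂ) + 2 * m + w‖ := by
    intro t ht w hw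
    have h1 := (Complex.abs_re_le_norm (w - z)).trans (mem_ball_iff_norm.1 hw).le
    have h2 := (le_abs_self _).trans (Complex.abs_re_le_norm ((t : ℂ) + 2 * m + w))
    simp at h1 h2
    linarith [(abs_le.1 h1).1, ht.1]
  have hne : ∀ t ∈ Icc ν L, ∀ w ∈ Metric.ball z (c / 2), (t : ℂ) + 2 * m + w ≠ 0 := fun t ht w hw =>
    norm_pos_iff.1 (lt_of_lt_of_le (by positivity) (hlow t ht w hw))
  have hz' : z ∈ Metric.ball z (c / 2) := Metric.mem_ball_self (by positivity)
  obtain ⟨K, hK⟩ := isCompact_Icc.exists_bound_of_continuousOn hρc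
  refine (hasDerivAt_integral_of_dominated_loc_of_deriv_le (μ := volume.restrict (Icc ν L))
    (F := fun (z : ℂ) (t : ℝ) => (ρ t : ℂ) / (t + 2 * m + z))
    (F' := fun (z : ℂ) (t : ℝ) => -(ρ t : ℂ) / (t + 2 * m + z) ^ 2)
    (bound := fun _ => |K| / (c / 2) ^ 2) (s := Metric.ball z (c / 2)) (Metric.ball_mem_nhds z (by positivity)) ?_ ?_ ?_ ?_ ?_
    ?_).2
  · filter_upwards [Metric.ball_mem_nhds z (show 0 < c / 2 by positivity)] with w hw
    exact (hρc.div (by fun_prop) fun t ht => hne t ht w hw).aestronglyMeasurable measurableSet_Icc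
  · exact (hρc.div (by fun_prop) fun t ht => hne t ht z hz').integrableOn_Icc
  · exact (hρc.neg.div (by fun_prop) fun t ht =>
      pow_ne_zero 2 (hne t ht z hz')).aestronglyMeasurable measurableSet_Icc
  · filter_upwards [ae_restrict_mem measurableSet_Icc] with t ht w hw
    rw [norm_div, norm_neg, norm_pow]
    have := (hK t ht).trans (le_abs_self _)
    have h2 := hlow t ht w hw
    gcongr
  · exact integrable_const _
  · filter_upwards [ae_restrict_mem measurableSet_Icc] with t ht w hw
    have := ((hasDerivAt_id' w).const_add ((t : ℂ) + 2 * m)).fun_inv (hne t ht w hw)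
    simp_rw [div_eq_mul_inv]
    refine (this.const_mul (ρ t : ℂ)).congr_deriv ?_
    ring

/-- For ν > L the integral would be over the empty set and R_D the identity, giving ν = 0 < Λ² = L;
for ν = L the end values would give 0 = Λ². -/
lemma IsDeformation.lt {D : ℕ} {μ lam Λ ν L : ℝ} {ρ0 ρ : ℝ → ℝ}
    (h : IsDeformation D μ lam ρ0 Λ ρ ν L) (hΛ : 0 < Λ) : ν < L := by
  by_contra! hle
  have h1 := h.map_left
  have h2 := h.map_right
  rcases hle.lt_or_eq with hlt | heq
  · have hz : ∀ z : ℂ, R D μ lam ρ (Icc ν L) z = z := fun z => by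
      rw [R_eq, Icc_eq_empty (not_le.2 hlt)]
      simp
    rw [hz] at h1 h2
    have h3 : ν = 0 := by exact_mod_cast h1
    have h4 : L = Λ ^ 2 := by exact_mod_cast h2
    nlinarith
  · rw [show (L : ℂ) = (ν : ℂ) by rw [heq], h1] at h2
    have : (0 : ℝ) = Λ ^ 2 := by exact_mod_cast h2
    nlinarith

/-- The slope of `R_D` at infinity. -/
def slopeR (D : ℕ) (μ lam : ℝ) (ρ : ℝ → ℝ) (S : Set ℝ) : ℝ :=
  1 - if D = 4 then lam * ∫ t in S, ρ t / (t + μ ^ 2) ^ 2 else 0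

/-- The constant term of `R_D` at infinity. -/
def shiftR (D : ℕ) (μ lam : ℝ) (ρ : ℝ → ℝ) (S : Set ℝ) : ℝ :=
  if D = 0 then 0 else lam * ∫ t in S, ρ t / (t + μ ^ 2)

/-- Identifies the mass 2mA − 2B found in the deformed equation with the bare mass. -/
lemma bareMassSq_eq {D : ℕ} (hD : D = 0 ∨ D = 2 ∨ D = 4) (μ lam : ℝ) (ρ : ℝ → ℝ) (S : Set ℝ) :
    bareMassSq D μ lam ρ S
      = 2 * (μ ^ 2 / 2) * slopeR D μ lam ρ S - 2 * shiftR D μ lam ρ S := by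
  rcases hD with rfl | rfl | rfl <;> simp [bareMassSq, slopeR, shiftR] <;> ring

section Cutoff

variable {D : ℕ} {μ lam ν L : ℝ} {ρ : ℝ → ℝ}

/-- The subtraction terms may be integrated separately because the domain is compact and the
denominators do not vanish on it. -/
lemma R_Icc_eq (hD : D = 0 ∨ D = 2 ∨ D = 4) (hμ : 0 < μ) (hρ : ContinuousOn ρ (Icc ν L))
    (hν : -(μ ^ 2 / 2) < ν) {z : ℂ} (hz : 0 < ν + 2 * (μ ^ 2 / 2) + z.re) :
    R D μ lam ρ (Icc ν L) z = slopeR D μ lam ρ (Icc ν L) * z + shiftR D μ lam ρ (Icc ν L)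
      - lam * ∫ t in Icc ν L, (ρ t : ℂ) / (t + 2 * (μ ^ 2 / 2 : ℝ) + z) := by
  have hρc : ContinuousOn (fun t => (ρ t : ℂ)) (Icc ν L) :=
    Complex.continuous_ofReal.comp_continuousOn hρ
  have hμ2 : 0 < μ ^ 2 := by positivity
  have hT : ∀ t ∈ Icc ν L, (t : ℂ) + (μ : ℂ) ^ 2 ≠ 0 := fun t ht h => by
    have := congrArg Complex.re h
    rw [← Complex.ofReal_pow, Complex.add_re, Complex.ofReal_re, Complex.ofReal_re,
      Complex.zero_re] at this
    linarith [ht.1]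
  have hTz : ∀ t ∈ Icc ν L, (t : ℂ) + (μ : ℂ) ^ 2 + z ≠ 0 := fun t ht h => by
    have := congrArg Complex.re h
    rw [← Complex.ofReal_pow, Complex.add_re, Complex.add_re, Complex.ofReal_re, Complex.ofReal_re,
      Complex.zero_re] at this
    linarith [ht.1]
  have i1 : IntegrableOn (fun t : ℝ => (ρ t : ℂ) / (t + (μ : ℂ) ^ 2 + z)) (Icc ν L) :=
    (hρc.div (by fun_prop) hTz).integrableOn_Icc
  have i2 : IntegrableOn (fun t : ℝ => (ρ t : ℂ) / (t + (μ : ℂ) ^ 2)) (Icc ν L) :=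
    (hρc.div (by fun_prop) hT).integrableOn_Icc
  have i3 : IntegrableOn (fun t : ℝ => (ρ t : ℂ) / (t + (μ : ℂ) ^ 2) ^ 2) (Icc ν L) :=
    (hρc.div (by fun_prop) fun t ht => pow_ne_zero 2 (hT t ht)).integrableOn_Icc
  have e2 : ((∫ t in Icc ν L, ρ t / (t + μ ^ 2) : ℝ) : ℂ)
      = ∫ t in Icc ν L, (ρ t : ℂ) / (t + (μ : ℂ) ^ 2) := by
    rw [← integral_complex_ofReal]
    push_cast
    rfl
  have e3 : ((∫ t in Icc ν L, ρ t / (t + μ ^ 2) ^ 2 : ℝ) : ℂ)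
      = ∫ t in Icc ν L, (ρ t : ℂ) / (t + (μ : ℂ) ^ 2) ^ 2 := by
    rw [← integral_complex_ofReal]
    push_cast
    rfl
  have hsplit : ∫ t in Icc ν L, (ρ t : ℂ) * kern (D / 2) (t + (μ : ℂ) ^ 2) z
      = (∫ t in Icc ν L, (ρ t : ℂ) / (t + (μ : ℂ) ^ 2 + z))
        - (if D = 0 then 0 else 1) * (∫ t in Icc ν L, (ρ t : ℂ) / (t + (μ : ℂ) ^ 2))
        + (if D = 4 then z else 0) * ∫ t in Icc ν L, (ρ t : ℂ) / (t + (μ : ℂ) ^ 2) ^ 2 := by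
    have i12 : IntegrableOn (fun t : ℝ => (ρ t : ℂ) / (t + (μ : ℂ) ^ 2 + z)
        - (if D = 0 then 0 else 1) * ((ρ t : ℂ) / (t + (μ : ℂ) ^ 2))) (Icc ν L) :=
      i1.sub (i2.const_mul _)
    rw [← integral_const_mul, ← integral_const_mul, ← integral_sub i1 (i2.const_mul _),
      ← integral_add i12 (i3.const_mul _)]
    refine setIntegral_congr_fun measurableSet_Icc fun t ht => ?_
    rw [kern_eq hD (hT t ht) (hTz t ht)]
    split_ifs <;> ring
  have e4 : ((2 : ℂ) * ((μ ^ 2 / 2 : ℝ) : ℂ)) = (μ : ℂ) ^ 2 := by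
    push_cast
    ring
  rw [R_eq, hsplit, slopeR, shiftR, e4]
  rcases hD with rfl | rfl | rfl
  · simp
  · simp [e2]
    ring
  · simp [e2, e3]
    ring

/-- The contraction property, with the kernel evaluated on a larger half plane. -/
lemma norm_R_sub_le (hD : D = 0 ∨ D = 2 ∨ D = 4) (hμ : 0 < μ) (hρ : ContinuousOn ρ (Icc ν L))
    (hρ0 : ∀ t ∈ Icc ν L, 0 ≤ ρ t) {θ c δ : ℝ} (hc : 0 < c) (hcν : c ≤ ν + μ ^ 2 / 2)
    (hθ0 : |lam| * couplingBound D μ ρ (Icc ν L) ≤ θ) (hδ0 : 0 ≤ δ) (hδ : δ ≤ c * (1 - θ) / 8)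
    (hθ1 : θ < 1) (hθn : 0 ≤ θ) {z w : ℂ} (hz : -(μ ^ 2 / 2) - δ < z.re)
    (hw : -(μ ^ 2 / 2) - δ < w.re) :
    ‖R D μ lam ρ (Icc ν L) z - R D μ lam ρ (Icc ν L) w - (z - w)‖ ≤ (1 + θ) / 2 * ‖z - w‖ := by
  set m := μ ^ 2 / 2 with hm
  have hm0 : 0 < m := by positivity
  have hν : -m < ν := by linarith
  have hδc : δ ≤ c / 8 := by nlinarith
  have hρc : ContinuousOn (fun t => (ρ t : ℂ)) (Icc ν L) :=
    Complex.continuous_ofReal.comp_continuousOn hρ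
  have hre : ∀ {z : ℂ}, -m - δ < z.re → ∀ t ∈ Icc ν L, t + m - δ ≤ ‖(t : ℂ) + 2 * m + z‖ := by
    intro z hz t ht
    have h2 := (le_abs_self _).trans (Complex.abs_re_le_norm ((t : ℂ) + 2 * m + z))
    simp at h2
    linarith
  have hpos : ∀ t ∈ Icc ν L, 0 < t + m - δ := fun t ht => by linarith [ht.1]
  have hne : ∀ {z : ℂ}, -m - δ < z.re → ∀ t ∈ Icc ν L, (t : ℂ) + 2 * m + z ≠ 0 :=
    fun hz t ht => norm_pos_iff.1 ((hpos t ht).trans_le (hre hz t ht))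
  have i1 : ∀ {z : ℂ}, -m - δ < z.re →
      IntegrableOn (fun t : ℝ => (ρ t : ℂ) / (t + 2 * m + z)) (Icc ν L) := fun hz =>
    (hρc.div (by fun_prop) (hne hz)).integrableOn_Icc
  -- Leaving the half plane by δ ≤ c x, with c ≤ t + m, shrinks the denominators at most by the
  -- factor 1 − x. The constant θ = 1 − 8x thus grows to at most θ/(1 − x)² ≤ (1 + θ)/2, still below
  -- 1.
  set x := (1 - θ) / 8 with hx
  have hx0 : 0 < x := by rw [hx]; linarith
  have hx1 : x ≤ 1 / 8 := by rw [hx]; linarith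
  have i2 : IntegrableOn (fun t : ℝ => ρ t / (t + m) ^ 2) (Icc ν L) :=
    (hρ.div (by fun_prop) fun t ht => pow_ne_zero 2 (by linarith [ht.1])).integrableOn_Icc
  have hdiff : ‖∫ t in Icc ν L, ((ρ t : ℂ) / (t + 2 * m + z) - (ρ t : ℂ) / (t + 2 * m + w))‖
      ≤ ((1 - x) ^ 2)⁻¹ * (∫ t in Icc ν L, ρ t / (t + m) ^ 2) * ‖z - w‖ := by
    rw [← integral_const_mul, ← integral_mul_const]
    refine norm_integral_le_of_norm_le ((i2.const_mul _).mul_const _) ?_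
    filter_upwards [ae_restrict_mem measurableSet_Icc] with t ht
    have n1 := hne hz t ht
    have n2 := hne hw t ht
    have e1 : (ρ t : ℂ) / (t + 2 * m + z) - (ρ t : ℂ) / (t + 2 * m + w)
        = -(ρ t * (z - w) / ((t + 2 * m + z) * (t + 2 * m + w))) := by
      field_simp
      ring
    have hT : 0 < t + m := by linarith [ht.1]
    have e2 : (1 - x) * (t + m) ≤ t + m - δ := by
      have : c ≤ t + m := by linarith [ht.1]
      rw [hx]
      nlinarith
    have e3 : 0 < (1 - x) * (t + m) := mul_pos (by linarith) hT
    rw [e1, norm_neg, norm_div, norm_mul, norm_mul, Complex.norm_real, Real.norm_eq_abs,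
      abs_of_nonneg (hρ0 t ht)]
    calc ρ t * ‖z - w‖ / (‖(t : ℂ) + 2 * m + z‖ * ‖(t : ℂ) + 2 * m + w‖)
        ≤ ρ t * ‖z - w‖ / (((1 - x) * (t + m)) * ((1 - x) * (t + m))) := by
          have := hρ0 t ht
          have := e2.trans (hre hz t ht)
          have := e2.trans (hre hw t ht)
          gcongr
      _ = _ := by
        have : 1 - x ≠ 0 := by linarith
        field_simp
  have hβ0 : 0 ≤ ∫ t in Icc ν L, ρ t / (t + m) ^ 2 :=
    setIntegral_nonneg measurableSet_Icc fun t ht => div_nonneg (hρ0 t ht) (by positivity)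
  have hκ0 : 0 ≤ ∫ t in Icc ν L, ρ t / (t + μ ^ 2) ^ 2 :=
    setIntegral_nonneg measurableSet_Icc fun t ht => div_nonneg (hρ0 t ht) (by positivity)
  set β := ∫ t in Icc ν L, ρ t / (t + m) ^ 2 with hβ
  set κ := if D = 4 then ∫ t in Icc ν L, ρ t / (t + μ ^ 2) ^ 2 else 0 with hκ
  have hκn : 0 ≤ κ := by
    rw [hκ]
    split_ifs
    · exact hκ0
    · exact le_rfl
  have hcb : |lam| * (β + κ) ≤ θ := hθ0
  have hR : R D μ lam ρ (Icc ν L) z - R D μ lam ρ (Icc ν L) w - (z - w)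
      = -(lam * κ : ℝ) * (z - w)
        - lam * ∫ t in Icc ν L, ((ρ t : ℂ) / (t + 2 * m + z) - (ρ t : ℂ) / (t + 2 * m + w)) := by
    have hs : (slopeR D μ lam ρ (Icc ν L) : ℂ) = 1 - (lam * κ : ℝ) := by
      rw [slopeR, hκ, mul_ite, mul_zero, Complex.ofReal_sub, Complex.ofReal_one]
    rw [integral_sub (i1 hz) (i1 hw), R_Icc_eq hD hμ hρ hν (by linarith),
      R_Icc_eq hD hμ hρ hν (by linarith), hs]
    ring
  have hx2 : θ * ((1 - x) ^ 2)⁻¹ ≤ (1 + θ) / 2 := by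
    rw [← div_eq_mul_inv, div_le_iff₀ (by nlinarith)]
    have : θ = 1 - 8 * x := by rw [hx]; ring
    rw [this]
    nlinarith [sq_nonneg x, mul_nonneg hx0.le (sq_nonneg x)]
  have hx3 : 1 ≤ ((1 - x) ^ 2)⁻¹ := (one_le_inv₀ (by nlinarith)).2 (by nlinarith)
  rw [hR]
  calc _ ≤ ‖-((lam * κ : ℝ) : ℂ) * (z - w)‖ + ‖(lam : ℂ) * ∫ t in Icc ν L,
          ((ρ t : ℂ) / (t + 2 * m + z) - (ρ t : ℂ) / (t + 2 * m + w))‖ := norm_sub_le _ _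
    _ ≤ |lam| * κ * ‖z - w‖ + |lam| * (((1 - x) ^ 2)⁻¹ * β * ‖z - w‖) := by
        rw [norm_mul, norm_mul, norm_neg, Complex.norm_real, Complex.norm_real, Real.norm_eq_abs,
          Real.norm_eq_abs, abs_mul, abs_of_nonneg hκn]
        gcongr
    _ ≤ |lam| * (((1 - x) ^ 2)⁻¹ * κ) * ‖z - w‖ + |lam| * (((1 - x) ^ 2)⁻¹ * β * ‖z - w‖) := by
        gcongr
        exact le_mul_of_one_le_left hκn hx3
    _ = |lam| * (β + κ) * ((1 - x) ^ 2)⁻¹ * ‖z - w‖ := by ring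
    _ ≤ θ * ((1 - x) ^ 2)⁻¹ * ‖z - w‖ := by
        have : 0 ≤ ((1 - x) ^ 2)⁻¹ := by linarith
        gcongr
    _ ≤ _ := by gcongr

end Cutoff

/-- The width of the half plane on which `R_D` is a contraction perturbation of the identity. -/
def margin (μ c θ : ℝ) : ℝ := min (μ ^ 2 / 4) (c * (1 - θ) / 8)

lemma margin_pos {μ c θ : ℝ} (hμ : 0 < μ) (hc : 0 < c) (hθ : θ < 1) : 0 < margin μ c θ :=
  lt_min (by positivity) (by have := mul_pos hc (sub_pos.2 hθ); linarith)

/-- The contraction constant is raised to (1 + θ)/2 to gain a strictly larger half plane. The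
numbers θ and c stay free, so that one choice can serve a whole sequence of cut-offs. -/
theorem IsDeformation.cutData {D : ℕ} {μ lam Λ ν L : ℝ} {ρ0 ρ : ℝ → ℝ}
    (h : IsDeformation D μ lam ρ0 Λ ρ ν L) (hD : D = 0 ∨ D = 2 ∨ D = 4) (hμ : 0 < μ)
    (hρ0 : ∀ t, 0 ≤ t → 0 ≤ ρ0 t) {θ c : ℝ}
    (hθ0 : |lam| * couplingBound D μ ρ (Icc ν L) ≤ θ) (hθ1 : θ < 1) (hc : 0 < c)
    (hcν : c ≤ ν + μ ^ 2 / 2) :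
    CutData lam (slopeR D μ lam ρ (Icc ν L)) (shiftR D μ lam ρ (Icc ν L)) (μ ^ 2 / 2)
      ((1 + θ) / 2) (margin μ c θ) ν L ρ (R D μ lam ρ (Icc ν L)) := by
  have hρ := h.continuousOn
  have hρn : ∀ t ∈ Icc ν L, 0 ≤ ρ t := fun t ht => by
    rw [h.deform t ht]
    exact hρ0 _ (h.maps_to t ht).1
  have hβ0 : 0 ≤ ∫ t in Icc ν L, ρ t / (t + μ ^ 2 / 2) ^ 2 :=
    setIntegral_nonneg measurableSet_Icc fun t ht => div_nonneg (hρn t ht) (by positivity)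
  have hκ0 : 0 ≤ ∫ t in Icc ν L, ρ t / (t + μ ^ 2) ^ 2 :=
    setIntegral_nonneg measurableSet_Icc fun t ht => div_nonneg (hρn t ht) (by positivity)
  have hcb : 0 ≤ couplingBound D μ ρ (Icc ν L) := by
    rw [couplingBound]
    split_ifs <;> linarith
  have hθn : 0 ≤ θ := (mul_nonneg (abs_nonneg _) hcb).trans hθ0
  have hδ0 := margin_pos hμ hc hθ1
  have hδ1 : margin μ c θ ≤ μ ^ 2 / 4 := min_le_left _ _
  have hδ2 : margin μ c θ ≤ c * (1 - θ) / 8 := min_le_right _ _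
  have hδ3 : margin μ c θ ≤ c / 8 := by nlinarith
  have hμ2 : 0 < μ ^ 2 := by positivity
  have hν : -(μ ^ 2 / 2) < ν := by linarith
  have hf : ∀ z : ℂ, -(μ ^ 2 / 2) - margin μ c θ < z.re → R D μ lam ρ (Icc ν L) z
      = slopeR D μ lam ρ (Icc ν L) * z + shiftR D μ lam ρ (Icc ν L)
      - lam * ∫ t in Icc ν L, (ρ t : ℂ) / (t + 2 * (μ ^ 2 / 2 : ℝ) + z) := fun z hz =>
    R_Icc_eq hD hμ hρ hν (by linarith)
  have hd : ∀ z : ℂ, -(μ ^ 2 / 2) - margin μ c θ < z.re → HasDerivAt (R D μ lam ρ (Icc ν L))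
      (slopeR D μ lam ρ (Icc ν L)
        - lam * ∫ t in Icc ν L, -(ρ t : ℂ) / (t + 2 * (μ ^ 2 / 2 : ℝ) + z) ^ 2) z := by
    intro z hz
    have h1 := hasDerivAt_stieltjes (m := μ ^ 2 / 2) hρ (show 0 < c / 2 by positivity) (z := z)
      (by linarith)
    have h2 := (((hasDerivAt_id' z).const_mul (slopeR D μ lam ρ (Icc ν L) : ℂ)).add_const
      (shiftR D μ lam ρ (Icc ν L) : ℂ)).fun_sub (h1.const_mul (lam : ℂ))
    rw [mul_one] at h2
    refine h2.congr_of_eventuallyEq ?_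
    filter_upwards [(isOpen_rightHalf _).mem_nhds hz] with w hw using hf w hw
  obtain ⟨K, hK⟩ := isCompact_Icc.exists_bound_of_continuousOn
    (Complex.continuous_ofReal.comp_continuousOn hρ)
  have hT : ∃ K', 0 < K' ∧ ∀ z : ℂ, -(μ ^ 2 / 2) - margin μ c θ < z.re → ∀ t ∈ Icc ν L,
      1 + ‖z‖ ≤ K' * ‖(t : ℂ) + 2 * (μ ^ 2 / 2 : ℝ) + z‖ ∧
      c / 2 ≤ ‖(t : ℂ) + 2 * (μ ^ 2 / 2 : ℝ) + z‖ := by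
    have hML : ∀ t ∈ Icc ν L, ‖(t : ℂ) + 2 * (μ ^ 2 / 2 : ℝ)‖ ≤ |ν| + |L| + μ ^ 2 := by
      intro t ht
      have : (t : ℂ) + 2 * (μ ^ 2 / 2 : ℝ) = ((t + μ ^ 2 : ℝ) : ℂ) := by push_cast; ring
      rw [this, Complex.norm_real, Real.norm_eq_abs]
      have h1 : |t| ≤ |ν| + |L| := abs_le.2 ⟨by linarith [neg_abs_le ν, abs_nonneg L, ht.1],
        by linarith [le_abs_self L, abs_nonneg ν, ht.2]⟩
      exact (abs_add_le _ _).trans (by rw [abs_of_pos hμ2]; linarith)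
    refine ⟨(1 + (|ν| + |L| + μ ^ 2)) / (c / 2) + 1, by positivity, fun z hz t ht => ?_⟩
    have h1 : c / 2 ≤ ‖(t : ℂ) + 2 * (μ ^ 2 / 2 : ℝ) + z‖ := by
      have h2 := (le_abs_self _).trans
        (Complex.abs_re_le_norm ((t : ℂ) + 2 * (μ ^ 2 / 2 : ℝ) + z))
      rw [Complex.add_re, Complex.add_re, ← Complex.ofReal_ofNat, ← Complex.ofReal_mul,
        Complex.ofReal_re, Complex.ofReal_re] at h2
      push_cast at h2 ⊢
      linarith [ht.1]
    refine ⟨?_, h1⟩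
    have h3 := norm_sub_norm_le z (-((t : ℂ) + 2 * (μ ^ 2 / 2 : ℝ)))
    rw [norm_neg, sub_neg_eq_add, add_comm z] at h3
    have h4 := hML t ht
    have h5 : 1 + (|ν| + |L| + μ ^ 2)
        ≤ (1 + (|ν| + |L| + μ ^ 2)) / (c / 2) * ‖(t : ℂ) + 2 * (μ ^ 2 / 2 : ℝ) + z‖ := by
      rw [div_mul_eq_mul_div, le_div_iff₀ (by positivity)]
      gcongr
    linarith
  obtain ⟨K', hK', hlow⟩ := hT
  exact {
    θ_nonneg := by linarith
    θ_lt := by linarith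
    δ_pos := hδ0
    δ_lt := by linarith
    δ_lt' := by linarith
    contr := fun z w hz hw => norm_R_sub_le hD hμ hρ hρn hc hcν hθ0 hδ0.le hδ2 hθ1 hθn hz hw
    diff := fun z hz => (hd z hz).differentiableAt.differentiableWithinAt
    conj_eq := conj_R _ _ _ _ _
    zero := h.map_left
    -- For D = 4 positivity of the slope is ensured by the second integral in the coupling bound.
    A_pos := by
      rw [slopeR]
      split_ifs with hD4
      · have h1 : |lam| * ∫ t in Icc ν L, ρ t / (t + μ ^ 2) ^ 2 ≤ θ := by
          refine le_trans ?_ hθ0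
          rw [couplingBound, if_pos hD4]
          gcongr
          linarith
        have h2 := mul_le_mul_of_nonneg_right (le_abs_self lam) hκ0
        linarith
      · norm_num
    asymp := by
      refine ⟨|lam| * (|K| * K' * volume.real (Icc ν L)), fun z hz => ?_⟩
      rw [hf z hz, show ∀ a b d : ℂ, a + b - d - a - b = -d by intros; ring, norm_neg, norm_mul,
        Complex.norm_real, Real.norm_eq_abs, mul_assoc |lam|]
      gcongr
      refine (norm_setIntegral_le_of_norm_le_const (C := |K| * K' * (1 + ‖z‖)⁻¹)
        measure_Icc_lt_top fun t ht => ?_).trans (le_of_eq (by ring))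
      obtain ⟨h1, h2⟩ := hlow z hz t ht
      rw [norm_div, div_le_iff₀ (lt_of_lt_of_le (by positivity) h2)]
      have h3 : ‖(ρ t : ℂ)‖ ≤ |K| := (hK t ht).trans (le_abs_self _)
      calc ‖(ρ t : ℂ)‖ ≤ |K| * ((1 + ‖z‖) * (1 + ‖z‖)⁻¹) := by
            rwa [mul_inv_cancel₀ (by positivity), mul_one]
        _ ≤ |K| * ((K' * ‖(t : ℂ) + 2 * (μ ^ 2 / 2 : ℝ) + z‖) * (1 + ‖z‖)⁻¹) := by gcongr
        _ = _ := by ring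
    deriv_asymp := by
      refine ⟨|lam| * (|K| * K' * (c / 2)⁻¹ * volume.real (Icc ν L)), fun z hz => ?_⟩
      rw [(hd z hz).deriv, sub_sub_cancel_left, norm_neg, norm_mul,
        Complex.norm_real, Real.norm_eq_abs, mul_assoc |lam|]
      gcongr
      refine (norm_setIntegral_le_of_norm_le_const (C := |K| * K' * (c / 2)⁻¹ * (1 + ‖z‖)⁻¹)
        measure_Icc_lt_top fun t ht => ?_).trans (le_of_eq (by ring))
      obtain ⟨h1, h2⟩ := hlow z hz t ht
      have h4 : 0 < ‖(t : ℂ) + 2 * (μ ^ 2 / 2 : ℝ) + z‖ := lt_of_lt_of_le (by positivity) h2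
      rw [norm_div, norm_neg, norm_pow, div_le_iff₀ (by positivity)]
      have h3 : ‖(ρ t : ℂ)‖ ≤ |K| := (hK t ht).trans (le_abs_self _)
      calc ‖(ρ t : ℂ)‖ ≤ |K| * ((1 + ‖z‖) * (1 + ‖z‖)⁻¹) * ((c / 2)⁻¹ * (c / 2)) := by
            rwa [mul_inv_cancel₀ (by positivity), mul_one, inv_mul_cancel₀ (by positivity), mul_one]
        _ ≤ |K| * ((K' * ‖(t : ℂ) + 2 * (μ ^ 2 / 2 : ℝ) + z‖) * (1 + ‖z‖)⁻¹)
            * ((c / 2)⁻¹ * ‖(t : ℂ) + 2 * (μ ^ 2 / 2 : ℝ) + z‖) := by gcongr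
        _ = _ := by ring
    cont := hρ
    formula := hf }

end QuarticMatrix
-- The displayed formulas at finite cut-off.
namespace QuarticMatrix

open VerticalLine ComplexConjugate LineNear

lemma evenDim_cases {ρ0 : ℝ → ℝ} (hdim : spectralDimension ρ0 < 6) :
    (evenDim ρ0 = 0 ∨ evenDim ρ0 = 2 ∨ evenDim ρ0 = 4) ∧
      (spectralDimension ρ0 < 4 → evenDim ρ0 ≠ 4) ∧
      (4 ≤ spectralDimension ρ0 → evenDim ρ0 = 4) := by
  have htop : spectralDimension ρ0 ≠ ∞ := hdim.ne_top
  set x := (spectralDimension ρ0).toReal with hx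
  have hx0 : 0 ≤ x := ENNReal.toReal_nonneg
  have hx6 : x < 6 := by
    have := (ENNReal.toReal_lt_toReal htop (by simp)).2 hdim
    simpa using this
  have hfl : ⌊x / 2⌋₊ < 3 := (Nat.floor_lt (by linarith)).2 (by push_cast; linarith)
  have he : evenDim ρ0 = 2 * ⌊x / 2⌋₊ := rfl
  refine ⟨by omega, fun h => ?_, fun h => ?_⟩
  · have hx4 : x < 4 := by
      have := (ENNReal.toReal_lt_toReal htop (by simp)).2 h
      simpa using this
    have : ⌊x / 2⌋₊ < 2 := (Nat.floor_lt (by linarith)).2 (by push_cast; linarith)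
    omega
  · have hx4 : 4 ≤ x := by
      have := (ENNReal.toReal_le_toReal (by simp) htop).2 h
      simpa using this
    have : 2 ≤ ⌊x / 2⌋₊ := Nat.le_floor (by push_cast; linarith)
    omega

lemma line_eq (μ t : ℝ) : line μ t = vline (-(μ ^ 2 / 2)) t := by
  rw [line, vline]
  push_cast
  ring

lemma logTerm_eq {μ κ K : ℝ} {f : ℂ → ℂ} {F' : ℝ → ℂ}
    (H : LineBase κ K (fun t => f (vline (-(μ ^ 2 / 2)) t)) F') {b : ℝ} (hb : 0 ≤ b) (a t : ℝ) :
    logTerm μ f a b t = lineLog (fun t => f (vline (-(μ ^ 2 / 2)) t)) a (-t)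
      * lineLog' (fun t => f (vline (-(μ ^ 2 / 2)) t)) F' b t := by
  rw [logTerm]
  simp_rw [line_eq]
  rw [← (H.hasDerivAt_lineLog hb t).deriv]
  rfl

lemma integrandN_eq {D : ℕ} {μ lam κ K : ℝ} {ρ : ℝ → ℝ} {S : Set ℝ} (hμ : 0 < μ) {F' : ℝ → ℂ}
    (H : LineBase κ K (fun t => R D μ lam ρ S (vline (-(μ ^ 2 / 2)) t)) F') {b : ℝ} (hb : 0 ≤ b)
    (a t : ℝ) :
    integrandN D μ lam ρ S a b t
      = logDiff (μ ^ 2 / 2) (fun t => R D μ lam ρ S (vline (-(μ ^ 2 / 2)) t)) F' a b t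
        - (if D = 4 then 1 else 0)
          * logDiff (μ ^ 2 / 2) (fun t => R D μ lam ρ S (vline (-(μ ^ 2 / 2)) t)) F' 0 0 t := by
  have H0 : LineBase (min (μ ^ 2 / 2) 1 / 2) (μ ^ 2 / 2 + 1)
    (fun t => id (vline (-(μ ^ 2 / 2)) t)) (fun _ => Complex.I) := lineBase_vline (by positivity)
  rw [integrandN, logTerm_eq H hb, logTerm_eq H0 hb, logTerm_eq H le_rfl, logTerm_eq H0 le_rfl,
    logDiff, logDiff]
  simp only [id]
  ring

lemma integrandAlt_eq {D : ℕ} {μ lam κ K ε : ℝ} {ρ : ℝ → ℝ} {S : Set ℝ} {F' : ℝ → ℂ}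
    (H : LineNear 1 (μ ^ 2 / 2) κ K ε (fun t => R D μ lam ρ S (vline (-(μ ^ 2 / 2)) t)) F')
    {b : ℝ} (hb : 0 ≤ b) (a t : ℝ) :
    integrandAlt D μ lam ρ S a b t
      = lineRatio 1 (μ ^ 2 / 2) (fun t => R D μ lam ρ S (vline (-(μ ^ 2 / 2)) t)) a (-t)
        * lineRatio' (μ ^ 2 / 2) (fun t => R D μ lam ρ S (vline (-(μ ^ 2 / 2)) t)) F' b t := by
  rw [integrandAlt]
  simp_rw [line_eq]
  rw [← (H.hasDerivAt_lineRatio hb t).deriv]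
  have hr : ∀ (a : ℝ), lineRatio 1 (μ ^ 2 / 2)
      (fun t => R D μ lam ρ S (vline (-(μ ^ 2 / 2)) t)) a = fun t => Complex.log
        ((a - R D μ lam ρ S (vline (-(μ ^ 2 / 2)) t)) / (a - vline (-(μ ^ 2 / 2)) t)) := by
    intro a
    ext t
    rw [lineRatio, Complex.ofReal_one, one_mul]
  rw [hr, hr]

lemma mem_halfPlane {μ : ℝ} {z : ℂ} : z ∈ halfPlane μ ↔ -(μ ^ 2 / 2) < z.re := by
  rw [halfPlane, mem_ofPred, neg_div]

/-- The inverse picks some preimage in the half plane; injectivity identifies it with the real one.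
-/
lemma ContrData.Rinv_eq {D : ℕ} {μ lam θ δ ν α a : ℝ} {ρ : ℝ → ℝ} {S : Set ℝ}
    (H : ContrData (μ ^ 2 / 2) θ δ ν (R D μ lam ρ S)) (hα : ν ≤ α)
    (hRα : R D μ lam ρ S α = a) : Rinv D μ lam ρ S a = α := by
  have hν := H.contr_neg
  have hex : ∃ z ∈ halfPlane μ, R D μ lam ρ S z = a :=
    ⟨α, mem_halfPlane.2 (by rw [Complex.ofReal_re]; linarith), hRα⟩
  have h1 := mem_halfPlane.1 (Function.invFunOn_mem hex)
  have h2 := Function.invFunOn_eq hex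
  exact H.injOn (by have := H.δ_pos; rw [Rinv]; linarith) (H.ofReal_mem hα) (h2.trans hRα.symm)

lemma LineBase.measurable_logDiff {m κ K : ℝ} (hm : 0 < m) {F F' : ℝ → ℂ}
    (H : LineBase κ K F F') {a : ℝ} (ha : 0 ≤ a) (b : ℝ) :
    Measurable (logDiff m F F' a b) :=
  (((H.continuous_lineLog ha).comp continuous_neg).measurable.mul (H.measurable_lineLog' b)).sub
    ((((lineBase_vline hm).continuous_lineLog ha).comp continuous_neg).measurable.mul
      ((lineBase_vline hm).measurable_lineLog' b))

/-- The subtraction at a = b = 0 alone makes the integrand integrable. No asymptotics of F enter, so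
the bound remains available for D = 4 when the cut-off is removed. -/
lemma LineBase.exists_norm_logDiff_sub_le (m κ K a b : ℝ) (hm : 0 < m) (hκ : 0 < κ) (ha : 0 ≤ a)
    (hb : 0 ≤ b) : ∃ C, ∀ F F' : ℝ → ℂ, LineBase κ K F F' → ∀ t,
      ‖logDiff m F F' a b t - logDiff m F F' 0 0 t‖ ≤ C * (1 + |t|) ^ (-(3 / 2) : ℝ) := by
  obtain ⟨C1, hC1, h1⟩ := exists_norm_subtracted_le κ K a b hκ ha hb
  have H0 := lineBase_vline hm
  obtain ⟨C2, hC2, h2⟩ := exists_norm_subtracted_le _ (m + 1) a b H0.κ_pos ha hb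
  refine ⟨C1 + C2, fun F F' H t => ?_⟩
  have e1 := h1 F F' H t
  have e2 := h2 _ _ H0 t
  rw [logDiff, logDiff, sub_sub_sub_comm, add_mul]
  exact (norm_sub_le _ _).trans (add_le_add e1 e2)

namespace CutData

variable {lam A B m θ δ ν L : ℝ} {ρ : ℝ → ℝ} {R : ℂ → ℂ}

/-- The two cross exponents supply (2m + a + b)² over the two denominators of `gTwo_eq`, of which
one power of 2m + a + b is already contained in `gTwo`. -/
lemma exp_sum_eq (H : CutData lam A B m θ δ ν L ρ R) {α a b : ℝ} (ha : 0 ≤ a) (hb : 0 ≤ b)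
    (hα : ν ≤ α) (hRα : R α = a) :
    Complex.exp (altExponent A m (fun t => R (vline (-m) t))
        (fun t => deriv R (vline (-m) t) * Complex.I) a b
      + crossExponent A m (fun t => R (vline (-m) t)) b a
      + crossExponent A m (fun t => R (vline (-m) t)) a b)
      = A * (2 * m + a + b) * gTwo A m R b α := by
  obtain ⟨β, hβ, hRβ⟩ := H.exists_preimage hb
  have hm := H.m_pos
  have hA := H.A_pos
  have hν := H.contr_neg
  have n1 : (2 * m + b + α : ℂ) ≠ 0 := by
    have : 2 * m + b + α ≠ 0 := by linarith
    exact_mod_cast this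
  have n2 : (2 * m + a + β : ℂ) ≠ 0 := by
    have : 2 * m + a + β ≠ 0 := by linarith
    exact_mod_cast this
  have n3 : (A : ℂ) ≠ 0 := by exact_mod_cast hA.ne'
  rw [Complex.exp_add, Complex.exp_add, H.exp_crossExponent ha hb hα hRα,
    H.exp_crossExponent hb ha hβ hRβ, H.gTwo_eq ha hb hβ hRα hRβ,
    show (2 * m + b + a : ℂ) = 2 * m + a + b by ring]
  generalize Complex.exp _ = E
  field_simp

end CutData

section Cutoff

variable {D : ℕ} {μ lam θ δ ν L : ℝ} {ρ : ℝ → ℝ}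

lemma slopeR_eq_one (hD4 : D ≠ 4) (S : Set ℝ) : slopeR D μ lam ρ S = 1 := by
  rw [slopeR, if_neg hD4, sub_zero]

/-- The explicit formula in dimension less than four. -/
lemma formulaG_eq_gTwo (hμ : 0 < μ) (hD4 : D ≠ 4)
    (H : CutData lam (slopeR D μ lam ρ (Icc ν L)) (shiftR D μ lam ρ (Icc ν L)) (μ ^ 2 / 2)
      θ δ ν L ρ (R D μ lam ρ (Icc ν L))) {a b α : ℝ} (ha : 0 ≤ a) (hb : 0 ≤ b) (hα : ν ≤ α)
    (hRα : R D μ lam ρ (Icc ν L) α = a) :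
    Integrable (integrandN D μ lam ρ (Icc ν L) a b) ∧
    formulaG D μ lam ρ (Icc ν L) a b
      = gTwo (slopeR D μ lam ρ (Icc ν L)) (μ ^ 2 / 2) (R D μ lam ρ (Icc ν L)) b α := by
  rw [slopeR_eq_one hD4] at H ⊢
  obtain ⟨κ, K, hL⟩ := H.exists_lineNear
  have hm : 0 < μ ^ 2 / 2 := H.m_pos
  have hint : integrandN D μ lam ρ (Icc ν L) a b = logDiff (μ ^ 2 / 2)
      (fun t => R D μ lam ρ (Icc ν L) (vline (-(μ ^ 2 / 2)) t))
      (fun t => deriv (R D μ lam ρ (Icc ν L)) (vline (-(μ ^ 2 / 2)) t) * Complex.I) a b := by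
    ext t
    rw [integrandN_eq hμ hL.toLineBase hb, if_neg hD4, zero_mul, sub_zero]
  refine ⟨?_, ?_⟩
  · obtain ⟨C, hC, hbd⟩ := exists_norm_logDiff_le (μ ^ 2 / 2) κ K 1 a b hm hL.κ_pos one_pos le_rfl
      ha hb
    rw [hint]
    exact integrable_of_le_rpow_neg (by norm_num)
      (hL.toLineBase.measurable_logDiff hm ha b).aestronglyMeasurable (hbd _ _ hL)
  · rw [formulaG, N, hint, hL.integral_logDiff ha hb, H.exp_sum_eq ha hb hα hRα, if_neg hD4,
      pow_zero, one_mul, Complex.ofReal_one, one_mul]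
    have h2 : (2 * ((μ ^ 2 / 2 : ℝ) : ℂ)) = (μ : ℂ) ^ 2 := by
      push_cast
      ring
    rw [h2, mul_comm, mul_div_assoc, div_self, mul_one]
    have : μ ^ 2 + a + b ≠ 0 := by linarith
    exact_mod_cast this

/-- The explicit formula in dimension four. -/
lemma formulaG_eq_gTwo_div (hμ : 0 < μ) (hD4 : D = 4)
    (H : CutData lam (slopeR D μ lam ρ (Icc ν L)) (shiftR D μ lam ρ (Icc ν L)) (μ ^ 2 / 2)
      θ δ ν L ρ (R D μ lam ρ (Icc ν L))) {a b α : ℝ} (ha : 0 ≤ a) (hb : 0 ≤ b) (hα : ν ≤ α)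
    (hRα : R D μ lam ρ (Icc ν L) α = a) :
    Integrable (integrandN D μ lam ρ (Icc ν L) a b) ∧
    formulaG D μ lam ρ (Icc ν L) a b
      = gTwo (slopeR D μ lam ρ (Icc ν L)) (μ ^ 2 / 2) (R D μ lam ρ (Icc ν L)) b α
        / gTwo (slopeR D μ lam ρ (Icc ν L)) (μ ^ 2 / 2) (R D μ lam ρ (Icc ν L)) 0 ν := by
  obtain ⟨κ, K, hL⟩ := H.exists_lineNear
  have hm : 0 < μ ^ 2 / 2 := H.m_pos
  have hint : integrandN D μ lam ρ (Icc ν L) a b = fun t => logDiff (μ ^ 2 / 2)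
      (fun t => R D μ lam ρ (Icc ν L) (vline (-(μ ^ 2 / 2)) t))
      (fun t => deriv (R D μ lam ρ (Icc ν L)) (vline (-(μ ^ 2 / 2)) t) * Complex.I) a b t
      - logDiff (μ ^ 2 / 2)
      (fun t => R D μ lam ρ (Icc ν L) (vline (-(μ ^ 2 / 2)) t))
      (fun t => deriv (R D μ lam ρ (Icc ν L)) (vline (-(μ ^ 2 / 2)) t) * Complex.I) 0 0 t := by
    ext t
    rw [integrandN_eq hμ hL.toLineBase hb, if_pos hD4, one_mul]
  have hz : R D μ lam ρ (Icc ν L) ν = ((0 : ℝ) : ℂ) := by rw [H.zero, Complex.ofReal_zero]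
  refine ⟨?_, ?_⟩
  · obtain ⟨C, hbd⟩ := LineBase.exists_norm_logDiff_sub_le (μ ^ 2 / 2) κ K a b hm hL.κ_pos ha hb
    rw [hint]
    exact integrable_of_le_rpow_neg (by norm_num)
      ((hL.toLineBase.measurable_logDiff hm ha b).sub
        (hL.toLineBase.measurable_logDiff hm le_rfl 0)).aestronglyMeasurable (hbd _ _ hL.toLineBase)
  -- Subtracting the exponent at (0, 0) divides by A μ² times the value of `gTwo` there: A cancels,
  -- and μ² is compensated by the prefactor of the formula.
  · rw [formulaG, N, hint, hL.integral_logDiff_sub ha hb, Complex.exp_sub,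
      H.exp_sum_eq ha hb hα hRα, H.exp_sum_eq le_rfl le_rfl le_rfl hz, if_pos hD4]
    have h2 : (2 * ((μ ^ 2 / 2 : ℝ) : ℂ)) = (μ : ℂ) ^ 2 := by
      push_cast
      ring
    have n0 : (slopeR D μ lam ρ (Icc ν L) : ℂ) ≠ 0 := by exact_mod_cast H.A_pos.ne'
    have n1 : (μ : ℂ) ^ 2 + a + b ≠ 0 := by
      have : μ ^ 2 + a + b ≠ 0 := by linarith
      exact_mod_cast this
    have n2 : (μ : ℂ) ≠ 0 := by exact_mod_cast hμ.ne'
    obtain ⟨g, hg, hg'⟩ := H.exists_gTwo_eq_ofReal le_rfl le_rfl le_rfl hz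
    have n3 : (g : ℂ) ≠ 0 := by exact_mod_cast hg.ne'
    rw [h2, hg', Complex.ofReal_zero, add_zero, add_zero]
    field_simp

/-- The alternative formula in dimension less than four. -/
lemma formulaAlt_eq_gTwo (hD4 : D ≠ 4)
    (H : CutData lam (slopeR D μ lam ρ (Icc ν L)) (shiftR D μ lam ρ (Icc ν L)) (μ ^ 2 / 2)
      θ δ ν L ρ (R D μ lam ρ (Icc ν L))) {a b α : ℝ} (ha : 0 ≤ a) (hb : 0 ≤ b) (hα : ν ≤ α)
    (hRα : R D μ lam ρ (Icc ν L) α = a) :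
    Integrable (integrandAlt D μ lam ρ (Icc ν L) a b) ∧
    formulaAlt D μ lam ρ (Icc ν L) a b
      = gTwo (slopeR D μ lam ρ (Icc ν L)) (μ ^ 2 / 2) (R D μ lam ρ (Icc ν L)) b α := by
  rw [slopeR_eq_one hD4] at H ⊢
  obtain ⟨κ, K, hL⟩ := H.exists_lineNear
  obtain ⟨β, hβ, hRβ⟩ := H.exists_preimage hb
  have hint := funext (integrandAlt_eq hL hb a)
  refine ⟨?_, ?_⟩
  · rw [hint]
    exact hL.integrable_alt ha hb
  · have h2 : (2 * ((μ ^ 2 / 2 : ℝ) : ℂ)) = (μ : ℂ) ^ 2 := by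
      push_cast
      ring
    rw [formulaAlt, hint, H.toContrData.Rinv_eq hα hRα, H.toContrData.Rinv_eq hβ hRβ,
      H.gTwo_eq ha hb hβ hRα hRβ, h2, altExponent, Complex.ofReal_one, one_mul]
    congr 1
    ring

end Cutoff

/-- The model with a finite cut-off. -/
theorem cutoff_model {μ lam : ℝ} (hμ : 0 < μ) {ρ0 : ℝ → ℝ} (hρ0 : ∀ t, 0 ≤ t → 0 ≤ ρ0 t)
    (hdim : spectralDimension ρ0 < 6) {D : ℕ} (hD : D = evenDim ρ0) {Λ : ℝ} {ρ : ℝ → ℝ} {ν L : ℝ}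
    (hΛ : 0 < Λ) (h : IsDeformation D μ lam ρ0 Λ ρ ν L)
    (hβ : |lam| * couplingBound D μ ρ (Icc ν L) < 1) :
    ∃ (Z : ℝ) (G : ℝ → ℝ → ℝ), 0 < Z ∧
      IsPlanarTwoPoint ρ0 lam Λ (bareMassSq D μ lam ρ (Icc ν L)) Z G ∧
      (∀ a ∈ Icc 0 (Λ ^ 2), ∀ b ∈ Icc 0 (Λ ^ 2),
        Integrable (integrandN D μ lam ρ (Icc ν L) a b) ∧
        (G a b : ℂ) = formulaG D μ lam ρ (Icc ν L) a b) ∧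
      (4 ≤ spectralDimension ρ0 →
        G 0 0 = 1 ∧
        ∀ c : ℝ, 0 < c → IsPlanarTwoPoint ρ0 lam Λ
          (bareMassSq D μ lam ρ (Icc ν L)) (Z / c) (fun a b => c * G a b)) ∧
      (spectralDimension ρ0 < 4 →
        Z = 1 ∧
        (∀ a ∈ Icc 0 (Λ ^ 2), ∃! z : ℂ, z ∈ halfPlane μ ∧ R D μ lam ρ (Icc ν L) z = a) ∧
        ∀ a ∈ Icc 0 (Λ ^ 2), ∀ b ∈ Icc 0 (Λ ^ 2),
          Integrable (integrandAlt D μ lam ρ (Icc ν L) a b) ∧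
          (G a b : ℂ) = formulaAlt D μ lam ρ (Icc ν L) a b) := by
  obtain ⟨hDc, hlt4, hge4⟩ := evenDim_cases hdim
  rw [← hD] at hDc hlt4 hge4
  have hν := mem_halfPlane.1 h.left_mem
  rw [Complex.ofReal_re] at hν
  -- For a single cut-off θ is taken to be the coupling bound itself and c the full distance of ν
  -- from −μ²/2.
  have H := h.cutData hDc hμ hρ0 le_rfl hβ (c := ν + μ ^ 2 / 2) (by linarith) le_rfl
  obtain ⟨G, hG, hGg⟩ := H.exists_isPlanarTwoPoint (h.lt hΛ).le h.map_right h.deform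
  rw [← bareMassSq_eq hDc] at hG
  by_cases hD4 : D = 4
  · have hz : R D μ lam ρ (Icc ν L) ν = ((0 : ℝ) : ℂ) := by rw [H.zero, Complex.ofReal_zero]
    obtain ⟨hZ, hZg⟩ := hGg 0 0 ν le_rfl le_rfl le_rfl hz
    -- The solution with field renormalisation 1 is divided by its value at (0, 0), which thereby
    -- becomes Z.
    have hG1 := hG.const_mul (inv_pos.2 hZ)
    rw [one_div, inv_inv] at hG1
    refine ⟨G 0 0, fun a b => (G 0 0)⁻¹ * G a b, hZ, hG1, fun a ha b hb => ?_, fun _ => ⟨?_, ?_⟩,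
      fun hc => absurd hD4 (hlt4 hc)⟩
    · obtain ⟨α, hα, hRα⟩ := H.exists_preimage ha.1
      obtain ⟨i, e⟩ := formulaG_eq_gTwo_div hμ hD4 H ha.1 hb.1 hα hRα
      refine ⟨i, ?_⟩
      rw [e, ← hZg, ← (hGg a b α ha.1 hb.1 hα hRα).2]
      push_cast
      rw [div_eq_inv_mul]
    · exact inv_mul_cancel₀ hZ.ne'
    · exact fun c hc => hG1.const_mul hc
  · refine ⟨1, G, one_pos, hG, fun a ha b hb => ?_, fun hc => absurd (hge4 hc) hD4, fun _ =>
      ⟨rfl, fun a ha => ?_, fun a ha b hb => ?_⟩⟩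
    · obtain ⟨α, hα, hRα⟩ := H.exists_preimage ha.1
      obtain ⟨i, e⟩ := formulaG_eq_gTwo hμ hD4 H ha.1 hb.1 hα hRα
      exact ⟨i, by rw [e]; exact (hGg a b α ha.1 hb.1 hα hRα).2⟩
    · simp_rw [mem_halfPlane]
      exact H.existsUnique_preimage ha.1
    · obtain ⟨α, hα, hRα⟩ := H.exists_preimage ha.1
      obtain ⟨i, e⟩ := formulaAlt_eq_gTwo hD4 H ha.1 hb.1 hα hRα
      exact ⟨i, by rw [e]; exact (hGg a b α ha.1 hb.1 hα hRα).2⟩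

end QuarticMatrix
-- Convergence tools and integrability of the deformed measures.
namespace QuarticMatrix

open VerticalLine ComplexConjugate LineNear

/-- Convergence of integrals under a uniform bound with a growing weight. -/
theorem tendsto_integral_of_weight {f : ℕ → ℝ → ℂ} {g : ℝ → ℂ} {s : ℝ} {B : ℝ≥0∞} (hs : 0 < s)
    (hB : B ≠ ∞) (hm : ∀ n, AEStronglyMeasurable (f n))
    (hlim : ∀ᵐ t, Tendsto (fun n => f n t) atTop (𝓝 (g t)))
    (hw : ∀ n, ∫⁻ t, ‖f n t‖ₑ * ENNReal.ofReal ((1 + |t|) ^ s) ≤ B)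
    (hloc : ∀ X : ℝ, ∃ C : ℝ, ∀ n t, |t| ≤ X → ‖f n t‖ ≤ C) :
    Integrable g ∧ Tendsto (fun n => ∫ t, f n t) atTop (𝓝 (∫ t, g t)) := by
  have hgm : AEStronglyMeasurable g := aestronglyMeasurable_of_tendsto_ae atTop hm hlim
  have hWm : Measurable fun t : ℝ => ENNReal.ofReal ((1 + |t|) ^ s) := by fun_prop
  have hW1 : ∀ t : ℝ, 1 ≤ ENNReal.ofReal ((1 + |t|) ^ s) := fun t => by
    rw [ENNReal.one_le_ofReal]
    exact Real.one_le_rpow (by linarith [abs_nonneg t]) hs.le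
  -- The weighted bound passes to the limit by Fatou's lemma.
  have hgw : ∫⁻ t, ‖g t‖ₑ * ENNReal.ofReal ((1 + |t|) ^ s) ≤ B := by
    calc _ ≤ ∫⁻ t, liminf (fun n => ‖f n t‖ₑ * ENNReal.ofReal ((1 + |t|) ^ s)) atTop := by
          refine lintegral_mono_ae ?_
          filter_upwards [hlim] with t ht
          exact (ENNReal.Tendsto.mul_const ht.enorm (Or.inr ENNReal.ofReal_ne_top)).liminf_eq.ge
      _ ≤ liminf (fun n => ∫⁻ t, ‖f n t‖ₑ * ENNReal.ofReal ((1 + |t|) ^ s)) atTop :=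
          lintegral_liminf_le' fun n => (hm n).enorm.mul hWm.aemeasurable
      _ ≤ B := by
          refine (liminf_le_liminf (Eventually.of_forall hw)).trans ?_
          simp
  have hint : ∀ u : ℝ → ℂ, AEStronglyMeasurable u →
      ∫⁻ t, ‖u t‖ₑ * ENNReal.ofReal ((1 + |t|) ^ s) ≤ B → Integrable u := by
    intro u hu hub
    refine ⟨hu, lt_of_le_of_lt ?_ hB.lt_top⟩
    refine (lintegral_mono fun t => ?_).trans hub
    exact le_mul_of_one_le_right zero_le (hW1 t)
  have hfi : ∀ n, Integrable (f n) := fun n => hint _ (hm n) (hw n)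
  have hgi : Integrable g := hint _ hgm hgw
  refine ⟨hgi, ?_⟩
  -- Outside [−X, X] the weight exceeds X^s, so all tails are at most X^(−s) times the common bound.
  -- On [−X, X] the local bound gives dominated convergence.
  have htail : ∀ X : ℝ, 0 < X → ∀ u : ℝ → ℂ, Integrable u →
      ∫⁻ t, ‖u t‖ₑ * ENNReal.ofReal ((1 + |t|) ^ s) ≤ B →
      ‖(∫ t, u t) - ∫ t in Icc (-X) X, u t‖ ≤ X ^ (-s) * B.toReal := by
    intro X hX u hu hub
    have h1 : (∫ t, u t) - ∫ t in Icc (-X) X, u t = ∫ t in (Icc (-X) X)ᶜ, u t := by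
      rw [← integral_add_compl measurableSet_Icc hu, add_sub_cancel_left]
    rw [h1]
    refine (norm_integral_le_lintegral_norm _).trans ?_
    rw [← ENNReal.toReal_ofReal (Real.rpow_nonneg hX.le (-s)), ← ENNReal.toReal_mul]
    refine ENNReal.toReal_mono (ENNReal.mul_ne_top ENNReal.ofReal_ne_top hB) ?_
    calc ∫⁻ t in (Icc (-X) X)ᶜ, ENNReal.ofReal ‖u t‖
        ≤ ∫⁻ t in (Icc (-X) X)ᶜ, ENNReal.ofReal (X ^ (-s))
            * (‖u t‖ₑ * ENNReal.ofReal ((1 + |t|) ^ s)) := by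
          refine setLIntegral_mono_ae' measurableSet_Icc.compl (ae_of_all _ fun t ht => ?_)
          have htX : X ≤ 1 + |t| := by
            by_contra! hlt
            exact ht (abs_le.1 (by linarith))
          rw [ofReal_norm, mul_left_comm, ← ENNReal.ofReal_mul (Real.rpow_nonneg hX.le _)]
          refine le_mul_of_one_le_right zero_le ?_
          rw [ENNReal.one_le_ofReal, Real.rpow_neg hX.le, ← div_eq_inv_mul,
            one_le_div (Real.rpow_pos_of_pos hX _)]
          exact Real.rpow_le_rpow hX.le htX hs.le
      _ ≤ ∫⁻ t, ENNReal.ofReal (X ^ (-s)) * (‖u t‖ₑ * ENNReal.ofReal ((1 + |t|) ^ s)) :=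
          setLIntegral_le_lintegral _ _
      _ = ENNReal.ofReal (X ^ (-s)) * ∫⁻ t, (‖u t‖ₑ * ENNReal.ofReal ((1 + |t|) ^ s)) :=
          lintegral_const_mul' _ _ ENNReal.ofReal_ne_top
      _ ≤ _ := by gcongr
  have hcut : ∀ X : ℝ, Tendsto (fun n => ∫ t in Icc (-X) X, f n t) atTop
      (𝓝 (∫ t in Icc (-X) X, g t)) := by
    intro X
    obtain ⟨C, hC⟩ := hloc X
    refine tendsto_integral_of_dominated_convergence (fun _ => C) (fun n => (hm n).restrict)
      (integrable_const C) (fun n => ?_) (ae_restrict_of_ae hlim)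
    filter_upwards [ae_restrict_mem measurableSet_Icc] with t ht
    exact hC n t (abs_le.2 ht)
  have hzero : Tendsto (fun X : ℝ => X ^ (-s) * B.toReal) atTop (𝓝 0) := by
    simpa using (tendsto_rpow_neg_atTop hs).mul_const B.toReal
  rw [Metric.tendsto_atTop]
  intro ε hε
  obtain ⟨X, hX, hX0⟩ := ((hzero.eventually (gt_mem_nhds (show 0 < ε / 3 by positivity))).and
    (eventually_gt_atTop 0)).exists
  obtain ⟨n0, hn0⟩ := Metric.tendsto_atTop.1 (hcut X) (ε / 3) (by positivity)
  refine ⟨n0, fun n hn => ?_⟩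
  have e1 := htail X hX0 _ (hfi n) (hw n)
  have e2 := htail X hX0 _ hgi hgw
  have e3 := hn0 n hn
  rw [dist_eq_norm] at e3 ⊢
  have e4 : (∫ t, f n t) - ∫ t, g t = ((∫ t, f n t) - ∫ t in Icc (-X) X, f n t)
      + ((∫ t in Icc (-X) X, f n t) - ∫ t in Icc (-X) X, g t)
      + -((∫ t, g t) - ∫ t in Icc (-X) X, g t) := by ring
  rw [e4]
  refine (norm_add₃_le).trans_lt ?_
  rw [norm_neg]
  linarith

/-- Pointwise convergence of equi-Lipschitz functions is locally uniform. -/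
lemma tendstoLocallyUniformlyOn_of_lipschitz {U : Set ℂ} {f : ℕ → ℂ → ℂ} {g : ℂ → ℂ} {K : ℝ}
    (hK : 0 < K) (hf : ∀ n, ∀ z ∈ U, ∀ w ∈ U, ‖f n z - f n w‖ ≤ K * ‖z - w‖)
    (hlim : ∀ z ∈ U, Tendsto (fun n => f n z) atTop (𝓝 (g z))) :
    TendstoLocallyUniformlyOn f g atTop U := by
  have hg : ∀ z ∈ U, ∀ w ∈ U, ‖g z - g w‖ ≤ K * ‖z - w‖ := fun z hz w hw =>
    le_of_tendsto ((hlim z hz).sub (hlim w hw)).norm (Eventually.of_forall fun n => hf n z hz w hw)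
  rw [Metric.tendstoLocallyUniformlyOn_iff]
  intro ε hε x hx
  refine ⟨Metric.ball x (ε / (3 * K)) ∩ U, ?_, ?_⟩
  · exact inter_mem (mem_nhdsWithin_of_mem_nhds (Metric.ball_mem_nhds _ (by positivity)))
      self_mem_nhdsWithin
  · filter_upwards [Metric.tendsto_atTop.1 (hlim x hx) (ε / 3) (by positivity) |>.elim
      fun n0 h => eventually_atTop.2 ⟨n0, h⟩] with n hn y hy
    have h1 : K * ‖x - y‖ < ε / 3 := by
      have := hy.1
      rw [Metric.mem_ball, dist_eq_norm, norm_sub_rev, lt_div_iff₀ (by positivity)] at this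
      linarith
    have h2 := hg y hy.2 x hx
    have h3 := hf n x hx y hy.2
    rw [norm_sub_rev y x] at h2
    rw [dist_eq_norm, norm_sub_rev] at hn
    rw [dist_eq_norm, show g y - f n y = (g y - g x) + (g x - f n x) + (f n x - f n y) by ring]
    exact (norm_add₃_le).trans_lt (by linarith)

/-! ### The undeformed measure -/

lemma continuousOn_of_isHolderOn {ρ0 : ℝ → ℝ} (hH : ∀ M : ℝ, IsHolderOn ρ0 (Icc 0 M)) :
    ContinuousOn ρ0 (Ici 0) := by
  intro x hx
  obtain ⟨C, α, hα, -, hC⟩ := hH (x + 1)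
  refine (hC.continuousOn hα x ⟨hx, by linarith⟩).mono_of_mem_nhdsWithin ?_
  have h1 : Iic (x + 1) ∈ 𝓝[Ici 0] x := mem_nhdsWithin_of_mem_nhds (Iic_mem_nhds (by linarith))
  filter_upwards [h1, self_mem_nhdsWithin] with t h2 h3 using ⟨h3, h2⟩

/-- The spectral dimension is strictly below D + 2 because 𝔇/2 < ⌊𝔇/2⌋ + 1, so an exponent smaller
than D/2 + 1 already integrates ρ0. The gap between the two exponents provides tightness when the
cut-off is removed. -/
lemma exists_integrableOn_rpow {ρ0 : ℝ → ℝ} (hρ0 : ∀ t, 0 ≤ t → 0 ≤ ρ0 t)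
    (hc : ContinuousOn ρ0 (Ici 0)) (hdim : spectralDimension ρ0 < 6) :
    ∃ p : ℝ, 0 < p ∧ p < (evenDim ρ0 / 2 : ℕ) + 1 ∧
      IntegrableOn (fun t => ρ0 t * (1 + t) ^ (-p)) (Ici 0) := by
  have htop : spectralDimension ρ0 ≠ ∞ := hdim.ne_top
  set x := (spectralDimension ρ0).toReal with hx
  have he : evenDim ρ0 / 2 = ⌊x / 2⌋₊ := by
    rw [evenDim, ← hx]
    omega
  have hlt : x < 2 * (⌊x / 2⌋₊ + 1) := by
    linarith [Nat.lt_floor_add_one (x / 2)]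
  have hlt' : spectralDimension ρ0 < ENNReal.ofReal (2 * (⌊x / 2⌋₊ + 1)) :=
    (ENNReal.lt_ofReal_iff_toReal_lt htop).2 hlt
  obtain ⟨_, ⟨q, hq, rfl, hfin⟩, hqlt⟩ := exists_lt_of_csInf_lt (by
    by_contra hne
    rw [not_nonempty_iff_eq_empty] at hne
    rw [spectralDimension, hne, sInf_empty] at htop
    exact htop rfl) hlt'
  rw [ENNReal.ofReal_lt_ofReal_iff (by positivity)] at hqlt
  have heq : ∀ t ∈ Ici (0 : ℝ), ρ0 t / (1 + t) ^ (q / 2) = ρ0 t * (1 + t) ^ (-(q / 2)) :=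
    fun t ht => by
      have : 0 ≤ 1 + t := by linarith [mem_Ici.1 ht]
      rw [Real.rpow_neg this, div_eq_mul_inv]
  have hcont : ContinuousOn (fun t => ρ0 t * (1 + t) ^ (-(q / 2))) (Ici 0) := by
    refine hc.mul (ContinuousOn.rpow_const (by fun_prop) fun t ht => Or.inl ?_)
    have := mem_Ici.1 ht
    positivity
  refine ⟨q / 2, by positivity, by rw [he]; linarith, hcont.aestronglyMeasurable measurableSet_Ici,
    ?_⟩
  refine lt_of_le_of_lt (le_of_eq ?_) hfin
  refine setLIntegral_congr_fun measurableSet_Ici fun t ht => ?_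
  have : 0 ≤ t := ht
  have h2 := hρ0 t this
  simp only
  rw [← ofReal_norm, Real.norm_of_nonneg (by positivity), heq t ht]

lemma ContrData.deriv_re_ge {m θ δ ν : ℝ} {R : ℂ → ℂ} (H : ContrData m θ δ ν R) {s : ℝ}
    (hs : ν ≤ s) : 1 - θ ≤ (deriv R s).re := by
  have h := (Complex.abs_re_le_norm _).trans (H.norm_deriv_sub_one_le (H.ofReal_mem hs))
  rw [Complex.sub_re, Complex.one_re, abs_le] at h
  linarith [h.1]

lemma ContrData.re_le {m θ δ ν : ℝ} {R : ℂ → ℂ} (H : ContrData m θ δ ν R) {s : ℝ}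
    (hs : ν ≤ s) : (R s).re ≤ 2 * (s - ν) := by
  have h := H.contr s ν (H.ofReal_mem hs) (H.ofReal_mem le_rfl)
  have h2 := (Complex.abs_re_le_norm _).trans h
  rw [H.zero, sub_zero, ← Complex.ofReal_sub, Complex.norm_real, Real.norm_eq_abs,
    abs_of_nonneg (a := s - ν) (by linarith), abs_le, Complex.sub_re, Complex.ofReal_re] at h2
  nlinarith [h2.2, H.θ_lt]

/-- The deformed measure inherits the integrability of the undeformed one, uniformly in the
cut-off. -/
lemma CutData.integral_rpow_le {lam A B m θ δ ν L Λ : ℝ} {ρ ρ0 : ℝ → ℝ} {R : ℂ → ℂ}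
    (H : CutData lam A B m θ δ ν L ρ R) (hνL : ν ≤ L) (hL : R L = (Λ : ℂ) ^ 2)
    (hρ : ∀ s ∈ Icc ν L, ρ s = ρ0 (R s).re) (hρ0 : ∀ t, 0 ≤ t → 0 ≤ ρ0 t) {p : ℝ} (hp : 0 < p)
    (hi : IntegrableOn (fun t => ρ0 t * (1 + t) ^ (-p)) (Ici 0)) :
    IntegrableOn (fun t => ρ t * (t + 2 * m) ^ (-p)) (Icc ν L) ∧
    ∫ t in Icc ν L, ρ t * (t + 2 * m) ^ (-p)
      ≤ (1 - θ)⁻¹ * (m⁻¹ + 2) ^ p * ∫ t in Ici 0, ρ0 t * (1 + t) ^ (-p) := by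
  have hm := H.m_pos
  have hν := H.contr_neg
  have hθ := H.θ_lt
  have hθ' : 0 < 1 - θ := by linarith
  have hLre : (R L).re = Λ ^ 2 := by rw [hL, ← Complex.ofReal_pow, Complex.ofReal_re]
  set r : ℝ → ℝ := fun s => (R s).re with hr
  have himg : r '' Icc ν L = Icc 0 (Λ ^ 2) := by rw [hr, H.image_re_Icc hνL, hLre]
  have hderiv : ∀ s ∈ Icc ν L, HasDerivWithinAt r ((deriv R s).re) (Icc ν L) s := fun s hs =>
    (H.hasDerivAt_re hs.1).hasDerivWithinAt
  have hinj : InjOn r (Icc ν L) := H.re_strictMonoOn.injOn.mono fun s hs => hs.1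
  have hsub : Icc 0 (Λ ^ 2) ⊆ Ici (0 : ℝ) := fun t ht => ht.1
  have hi' := hi.mono_set hsub
  have i1 : IntegrableOn (fun s : ℝ => |(deriv R s).re| • (ρ0 (r s) * (1 + r s) ^ (-p)))
      (Icc ν L) := by
    rw [← himg] at hi'
    exact (integrableOn_image_iff_integrableOn_abs_deriv_smul measurableSet_Icc hderiv hinj _).1 hi'
  have e1 := integral_image_eq_integral_abs_deriv_smul measurableSet_Icc hderiv hinj
    (fun t => ρ0 t * (1 + t) ^ (-p))
  rw [himg] at e1
  have e2 : ∫ t in Icc 0 (Λ ^ 2), ρ0 t * (1 + t) ^ (-p) ≤ ∫ t in Ici 0, ρ0 t * (1 + t) ^ (-p) := by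
    refine setIntegral_mono_set hi ?_ (Eventually.of_forall hsub)
    filter_upwards [ae_restrict_mem measurableSet_Ici] with t ht
    have : 0 ≤ t := ht
    have := hρ0 t this
    positivity
  have i2 : IntegrableOn (fun t => ρ t * (t + 2 * m) ^ (-p)) (Icc ν L) := by
    refine (H.cont.mul (ContinuousOn.rpow_const (by fun_prop) fun t ht =>
      Or.inl ?_)).integrableOn_Icc
    linarith [ht.1]
  refine ⟨i2, ?_⟩
  -- The factor (1 − θ)⁻¹ inserts the Jacobian, as R' ≥ 1 − θ; the factor (m⁻¹ + 2)^p comes from 1 +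
  -- R(s) ≤ (m⁻¹ + 2)(s + 2m).
  calc ∫ t in Icc ν L, ρ t * (t + 2 * m) ^ (-p)
      ≤ ∫ s in Icc ν L, (1 - θ)⁻¹ * (m⁻¹ + 2) ^ p
          * |(deriv R s).re| • (ρ0 (r s) * (1 + r s) ^ (-p)) := by
        refine setIntegral_mono_on i2 (i1.const_mul _) measurableSet_Icc fun s hs => ?_
        have h1 := H.re_nonneg hs.1
        have h2 := H.re_le hs.1
        have h3 := H.deriv_re_ge hs.1
        have h4 := hρ0 _ h1
        have hT : 0 < s + 2 * m := by linarith [hs.1]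
        have h5 : 1 + r s ≤ (m⁻¹ + 2) * (s + 2 * m) := by
          have : 1 ≤ m⁻¹ * (s + 2 * m) := by
            rw [← div_eq_inv_mul, one_le_div hm]
            linarith [hs.1]
          simp only [hr]
          linarith
        have h6 : (s + 2 * m) ^ (-p) ≤ (m⁻¹ + 2) ^ p * (1 + r s) ^ (-p) := by
          rw [Real.rpow_neg hT.le, Real.rpow_neg (by simp only [hr]; linarith), ← div_eq_mul_inv,
            inv_eq_one_div, div_le_div_iff₀ (by positivity)
              (Real.rpow_pos_of_pos (by simp only [hr]; linarith) _), one_mul,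
            ← Real.mul_rpow (by positivity) hT.le]
          exact Real.rpow_le_rpow (by simp only [hr]; linarith) h5 hp.le
        have h7 : 1 ≤ (1 - θ)⁻¹ * |(deriv R s).re| := by
          rw [← div_eq_inv_mul, one_le_div hθ', abs_of_pos (by linarith)]
          exact h3
        have h8 : 0 ≤ ρ0 (r s) * ((m⁻¹ + 2) ^ p * (1 + r s) ^ (-p)) :=
          mul_nonneg h4 (le_trans (Real.rpow_nonneg hT.le _) h6)
        rw [hρ s hs, smul_eq_mul]
        calc ρ0 (R s).re * (s + 2 * m) ^ (-p)
            ≤ ρ0 (r s) * ((m⁻¹ + 2) ^ p * (1 + r s) ^ (-p)) := mul_le_mul_of_nonneg_left h6 h4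
          _ ≤ ((1 - θ)⁻¹ * |(deriv R s).re|)
              * (ρ0 (r s) * ((m⁻¹ + 2) ^ p * (1 + r s) ^ (-p))) :=
            le_mul_of_one_le_left h8 h7
          _ = _ := by ring
    _ = (1 - θ)⁻¹ * (m⁻¹ + 2) ^ p * ∫ t in Icc 0 (Λ ^ 2), ρ0 t * (1 + t) ^ (-p) := by
        rw [integral_const_mul, e1]
    _ ≤ _ := by gcongr

end QuarticMatrix
-- Removing the cut-off: convergence of R_D.
namespace QuarticMatrix

open VerticalLine ComplexConjugate LineNear

/-- A sequence of deformations whose cut-offs are removed, with its uniform bounds. -/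
structure DeformSeq (D : ℕ) (μ lam θ c N p : ℝ) (ρ0 : ℝ → ℝ) (Λ ν L : ℕ → ℝ) (ρ : ℕ → ℝ → ℝ)
    (ρlim : ℝ → ℝ) (νlim : ℝ) : Prop where
  hD : D = 0 ∨ D = 2 ∨ D = 4
  hμ : 0 < μ
  ρ0_nonneg : ∀ t, 0 ≤ t → 0 ≤ ρ0 t
  ρ0_cont : ContinuousOn ρ0 (Ici 0)
  p_pos : 0 < p
  p_lt : p < (D / 2 : ℕ) + 1
  ρ0_int : IntegrableOn (fun t => ρ0 t * (1 + t) ^ (-p)) (Ici 0)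
  Λ_pos : ∀ n, 0 < Λ n
  Λ_top : Tendsto Λ atTop atTop
  deform : ∀ n, IsDeformation D μ lam ρ0 (Λ n) (ρ n) (ν n) (L n)
  θ_lt : θ < 1
  coupling : ∀ n, |lam| * couplingBound D μ (ρ n) (Icc (ν n) (L n)) ≤ θ
  c_pos : 0 < c
  c_le : ∀ n, c ≤ ν n + μ ^ 2 / 2
  abs_ν_le : ∀ n, |ν n| ≤ N
  ν_tendsto : Tendsto ν atTop (𝓝 νlim)
  ρ_tendsto : ∀ x, νlim < x → Tendsto (fun n => ρ n x) atTop (𝓝 (ρlim x))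

namespace DeformSeq

variable {D : ℕ} {μ lam θ c N p : ℝ} {ρ0 : ℝ → ℝ} {Λ ν L : ℕ → ℝ} {ρ : ℕ → ℝ → ℝ}
  {ρlim : ℝ → ℝ} {νlim : ℝ}

lemma cutData (H : DeformSeq D μ lam θ c N p ρ0 Λ ν L ρ ρlim νlim) (n : ℕ) :
    CutData lam (slopeR D μ lam (ρ n) (Icc (ν n) (L n))) (shiftR D μ lam (ρ n) (Icc (ν n) (L n)))
      (μ ^ 2 / 2) ((1 + θ) / 2) (margin μ c θ) (ν n) (L n) (ρ n)
      (R D μ lam (ρ n) (Icc (ν n) (L n))) :=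
  (H.deform n).cutData H.hD H.hμ H.ρ0_nonneg (H.coupling n) H.θ_lt H.c_pos (H.c_le n)

lemma c_le_lim (H : DeformSeq D μ lam θ c N p ρ0 Λ ν L ρ ρlim νlim) : c ≤ νlim + μ ^ 2 / 2 :=
  ge_of_tendsto (H.ν_tendsto.add_const _) (Eventually.of_forall H.c_le)

lemma abs_lim_le (H : DeformSeq D μ lam θ c N p ρ0 Λ ν L ρ ρlim νlim) : |νlim| ≤ N :=
  le_of_tendsto H.ν_tendsto.abs (Eventually.of_forall H.abs_ν_le)

lemma margin_le (H : DeformSeq D μ lam θ c N p ρ0 Λ ν L ρ ρlim νlim) : margin μ c θ ≤ c / 4 := by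
  have h1 : margin μ c θ ≤ c * (1 - θ) / 8 := min_le_right _ _
  have h2 : 0 ≤ (1 + θ) / 2 := (H.cutData 0).θ_nonneg
  nlinarith [H.c_pos]

/-- R grows at most with slope 2, so R(L_n) = Λ_n² forces L_n ≥ Λ_n²/2 + ν_n; the linear lower bound
Λ_n/2 − N is weaker but sufficient. -/
lemma tendsto_L (H : DeformSeq D μ lam θ c N p ρ0 Λ ν L ρ ρlim νlim) :
    Tendsto L atTop atTop := by
  have h1 : Tendsto (fun n => Λ n / 2 - N) atTop atTop :=
    tendsto_atTop_add_const_right _ _ (H.Λ_top.atTop_div_const two_pos)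
  refine tendsto_atTop_mono' _ ?_ h1
  filter_upwards [H.Λ_top.eventually_ge_atTop 1] with n hn
  have h2 := (H.cutData n).re_le ((H.deform n).lt (H.Λ_pos n)).le
  rw [(H.deform n).map_right, ← Complex.ofReal_pow, Complex.ofReal_re] at h2
  nlinarith [neg_abs_le (ν n), H.abs_ν_le n]

lemma eventually_mem (H : DeformSeq D μ lam θ c N p ρ0 Λ ν L ρ ρlim νlim) {t : ℝ}
    (ht : νlim < t) : ∀ᶠ n in atTop, t ∈ Icc (ν n) (L n) := by
  filter_upwards [H.ν_tendsto.eventually_lt_const ht, H.tendsto_L.eventually_ge_atTop t] with n h1 h2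
    using ⟨h1.le, h2⟩

lemma ρ_nonneg (H : DeformSeq D μ lam θ c N p ρ0 Λ ν L ρ ρlim νlim) (n : ℕ) {t : ℝ}
    (ht : t ∈ Icc (ν n) (L n)) : 0 ≤ ρ n t := by
  rw [(H.deform n).deform t ht]
  exact H.ρ0_nonneg _ ((H.deform n).maps_to t ht).1

/-- A uniform bound for the deformed measures. -/
lemma exists_integral_le (H : DeformSeq D μ lam θ c N p ρ0 Λ ν L ρ ρlim νlim) :
    ∃ B, 0 ≤ B ∧ ∀ n, IntegrableOn (fun t => ρ n t * (t + μ ^ 2) ^ (-p)) (Icc (ν n) (L n)) ∧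
      ∫ t in Icc (ν n) (L n), ρ n t * (t + μ ^ 2) ^ (-p) ≤ B := by
  have h : ∀ n, _ := fun n => (H.cutData n).integral_rpow_le ((H.deform n).lt (H.Λ_pos n)).le
    (H.deform n).map_right (H.deform n).deform H.ρ0_nonneg H.p_pos H.ρ0_int
  have e : 2 * (μ ^ 2 / 2) = μ ^ 2 := by ring
  rw [e] at h
  refine ⟨_, ?_, h⟩
  refine le_trans ?_ (h 0).2
  refine setIntegral_nonneg measurableSet_Icc fun t ht => mul_nonneg (H.ρ_nonneg 0 ht)
    (Real.rpow_nonneg ?_ _)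
  linarith [H.c_le 0, H.c_pos, ht.1, sq_nonneg μ]

/-- Convergence of integrals against the deformed measures. -/
theorem tendsto_integral (H : DeformSeq D μ lam θ c N p ρ0 Λ ν L ρ ρlim νlim) {q : ℝ → ℂ} {C : ℝ}
    (hq : ContinuousOn q (Ici (-(μ ^ 2 / 2) + c)))
    (hqb : ∀ t, -(μ ^ 2 / 2) + c ≤ t → ‖q t‖ ≤ C * (t + μ ^ 2) ^ (-((D / 2 : ℕ) + 1 : ℝ))) :
    IntegrableOn (fun t => (ρlim t : ℂ) * q t) (Ioi νlim) ∧
    Tendsto (fun n => ∫ t in Icc (ν n) (L n), (ρ n t : ℂ) * q t) atTop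
      (𝓝 (∫ t in Ioi νlim, (ρlim t : ℂ) * q t)) := by
  have hc := H.c_pos
  have hμ := H.hμ
  set m := μ ^ 2 / 2 with hm
  have hm0 : 0 < m := by positivity
  have hμm : μ ^ 2 = 2 * m := by rw [hm]; ring
  rw [hμm] at hqb
  obtain ⟨B, hB, hBn⟩ := H.exists_integral_le
  rw [hμm] at hBn
  set k : ℝ := (D / 2 : ℕ) + 1 with hk
  have hk0 : 0 < k := by positivity
  have hC : 0 ≤ C := by
    have h1 := (norm_nonneg _).trans (hqb (-m + c) le_rfl)
    exact nonneg_of_mul_nonneg_left h1 (Real.rpow_pos_of_pos (by linarith) _)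
  -- The gap between the decay k of the test function and the integrability exponent p serves as the
  -- growing weight.
  have hs : 0 < k - p := by linarith [H.p_lt]
  have hin : ∀ n, ∀ t ∈ Icc (ν n) (L n), -m + c ≤ t := fun n t ht => by
    linarith [H.c_le n, ht.1]
  set f : ℕ → ℝ → ℂ := fun n => (Icc (ν n) (L n)).indicator fun t => (ρ n t : ℂ) * q t with hf
  set g : ℝ → ℂ := (Ioi νlim).indicator fun t => (ρlim t : ℂ) * q t with hg
  have hfm : ∀ n, AEStronglyMeasurable (f n) := fun n => by
    rw [hf, aestronglyMeasurable_indicator_iff measurableSet_Icc]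
    exact ((Complex.continuous_ofReal.comp_continuousOn (H.deform n).continuousOn).mul
      (hq.mono (hin n))).aestronglyMeasurable measurableSet_Icc
  have hlim : ∀ᵐ t, Tendsto (fun n => f n t) atTop (𝓝 (g t)) := by
    -- At νlim itself the indicator functions of [ν_n, L_n] need not converge; a single point does
    -- not matter.
    filter_upwards [Measure.ae_ne volume νlim] with t ht
    rcases ht.lt_or_gt with hlt | hgt
    · rw [hg, indicator_of_notMem (by simpa using hlt.le)]
      refine tendsto_const_nhds.congr' ?_
      filter_upwards [H.ν_tendsto.eventually_const_lt hlt] with n hn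
      exact (indicator_of_notMem (s := Icc (ν n) (L n)) (fun h => absurd h.1 (not_le.2 hn))
        fun t => (ρ n t : ℂ) * q t).symm
    · rw [hg, indicator_of_mem (by exact hgt)]
      have h1 := ((Complex.continuous_ofReal.tendsto _).comp (H.ρ_tendsto t hgt)).mul_const (q t)
      refine h1.congr' ?_
      filter_upwards [H.eventually_mem hgt] with n hn
      exact (indicator_of_mem hn fun t => (ρ n t : ℂ) * q t).symm
  have hw : ∀ n, ∫⁻ t, ‖f n t‖ₑ * ENNReal.ofReal ((1 + |t|) ^ (k - p))
      ≤ ENNReal.ofReal (C * (1 + m⁻¹) ^ (k - p) * B) := by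
    intro n
    obtain ⟨i1, e1⟩ := hBn n
    have hle : ∀ t, ‖f n t‖ₑ * ENNReal.ofReal ((1 + |t|) ^ (k - p))
        ≤ (Icc (ν n) (L n)).indicator (fun t => ENNReal.ofReal
          (C * (1 + m⁻¹) ^ (k - p) * (ρ n t * (t + 2 * m) ^ (-p)))) t := by
      intro t
      by_cases ht : t ∈ Icc (ν n) (L n)
      · have ht' := hin n t ht
        have hT : 0 < t + 2 * m := by linarith
        have hρ := H.ρ_nonneg n ht
        have h1 : 1 + |t| ≤ (1 + m⁻¹) * (t + 2 * m) := by
          have h2 : |t| ≤ t + 2 * m := abs_le.2 ⟨by linarith, by linarith⟩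
          have h3 : 1 ≤ m⁻¹ * (t + 2 * m) := by
            rw [← div_eq_inv_mul, one_le_div hm0]
            linarith
          linarith
        rw [hf, indicator_of_mem ht]
        simp only
        rw [indicator_of_mem ht, ← ofReal_norm, ← ENNReal.ofReal_mul (norm_nonneg _)]
        refine ENNReal.ofReal_le_ofReal ?_
        rw [norm_mul, Complex.norm_real, Real.norm_of_nonneg hρ]
        calc ρ n t * ‖q t‖ * (1 + |t|) ^ (k - p)
            ≤ ρ n t * (C * (t + 2 * m) ^ (-k)) * ((1 + m⁻¹) * (t + 2 * m)) ^ (k - p) := by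
              gcongr
              exact hqb t ht'
          _ = C * (1 + m⁻¹) ^ (k - p) * (ρ n t * ((t + 2 * m) ^ (-k) * (t + 2 * m) ^ (k - p))) := by
              rw [Real.mul_rpow (by positivity) hT.le]
              ring
          _ = _ := by
              rw [← Real.rpow_add hT]
              congr 4
              ring
      · rw [hf, indicator_of_notMem ht]
        simp only
        rw [indicator_of_notMem ht, enorm_zero, zero_mul]
    refine (lintegral_mono hle).trans ?_
    rw [lintegral_indicator measurableSet_Icc, ← ofReal_integral_eq_lintegral_ofReal
      (i1.const_mul _), integral_const_mul]
    · exact ENNReal.ofReal_le_ofReal (by gcongr)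
    · filter_upwards [ae_restrict_mem measurableSet_Icc] with t ht
      have := H.ρ_nonneg n ht
      have hT : 0 ≤ t + 2 * m := by linarith [hin n t ht]
      simp only [Pi.zero_apply]
      positivity
  -- Locally ρ_n = ρ0 ∘ R_n, with R_n(t) ≤ 2(t − ν_n) in a fixed compact interval on which ρ0 is
  -- bounded.
  have hloc : ∀ X : ℝ, ∃ K : ℝ, ∀ n t, |t| ≤ X → ‖f n t‖ ≤ K := by
    intro X
    obtain ⟨Kρ, hKρ⟩ := isCompact_Icc.exists_bound_of_continuousOn
      (H.ρ0_cont.mono (show Icc 0 (2 * (X + N)) ⊆ Ici 0 from fun t ht => ht.1))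
    refine ⟨|Kρ| * (C * m ^ (-k)), fun n t ht => ?_⟩
    by_cases htm : t ∈ Icc (ν n) (L n)
    · rw [hf]
      simp only
      rw [indicator_of_mem htm, norm_mul, Complex.norm_real, (H.deform n).deform t htm]
      have h1 := (H.cutData n).re_nonneg htm.1
      have h2 := (H.cutData n).re_le htm.1
      have h3 := hin n t htm
      refine mul_le_mul ((hKρ _ ⟨h1, ?_⟩).trans (le_abs_self _)) ((hqb t h3).trans ?_)
        (norm_nonneg _) (abs_nonneg _)
      · linarith [le_abs_self t, neg_abs_le (ν n), H.abs_ν_le n]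
      · have : (t + 2 * m) ^ (-k) ≤ m ^ (-k) :=
          Real.rpow_le_rpow_of_nonpos hm0 (by linarith) (by linarith)
        gcongr
    · rw [hf]
      simp only
      rw [indicator_of_notMem htm, norm_zero]
      positivity
  obtain ⟨h1, h2⟩ := tendsto_integral_of_weight hs ENNReal.ofReal_ne_top hfm hlim hw hloc
  rw [hg, integrable_indicator_iff measurableSet_Ioi] at h1
  simp_rw [hf, hg, integral_indicator measurableSet_Icc, integral_indicator measurableSet_Ioi] at h2
  exact ⟨h1, h2⟩

lemma rpow_neg_natCast_add_one {x : ℝ} (hx : 0 < x) (k : ℕ) :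
    x ^ (-((k : ℝ) + 1)) = (x ^ (k + 1))⁻¹ := by
  rw [Real.rpow_neg hx.le, ← Nat.cast_add_one, Real.rpow_natCast]

lemma norm_kern_le {c' t : ℝ} (hc : 0 < c') (k : ℕ) {z : ℂ}
    (ht : 0 < t + μ ^ 2) (hz : c' * (t + μ ^ 2) ≤ ‖(t : ℂ) + (μ : ℂ) ^ 2 + z‖) :
    ‖kern k (t + (μ : ℂ) ^ 2) z‖ ≤ ‖z‖ ^ k * c'⁻¹ * (t + μ ^ 2) ^ (-((k : ℝ) + 1)) := by
  have h1 : ‖(t : ℂ) + (μ : ℂ) ^ 2‖ = t + μ ^ 2 := by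
    rw [← Complex.ofReal_pow, ← Complex.ofReal_add, Complex.norm_real, Real.norm_of_nonneg ht.le]
  rw [rpow_neg_natCast_add_one ht, kern, norm_div, norm_mul, norm_pow, norm_pow, norm_neg, h1,
    mul_assoc, ← mul_inv, ← div_eq_mul_inv]
  refine div_le_div_of_nonneg_left (by positivity) (by positivity) ?_
  calc c' * (t + μ ^ 2) ^ (k + 1) = (t + μ ^ 2) ^ k * (c' * (t + μ ^ 2)) := by ring
    _ ≤ _ := mul_le_mul_of_nonneg_left hz (by positivity)

lemma tendsto_R (H : DeformSeq D μ lam θ c N p ρ0 Λ ν L ρ ρlim νlim) {z : ℂ}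
    (hz : -(μ ^ 2 / 2) - margin μ c θ < z.re) :
    Tendsto (fun n => R D μ lam (ρ n) (Icc (ν n) (L n)) z) atTop
      (𝓝 (R D μ lam ρlim (Ioi νlim) z)) := by
  have hc := H.c_pos
  have hμ := H.hμ
  have hδ := H.margin_le
  have hμ2 : 0 < μ ^ 2 := by positivity
  set c' := c / 2 / (μ ^ 2 / 2 + c) with hc'
  have hc'0 : 0 < c' := by positivity
  have hlow : ∀ t, -(μ ^ 2 / 2) + c ≤ t → c' * (t + μ ^ 2) ≤ ‖(t : ℂ) + (μ : ℂ) ^ 2 + z‖ := by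
    intro t ht
    have h2 := (le_abs_self _).trans (Complex.abs_re_le_norm ((t : ℂ) + (μ : ℂ) ^ 2 + z))
    rw [← Complex.ofReal_pow, Complex.add_re, Complex.add_re, Complex.ofReal_re,
      Complex.ofReal_re, Complex.ofReal_pow] at h2
    refine le_trans ?_ h2
    rw [hc', div_mul_eq_mul_div, div_le_iff₀ (by positivity)]
    nlinarith
  simp_rw [R_eq]
  refine tendsto_const_nhds.sub (Tendsto.const_mul _ (H.tendsto_integral (C := ‖z‖ ^ (D / 2) * c'⁻¹)
    ?_ ?_).2)
  · have h1 : ContinuousOn (fun t : ℝ => (t : ℂ) + (μ : ℂ) ^ 2) (Ici (-(μ ^ 2 / 2) + c)) := by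
      fun_prop
    refine continuousOn_const.div ((h1.pow _).mul (h1.add continuousOn_const)) fun t ht => ?_
    have ht' : -(μ ^ 2 / 2) + c ≤ t := ht
    refine mul_ne_zero (pow_ne_zero _ fun h => ?_) fun h => ?_
    · have h2 : t + μ ^ 2 = 0 := by exact_mod_cast h
      linarith
    · have h2 := hlow t ht'
      rw [h, norm_zero] at h2
      nlinarith [mul_pos hc'0 (show 0 < t + μ ^ 2 by linarith)]
  · intro t ht
    exact norm_kern_le hc'0 _ (by linarith) (hlow t ht)

/-- The contraction property makes the sequence equi-Lipschitz with constant 2. Locally uniform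
convergence is what carries holomorphy and derivatives to the limit. -/
lemma tendstoLocallyUniformlyOn_R (H : DeformSeq D μ lam θ c N p ρ0 Λ ν L ρ ρlim νlim) :
    TendstoLocallyUniformlyOn (fun n => R D μ lam (ρ n) (Icc (ν n) (L n)))
      (R D μ lam ρlim (Ioi νlim)) atTop {z | -(μ ^ 2 / 2) - margin μ c θ < z.re} := by
  refine tendstoLocallyUniformlyOn_of_lipschitz two_pos (fun n z hz w hw => ?_)
    fun z hz => H.tendsto_R hz
  have h1 := (H.cutData n).contr z w hz hw
  have h2 := norm_add_le (R D μ lam (ρ n) (Icc (ν n) (L n)) z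
    - R D μ lam (ρ n) (Icc (ν n) (L n)) w - (z - w)) (z - w)
  rw [sub_add_cancel] at h2
  nlinarith [(H.cutData n).θ_lt, norm_nonneg (z - w)]

/-- The inequalities are closed conditions and pass to the limit, and holomorphy follows from
locally uniform convergence. The zero persists since |R_n(νlim)| ≤ 2 |νlim − ν_n|. -/
lemma contrData_lim (H : DeformSeq D μ lam θ c N p ρ0 Λ ν L ρ ρlim νlim) :
    ContrData (μ ^ 2 / 2) ((1 + θ) / 2) (margin μ c θ) νlim (R D μ lam ρlim (Ioi νlim)) where
  θ_nonneg := (H.cutData 0).θ_nonneg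
  θ_lt := (H.cutData 0).θ_lt
  δ_pos := (H.cutData 0).δ_pos
  δ_lt := (H.cutData 0).δ_lt
  δ_lt' := by linarith [H.margin_le, H.c_le_lim, H.c_pos]
  contr z w hz hw := le_of_tendsto (((H.tendsto_R hz).sub (H.tendsto_R hw)).sub_const _).norm
    (Eventually.of_forall fun n => (H.cutData n).contr z w hz hw)
  diff := H.tendstoLocallyUniformlyOn_R.differentiableOn
    (Eventually.of_forall fun n => (H.cutData n).diff) (isOpen_rightHalf _)
  conj_eq := conj_R _ _ _ _ _
  zero := by
    have hν : -(μ ^ 2 / 2) - margin μ c θ < (νlim : ℂ).re := by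
      rw [Complex.ofReal_re]
      linarith [H.c_le_lim, H.c_pos, (H.cutData 0).δ_pos]
    refine tendsto_nhds_unique (H.tendsto_R hν) ?_
    have h0 : Tendsto (fun n => 2 * ‖(νlim : ℂ) - ν n‖) atTop (𝓝 0) := by
      have h1 : Tendsto (fun n => (νlim : ℂ) - ν n) atTop (𝓝 ((νlim : ℂ) - νlim)) :=
        tendsto_const_nhds.sub ((Complex.continuous_ofReal.tendsto _).comp H.ν_tendsto)
      simpa using h1.norm.const_mul 2
    refine squeeze_zero_norm (fun n => ?_) h0
    have h1 := (H.cutData n).contr νlim (ν n) hν ((H.cutData n).ofReal_mem le_rfl)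
    rw [(H.cutData n).zero, sub_zero] at h1
    have h2 := norm_add_le (R D μ lam (ρ n) (Icc (ν n) (L n)) νlim - ((νlim : ℂ) - ν n))
      ((νlim : ℂ) - ν n)
    rw [sub_add_cancel] at h2
    nlinarith [(H.cutData n).θ_lt, norm_nonneg ((νlim : ℂ) - ν n)]

lemma tendsto_deriv_R (H : DeformSeq D μ lam θ c N p ρ0 Λ ν L ρ ρlim νlim) {z : ℂ}
    (hz : -(μ ^ 2 / 2) - margin μ c θ < z.re) :
    Tendsto (fun n => deriv (R D μ lam (ρ n) (Icc (ν n) (L n))) z) atTop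
      (𝓝 (deriv (R D μ lam ρlim (Ioi νlim)) z)) :=
  (H.tendstoLocallyUniformlyOn_R.deriv (Eventually.of_forall fun n => (H.cutData n).diff)
    (isOpen_rightHalf _)).tendsto_at hz

/-- The limit is a deformation without cut-off. -/
theorem isDeformationNoCutoff (H : DeformSeq D μ lam θ c N p ρ0 Λ ν L ρ ρlim νlim) :
    IsDeformationNoCutoff D μ lam ρ0 ρlim νlim := by
  have hc := H.c_pos
  have hμ := H.hμ
  have hμ2 : 0 < μ ^ 2 := by positivity
  have hlim := H.c_le_lim
  have HL := H.contrData_lim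
  have hre : ∀ x, νlim < x → Tendsto (fun n => (R D μ lam (ρ n) (Icc (ν n) (L n)) x).re) atTop
      (𝓝 (R D μ lam ρlim (Ioi νlim) x).re) := fun x hx =>
    (Complex.continuous_re.tendsto _).comp (H.tendsto_R (HL.ofReal_mem hx.le))
  refine ⟨mem_halfPlane.2 (by rw [Complex.ofReal_re]; linarith), ?_, HL.zero,
    fun x hx => HL.re_nonneg (le_of_lt hx), fun x hx => ?_⟩
  · have h := (H.tendsto_integral (C := 1)
      (q := fun t => (((t + μ ^ 2) ^ (D / 2 + 1) : ℝ) : ℂ)⁻¹) ?_ ?_).1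
    · have h2 := h.re
      refine IntegrableOn.congr_fun (f := fun t => RCLike.re ((ρlim t : ℂ)
        * (((t + μ ^ 2) ^ (D / 2 + 1) : ℝ) : ℂ)⁻¹)) h2 (fun t _ => ?_) measurableSet_Ioi
      simp only
      rw [← Complex.ofReal_inv, ← Complex.ofReal_mul, div_eq_mul_inv]
      exact Complex.ofReal_re _
    · refine ContinuousOn.inv₀ (by fun_prop) fun t ht => ?_
      have ht' : -(μ ^ 2 / 2) + c ≤ t := ht
      have : 0 < t + μ ^ 2 := by linarith
      exact_mod_cast (pow_pos this _).ne'
    · intro t ht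
      have : 0 < t + μ ^ 2 := by linarith
      rw [rpow_neg_natCast_add_one this, one_mul, norm_inv, Complex.norm_real,
        Real.norm_of_nonneg (by positivity)]
  · have hx' : νlim < x := hx
    -- Continuity of ρ0 is available only on [0, ∞). The values R_n(x) lie there as soon as ν_n ≤ x.
    have h1 : Tendsto (fun n => ρ0 (R D μ lam (ρ n) (Icc (ν n) (L n)) x).re) atTop
        (𝓝 (ρ0 (R D μ lam ρlim (Ioi νlim) x).re)) := by
      refine (H.ρ0_cont _ (HL.re_nonneg hx'.le)).tendsto.comp
        (tendsto_nhdsWithin_of_tendsto_nhds_of_eventually_within _ (hre x hx') ?_)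
      filter_upwards [H.eventually_mem hx'] with n hn
      exact (H.cutData n).re_nonneg hn.1
    refine tendsto_nhds_unique (H.ρ_tendsto x hx') (h1.congr' ?_)
    filter_upwards [H.eventually_mem hx'] with n hn
    exact ((H.deform n).deform x hn).symm

end DeformSeq

end QuarticMatrix
-- Uniform closeness to the undeformed line for D < 4.
namespace QuarticMatrix

open VerticalLine ComplexConjugate LineNear

lemma LineBase.mono {κ K K' : ℝ} {F F' : ℝ → ℂ} (H : LineBase κ K F F') (hK : K ≤ K') :
    LineBase κ K' F F' :=
  { H with
    up := fun t => (H.up t).trans (by gcongr)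
    up' := fun t => (H.up' t).trans hK }

/-- The logarithms of a convergent family of lines converge. -/
lemma LineBase.tendsto_logDiff {m κ K : ℝ} {Fn Fn' : ℕ → ℝ → ℂ} {F F' : ℝ → ℂ}
    (H : LineBase κ K F F') (hF : ∀ t, Tendsto (fun n => Fn n t) atTop (𝓝 (F t)))
    (hF' : ∀ t, Tendsto (fun n => Fn' n t) atTop (𝓝 (F' t))) {a b : ℝ} (ha : 0 ≤ a) (hb : 0 ≤ b)
    (t : ℝ) :
    Tendsto (fun n => logDiff m (Fn n) (Fn' n) a b t) atTop (𝓝 (logDiff m F F' a b t)) := by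
  have h1 : Tendsto (fun n => lineLog (Fn n) a (-t)) atTop (𝓝 (lineLog F a (-t))) :=
    (tendsto_const_nhds.sub (hF (-t))).clog (H.mem_slitPlane ha (-t))
  have h2 : Tendsto (fun n => lineLog' (Fn n) (Fn' n) b t) atTop (𝓝 (lineLog' F F' b t)) :=
    (hF' t).neg.div (tendsto_const_nhds.sub (hF t)) (H.ne_zero hb t)
  exact (h1.mul h2).sub_const _

lemma LineNear.tendsto_alt {A m κ K ε : ℝ} {Fn Fn' : ℕ → ℝ → ℂ} {F F' : ℝ → ℂ}
    (Hn : ∀ n, LineNear A m κ K ε (Fn n) (Fn' n)) (H : LineNear A m κ K ε F F')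
    (hF : ∀ t, Tendsto (fun n => Fn n t) atTop (𝓝 (F t)))
    (hF' : ∀ t, Tendsto (fun n => Fn' n t) atTop (𝓝 (F' t))) {a b : ℝ} (ha : 0 ≤ a) (hb : 0 ≤ b)
    (t : ℝ) :
    Tendsto (fun n => lineRatio A m (Fn n) a (-t) * lineRatio' m (Fn n) (Fn' n) b t) atTop
      (𝓝 (lineRatio A m F a (-t) * lineRatio' m F F' b t)) := by
  have h1 : Tendsto (fun n => lineLog (Fn n) a (-t)) atTop (𝓝 (lineLog F a (-t))) :=
    (tendsto_const_nhds.sub (hF (-t))).clog (H.toLineBase.mem_slitPlane ha (-t))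
  have h2 : Tendsto (fun n => lineLog' (Fn n) (Fn' n) b t) atTop (𝓝 (lineLog' F F' b t)) :=
    (hF' t).neg.div (tendsto_const_nhds.sub (hF t)) (H.toLineBase.ne_zero hb t)
  simp_rw [fun n => (Hn n).lineRatio_eq ha (-t), H.lineRatio_eq ha (-t)]
  exact ((h1.sub_const _).sub_const _).mul (h2.sub_const _)

lemma le_norm_add_vline {m c : ℝ} (hm : 0 < m) (hc : 0 < c) {T : ℝ} (hT : m + c ≤ T) (y : ℝ) :
    c / (m + c) / 2 * (T + |y|) ≤ ‖(T : ℂ) + vline (-m) y‖ := by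
  have h1 := (le_abs_self _).trans (Complex.abs_re_le_norm ((T : ℂ) + vline (-m) y))
  have h2 := Complex.abs_im_le_norm ((T : ℂ) + vline (-m) y)
  rw [Complex.add_re, Complex.ofReal_re, vline_re] at h1
  rw [Complex.add_im, Complex.ofReal_im, vline_im, zero_add] at h2
  have h3 : c / (m + c) ≤ 1 := (div_le_one (by positivity)).2 (by linarith)
  have h4 : c / (m + c) * T ≤ T + -m := by
    rw [div_mul_eq_mul_div, div_le_iff₀ (by positivity)]
    nlinarith
  nlinarith [abs_nonneg y]

/-- Interpolation between the variable of the measure and the height on the line, with T = t + μ², S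
= T + |y|, W = 1 + |y| in mind. The power T^(−q) is kept for integration against ρ and the remaining
decay is given to W; for q < 2 the resulting growth W^(q − 1) is less than linear. -/
lemma rpow_weights {m T S W q : ℝ} (hm : 0 < m) (hT : 0 < T) (hW : 0 < W) (hTS : T ≤ S)
    (hWS : m * W ≤ S) (hq1 : 1 ≤ q) (hq2 : q ≤ 2) :
    W * (T * S)⁻¹ ≤ m ^ (q - 2) * (T ^ (-q) * W ^ (q - 1)) ∧
    (S ^ 2)⁻¹ ≤ m ^ (q - 2) * (T ^ (-q) * W ^ (q - 2)) := by
  have hS : 0 < S := hT.trans_le hTS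
  have h1 : S ^ (q - 2) ≤ m ^ (q - 2) * W ^ (q - 2) := by
    rw [← Real.mul_rpow hm.le hW.le]
    exact Real.rpow_le_rpow_of_nonpos (by positivity) hWS (by linarith)
  have h2 : S ^ (1 - q) ≤ T ^ (1 - q) := Real.rpow_le_rpow_of_nonpos hT hTS (by linarith)
  have h3 : S ^ (-q) ≤ T ^ (-q) := Real.rpow_le_rpow_of_nonpos hT hTS (by linarith)
  constructor
  · have e1 : S⁻¹ = S ^ (q - 2) * S ^ (1 - q) := by
      rw [← Real.rpow_add hS, ← Real.rpow_neg_one]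
      congr 1
      ring
    have e2 : T ^ (-q) = T⁻¹ * T ^ (1 - q) := by
      rw [← Real.rpow_neg_one, ← Real.rpow_add hT]
      congr 1
      ring
    have e3 : W ^ (q - 1) = W * W ^ (q - 2) := by
      nth_rw 2 [← Real.rpow_one W]
      rw [← Real.rpow_add hW]
      congr 1
      ring
    rw [mul_inv, e1, e2, e3]
    calc W * (T⁻¹ * (S ^ (q - 2) * S ^ (1 - q)))
        ≤ W * (T⁻¹ * ((m ^ (q - 2) * W ^ (q - 2)) * T ^ (1 - q))) := by gcongr
      _ = _ := by ring
  · have e1 : (S ^ 2)⁻¹ = S ^ (q - 2) * S ^ (-q) := by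
      rw [← Real.rpow_add hS, ← Real.rpow_natCast, ← Real.rpow_neg hS.le]
      congr 1
      push_cast
      ring
    rw [e1]
    calc S ^ (q - 2) * S ^ (-q) ≤ (m ^ (q - 2) * W ^ (q - 2)) * T ^ (-q) := by gcongr
      _ = _ := by ring

namespace DeformSeq

variable {D : ℕ} {μ lam θ c N p : ℝ} {ρ0 : ℝ → ℝ} {Λ ν L : ℕ → ℝ} {ρ : ℕ → ℝ → ℝ}
  {ρlim : ℝ → ℝ} {νlim : ℝ}

lemma lineBase (H : DeformSeq D μ lam θ c N p ρ0 Λ ν L ρ ρlim νlim) (n : ℕ) :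
    LineBase ((1 - (1 + θ) / 2) * (min c 1 / 2)) (2 * (N + μ ^ 2 / 2 + 1))
      (fun t => R D μ lam (ρ n) (Icc (ν n) (L n)) (vline (-(μ ^ 2 / 2)) t))
      (fun t => deriv (R D μ lam (ρ n) (Icc (ν n) (L n))) (vline (-(μ ^ 2 / 2)) t) * Complex.I) :=
  (H.cutData n).toContrData.lineBase H.c_pos (H.c_le n) (H.abs_ν_le n)

lemma lineBase_lim (H : DeformSeq D μ lam θ c N p ρ0 Λ ν L ρ ρlim νlim) :
    LineBase ((1 - (1 + θ) / 2) * (min c 1 / 2)) (2 * (N + μ ^ 2 / 2 + 1))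
      (fun t => R D μ lam ρlim (Ioi νlim) (vline (-(μ ^ 2 / 2)) t))
      (fun t => deriv (R D μ lam ρlim (Ioi νlim)) (vline (-(μ ^ 2 / 2)) t) * Complex.I) :=
  H.contrData_lim.lineBase H.c_pos H.c_le_lim H.abs_lim_le

lemma vline_mem (H : DeformSeq D μ lam θ c N p ρ0 Λ ν L ρ ρlim νlim) (t : ℝ) :
    -(μ ^ 2 / 2) - margin μ c θ < (vline (-(μ ^ 2 / 2)) t).re := by
  rw [vline_re]
  linarith [H.contrData_lim.δ_pos]

lemma tendsto_line (H : DeformSeq D μ lam θ c N p ρ0 Λ ν L ρ ρlim νlim) (t : ℝ) :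
    Tendsto (fun n => R D μ lam (ρ n) (Icc (ν n) (L n)) (vline (-(μ ^ 2 / 2)) t)) atTop
      (𝓝 (R D μ lam ρlim (Ioi νlim) (vline (-(μ ^ 2 / 2)) t))) :=
  H.tendsto_R (H.vline_mem t)

lemma tendsto_line' (H : DeformSeq D μ lam θ c N p ρ0 Λ ν L ρ ρlim νlim) (t : ℝ) :
    Tendsto (fun n => deriv (R D μ lam (ρ n) (Icc (ν n) (L n))) (vline (-(μ ^ 2 / 2)) t)
      * Complex.I) atTop
      (𝓝 (deriv (R D μ lam ρlim (Ioi νlim)) (vline (-(μ ^ 2 / 2)) t) * Complex.I)) :=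
  (H.tendsto_deriv_R (H.vline_mem t)).mul_const _

lemma hasDerivAt_R (H : DeformSeq D μ lam θ c N p ρ0 Λ ν L ρ ρlim νlim) (hD4 : D ≠ 4) (n : ℕ)
    {z : ℂ} (hz : -(μ ^ 2 / 2) - margin μ c θ < z.re) :
    HasDerivAt (R D μ lam (ρ n) (Icc (ν n) (L n)))
      (1 - lam * ∫ t in Icc (ν n) (L n), -(ρ n t : ℂ) / (t + 2 * (μ ^ 2 / 2 : ℝ) + z) ^ 2) z := by
  have hc := H.c_pos
  have hδ := H.margin_le
  have hcn := H.c_le n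
  have hμ := H.hμ
  have hμ2 : 0 < μ ^ 2 := by positivity
  have h1 := hasDerivAt_stieltjes (m := μ ^ 2 / 2) (H.deform n).continuousOn
    (show 0 < c / 2 by positivity) (z := z) (by linarith)
  have h2 := (((hasDerivAt_id' z).const_mul (slopeR D μ lam (ρ n) (Icc (ν n) (L n)) : ℂ)).add_const
    (shiftR D μ lam (ρ n) (Icc (ν n) (L n)) : ℂ)).fun_sub (h1.const_mul (lam : ℂ))
  rw [mul_one, slopeR_eq_one hD4, Complex.ofReal_one] at h2
  refine h2.congr_of_eventuallyEq ?_
  filter_upwards [(isOpen_rightHalf _).mem_nhds hz] with w hw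
  have h3 := (H.cutData n).formula w hw
  rwa [slopeR_eq_one hD4, Complex.ofReal_one] at h3

/-- Uniform closeness of the lines to the undeformed line, in dimension less than four. -/
theorem exists_lineNear (H : DeformSeq D μ lam θ c N p ρ0 Λ ν L ρ ρlim νlim) (hD4 : D ≠ 4) :
    ∃ κ K ε : ℝ, (∀ n, LineNear 1 (μ ^ 2 / 2) κ K ε
      (fun t => R D μ lam (ρ n) (Icc (ν n) (L n)) (vline (-(μ ^ 2 / 2)) t))
      (fun t => deriv (R D μ lam (ρ n) (Icc (ν n) (L n))) (vline (-(μ ^ 2 / 2)) t) * Complex.I)) ∧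
    LineNear 1 (μ ^ 2 / 2) κ K ε
      (fun t => R D μ lam ρlim (Ioi νlim) (vline (-(μ ^ 2 / 2)) t))
      (fun t => deriv (R D μ lam ρlim (Ioi νlim)) (vline (-(μ ^ 2 / 2)) t) * Complex.I) := by
  obtain ⟨B, hB, hBn⟩ := H.exists_integral_le
  have hc := H.c_pos
  have hμ := H.hμ
  have hp := H.p_pos
  have hpk := H.p_lt
  have hD02 : D = 0 ∨ D = 2 := by
    have := H.hD
    tauto
  set m := μ ^ 2 / 2 with hm
  have hm0 : 0 < m := by positivity
  have hμm : μ ^ 2 = 2 * m := by rw [hm]; ring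
  have hμmC : (μ : ℂ) ^ 2 = 2 * (m : ℂ) := by exact_mod_cast hμm
  rw [hμm] at hBn
  set q := max p 1 with hq
  have hq1 : 1 ≤ q := le_max_right _ _
  have hpq : p ≤ q := le_max_left _ _
  have hq2 : q < 2 := by
    refine max_lt ?_ one_lt_two
    rcases hD02 with rfl | rfl <;> norm_num at hpk <;> linarith
  set c1 := c / (m + c) / 2 with hc1
  have hc10 : 0 < c1 := by positivity
  set w := min m 1 with hw
  have hw0 : 0 < w := by positivity
  have hTin : ∀ n, ∀ t ∈ Icc (ν n) (L n), m + c ≤ t + 2 * m := fun n t ht => by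
    linarith [H.c_le n, ht.1]
  have hWS : ∀ T y : ℝ, m + c ≤ T → w * (1 + |y|) ≤ T + |y| := fun T y hT => by
    have h1 : w ≤ m := min_le_left _ _
    have h2 : w ≤ 1 := min_le_right _ _
    nlinarith [abs_nonneg y]
  have hTq : ∀ T : ℝ, m + c ≤ T → T ^ (-q) ≤ m ^ (p - q) * T ^ (-p) := fun T hT => by
    have hT0 : 0 < T := by linarith
    rw [show -q = (p - q) + -p by ring, Real.rpow_add hT0]
    have : T ^ (p - q) ≤ m ^ (p - q) :=
      Real.rpow_le_rpow_of_nonpos hm0 (by linarith) (by linarith)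
    gcongr
  -- integrals against the deformed measures
  have hint : ∀ (n : ℕ) (f : ℝ → ℂ) (C : ℝ), 0 ≤ C →
      (∀ t ∈ Icc (ν n) (L n), ‖f t‖ ≤ C * (t + 2 * m) ^ (-q)) →
      ‖∫ t in Icc (ν n) (L n), (ρ n t : ℂ) * f t‖ ≤ C * (m ^ (p - q) * B) := by
    intro n f C hC hf
    obtain ⟨i, e⟩ := hBn n
    refine (norm_integral_le_of_norm_le ((i.const_mul (C * m ^ (p - q)))) ?_).trans ?_
    · filter_upwards [ae_restrict_mem measurableSet_Icc] with t ht
      have hρ := H.ρ_nonneg n ht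
      rw [norm_mul, Complex.norm_real, Real.norm_of_nonneg hρ]
      calc ρ n t * ‖f t‖ ≤ ρ n t * (C * (m ^ (p - q) * (t + 2 * m) ^ (-p))) := by
            refine mul_le_mul_of_nonneg_left ((hf t ht).trans ?_) hρ
            exact mul_le_mul_of_nonneg_left (hTq _ (hTin n t ht)) hC
        _ = _ := by ring
    · rw [integral_const_mul, mul_assoc]
      gcongr
  -- the kernels
  have hker : ∀ (y T : ℝ), m + c ≤ T → ‖kern (D / 2) (T : ℂ) (vline (-m) y)‖
      ≤ (m + 1) * c1⁻¹ * (w ^ (q - 2) + 1) * (1 + |y|) ^ (q - 1) * T ^ (-q) := by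
    intro y T hT
    have hT0 : 0 < T := by linarith
    have hS0 : 0 < T + |y| := by positivity
    have h1 := le_norm_add_vline hm0 hc hT y
    rw [← hc1] at h1
    have hy1 : 1 ≤ 1 + |y| := by linarith [abs_nonneg y]
    have hden : ‖(T : ℂ) + vline (-m) y‖⁻¹ ≤ c1⁻¹ * (T + |y|)⁻¹ := by
      rw [← mul_inv]
      exact inv_anti₀ (by positivity) h1
    have hTn : ‖(T : ℂ)‖ = T := by rw [Complex.norm_real, Real.norm_of_nonneg hT0.le]
    rcases hD02 with rfl | rfl
    -- For D = 0 one has p < 1, hence q = 1: the kernel is bounded by a multiple of 1/T without any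
    -- growth in y.
    · have hq' : q = 1 := by
        norm_num at hpk
        exact max_eq_right hpk.le
      rw [hq', show (1 : ℝ) - 1 = 0 by ring, Real.rpow_zero, Real.rpow_neg_one]
      simp only [kern, Nat.zero_div, pow_zero, one_mul, one_div, norm_inv]
      have h2 : (T + |y|)⁻¹ ≤ T⁻¹ := inv_anti₀ hT0 (by linarith [abs_nonneg y])
      have h3 : 0 < w ^ ((1 : ℝ) - 2) := by positivity
      calc ‖(T : ℂ) + vline (-m) y‖⁻¹ ≤ 1 * c1⁻¹ * 1 * 1 * T⁻¹ := by
            refine hden.trans ?_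
            rw [one_mul, mul_one, mul_one]
            gcongr
        _ ≤ _ := by
            gcongr
            · linarith
            · linarith
    · have h2 := (rpow_weights hw0 hT0 (show 0 < 1 + |y| by positivity)
        (show T ≤ T + |y| by linarith [abs_nonneg y]) (hWS T y hT) hq1 hq2.le).1
      have h3 := (lineBase_vline hm0).up y
      simp only [kern, Nat.div_self two_pos, pow_one, norm_div, norm_mul, norm_neg, hTn]
      rw [div_eq_mul_inv, mul_inv]
      have h5 : 0 < w ^ (q - 2) := by positivity
      calc ‖vline (-m) y‖ * (T⁻¹ * ‖(T : ℂ) + vline (-m) y‖⁻¹)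
          ≤ ((m + 1) * (1 + |y|)) * (T⁻¹ * (c1⁻¹ * (T + |y|)⁻¹)) := by gcongr
        _ = (m + 1) * c1⁻¹ * ((1 + |y|) * (T * (T + |y|))⁻¹) := by
            rw [mul_inv]
            ring
        _ ≤ (m + 1) * c1⁻¹ * ((w ^ (q - 2) + 1) * (T ^ (-q) * (1 + |y|) ^ (q - 1))) := by
            refine mul_le_mul_of_nonneg_left (h2.trans ?_) (by positivity)
            gcongr
            linarith
        _ = _ := by ring
  have hker' : ∀ (y T : ℝ), m + c ≤ T → ‖-1 / ((T : ℂ) + vline (-m) y) ^ 2‖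
      ≤ c1⁻¹ ^ 2 * w ^ (q - 2) * (1 + |y|) ^ (q - 2) * T ^ (-q) := by
    intro y T hT
    have hT0 : 0 < T := by linarith
    have hS0 : 0 < T + |y| := by positivity
    have h1 := le_norm_add_vline hm0 hc hT y
    rw [← hc1] at h1
    have h2 := (rpow_weights hw0 hT0 (show 0 < 1 + |y| by positivity)
      (show T ≤ T + |y| by linarith [abs_nonneg y]) (hWS T y hT) hq1 hq2.le).2
    rw [norm_div, norm_neg, norm_one, norm_pow, one_div]
    calc (‖(T : ℂ) + vline (-m) y‖ ^ 2)⁻¹ ≤ ((c1 * (T + |y|)) ^ 2)⁻¹ := by gcongr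
      _ = c1⁻¹ ^ 2 * ((T + |y|) ^ 2)⁻¹ := by rw [mul_pow, mul_inv, inv_pow]
      _ ≤ c1⁻¹ ^ 2 * (w ^ (q - 2) * (T ^ (-q) * (1 + |y|) ^ (q - 2))) := by gcongr
      _ = _ := by ring
  set K1 := |lam| * ((m + 1) * c1⁻¹ * (w ^ (q - 2) + 1) * (m ^ (p - q) * B)) with hK1
  set K2 := |lam| * (c1⁻¹ ^ 2 * w ^ (q - 2) * (m ^ (p - q) * B)) with hK2
  have hK10 : 0 ≤ K1 := by positivity
  have hK20 : 0 ≤ K2 := by positivity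
  have hK0 := H.lineBase_lim.K_nonneg
  rw [← hm] at hK0
  set K0 := 2 * (N + m + 1) with hK0'
  have hnear : ∀ n t, ‖R D μ lam (ρ n) (Icc (ν n) (L n)) (vline (-m) t)
      - ((1 : ℝ) : ℂ) * vline (-m) t‖ ≤ (K0 + K1 + K2) * (1 + |t|) ^ (1 - (2 - q)) := by
    intro n y
    have h1 := hint n (fun t => kern (D / 2) (t + (μ : ℂ) ^ 2) (vline (-m) y))
      ((m + 1) * c1⁻¹ * (w ^ (q - 2) + 1) * (1 + |y|) ^ (q - 1)) (by positivity) fun t ht => by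
        have := hker y (t + 2 * m) (hTin n t ht)
        rw [hμmC]
        push_cast at this
        exact this
    rw [R_eq, Complex.ofReal_one, one_mul, sub_sub_cancel_left, norm_neg, norm_mul,
      Complex.norm_real, Real.norm_eq_abs, show 1 - (2 - q) = q - 1 by ring]
    refine (mul_le_mul_of_nonneg_left h1 (abs_nonneg _)).trans ?_
    calc _ = K1 * (1 + |y|) ^ (q - 1) := by rw [hK1]; ring
      _ ≤ _ := by
        gcongr
        linarith
  have hnear' : ∀ n t, ‖deriv (R D μ lam (ρ n) (Icc (ν n) (L n))) (vline (-m) t) * Complex.I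
      - ((1 : ℝ) : ℂ) * Complex.I‖ ≤ (K0 + K1 + K2) * (1 + |t|) ^ (-(2 - q)) := by
    intro n y
    have h1 := hint n (fun t => -1 / ((t : ℂ) + 2 * (m : ℝ) + vline (-m) y) ^ 2)
      (c1⁻¹ ^ 2 * w ^ (q - 2) * (1 + |y|) ^ (q - 2)) (by positivity) fun t ht => by
        have := hker' y (t + 2 * m) (hTin n t ht)
        push_cast at this
        exact this
    have h2 : ∀ t : ℝ, (ρ n t : ℂ) * (-1 / ((t : ℂ) + 2 * (m : ℝ) + vline (-m) y) ^ 2)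
        = -(ρ n t : ℂ) / ((t : ℂ) + 2 * (m : ℝ) + vline (-m) y) ^ 2 := fun t => by ring
    simp_rw [h2] at h1
    rw [(H.hasDerivAt_R hD4 n (H.vline_mem y)).deriv, ← sub_mul, Complex.ofReal_one,
      sub_sub_cancel_left, norm_mul, Complex.norm_I, mul_one, norm_neg, norm_mul,
      Complex.norm_real, Real.norm_eq_abs, show -(2 - q) = q - 2 by ring]
    refine (mul_le_mul_of_nonneg_left h1 (abs_nonneg _)).trans ?_
    calc _ = K2 * (1 + |y|) ^ (q - 2) := by rw [hK2]; ring
      _ ≤ _ := by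
        gcongr
        linarith
  have hK : 2 * (N + μ ^ 2 / 2 + 1) ≤ K0 + K1 + K2 := by
    rw [← hm]
    linarith
  refine ⟨(1 - (1 + θ) / 2) * (min c 1 / 2), K0 + K1 + K2, 2 - q, fun n => ?_, ?_⟩
  · exact { (H.lineBase n).mono hK with
      A_pos := one_pos
      m_pos := hm0
      ε_pos := by linarith
      ε_le := by linarith
      near := hnear n
      near' := hnear' n }
  -- The estimates for R_n have constants independent of n, so they survive pointwise limits of the
  -- functions and of their derivatives.
  · exact { H.lineBase_lim.mono hK with
      A_pos := one_pos
      m_pos := hm0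
      ε_pos := by linarith
      ε_le := by linarith
      near := fun t => le_of_tendsto ((H.tendsto_line t).sub_const _).norm
        (Eventually.of_forall fun n => hnear n t)
      near' := fun t => le_of_tendsto ((H.tendsto_line' t).sub_const _).norm
        (Eventually.of_forall fun n => hnear' n t) }

end DeformSeq

end QuarticMatrix
-- Passage to the limit in the formulas.
namespace QuarticMatrix

open VerticalLine ComplexConjugate LineNear

/-- Dominated convergence on the real line with a power bound. -/
lemma tendsto_integral_of_le_rpow_neg {f : ℕ → ℝ → ℂ} {g : ℝ → ℂ} {C r : ℝ} (hr : 1 < r)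
    (hf : ∀ n, AEStronglyMeasurable (f n)) (hb : ∀ n t, ‖f n t‖ ≤ C * (1 + |t|) ^ (-r))
    (hlim : ∀ t, Tendsto (fun n => f n t) atTop (𝓝 (g t))) :
    Integrable g ∧ Tendsto (fun n => ∫ t, f n t) atTop (𝓝 (∫ t, g t)) :=
  ⟨integrable_of_le_rpow_neg hr (aestronglyMeasurable_of_tendsto_ae atTop hf (ae_of_all _ hlim))
      fun t => le_of_tendsto (hlim t).norm (Eventually.of_forall fun n => hb n t),
    tendsto_integral_of_dominated_convergence _ hf ((integrable_rpow_neg hr).const_mul C)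
      (fun n => ae_of_all _ (hb n)) (ae_of_all _ hlim)⟩

namespace DeformSeq

variable {D : ℕ} {μ lam θ c N p : ℝ} {ρ0 : ℝ → ℝ} {Λ ν L : ℕ → ℝ} {ρ : ℕ → ℝ → ℝ}
  {ρlim : ℝ → ℝ} {νlim : ℝ}

lemma tendsto_integral_integrandN (H : DeformSeq D μ lam θ c N p ρ0 Λ ν L ρ ρlim νlim) {a b : ℝ}
    (ha : 0 ≤ a) (hb : 0 ≤ b) :
    Integrable (integrandN D μ lam ρlim (Ioi νlim) a b) ∧
    Tendsto (fun n => ∫ t, integrandN D μ lam (ρ n) (Icc (ν n) (L n)) a b t) atTop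
      (𝓝 (∫ t, integrandN D μ lam ρlim (Ioi νlim) a b t)) := by
  have hμ := H.hμ
  have hm : 0 < μ ^ 2 / 2 := by positivity
  have HL := H.lineBase_lim
  have e := fun n => funext (integrandN_eq hμ (H.lineBase n) hb a)
  have elim := funext (integrandN_eq hμ HL hb a)
  have hlim := fun t => HL.tendsto_logDiff (m := μ ^ 2 / 2) H.tendsto_line H.tendsto_line' ha hb t
  have hlim0 := fun t =>
    HL.tendsto_logDiff (m := μ ^ 2 / 2) H.tendsto_line H.tendsto_line' le_rfl le_rfl t
  have hmeas := fun n => (H.lineBase n).measurable_logDiff hm ha b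
  have hmeas0 := fun n => (H.lineBase n).measurable_logDiff hm le_rfl 0
  -- The dominating function has two sources: for D = 4 the subtraction at (0, 0), with decay
  -- exponent 3/2; for D < 4 the closeness of the lines to the undeformed one, with exponent 1 +
  -- ε/2.
  by_cases hD4 : D = 4
  · obtain ⟨C, hC⟩ := LineBase.exists_norm_logDiff_sub_le (μ ^ 2 / 2) _
      (2 * (N + μ ^ 2 / 2 + 1)) a b hm HL.κ_pos ha hb
    simp only [if_pos hD4, one_mul] at e elim
    simp_rw [e, elim]
    exact tendsto_integral_of_le_rpow_neg (by norm_num)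
      (fun n => ((hmeas n).sub (hmeas0 n)).aestronglyMeasurable)
      (fun n => hC _ _ (H.lineBase n)) fun t => (hlim t).sub (hlim0 t)
  · obtain ⟨κ, K, ε, hn, hl⟩ := H.exists_lineNear hD4
    have hε := hl.ε_pos
    obtain ⟨C, -, hC⟩ := exists_norm_logDiff_le (μ ^ 2 / 2) κ K ε a b hm hl.κ_pos hε hl.ε_le ha hb
    simp only [if_neg hD4, zero_mul, sub_zero] at e elim
    simp_rw [e, elim]
    exact tendsto_integral_of_le_rpow_neg (by linarith) (fun n => (hmeas n).aestronglyMeasurable)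
      (fun n => hC _ _ (hn n)) hlim

lemma tendsto_formulaG (H : DeformSeq D μ lam θ c N p ρ0 Λ ν L ρ ρlim νlim) {a b : ℝ}
    (ha : 0 ≤ a) (hb : 0 ≤ b) :
    Tendsto (fun n => formulaG D μ lam (ρ n) (Icc (ν n) (L n)) a b) atTop
      (𝓝 (formulaG D μ lam ρlim (Ioi νlim) a b)) :=
  ((((H.tendsto_integral_integrandN ha hb).2.const_mul _).cexp).const_mul _).div_const _

lemma tendsto_integral_integrandAlt (H : DeformSeq D μ lam θ c N p ρ0 Λ ν L ρ ρlim νlim)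
    (hD4 : D ≠ 4) {a b : ℝ} (ha : 0 ≤ a) (hb : 0 ≤ b) :
    Integrable (integrandAlt D μ lam ρlim (Ioi νlim) a b) ∧
    Tendsto (fun n => ∫ t, integrandAlt D μ lam (ρ n) (Icc (ν n) (L n)) a b t) atTop
      (𝓝 (∫ t, integrandAlt D μ lam ρlim (Ioi νlim) a b t)) := by
  have hμ := H.hμ
  have hm : 0 < μ ^ 2 / 2 := by positivity
  obtain ⟨κ, K, ε, hn, hl⟩ := H.exists_lineNear hD4
  have hε := hl.ε_pos
  obtain ⟨C, -, hC⟩ :=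
    exists_norm_alt_le 1 (μ ^ 2 / 2) κ K ε a b one_pos hm hl.κ_pos hε hl.ε_le ha hb
  have e := fun n => funext (integrandAlt_eq (hn n) hb a)
  have elim := funext (integrandAlt_eq hl hb a)
  simp_rw [e, elim]
  exact tendsto_integral_of_le_rpow_neg (by linarith)
    (fun n => ((hn n).integrable_alt ha hb).aestronglyMeasurable)
    (fun n => hC _ _ (hn n)) (LineNear.tendsto_alt hn hl H.tendsto_line H.tendsto_line' ha hb)

/-- The preimages of a point of the half line converge. -/
lemma tendsto_Rinv (H : DeformSeq D μ lam θ c N p ρ0 Λ ν L ρ ρlim νlim) {a : ℝ} (ha : 0 ≤ a) :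
    Tendsto (fun n => Rinv D μ lam (ρ n) (Icc (ν n) (L n)) a) atTop
      (𝓝 (Rinv D μ lam ρlim (Ioi νlim) a)) := by
  obtain ⟨α, hα, hRα⟩ := H.contrData_lim.exists_preimage ha
  have hmem := H.contrData_lim.ofReal_mem hα
  rw [H.contrData_lim.Rinv_eq hα hRα]
  have hθ := H.contrData_lim.θ_lt
  -- The preimage α for the limit is nearly a preimage for R_n, and the lower Lipschitz bound turns
  -- the error R_n(α) − a into a distance of preimages.
  have h0 : Tendsto (fun n => (1 - (1 + θ) / 2)⁻¹
      * ‖R D μ lam (ρ n) (Icc (ν n) (L n)) α - a‖) atTop (𝓝 0) := by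
    have h1 := ((H.tendsto_R hmem).sub_const (a : ℂ)).norm.const_mul (1 - (1 + θ) / 2)⁻¹
    rwa [hRα, sub_self, norm_zero, mul_zero] at h1
  refine tendsto_iff_norm_sub_tendsto_zero.2 (squeeze_zero (fun _ => norm_nonneg _) (fun n => ?_) h0)
  obtain ⟨β, hβ, hRβ⟩ := (H.cutData n).exists_preimage ha
  rw [(H.cutData n).toContrData.Rinv_eq hβ hRβ]
  have h1 := (H.cutData n).norm_sub_ge hmem ((H.cutData n).ofReal_mem hβ)
  rw [hRβ, norm_sub_rev (α : ℂ)] at h1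
  rw [← div_eq_inv_mul, le_div_iff₀ (by linarith), mul_comm]
  exact h1

lemma tendsto_formulaAlt (H : DeformSeq D μ lam θ c N p ρ0 Λ ν L ρ ρlim νlim)
    (hD4 : D ≠ 4) {a b : ℝ} (ha : 0 ≤ a) (hb : 0 ≤ b) :
    Tendsto (fun n => formulaAlt D μ lam (ρ n) (Icc (ν n) (L n)) a b) atTop
      (𝓝 (formulaAlt D μ lam ρlim (Ioi νlim) a b)) := by
  have hne : ∀ {x y : ℝ}, 0 ≤ x → 0 ≤ y →
      (μ : ℂ) ^ 2 + x + Rinv D μ lam ρlim (Ioi νlim) y ≠ 0 := by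
    intro x y hx hy
    obtain ⟨β, hβ, hRβ⟩ := H.contrData_lim.exists_preimage hy
    rw [H.contrData_lim.Rinv_eq hβ hRβ]
    have h1 := H.c_le_lim
    have h2 := H.c_pos
    have : μ ^ 2 + x + β ≠ 0 := by linarith [sq_nonneg μ]
    exact_mod_cast this
  exact ((((H.tendsto_integral_integrandAlt hD4 ha hb).2.const_mul _).cexp).const_mul _).div
    (((H.tendsto_Rinv ha).const_add _).mul ((H.tendsto_Rinv hb).const_add _))
    (mul_ne_zero (hne hb ha) (hne ha hb))

/-- The limit has the alternative representation. -/
lemma formulaG_eq_formulaAlt (H : DeformSeq D μ lam θ c N p ρ0 Λ ν L ρ ρlim νlim)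
    (hD4 : D ≠ 4) {a b : ℝ} (ha : 0 ≤ a) (hb : 0 ≤ b) :
    formulaG D μ lam ρlim (Ioi νlim) a b = formulaAlt D μ lam ρlim (Ioi νlim) a b := by
  -- At every finite cut-off both representations equal `gTwo`, so their limits agree; no contour
  -- argument is needed for the limiting R.
  refine tendsto_nhds_unique (H.tendsto_formulaG ha hb)
    ((H.tendsto_formulaAlt hD4 ha hb).congr fun n => ?_)
  obtain ⟨α, hα, hRα⟩ := (H.cutData n).exists_preimage ha
  rw [(formulaG_eq_gTwo H.hμ hD4 (H.cutData n) ha hb hα hRα).2,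
    (formulaAlt_eq_gTwo hD4 (H.cutData n) ha hb hα hRα).2]

end DeformSeq

/-- The removal of the cut-off. -/
theorem cutoff_removal {μ lam : ℝ} (hμ : 0 < μ) {ρ0 : ℝ → ℝ} (hρ0 : ∀ t, 0 ≤ t → 0 ≤ ρ0 t)
    (hHolder : ∀ M : ℝ, IsHolderOn ρ0 (Icc 0 M)) (hdim : spectralDimension ρ0 < 6) {D : ℕ}
    (hD : D = evenDim ρ0) {Λ : ℕ → ℝ} {ρ : ℕ → ℝ → ℝ} {ν L : ℕ → ℝ} {ρlim : ℝ → ℝ} {νlim θ : ℝ}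
    (hΛ : ∀ n, 0 < Λ n) (hΛt : Tendsto Λ atTop atTop)
    (hdef : ∀ n, IsDeformation D μ lam ρ0 (Λ n) (ρ n) (ν n) (L n)) (hθ : θ < 1)
    (hβ : ∀ n, |lam| * couplingBound D μ (ρ n) (Icc (ν n) (L n)) ≤ θ)
    (hνlim : -μ ^ 2 / 2 < νlim) (hν : Tendsto ν atTop (𝓝 νlim))
    (hρ : ∀ x, νlim < x → Tendsto (fun n => ρ n x) atTop (𝓝 (ρlim x))) :
    IsDeformationNoCutoff D μ lam ρ0 ρlim νlim ∧
    (∀ a, 0 ≤ a → ∀ b, 0 ≤ b →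
      Integrable (integrandN D μ lam ρlim (Ioi νlim) a b) ∧
      Tendsto (fun n => formulaG D μ lam (ρ n) (Icc (ν n) (L n)) a b) atTop
        (𝓝 (formulaG D μ lam ρlim (Ioi νlim) a b))) ∧
    (spectralDimension ρ0 < 4 →
      (∀ a : ℝ, 0 ≤ a → ∃! z : ℂ, z ∈ halfPlane μ ∧ R D μ lam ρlim (Ioi νlim) z = a) ∧
      ∀ a, 0 ≤ a → ∀ b, 0 ≤ b →
        Integrable (integrandAlt D μ lam ρlim (Ioi νlim) a b) ∧
        formulaG D μ lam ρlim (Ioi νlim) a b = formulaAlt D μ lam ρlim (Ioi νlim) a b) := by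
  obtain ⟨hDc, hlt4, -⟩ := evenDim_cases hdim
  have hcont := continuousOn_of_isHolderOn hHolder
  obtain ⟨p, hp, hpk, hpi⟩ := exists_integrableOn_rpow hρ0 hcont hdim
  rw [← hD] at hDc hlt4 hpk
  have hmem : ∀ n, 0 < ν n + μ ^ 2 / 2 := fun n => by
    have h1 := mem_halfPlane.1 (hdef n).left_mem
    rw [Complex.ofReal_re] at h1
    linarith
  have hpos : 0 < νlim + μ ^ 2 / 2 := by linarith
  -- Because the limit of ν_n + μ²/2 is positive, the inverses converge and are bounded by some C;
  -- then C⁻¹ is a distance from the line valid for all n at once.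
  obtain ⟨C, hC⟩ := ((hν.add_const (μ ^ 2 / 2)).inv₀ hpos.ne').bddAbove_range
  obtain ⟨N, hN⟩ := hν.abs.bddAbove_range
  have hC' : ∀ n, (ν n + μ ^ 2 / 2)⁻¹ ≤ C := fun n => hC ⟨n, rfl⟩
  have hC0 : 0 < C := (inv_pos.2 (hmem 0)).trans_le (hC' 0)
  have H : DeformSeq D μ lam θ C⁻¹ N p ρ0 Λ ν L ρ ρlim νlim :=
    { hD := hDc
      hμ := hμ
      ρ0_nonneg := hρ0
      ρ0_cont := hcont
      p_pos := hp
      p_lt := hpk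
      ρ0_int := hpi
      Λ_pos := hΛ
      Λ_top := hΛt
      deform := hdef
      θ_lt := hθ
      coupling := hβ
      c_pos := inv_pos.2 hC0
      c_le := fun n => inv_le_of_inv_le₀ (hmem n) (hC' n)
      abs_ν_le := fun n => hN ⟨n, rfl⟩
      ν_tendsto := hν
      ρ_tendsto := hρ }
  refine ⟨H.isDeformationNoCutoff, fun a ha b hb =>
    ⟨(H.tendsto_integral_integrandN ha hb).1, H.tendsto_formulaG ha hb⟩, fun h4 =>
    ⟨fun a ha => ?_, fun a ha b hb => ⟨(H.tendsto_integral_integrandAlt (hlt4 h4) ha hb).1,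
      H.formulaG_eq_formulaAlt (hlt4 h4) ha hb⟩⟩⟩
  simp_rw [mem_halfPlane]
  exact H.contrData_lim.existsUnique_preimage ha

end QuarticMatrix
end

theorem theorem4p2 (μ lam : ℝ) (hμ : 0 < μ) (ρ0 : ℝ → ℝ)
    (hρ0 : ∀ t, 0 ≤ t → 0 ≤ ρ0 t)
    (hHolder : ∀ M : ℝ, QuarticMatrix.IsHolderOn ρ0 (Icc 0 M))
    (hdim : QuarticMatrix.spectralDimension ρ0 < 6)
    (D : ℕ) (hD : D = QuarticMatrix.evenDim ρ0) :
    -- the model with a finite cut-off `Λ`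
    (∀ (Λ : ℝ) (ρ : ℝ → ℝ) (ν L : ℝ), 0 < Λ →
      QuarticMatrix.IsDeformation D μ lam ρ0 Λ ρ ν L →
      |lam| * QuarticMatrix.couplingBound D μ ρ (Icc ν L) < 1 →
      ∃ (Z : ℝ) (G : ℝ → ℝ → ℝ), 0 < Z ∧
        QuarticMatrix.IsPlanarTwoPoint ρ0 lam Λ
          (QuarticMatrix.bareMassSq D μ lam ρ (Icc ν L)) Z G ∧
        (∀ a ∈ Icc 0 (Λ ^ 2), ∀ b ∈ Icc 0 (Λ ^ 2),
          Integrable (QuarticMatrix.integrandN D μ lam ρ (Icc ν L) a b) ∧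
          (G a b : ℂ) = QuarticMatrix.formulaG D μ lam ρ (Icc ν L) a b) ∧
        (4 ≤ QuarticMatrix.spectralDimension ρ0 →
          G 0 0 = 1 ∧
          ∀ c : ℝ, 0 < c → QuarticMatrix.IsPlanarTwoPoint ρ0 lam Λ
            (QuarticMatrix.bareMassSq D μ lam ρ (Icc ν L)) (Z / c) (fun a b => c * G a b)) ∧
        (QuarticMatrix.spectralDimension ρ0 < 4 →
          Z = 1 ∧
          (∀ a ∈ Icc 0 (Λ ^ 2), ∃! z : ℂ, z ∈ QuarticMatrix.halfPlane μ ∧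
            QuarticMatrix.R D μ lam ρ (Icc ν L) z = a) ∧
          ∀ a ∈ Icc 0 (Λ ^ 2), ∀ b ∈ Icc 0 (Λ ^ 2),
            Integrable (QuarticMatrix.integrandAlt D μ lam ρ (Icc ν L) a b) ∧
            (G a b : ℂ) = QuarticMatrix.formulaAlt D μ lam ρ (Icc ν L) a b)) ∧
    -- removal of the cut-off
    (∀ (Λ : ℕ → ℝ) (ρ : ℕ → ℝ → ℝ) (ν L : ℕ → ℝ) (ρlim : ℝ → ℝ) (νlim θ : ℝ),
      (∀ n, 0 < Λ n) → Tendsto Λ atTop atTop →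
      (∀ n, QuarticMatrix.IsDeformation D μ lam ρ0 (Λ n) (ρ n) (ν n) (L n)) →
      θ < 1 →
      (∀ n, |lam| * QuarticMatrix.couplingBound D μ (ρ n) (Icc (ν n) (L n)) ≤ θ) →
      -μ ^ 2 / 2 < νlim → Tendsto ν atTop (𝓝 νlim) →
      (∀ x, νlim < x → Tendsto (fun n => ρ n x) atTop (𝓝 (ρlim x))) →
      QuarticMatrix.IsDeformationNoCutoff D μ lam ρ0 ρlim νlim ∧
      (∀ a, 0 ≤ a → ∀ b, 0 ≤ b →
        Integrable (QuarticMatrix.integrandN D μ lam ρlim (Ioi νlim) a b) ∧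
        Tendsto (fun n => QuarticMatrix.formulaG D μ lam (ρ n) (Icc (ν n) (L n)) a b) atTop
          (𝓝 (QuarticMatrix.formulaG D μ lam ρlim (Ioi νlim) a b))) ∧
      (QuarticMatrix.spectralDimension ρ0 < 4 →
        (∀ a : ℝ, 0 ≤ a → ∃! z : ℂ, z ∈ QuarticMatrix.halfPlane μ ∧
          QuarticMatrix.R D μ lam ρlim (Ioi νlim) z = a) ∧
        ∀ a, 0 ≤ a → ∀ b, 0 ≤ b →
          Integrable (QuarticMatrix.integrandAlt D μ lam ρlim (Ioi νlim) a b) ∧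
          QuarticMatrix.formulaG D μ lam ρlim (Ioi νlim) a b =
            QuarticMatrix.formulaAlt D μ lam ρlim (Ioi νlim) a b)) := by
  exact ⟨fun Λ ρ ν L hΛ h hβ => QuarticMatrix.cutoff_model hμ hρ0 hdim hD hΛ h hβ,
    fun Λ ρ ν L ρlim νlim θ hΛ hΛt hdef hθ hβ hνlim hν hρ =>
      QuarticMatrix.cutoff_removal hμ hρ0 hHolder hdim hD hΛ hΛt hdef hθ hβ hνlim hν hρ⟩
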